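/- **Setting.** Let $\Sigma$ be a finite alphabet and let $L\subseteq\Sigma^\omega$ be an $\omega$-regular language, i.e. the language of some Büchi automaton (BA). A *BA teacher* for $L$ answers membership queries "$uv^\omega\in L$?" ($u,v\in\Sigma^*$; the answer is "no" if $v=\epsilon$) and equivalence queries "$L(B)=L$?" for BAs $B$: it answers "yes" if $L(B)=L$, and otherwise returns some $(u,v)$ with $v\ne\epsilon$ and $uv^\omega\in L\oplus L(B)$, which may depend on everything asked so far. A *family of DFAs* (FDFA) $\mathcal F=(M,\{A^u\})$ consists of a DFA $M$ without accepting states (the leading automaton) and a DFA $A^u$ (progress automaton) for every state $u$ of $M$; it accepts $(u,v)$ if $M(uv)=M(u)$ and $v\in L(A^{M(u)})$, where $M(w)$ is the state reached by $w$. **The algorithm** has three parameters: the kind of FDFA (periodic, syntactic or recurrent), the data structure of the DFA learners (classification trees or observation tables), and the method (under- or over-approximation). States are words. For the leading automaton and for each progress automaton $A^u$ it keeps words (the states, initially only $\epsilon$) that are told apart by experiments, arranged in a classification tree or an observation table. For the leading automaton, $\mathrm{TE}(x,(y,z))$ is the truth value of $xyz^\omega\in L$. For $A^u$, $\mathrm{TE}(x,e)$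 is - periodic: the truth value of $u(xe)^\omega\in L$; - recurrent: the truth value of "$u=M(uxe)$ and $u(xe)^\omega\in L$"; - syntactic: $(M(ux),t)$ with $t=\mathrm A$ if $u=M(uxe)$ and $u(xe)^\omega\in L$, $t=\mathrm B$ if $u=M(uxe)$ and $u(xe)^\omega\notin L$, and $t=\mathrm C$ if $u\neq M(uxe)$. For a state $s$ and a letter $a$, $\delta(s,a)$ is the state to which $sa$ is assigned by the tree or table; if there is none, $sa$ becomes a new state. A state $v$ of $A^u$ is accepting if $uv^\omega\in L$ and, in the syntactic and recurrent cases, $M(uv)=M(u)$. Once all automata are complete, the FDFA is turned into the BA with $\omega$-language $\bigcup_{u,v}L(M^{\epsilon}_u)\,L(P_{(u,v)})^\omega$, where $u$ ranges over the states of $M$ and $v$ over the accepting states of $A^u$; here $A^s_v$ is $A$ with initial state $s$ and only accepting state $v$, and $$P_{(u,v)}=M^u_u\times(A^u)^{\epsilon}_v\times(A^u)^v_v\ \text{(under)},\qquad P_{(u,v)}=M^u_u\times(A^u)^{\epsilon}_v\ \text{(over)}.$$ This BA is submitted to an equivalence query. On "yes" it is returned. On a counterexample $uv^\omega$, a pair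 $(u',v')$ is computed with automata constructions: - if $uv^\omega\in L$, a decomposition $(u',v')$ of $uv^\omega$ with $M(u'v')=M(u')$ that $\mathcal F$ does not accept; - if $uv^\omega\notin L$, a decomposition that $\mathcal F$ accepts, if there is one; if there is none and the method is over-approximation, the algorithm finds a decomposition $(u',v_1\cdots v_m)$ of $uv^\omega$ with $M(u'v_i)=M(u')$ and $v_i\in L(A^{M(u')})$ for all $i$ and takes $(u',v_i)$ for some $i$ with $u'v_i^\omega\notin L$. If no pair is found, the algorithm stops and reports an error. Otherwise let $\tilde u=M(u')$. If exactly one of $u'v'^\omega,\tilde uv'^\omega$ is in $L$, the leading automaton is refined along its run on $u'$; otherwise $A^{\tilde u}$ is refined along its run on $v'$. Refining along a run $s_0\cdots s_r$ on a word $w=a_1\cdots a_r$ means: take the smallest $j$ such that the experiment $e$ made of the rest $a_{j+1}\cdots a_r$ (together with $v'$ in the case of the leading automaton) satisfies $\mathrm{TE}(s_{j-1}a_j,e)\ne\mathrm{TE}(s_j,e)$, and add the state $s_{j-1}a_j$ and the experiment $e$. When the leading automaton gets a new state, a progress learner is added for it (periodic), or all progress automata are learned anew (syntactic, recurrent). Then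 the FDFA is constructed again. **Cost.** Running time is the number of elementary steps (every query counts as one step; copying, comparing or scanning lists costs at least one step per entry). Let $n$ be the number of classes of $x\sim_L y:\iff\forall w\in\Sigma^\omega\,(xw\in L\Leftrightarrow yw\in L)$ and let $k$ be the maximum over $u\in\Sigma^*$ of the number of classes of $x\approx^u y:\iff\forall v\in\Sigma^*\,(u(xv)^\omega\in L\Leftrightarrow u(yv)^\omega\in L)$, so $n$ and $k$ are the numbers of states of the leading automaton and of the largest progress automaton of the periodic FDFA of $L$. **Theorem (Correctness and Termination).** 1. There is a polynomial $p$ in four variables with coefficients in $\mathbb N$ such that for every finite alphabet $\Sigma$, every $\omega$-regular $L\subseteq\Sigma^\omega$, every BA teacher for $L$, every kind of FDFA and either data structure, the algorithm with the under-approximation method terminates without an error, returns a BA $B$ with $L(B)=L$, and takes at most $p(n,k,|\Sigma|,\ell)$ steps, where $\ell$ is the length $|u|+|v|$ of the longest counterexample $(u,v)$ returned by the BA teacher during the run ($0$ if there is none). 2. For every finite alphabet $\Sigma$, every $\omega$-regular $L\subseteq\Sigma^\omega$, every BA teacher for $L$, every kind of FDFA and either data structure: if the algorithm with the over-approximation method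 terminates without reporting an error, then it returns a BA $B$ with $L(B)=L$. -/

import Mathlib

namespace BuchiLearning

/-! ## Words, ω-languages and finite automata -/

/-- Finite words. -/
abbrev Word (α : Type) := List α

/-- `uv^ω ∈ L`. For `v = ε` there is no ω-word `uv^ω`, and the assertion is false. -/
def UPMem {α : Type} (L : Set (Stream' α)) (u v : Word α) : Prop :=
  ∃ h : v ≠ [], u ++ₛ Stream'.cycle v h ∈ L

/-- A finite automaton over the letters `β` with (finitely many) states of type `σ`; all its parts
are explicit lists, so that writing down and scanning an automaton can be charged for.
It is used as an automaton on finite words and as a Büchi automaton; a DFA is one whose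
transition list contains exactly one triple `(q, b, q')` for every state `q` and letter `b`. -/
structure FA (β σ : Type) where
  states : List σ
  init : σ
  acc : List σ
  trans : List (σ × β × σ)

/-- The ω-language of an automaton with the Büchi acceptance condition. -/
def FA.omegaLang {β σ : Type} (A : FA β σ) : Set (Stream' β) :=
  {w | ∃ ρ : ℕ → σ, ρ 0 = A.init ∧ (∀ i, ρ i ∈ A.states) ∧
    (∀ i, (ρ i, w.get i, ρ (i + 1)) ∈ A.trans) ∧
    ∃ q ∈ A.acc, ∃ᶠ i in Filter.atTop, ρ i = q}

/-- `L` is ω-regular: it is the language of some Büchi automaton. -/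
def IsOmegaRegular {α : Type} (L : Set (Stream' α)) : Prop :=
  ∃ (σ : Type) (A : FA α σ), A.omegaLang = L

/-- The right congruence of the leading automaton:
`x ∼ y` iff `xw ∈ L ↔ yw ∈ L` for all ω-words `w`. -/
def leadCongr {α : Type} (L : Set (Stream' α)) : Setoid (Word α) where
  r x y := ∀ w : Stream' α, x ++ₛ w ∈ L ↔ y ++ₛ w ∈ L
  iseqv := ⟨fun _ _ => Iff.rfl, fun h w => (h w).symm, fun h₁ h₂ w => (h₁ w).trans (h₂ w)⟩

/-- The right congruence of the progress automaton of `u` in the periodic FDFA: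
`x ≈ y` iff `u(xv)^ω ∈ L ↔ u(yv)^ω ∈ L` for all finite words `v`. -/
def periodicCongr {α : Type} (L : Set (Stream' α)) (u : Word α) : Setoid (Word α) where
  r x y := ∀ v : Word α, UPMem L u (x ++ v) ↔ UPMem L u (y ++ v)
  iseqv := ⟨fun _ _ => Iff.rfl, fun h w => (h w).symm, fun h₁ h₂ w => (h₁ w).trans (h₂ w)⟩

/-- The number of states of the leading automaton of the periodic FDFA of `L`. -/
noncomputable def leadIndex {α : Type} (L : Set (Stream' α)) : ℕ :=
  Nat.card (Quotient (leadCongr L))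

/-- The number of states of the largest progress automaton of the periodic FDFA of `L`. -/
noncomputable def progressIndex {α : Type} (L : Set (Stream' α)) : ℕ :=
  ⨆ u : Word α, Nat.card (Quotient (periodicCongr L u))

/-- Names of the states of the Büchi automata built by the algorithm: a state of the leading
automaton, or a state of the component that belongs to a pair `(u, v)`; the latter is
either a tuple of a product automaton or the fresh state (`none`). -/
abbrev BName (α : Type) := Word α ⊕ ((Word α × Word α) × Option (List (Word α)))

/-- The Büchi automata on which equivalence queries are posed. -/
abbrev BA (α : Type) := FA α (BName α)

/-! ## Query programs with a step count

A program is a computation that may pose membership queries and equivalence queries to a BA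
teacher. Its steps are counted by `tick`; every query is a step, too. All programs below obey
the following discipline: every recursive function makes at least one `tick` per call, so that
between two steps only a bounded number of elementary operations (building or matching
a constructor, reading or updating a field of a record, comparing two letters) is carried out. In
particular copying, comparing or scanning a list costs at least one step per visited entry. -/

inductive Prog (α β : Type) where
  | ret (b : β)
  | tick (p : Prog α β)
  | mem (u v : Word α) (k : Bool → Prog α β)
  | equ (B : BA α) (k : Option (Word α × Word α) → Prog α β)

/-- Sequential composition. -/
def Prog.andThen {α β γ : Type} : Prog α β → (β → Prog α γ) → Prog α γ
  | .ret b, f => f b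
  | .tick p, f => .tick (p.andThen f)
  | .mem u v k, f => .mem u v fun b => (k b).andThen f
  | .equ B k, f => .equ B fun c => (k c).andThen f

instance {α : Type} : Monad (Prog α) where
  pure := Prog.ret
  bind := Prog.andThen

/-- The membership query `uv^ω ∈ L`? -/
def askMem {α : Type} (u v : Word α) : Prog α Bool := .mem u v .ret

/-- The equivalence query `L(B) = L`? -/
def askEqu {α : Type} (B : BA α) : Prog α (Option (Word α × Word α)) := .equ B .ret

/-- What a teacher has seen so far: the queries together with the answers. -/
inductive Event (α : Type) where
  | mem (u v : Word α) (answer : Bool)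
  | equ (B : BA α) (answer : Option (Word α × Word α))

/-- The queries answered so far, the latest one first. -/
abbrev Log (α : Type) := List (Event α)

/-- Executing a program against given answers: the result, the number of steps, the new log. -/
def Prog.eval {α β : Type} (member : Word α → Word α → Bool)
    (equiv : Log α → BA α → Option (Word α × Word α)) : Prog α β → Log α → β × ℕ × Log α
  | .ret b, h => (b, 0, h)
  | .tick p, h =>
      let r := p.eval member equiv h
      (r.1, r.2.1 + 1, r.2.2)
  | .mem u v k, h =>
      let r := (k (member u v)).eval member equiv (.mem u v (member u v) :: h)
      (r.1, r.2.1 + 1, r.2.2)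
  | .equ B k, h =>
      let r := (k (equiv h B)).eval member equiv (.equ B (equiv h B) :: h)
      (r.1, r.2.1 + 1, r.2.2)

/-- The length `|u| + |v|` of the longest counterexample `(u, v)` in a log (`0` if none). -/
def longestCE {α : Type} : Log α → ℕ
  | [] => 0
  | .equ _ (some (u, v)) :: h => max (u.length + v.length) (longestCE h)
  | _ :: h => longestCE h

/-- A BA teacher for `L`, as far as equivalence queries are concerned. The answer, which may
depend on everything asked before, is "yes" (`none`) if `L(B) = L`, and otherwise some
counterexample `uv^ω` in the symmetric difference of `L` and `L(B)`. -/
structure BATeacher {α : Type} (L : Set (Stream' α)) where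
  answer : Log α → BA α → Option (Word α × Word α)
  yes_iff : ∀ h B, answer h B = none ↔ B.omegaLang = L
  counterexample : ∀ h B u v, answer h B = some (u, v) →
    ∃ hv : v ≠ [], ¬ (u ++ₛ Stream'.cycle v hv ∈ L ↔ u ++ₛ Stream'.cycle v hv ∈ B.omegaLang)

/-! ## Basic list programs -/

section ListPrograms

variable {α β γ : Type}

def app : List β → List β → Prog α (List β)
  | [], l' => .tick (pure l')
  | b :: l, l' => .tick do
      let r ← app l l'
      pure (b :: r)

def mapL (f : β → Prog α γ) : List β → Prog α (List γ)
  | [] => .tick (pure [])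
  | b :: l => .tick do
      let c ← f b
      let r ← mapL f l
      pure (c :: r)

def bindL (f : β → Prog α (List γ)) : List β → Prog α (List γ)
  | [] => .tick (pure [])
  | b :: l => .tick do
      let c ← f b
      let r ← bindL f l
      app c r

def filterL (f : β → Prog α Bool) : List β → Prog α (List β)
  | [] => .tick (pure [])
  | b :: l => .tick do
      let c ← f b
      let r ← filterL f l
      if c then pure (b :: r) else pure r

/-- The first value that `f` yields on the list. -/
def firstL (f : β → Prog α (Option γ)) : List β → Prog α (Option γ)
  | [] => .tick (pure none)
  | b :: l => .tick do
      match ← f b with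
      | some c => pure (some c)
      | none => firstL f l

def foldL (f : γ → β → Prog α γ) : γ → List β → Prog α γ
  | c, [] => .tick (pure c)
  | c, b :: l => .tick do
      let c' ← f c b
      foldL f c' l

def revOnto : List β → List β → Prog α (List β)
  | [], l' => .tick (pure l')
  | b :: l, l' => .tick (revOnto l (b :: l'))

def rev (l : List β) : Prog α (List β) := revOnto l []

end ListPrograms

/-- Equality tests as programs. -/
class PEq (α σ : Type) where
  test : σ → σ → Prog α Bool

def peq {α σ : Type} [PEq α σ] (s t : σ) : Prog α Bool := PEq.test s t

def eqL {α σ : Type} [PEq α σ] : List σ → List σ → Prog α Bool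
  | [], [] => .tick (pure true)
  | a :: l, b :: l' => .tick do
      if ← peq a b then eqL l l' else pure false
  | _, _ => .tick (pure false)

instance {α : Type} [DecidableEq α] : PEq α α := ⟨fun a b => .tick (pure (decide (a = b)))⟩

instance {α σ : Type} [PEq α σ] : PEq α (List σ) := ⟨eqL⟩

instance {α σ τ : Type} [PEq α σ] [PEq α τ] : PEq α (σ × τ) :=
  ⟨fun s t => do if ← peq s.1 t.1 then peq s.2 t.2 else pure false⟩

instance {α σ τ : Type} [PEq α σ] [PEq α τ] : PEq α (σ ⊕ τ) :=
  ⟨fun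
    | .inl s, .inl t => peq s t
    | .inr s, .inr t => peq s t
    | _, _ => pure false⟩

instance {α σ : Type} [PEq α σ] : PEq α (Option σ) :=
  ⟨fun
    | some s, some t => peq s t
    | none, none => pure true
    | _, _ => pure false⟩

section

variable {α : Type}

/-- Membership in a list. -/
def memL {σ : Type} [PEq α σ] (s : σ) (l : List σ) : Prog α Bool := do
  let r ← firstL (fun t => do if ← peq s t then pure (some t) else pure none) l
  pure r.isSome

/-- The value stored under a key in an association list. -/
def assoc {σ γ : Type} [PEq α σ] (s : σ) (l : List (σ × γ)) : Prog α (Option γ) :=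
  firstL (fun e => do if ← peq s e.1 then pure (some e.2) else pure none) l

/-! ## Automata constructions -/

/-- The successor `δ(s, a)` in a DFA. -/
def FA.step {σ : Type} [DecidableEq α] [PEq α σ] (A : FA α σ) (s : σ) (a : α) : Prog α σ := do
  let r ← firstL (fun t => do
    if t.2.1 = a then
      if ← peq t.1 s then pure (some t.2.2) else pure none
    else pure none) A.trans
  pure (r.getD A.init)

/-- The state `δ(s, w)` of a DFA. -/
def FA.run {σ : Type} [DecidableEq α] [PEq α σ] (A : FA α σ) : σ → Word α → Prog α σ
  | s, [] => .tick (pure s)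
  | s, a :: w => .tick do
      let s' ← A.step s a
      A.run s' w

/-- The state `A(w)` reached from the initial state of a DFA. -/
def FA.reach {σ : Type} [DecidableEq α] [PEq α σ] (A : FA α σ) (w : Word α) : Prog α σ :=
  A.run A.init w

/-- The product automaton. -/
def FA.prod {β σ τ : Type} [DecidableEq β] (A : FA β σ) (B : FA β τ) : Prog α (FA β (σ × τ)) := do
  let states ← bindL (fun s => mapL (fun t => pure (s, t)) B.states) A.states
  let acc ← bindL (fun s => mapL (fun t => pure (s, t)) B.acc) A.acc
  let trans ← bindL (fun d => bindL (fun e =>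
    if d.2.1 = e.2.1 then pure [((d.1, e.1), d.2.1, (d.2.2, e.2.2))] else pure []) B.trans) A.trans
  pure { states := states, init := (A.init, B.init), acc := acc, trans := trans }

/-- Renaming states. -/
def FA.rename {β σ τ : Type} (f : σ → Prog α τ) (A : FA β σ) : Prog α (FA β τ) := do
  let states ← mapL f A.states
  let init ← f A.init
  let acc ← mapL f A.acc
  let trans ← mapL (fun d => do
    let p ← f d.1
    let q ← f d.2.2
    pure (p, d.2.1, q)) A.trans
  pure { states := states, init := init, acc := acc, trans := trans }

/-- Complementation of a DFA. -/
def FA.compl {β σ : Type} [PEq α σ] (A : FA β σ) : Prog α (FA β σ) := do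
  let acc ← filterL (fun s => do
    let b ← memL s A.acc
    pure !b) A.states
  pure { A with acc := acc }

/-- `A^s_v`: the automaton `A` with initial state `s` and `v` as the only accepting state. -/
def FA.fromTo {β σ : Type} (A : FA β σ) (s v : σ) : FA β σ := { A with init := s, acc := [v] }

/-- Some accepting run (as the list of its letters and target states), if the language of
the automaton is not empty. The states reached so far are kept together with a path; every round
extends them along all transitions, and there are as many rounds as states. -/
def FA.search {β σ : Type} [PEq α σ] (A : FA β σ) : Prog α (Option (List (β × σ))) := do
  let relax : List (σ × List (β × σ)) → σ × β × σ → Prog α (List (σ × List (β × σ))) :=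
    fun vis d => do
      match ← assoc d.1 vis with
      | none => pure vis
      | some path =>
        match ← assoc d.2.2 vis with
        | some _ => pure vis
        | none => pure ((d.2.2, (d.2.1, d.2.2) :: path) :: vis)
  let vis ← foldL (fun vis _ => foldL relax vis A.trans) [(A.init, [])] A.states
  match ← firstL (fun s => assoc s vis) A.acc with
  | none => pure none
  | some path => do
      let r ← rev path
      pure (some r)

/-- The automaton that runs through words of `P` again and again: whenever a word of `P` has
been completed, it may go to the fresh state `none`, from which it continues like
from the initial state. With the Büchi condition it recognizes `L(P)^ω`, on finite words `L(P)^+`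
(the words `ε` in between do not matter). It is the construction that links
the fresh state by `ε`-moves, with the `ε`-moves removed. -/
def FA.loop {σ : Type} [PEq α σ] (P : FA α σ) : Prog α (FA α (Option σ)) := do
  let states ← mapL (fun s => pure (some s)) P.states
  let trans ← bindL (fun d => do
    let fromInit ← peq d.1 P.init
    let toAcc ← memL d.2.2 P.acc
    let sources := if fromInit then [some d.1, none] else [some d.1]
    let targets := if toAcc then [some d.2.2, none] else [some d.2.2]
    bindL (fun p => mapL (fun q => pure (p, d.2.1, q)) targets) sources) P.trans
  pure { states := none :: states, init := some P.init, acc := [none], trans := trans }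

/-! ## Families of DFAs and their Büchi automata -/

/-- A family of DFAs. States are words. The leading automaton has no accepting states;
`progress` lists the progress automaton of every state of the leading automaton. -/
structure FDFA (α : Type) where
  lead : FA α (Word α)
  progress : List (Word α × FA α (Word α))

/-- The under-approximation or the over-approximation method. -/
inductive Method where
  | under
  | over

variable [DecidableEq α]

/-- The product automaton `P_(u,v)`, whose states are written as tuples:
`M^u_u × (A^u)^{s_u}_v × (A^u)^v_v` for the under-approximation and
`M^u_u × (A^u)^{s_u}_v` for the over-approximation. -/
def productPart (me : Method) (M A : FA α (Word α)) (u v : Word α) :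
    Prog α (FA α (List (Word α))) :=
  match me with
  | .under => do
      let N ← (A.fromTo A.init v).prod (A.fromTo v v)
      let P ← (M.fromTo u u).prod N
      P.rename fun s => pure [s.1, s.2.1, s.2.2]
  | .over => do
      let P ← (M.fromTo u u).prod (A.fromTo A.init v)
      P.rename fun s => pure [s.1, s.2]

/-- The Büchi automaton built from an FDFA: the leading automaton together with an automaton
for `L(P_(u,v))^ω` for every state `u` of the leading automaton and every accepting state `v` of
its progress automaton, which is entered from `u` (the `ε`-move from `u` to its
initial state being replaced by copies of the transitions of that state). -/
def buildBA (me : Method) (F : FDFA α) : Prog α (BA α) := do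
  let parts ← bindL (fun e => mapL (fun v => do
      let P ← productPart me F.lead e.2 e.1 v
      let C ← P.loop
      let C' ← C.rename fun s => pure (Sum.inr ((e.1, v), s))
      pure (e.1, C')) e.2.acc) F.progress
  let M ← F.lead.rename fun s => pure (Sum.inl s)
  let states ← bindL (fun c : Word α × BA α => pure c.2.states) parts
  let allStates ← app M.states states
  let acc ← bindL (fun c : Word α × BA α => pure c.2.acc) parts
  let trans ← bindL (fun c : Word α × BA α => do
      let entry ← bindL (fun d => do
        if ← peq d.1 c.2.init then pure [(Sum.inl c.1, d.2.1, d.2.2)] else pure []) c.2.trans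
      app c.2.trans entry) parts
  let allTrans ← app M.trans trans
  pure { states := allStates, init := M.init, acc := acc, trans := allTrans }

/-! ## Counterexample analysis -/

/-- The nonempty prefixes of the second argument, each with `p` in front, the shortest first. -/
def prefixes (p : Word α) : Word α → Prog α (List (Word α))
  | [] => .tick (pure [])
  | a :: w => .tick do
      let q ← app p [a]
      let r ← prefixes q w
      pure (q :: r)

/-- The word `w` without its prefix `p`, if it has this prefix. -/
def dropPrefix : Word α → Word α → Prog α (Option (Word α))
  | [], w => .tick (pure (some w))
  | _ :: _, [] => .tick (pure none)
  | a :: p, b :: w => .tick (if a = b then dropPrefix p w else pure none)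

/-- `w` with the prefix `p` removed as often as possible, but at most as often as the length of
the first argument says. -/
def dropPrefixes (p : Word α) : Word α → Word α → Prog α (Word α)
  | [], w => .tick (pure w)
  | _ :: n, w => .tick do
      match ← dropPrefix p w with
      | none => pure w
      | some w' => dropPrefixes p n w'

/-- The shortest nonempty prefix `y` of `v` such that `v` is a power of `y`. -/
def smallestPeriod (v : Word α) : Prog α (Word α) := do
  let ps ← prefixes [] v
  let r ← firstL (fun y => do
    match ← dropPrefixes y v v with
    | [] => pure (some y)
    | _ :: _ => pure none) ps
  pure (r.getD v)

/-- `u` with the suffix `y` removed as often as possible. -/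
def dropSuffixes (y u : Word α) : Prog α (Word α) := do
  let y' ← rev y
  let u' ← rev u
  let r ← dropPrefixes y' u' u'
  rev r

/-- The shortest forms that follow `(x, y)` when the period is rotated; the first argument counts
the rotations. -/
def rotations : Word α → Word α → Word α → Prog α (List (Word α × Word α))
  | [], _, _ => .tick (pure [])
  | _ :: _, _, [] => .tick (pure [])
  | _ :: n, x, a :: y => .tick do
      let u ← app x [a]
      let y' ← app y [a]
      let x' ← dropSuffixes y' u
      let r ← rotations n x' y'
      pure ((x, a :: y) :: r)

/-- All shortest forms `(x, y)` of decompositions of `uv^ω`. -/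
def shortestForms (u v : Word α) : Prog α (List (Word α × Word α)) := do
  let y ← smallestPeriod v
  let x ← dropSuffixes y u
  rotations y x y

/-- Transitions that read `w` from state `p` to state `t`, through the words in between. -/
def chain (p : Word α) (t : Word α) : Word α → Prog α (List (Word α × α × Word α))
  | [] => .tick (pure [])
  | [a] => .tick (pure [(p, a, t)])
  | a :: w => .tick do
      let q ← app p [a]
      let r ← chain q t w
      pure ((p, a, q) :: r)

/-- A DFA for `x y^* $ y^+`, where `$` is the letter `none`. The states before `$` are the proper
prefixes of `xy`, those after it are the prefixes of `y`. -/
def lassoFA (x y : Word α) : Prog α (FA (Option α) (Word α ⊕ Word α)) := do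
  let stem ← chain [] x x
  let cycle ← chain x x y
  let before ← app stem cycle
  let after ← chain [] y y
  let back := match y with
    | [] => []
    | a :: _ => [(y, a, [a])]
  let afterStates ← prefixes [] y
  let s₁ ← mapL (fun d => pure (Sum.inl d.1)) before
  let s₂ ← mapL (fun s => pure (Sum.inr s)) ([] :: afterStates)
  let states ← app s₁ s₂
  let t₁ ← mapL (fun d => pure (Sum.inl d.1, some d.2.1, Sum.inl d.2.2)) before
  let t₂ ← mapL (fun d => pure (Sum.inr d.1, some d.2.1, Sum.inr d.2.2)) after
  let t₃ ← mapL (fun d => pure (Sum.inr d.1, some d.2.1, Sum.inr d.2.2)) back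
  let t₂₃ ← app t₂ t₃
  let t ← app t₁ ((Sum.inl x, none, Sum.inr []) :: t₂₃)
  pure { states := states, init := Sum.inl [], acc := [Sum.inr y], trans := t }

/-- The automaton `M` on the letters of the alphabet, followed by the letter `$` (read in a state
`u` of `M`) and a part of the given list that belongs to `u`. -/
def dollarFA {σ : Type} (M : FA α (Word α)) (parts : List (Word α × FA α σ)) :
    Prog α (FA (Option α) (Word α ⊕ (Word α × σ))) := do
  let m ← mapL (fun s => pure (Sum.inl s)) M.states
  let s ← bindL (fun c => mapL (fun s => pure (Sum.inr (c.1, s))) c.2.states) parts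
  let states ← app m s
  let acc ← bindL (fun c => mapL (fun s => pure (Sum.inr (c.1, s))) c.2.acc) parts
  let t₁ ← mapL (fun d => pure (Sum.inl d.1, some d.2.1, Sum.inl d.2.2)) M.trans
  let t₂ ← mapL (fun c => pure (Sum.inl c.1, none, Sum.inr (c.1, c.2.init))) parts
  let t₃ ← bindL (fun c => mapL (fun d =>
    pure (Sum.inr (c.1, d.1), some d.2.1, Sum.inr (c.1, d.2.2))) c.2.trans) parts
  let t₂₃ ← app t₂ t₃
  let t ← app t₁ t₂₃
  pure { states := states, init := Sum.inl M.init, acc := acc, trans := t }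

/-- The DFA `D₁` (`accepted = true`) for the words `u$v` with `M(uv) = M(u)` and
`v ∈ L(A^{M(u)})`, or `D₂` (`accepted = false`) for those with `M(uv) = M(u)` and
`v ∉ L(A^{M(u)})`. -/
def decompFA (accepted : Bool) (F : FDFA α) :
    Prog α (FA (Option α) (Word α ⊕ (Word α × (Word α × Word α)))) := do
  let parts ← mapL (fun e => do
    let A ← if accepted then pure e.2 else e.2.compl
    let N ← (F.lead.fromTo e.1 e.1).prod A
    pure (e.1, N)) F.progress
  dollarFA F.lead parts

/-- The letters different from `$`. -/
def letters : List (Option α) → Prog α (Word α)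
  | [] => .tick (pure [])
  | none :: w => .tick (letters w)
  | some a :: w => .tick do
      let r ← letters w
      pure (a :: r)

/-- The pair `(u, v)` for a word `u$v`. -/
def splitDollar : List (Option α) → Prog α (Word α × Word α)
  | [] => .tick (pure ([], []))
  | none :: w => .tick do
      let v ← letters w
      pure ([], v)
  | some a :: w => .tick do
      let r ← splitDollar w
      pure (a :: r.1, r.2)

/-- Some decomposition `(u', v')` of `uv^ω` such that `u'$v'` is accepted by `D`; the decompositions
of `uv^ω` are given by the union of the automata `x y^* $ y^+`. -/
def findDecomp {σ : Type} [PEq α σ] (D : FA (Option α) σ) (u v : Word α) :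
    Prog α (Option (Word α × Word α)) := do
  let forms ← shortestForms u v
  firstL (fun c => do
    let W ← lassoFA c.1 c.2
    let P ← W.prod D
    match ← P.search with
    | none => pure none
    | some path => do
        let w ← mapL (fun e => pure e.1) path
        let r ← splitDollar w
        pure (some r)) forms

/-- The factors of the part after `$` of a run: a factor ends where the fresh state of
the loop is entered. -/
def factors {σ τ : Type} :
    List (Option α × ((Word α ⊕ (Word α × Option σ)) × τ)) → Prog α (List (Word α))
  | [] => .tick (pure [])
  | (none, _) :: l => .tick (factors l)
  | (some a, (Sum.inr (_, none), _)) :: l => .tick do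
      let r ← factors l
      pure ([a] :: r)
  | (some a, _) :: l => .tick do
      match ← factors l with
      | [] => pure [[a]]
      | w :: r => pure ((a :: w) :: r)

/-- The prefix before `$` and the factors after `$` of a run. -/
def prefixAndFactors {σ τ : Type} :
    List (Option α × ((Word α ⊕ (Word α × Option σ)) × τ)) → Prog α (Word α × List (Word α))
  | [] => .tick (pure ([], []))
  | (none, _) :: l => .tick do
      let r ← factors l
      pure ([], r)
  | (some a, _) :: l => .tick do
      let r ← prefixAndFactors l
      pure (a :: r.1, r.2)

/-- For an ω-word accepted by the over-approximation: a decomposition `(u', v₁⋯vₙ)` of it with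
`M(u'vᵢ) = M(u')` and `vᵢ ∈ L(A^{M(u')})` for all `i`. -/
def findFactors (F : FDFA α) (u v : Word α) : Prog α (Option (Word α × List (Word α))) := do
  let forms ← shortestForms u v
  firstL (fun e => firstL (fun p => do
    let P ← productPart .over F.lead e.2 e.1 p
    let C ← P.loop
    let D ← dollarFA F.lead [(e.1, C)]
    firstL (fun c => do
      let W ← lassoFA c.1 c.2
      let X ← D.prod W
      match ← X.search with
      | none => pure none
      | some path => do
          let r ← prefixAndFactors path
          pure (some r)) forms) e.2.acc) F.progress

/-- The counterexample analysis of the FDFA teacher: from a counterexample `uv^ω` for the Büchi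
automaton to a counterexample `(u', v')` for the FDFA learner, or `none` for an error. -/
def analyze (me : Method) (F : FDFA α) (u v : Word α) : Prog α (Option (Word α × Word α)) := do
  if ← askMem u v then
    let D ← decompFA false F
    findDecomp D u v
  else
    let D ← decompFA true F
    match ← findDecomp D u v with
    | some c => pure (some c)
    | none =>
      match me with
      | .under => pure none
      | .over =>
        match ← findFactors F u v with
        | none => pure none
        | some (u', vs) =>
          firstL (fun w => do
            if ← askMem u' w then pure none else pure (some (u', w))) vs

/-! ## Classification trees and observation tables -/

/-- The kind of canonical FDFA that is learned. -/
inductive Kind where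
  | periodic
  | syntactic
  | recurrent

/-- The third component of labels in the syntactic case. -/
inductive Mark where
  | A
  | B
  | C

/-- The labels of the edges of classification trees, and the entries of observation tables: `F` and
`T`, or pairs of a state of the leading automaton and a mark. -/
inductive Label (α : Type) where
  | truth (b : Bool)
  | mark (q : Word α) (m : Mark)

def eqLabel : Label α → Label α → Prog α Bool
  | .truth b, .truth c => pure (b == c)
  | .mark q m, .mark q' m' => do
      if ← peq q q' then
        match m, m' with
        | .A, .A => pure true
        | .B, .B => pure true
        | .C, .C => pure true
        | _, _ => pure false
      else pure false
  | _, _ => pure false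

/-- Classification trees with experiments in `E`. A terminal node is `leaf s` with its state `s`.
An internal node with experiment `e` and children `t₁, …, tₖ` along the edges `d₁, …, dₖ` is written
as the chain `branch e d₁ t₁ (branch e d₂ t₂ (… (branch e dₖ tₖ absent)))`, where
`absent` stands for the children that are not there. -/
inductive CTree (α E : Type) where
  | absent
  | leaf (s : Word α)
  | branch (e : E) (d : Label α) (child others : CTree α E)

/-- The states at the terminal nodes. -/
def CTree.leaves {E : Type} : CTree α E → Prog α (List (Word α))
  | .absent => .tick (pure [])
  | .leaf s => .tick (pure [s])
  | .branch _ _ t r => .tick do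
      let l ← t.leaves
      let l' ← r.leaves
      app l l'

/-- The state to which `x` is assigned, if the walk from the root ends in a terminal node. -/
def CTree.sift {E : Type} (te : Word α → E → Prog α (Label α)) (x : Word α) :
    CTree α E → Prog α (Option (Word α))
  | .absent => .tick (pure none)
  | .leaf s => .tick (pure (some s))
  | .branch e d t r => .tick do
      let c ← te x e
      if ← eqLabel c d then t.sift te x else r.sift te x

/-- The tree in which the missing child met by `x` is a new terminal node with state `x`. -/
def CTree.graft {E : Type} (te : Word α → E → Prog α (Label α)) (x : Word α) :
    CTree α E → Prog α (CTree α E)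
  | .absent => .tick (pure .absent)
  | .leaf s => .tick (pure (.leaf s))
  | .branch e d t r => .tick do
      let c ← te x e
      if ← eqLabel c d then do
        let t' ← t.graft te x
        pure (.branch e d t' r)
      else
        match r with
        | .absent => pure (.branch e d t (.branch e c (.leaf x) .absent))
        | r => do
            let r' ← r.graft te x
            pure (.branch e d t r')

/-- The tree in which the terminal node with state `q` has been replaced by an internal node
with experiment `e`, whose children are the terminal nodes `q` (along `dq`) and `x` (along `dx`). -/
def CTree.split {E : Type} (q x : Word α) (e : E) (dq dx : Label α) :
    CTree α E → Prog α (CTree α E)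
  | .absent => .tick (pure .absent)
  | .leaf s => .tick do
      if ← peq s q then
        pure (.branch e dq (.leaf q) (.branch e dx (.leaf x) .absent))
      else pure (.leaf s)
  | .branch e' d t r => .tick do
      let t' ← t.split q x e dq dx
      let r' ← r.split q x e dq dx
      pure (.branch e' d t' r')

/-- The row of `x`: the values of the experiment function on a list of experiments. -/
def rowOf {E : Type} (te : Word α → E → Prog α (Label α)) (x : Word α) (es : List E) :
    Prog α (List (Label α)) :=
  mapL (fun e => te x e) es

/-- Equality of two rows of the same table. -/
def eqRow : List (Label α) → List (Label α) → Prog α Bool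
  | [], [] => .tick (pure true)
  | c :: l, d :: l' => .tick do
      if ← eqLabel c d then eqRow l l' else pure false
  | _, _ => .tick (pure false)

/-- The data structure used by the DFA learners. -/
inductive Storage where
  | tree
  | table

/-- What a DFA learner keeps: a classification tree, or an observation table. A table consists of
its columns, labeled by experiments, and of the rows of its states; the rows of the words `sa`,
for states `s` and letters `a`, are filled in when the table is checked for being closed. -/
inductive Classifier (α E : Type) where
  | tree (t : CTree α E)
  | table (columns : List E) (rows : List (Word α × List (Label α)))

/-- At the beginning the only state is `ε`, and there are no experiments. -/
def Classifier.initial {E : Type} : Storage → Classifier α E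
  | .tree => .tree (.leaf [])
  | .table => .table [] [([], [])]

/-- The states distinguished so far. -/
def Classifier.states {E : Type} : Classifier α E → Prog α (List (Word α))
  | .tree t => t.leaves
  | .table _ rows => mapL (fun r => pure r.1) rows

/-- The state to which `x` is assigned, if there is one: in a tree by the walk from the root,
in a table by its row. -/
def Classifier.classify {E : Type} (te : Word α → E → Prog α (Label α)) (x : Word α) :
    Classifier α E → Prog α (Option (Word α))
  | .tree t => t.sift te x
  | .table columns rows => do
      let c ← rowOf te x columns
      firstL (fun r => do if ← eqRow c r.2 then pure (some r.1) else pure none) rows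

/-- Adding the new state `x`, which is not assigned to any state. -/
def Classifier.extend {E : Type} (te : Word α → E → Prog α (Label α)) (x : Word α) :
    Classifier α E → Prog α (Classifier α E)
  | .tree t => do
      let t' ← t.graft te x
      pure (.tree t')
  | .table columns rows => do
      let c ← rowOf te x columns
      let rows' ← app rows [(x, c)]
      pure (.table columns rows')

/-- Adding the new state `x`, which is assigned to `q` but told apart from it by
the experiment `e`, where `dq` and `dx` are the values of `e` on `q` and `x`. -/
def Classifier.refineBy {E : Type} (te : Word α → E → Prog α (Label α)) (q x : Word α) (e : E)
    (dq dx : Label α) : Classifier α E → Prog α (Classifier α E)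
  | .tree t => do
      let t' ← t.split q x e dq dx
      pure (.tree t')
  | .table columns rows => do
      let columns' ← app columns [e]
      let old ← mapL (fun r => do
        let d ← te r.1 e
        let c ← app r.2 [d]
        pure (r.1, c)) rows
      let c ← rowOf te x columns'
      let rows' ← app old [(x, c)]
      pure (.table columns' rows')

/-- The tree experiment function of the leading tree: `TE(x, (y, z)) = T` iff `xyz^ω ∈ L`. -/
def leadTE (x : Word α) (e : Word α × Word α) : Prog α (Label α) := do
  let w ← app x e.1
  let b ← askMem w e.2
  pure (.truth b)

/-- The tree experiment function of the progress tree of `u`, for the leading automaton `M`. -/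
def progressTE (K : Kind) (M : FA α (Word α)) (u x e : Word α) : Prog α (Label α) := do
  let xe ← app x e
  match K with
  | .periodic => do
      let b ← askMem u xe
      pure (.truth b)
  | .recurrent => do
      let uxe ← app u xe
      let q ← M.reach uxe
      if ← peq q u then do
        let b ← askMem u xe
        pure (.truth b)
      else pure (.truth false)
  | .syntactic => do
      let ux ← app u x
      let p ← M.reach ux
      let uxe ← app u xe
      let q ← M.reach uxe
      if ← peq q u then
        if ← askMem u xe then pure (.mark p .A) else pure (.mark p .B)
      else pure (.mark p .C)

/-- The DFA of a classification tree or an observation table (still without accepting states), or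
a word `sa` that is not assigned to any state. -/
def Classifier.toDFA {E : Type} (sig : List α) (te : Word α → E → Prog α (Label α))
    (C : Classifier α E) : Prog α (Word α ⊕ FA α (Word α)) := do
  let states ← C.states
  let targets ← bindL (fun s => mapL (fun a => do
    let x ← app s [a]
    let r ← C.classify te x
    pure (s, a, x, r)) sig) states
  match ← firstL (fun d => pure (if d.2.2.2.isNone then some d.2.2.1 else none)) targets with
  | some x => pure (Sum.inl x)
  | none => do
      let trans ← mapL (fun d => pure (d.1, d.2.1, d.2.2.2.getD [])) targets
      pure (Sum.inr { states := states, init := [], acc := [], trans := trans })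

/-- Whether the state `v` of the progress automaton of `u` is accepting. -/
def isAccepting (K : Kind) (M : FA α (Word α)) (u v : Word α) : Prog α Bool :=
  match K with
  | .periodic => askMem u v
  | _ => do
      let uv ← app u v
      let p ← M.reach uv
      let q ← M.reach u
      if ← peq p q then askMem u v else pure false

/-! ## The learning algorithm -/

/-- The data kept by the FDFA learner: a classification tree or observation table for the leading
automaton, and one for the progress automaton of every state of the leading automaton. -/
structure Learner (α : Type) where
  lead : Classifier α (Word α × Word α)
  progress : List (Word α × Classifier α (Word α))

/-- The initial data: the only state of all automata is `ε`. -/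
def Learner.initial (S : Storage) : Learner α :=
  { lead := Classifier.initial S, progress := [([], Classifier.initial S)] }

/-- The new data after the state `x` has been added to the leading automaton. In the periodic
case the learner of a new progress automaton is added; in the other cases, where the experiment
functions depend on the leading automaton, all progress automata are learned anew. -/
def Learner.newLead (S : Storage) (K : Kind) (D : Learner α)
    (lead : Classifier α (Word α × Word α)) (x : Word α) : Prog α (Learner α) :=
  match K with
  | .periodic => do
      let progress ← app D.progress [(x, Classifier.initial S)]
      pure { lead := lead, progress := progress }
  | _ => do
      let states ← lead.states
      let progress ← mapL (fun s => pure (s, Classifier.initial S)) states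
      pure { lead := lead, progress := progress }

/-- Along the run of `A` from `s` on a word: the first position where the state `q = δ(p, a)` and
the word `pa` are told apart by the experiment made of the rest of the word. The result
consists of `q`, `pa`, the experiment, `TE(q, e)` and `TE(pa, e)`. -/
def breakpoint {E : Type} (te : Word α → E → Prog α (Label α)) (experiment : Word α → E)
    (A : FA α (Word α)) :
    Word α → Word α → Prog α (Option (Word α × Word α × E × Label α × Label α))
  | _, [] => .tick (pure none)
  | p, a :: w => .tick do
      let q ← A.step p a
      let pa ← app p [a]
      let dq ← te q (experiment w)
      let dpa ← te pa (experiment w)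
      if ← eqLabel dq dpa then breakpoint te experiment A q w
      else pure (some (q, pa, experiment w, dq, dpa))

/-- The refinement by a counterexample `(u, v)` for the FDFA learner. -/
def refine (S : Storage) (K : Kind) (D : Learner α) (F : FDFA α) (u v : Word α) :
    Prog α (Option (Learner α)) := do
  let q₀ ← F.lead.reach u
  let b ← askMem u v
  let b' ← askMem q₀ v
  if b != b' then
    match ← breakpoint leadTE (fun w => (w, v)) F.lead F.lead.init u with
    | none => pure none
    | some (q, x, e, dq, dx) => do
        let lead ← D.lead.refineBy leadTE q x e dq dx
        let D' ← D.newLead S K lead x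
        pure (some D')
  else
    match ← assoc q₀ F.progress with
    | none => pure none
    | some A =>
      match ← breakpoint (progressTE K F.lead q₀) (fun w => w) A A.init v with
      | none => pure none
      | some (q, x, e, dq, dx) => do
          let progress ← mapL (fun c => do
            if ← peq c.1 q₀ then do
              let C ← c.2.refineBy (progressTE K F.lead q₀) q x e dq dx
              pure (c.1, C)
            else pure c) D.progress
          pure (some { lead := D.lead, progress := progress })

/-- How the algorithm ends: with a Büchi automaton or by reporting an error. -/
inductive Outcome (α : Type) where
  | returned (B : BA α)
  | error

/-- One round of the algorithm, for the alphabet listed by `sig`. The FDFA is constructed from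
the data of the learner; if this uncovers a new state, the state is added, and the next round
starts over. Otherwise the FDFA is turned into a Büchi automaton and an equivalence query is posed.
If the answer is "no", the counterexample is analyzed and the data are refined. -/
def round (sig : List α) (S : Storage) (K : Kind) (me : Method) (D : Learner α) :
    Prog α (Learner α ⊕ Outcome α) := .tick do
  match ← D.lead.toDFA sig leadTE with
  | .inl x => do
      let lead ← D.lead.extend leadTE x
      let D' ← D.newLead S K lead x
      pure (.inl D')
  | .inr M => do
      let built ← mapL (fun c => do
        let A ← c.2.toDFA sig (progressTE K M c.1)
        pure (c.1, A)) D.progress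
      match ← firstL (fun c => match c.2 with
          | .inl x => pure (some (c.1, x))
          | .inr _ => pure none) built with
      | some (u, x) => do
          let progress ← mapL (fun c => do
            if ← peq c.1 u then do
              let C ← c.2.extend (progressTE K M u) x
              pure (c.1, C)
            else pure c) D.progress
          pure (.inl { lead := D.lead, progress := progress })
      | none => do
          let progress ← bindL (fun c => match c.2 with
            | .inl _ => pure []
            | .inr A => do
                let acc ← filterL (isAccepting K M c.1) A.states
                pure [(c.1, { A with acc := acc })]) built
          let F : FDFA α := { lead := M, progress := progress }
          let B ← buildBA me F
          match ← askEqu B with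
          | none => pure (.inr (.returned B))
          | some (u, v) =>
            match ← analyze me F u v with
            | none => pure (.inr .error)
            | some (u', v') =>
              match ← refine S K D F u' v' with
              | none => pure (.inr .error)
              | some D' => pure (.inl D')

end

/-- `Terminates member equiv sig S K me D h o t h'`: when the rounds are repeated from the data `D`
and the log `h`, the algorithm terminates with outcome `o` after `t` steps, with log `h'`. -/
inductive Terminates {α : Type} [DecidableEq α] (member : Word α → Word α → Bool)
    (equiv : Log α → BA α → Option (Word α × Word α)) (sig : List α)
    (S : Storage) (K : Kind) (me : Method) :
    Learner α → Log α → Outcome α → ℕ → Log α → Prop where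
  | finish (D : Learner α) (h : Log α) (o : Outcome α) (t : ℕ) (h' : Log α)
      (hr : (round sig S K me D).eval member equiv h = (.inr o, t, h')) :
      Terminates member equiv sig S K me D h o t h'
  | next (D D' : Learner α) (h h' h'' : Log α) (o : Outcome α) (t t' : ℕ)
      (hr : (round sig S K me D).eval member equiv h = (.inl D', t, h'))
      (ht : Terminates member equiv sig S K me D' h' o t' h'') :
      Terminates member equiv sig S K me D h o (t + t') h''

open Classical in
/-- Against the BA teacher `τ` for `L`, the BA learning algorithm terminates with outcome `o` after
`t` steps, and `h` is the list of all queries and answers. -/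
def LearnsWith {α : Type} [Fintype α] [DecidableEq α] {L : Set (Stream' α)} (τ : BATeacher L)
    (S : Storage) (K : Kind) (me : Method) (o : Outcome α) (t : ℕ) (h : Log α) : Prop :=
  Terminates (fun u v => decide (UPMem L u v)) τ.answer (Finset.univ : Finset α).toList S K me
    (Learner.initial S) [] o t h

end BuchiLearning

open BuchiLearning

/-! The claim about over-approximation is a matter of control flow. A Büchi automaton is returned
only in the branch where the teacher has just answered "yes" to it, and a BA teacher says "yes" only
to automata with the right language (`confirms_round`, `Terminates.confirmed`).

For under-approximation the question is why every counterexample leads to progress, why progress is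
bounded, and why each round is cheap.

Every counterexample can be explained. Let the family have leading automaton M and progress automata
A^u. If the Büchi automaton accepts an ultimately periodic word, an accepting run visits the fresh
state of one component (u,v) infinitely often, hence twice at the same phase of the period. The
factor M^u_u keeps M synchronized with the word read. The two copies of A^u, started in ε and in v,
ensure that A^u reads the whole segment between the visits from ε to v. So the segment and the
prefix before it form a decomposition accepted by the family (`exists_accepted_decomp`). Conversely,
if all decompositions of xy^ω that loop in M are accepted, pumping y makes M loop and makes A^c
idempotent on a power z of y. Then z itself is a word of the product automaton, and xy^ω is accepted
(`mem_buildBA_of_forall`). Thus for a counterexample one of the two searches must succeed, and it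
yields a pair on which the family contradicts L (`analyze_under`). The searches are emptiness tests
of products with automata for x y^* $ y^+, so the pair is short.

Every such pair adds a state. Along a run s_0, s_1, ... one compares s_{j-1}a_j with s_j under the
experiment made of the remaining word. If no comparison shows a difference, the values telescope,
and the automaton agrees with L on the whole word (`val_breakpoint_none`), against the choice of the
pair. At the first difference, s_{j-1}a_j is assigned to s_j but told apart from it, so a tree leaf
can be split or a column added (`Classifier.Good.refineBy`, `refine_spec`).

The number of states is bounded. Distinct states always differ in some experiment. Experiments of
the leading automaton respect ∼_L, so there are at most n leading states. For every kind of FDFA the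
experiments of A^u on s depend only on M(us) and the ≈^u-class of s, so a progress automaton has at
most nk states (`length_le_leadIndex_of_good`, `length_le_progressIndex_of_good`). That n and k are
finite comes from transition profiles of a Büchi automaton for L (`finite_leadCongr`,
`finite_periodicCongr`). A potential that counts the missing states, with leading states weighing
more than all progress states together, drops in every round that does not return (`round_spec`),
also when progress automata are learned anew.

Costs are recorded on a logarithmic scale. All sizes and running times are bounded by powers of one
number m ≥ 2, ultimately m = n + k + |Σ| + ℓ + 2; sums raise the exponent by one, and products add
exponents. The resulting exponents are generous, but they are constants. Strong induction on the
potential multiplies the bound for one round by a bound for the number of rounds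
(`exists_terminates`). -/

namespace BuchiLearning

/-! ## Values and costs of programs -/

/-- The result of a program (equivalence queries are taken to be answered with "yes"). -/
def Prog.val {α β : Type} (mem : Word α → Word α → Bool) : Prog α β → β
  | .ret b => b
  | .tick p => p.val mem
  | .mem u v k => (k (mem u v)).val mem
  | .equ _ k => (k none).val mem

/-- The program poses no equivalence query and takes at most `c` steps. -/
def Prog.Within {α β : Type} (mem : Word α → Word α → Bool) : ℕ → Prog α β → Prop
  | _, .ret _ => True
  | 0, .tick _ => False
  | c + 1, .tick p => p.Within mem c
  | 0, .mem _ _ _ => False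
  | c + 1, .mem u v k => (k (mem u v)).Within mem c
  | _, .equ _ _ => False

section

variable {α β γ : Type} {mem : Word α → Word α → Bool}

@[simp] theorem val_pure (b : β) : (pure b : Prog α β).val mem = b := rfl
@[simp] theorem val_tick (p : Prog α β) : (Prog.tick p).val mem = p.val mem := rfl
@[simp] theorem val_askMem (u v : Word α) : (askMem u v).val mem = mem u v := rfl

@[simp] theorem val_bind (p : Prog α β) (f : β → Prog α γ) :
    (p >>= f).val mem = (f (p.val mem)).val mem := by
  change (p.andThen f).val mem = _
  induction p with
  | ret b => rfl
  | tick p ih => exact ih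
  | mem u v k ih => exact ih _
  | equ B k ih => exact ih _

@[simp] theorem val_ite (c : Prop) [Decidable c] (p q : Prog α β) :
    (if c then p else q).val mem = if c then p.val mem else q.val mem := by
  split_ifs <;> rfl

theorem Prog.Within.mono {p : Prog α β} {c d : ℕ} (h : p.Within mem c) (hcd : c ≤ d) :
    p.Within mem d := by
  induction p generalizing c d with
  | ret b => cases d <;> trivial
  | tick p ih =>
    cases c with
    | zero => exact h.elim
    | succ c =>
      obtain ⟨d, rfl⟩ : ∃ e, d = e + 1 := ⟨d - 1, by omega⟩
      exact ih h (by omega)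
  | mem u v k ih =>
    cases c with
    | zero => exact h.elim
    | succ c =>
      obtain ⟨d, rfl⟩ : ∃ e, d = e + 1 := ⟨d - 1, by omega⟩
      exact ih _ h (by omega)
  | equ B k ih => cases c <;> exact h.elim

theorem within_pure (b : β) (c : ℕ) : (pure b : Prog α β).Within mem c := by
  cases c <;> trivial

theorem Prog.Within.tick {p : Prog α β} {c : ℕ} (h : p.Within mem c) :
    (Prog.tick p).Within mem (c + 1) := h

theorem within_askMem (u v : Word α) : (askMem u v).Within mem 1 := trivial

/-- The continuation has to be bounded only at the value that the first program really produces.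
This is how facts about intermediate results, such as sizes of automata, enter the cost bounds. -/
theorem Prog.Within.bind {p : Prog α β} {f : β → Prog α γ} {c d : ℕ} (h : p.Within mem c)
    (h' : (f (p.val mem)).Within mem d) : (p >>= f).Within mem (c + d) := by
  change (p.andThen f).Within mem (c + d)
  induction p generalizing c with
  | ret b => exact h'.mono (by omega)
  | tick p ih =>
    cases c with
    | zero => exact h.elim
    | succ c => rw [Nat.add_right_comm]; exact ih h h'
  | mem u v k ih =>
    cases c with
    | zero => exact h.elim
    | succ c => rw [Nat.add_right_comm]; exact ih _ h h'
  | equ B k ih => cases c <;> exact h.elim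

theorem Prog.Within.ite {c : Prop} [Decidable c] {p q : Prog α β} {d : ℕ}
    (h : c → p.Within mem d) (h' : ¬ c → q.Within mem d) :
    (if c then p else q).Within mem d := by
  split_ifs with hc
  · exact h hc
  · exact h' hc

theorem Prog.eval_bind (equiv : Log α → BA α → Option (Word α × Word α)) (p : Prog α β)
    (f : β → Prog α γ) (h : Log α) :
    (p >>= f).eval mem equiv h =
      ((f (p.eval mem equiv h).1).eval mem equiv (p.eval mem equiv h).2.2 |>.1,
       (p.eval mem equiv h).2.1 +
         ((f (p.eval mem equiv h).1).eval mem equiv (p.eval mem equiv h).2.2).2.1,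
       ((f (p.eval mem equiv h).1).eval mem equiv (p.eval mem equiv h).2.2).2.2) := by
  change (p.andThen f).eval mem equiv h = _
  induction p generalizing h with
  | ret b => simp [Prog.andThen, Prog.eval]
  | tick p ih => simp [Prog.andThen, Prog.eval, ih, Nat.add_right_comm]
  | mem u v k ih => simp [Prog.andThen, Prog.eval, ih, Nat.add_right_comm]
  | equ B k ih => simp [Prog.andThen, Prog.eval, ih, Nat.add_right_comm]

/-- Without equivalence queries the teacher's strategy is irrelevant to the result, and membership
answers logged on the way contain no counterexamples. This transfers `val` and `Within` to real
executions. -/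
theorem Prog.Within.eval {p : Prog α β} {c : ℕ} (hp : p.Within mem c)
    (equiv : Log α → BA α → Option (Word α × Word α)) (h : Log α) :
    ∃ t h', p.eval mem equiv h = (p.val mem, t, h') ∧ t ≤ c ∧ longestCE h' = longestCE h := by
  induction p generalizing c h with
  | ret b => exact ⟨0, h, rfl, Nat.zero_le _, rfl⟩
  | tick p ih =>
    cases c with
    | zero => exact hp.elim
    | succ c =>
      obtain ⟨t, h', e, ht, hl⟩ := ih (c := c) hp h
      exact ⟨t + 1, h', by simp [Prog.eval, e, Prog.val], by omega, hl⟩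
  | mem u v k ih =>
    cases c with
    | zero => exact hp.elim
    | succ c =>
      obtain ⟨t, h', e, ht, hl⟩ := ih _ (c := c) hp (.mem u v (mem u v) :: h)
      exact ⟨t + 1, h', by simp [Prog.eval, e, Prog.val], by omega, hl⟩
  | equ B k ih => cases c <;> exact hp.elim

/-! ### Costs on a logarithmic scale -/

variable {m : ℕ}

/-- Two summands below `m ^ c` add up to at most `2 * m ^ c`, and the base `m ≥ 2` absorbs the
factor into one more exponent. So a cost bound is just an exponent, and sequential composition
increases it by one. -/
theorem pow_add_pow_le (hm : 2 ≤ m) {a b c x y : ℕ} (hx : x ≤ m ^ a) (hy : y ≤ m ^ b)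
    (ha : a < c) (hb : b < c) : x + y ≤ m ^ c := by
  obtain ⟨c, rfl⟩ : ∃ d, c = d + 1 := ⟨c - 1, by omega⟩
  have h1 : m ^ a ≤ m ^ c := Nat.pow_le_pow_right (by omega) (by omega)
  have h2 : m ^ b ≤ m ^ c := Nat.pow_le_pow_right (by omega) (by omega)
  calc x + y ≤ m ^ c * 2 := by omega
    _ ≤ m ^ c * m := Nat.mul_le_mul_left _ hm
    _ = m ^ (c + 1) := (pow_succ _ _).symm

theorem pow_mul_pow_le (hm : 2 ≤ m) {a b c x y : ℕ} (hx : x ≤ m ^ a) (hy : y ≤ m ^ b)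
    (h : a + b ≤ c) : x * y ≤ m ^ c :=
  calc x * y ≤ m ^ a * m ^ b := Nat.mul_le_mul hx hy
    _ = m ^ (a + b) := (pow_add _ _ _).symm
    _ ≤ m ^ c := Nat.pow_le_pow_right (by omega) h

theorem le_pow_of_le (hm : 2 ≤ m) {a c x : ℕ} (hx : x ≤ m ^ a) (h : a ≤ c) : x ≤ m ^ c :=
  hx.trans (Nat.pow_le_pow_right (by omega) h)

theorem one_le_pow' (hm : 2 ≤ m) (c : ℕ) : 1 ≤ m ^ c := Nat.one_le_pow _ _ (by omega)

theorem le_pow_one {x : ℕ} (hx : x ≤ m) : x ≤ m ^ 1 := by simpa using hx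

theorem le_pow_self (hm : 2 ≤ m) {x c : ℕ} (hx : x ≤ m) (hc : 1 ≤ c) : x ≤ m ^ c :=
  le_pow_of_le hm (le_pow_one hx) hc

theorem Prog.Within.pow {p : Prog α β} {a c : ℕ} (h : p.Within mem (m ^ a)) (hm : 2 ≤ m)
    (hac : a ≤ c) : p.Within mem (m ^ c) := h.mono (Nat.pow_le_pow_right (by omega) hac)

/-- For subroutines whose input is itself only bounded by a power: a bound proved with base `m ^ a`
is translated back to base `m`. -/
theorem Prog.Within.pow_pow {p : Prog α β} {a b c : ℕ} (h : p.Within mem ((m ^ a) ^ b))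
    (hm : 2 ≤ m) (hc : a * b ≤ c) : p.Within mem (m ^ c) := by
  rw [← pow_mul] at h
  exact h.pow hm hc

theorem two_le_pow (hm : 2 ≤ m) {c : ℕ} (hc : 1 ≤ c) : 2 ≤ m ^ c :=
  hm.trans (le_pow_self hm le_rfl hc)

theorem Prog.Within.tick_pow {p : Prog α β} (hm : 2 ≤ m) {a c : ℕ}
    (h : p.Within mem (m ^ a)) (hac : a < c) : (Prog.tick p).Within mem (m ^ c) :=
  h.tick.mono (pow_add_pow_le hm le_rfl (one_le_pow' hm a) hac hac)

theorem Prog.Within.bind_pow {p : Prog α β} {f : β → Prog α γ} (hm : 2 ≤ m) {a b c : ℕ}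
    (h : p.Within mem (m ^ a)) (h' : (f (p.val mem)).Within mem (m ^ b))
    (ha : a < c) (hb : b < c) : (p >>= f).Within mem (m ^ c) :=
  (h.bind h').mono (pow_add_pow_le hm le_rfl le_rfl ha hb)

theorem within_askMem_pow (hm : 2 ≤ m) (u v : Word α) (c : ℕ) :
    (askMem u v).Within mem (m ^ c) := (within_askMem u v).mono (one_le_pow' hm c)

/-! ### List programs -/

@[simp] theorem val_app (l l' : List β) : (app l l' : Prog α _).val mem = l ++ l' := by
  induction l with
  | nil => simp [app]
  | cons b l ih => simp [app, ih]

theorem within_app (l l' : List β) : (app l l' : Prog α _).Within mem (l.length + 1) := by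
  induction l with
  | nil => exact trivial
  | cons b l ih =>
    change (Prog.tick (app l l' >>= fun r => pure (b :: r))).Within mem _
    refine Prog.Within.tick (Prog.Within.bind (d := 0) ih ?_)
    exact within_pure _ _

@[simp] theorem val_mapL (f : β → Prog α γ) (l : List β) :
    (mapL f l).val mem = l.map fun b => (f b).val mem := by
  induction l with
  | nil => simp [mapL]
  | cons b l ih => simp [mapL, ih]

theorem within_mapL {f : β → Prog α γ} {l : List β} {c : ℕ}
    (hf : ∀ b ∈ l, (f b).Within mem c) : (mapL f l).Within mem ((c + 1) * l.length + 1) := by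
  induction l with
  | nil => exact trivial
  | cons b l ih =>
    have h : (mapL f (b :: l)).Within mem (c + ((c + 1) * l.length + 1 + 0) + 1) := by
      refine ((hf b (by simp)).bind ((ih fun b hb => hf b (by simp [hb])).bind ?_)).tick
      exact within_pure _ _
    refine h.mono ?_
    simp only [List.length_cons]; ring_nf; omega

@[simp] theorem val_bindL (f : β → Prog α (List γ)) (l : List β) :
    (bindL f l).val mem = l.flatMap fun b => (f b).val mem := by
  induction l with
  | nil => simp [bindL]
  | cons b l ih => simp [bindL, ih]

/-- The summand `d` pays for `app`, which walks through the list returned for each entry. -/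
theorem within_bindL {f : β → Prog α (List γ)} {l : List β} {c d : ℕ}
    (hf : ∀ b ∈ l, (f b).Within mem c) (hd : ∀ b ∈ l, ((f b).val mem).length ≤ d) :
    (bindL f l).Within mem ((c + d + 2) * l.length + 1) := by
  induction l with
  | nil => exact trivial
  | cons b l ih =>
    have h : (bindL f (b :: l)).Within mem
        (c + ((c + d + 2) * l.length + 1 + (((f b).val mem).length + 1)) + 1) :=
      ((hf b (by simp)).bind
        ((ih (fun b hb => hf b (by simp [hb])) fun b hb => hd b (by simp [hb])).bind
          (within_app _ _))).tick
    refine h.mono ?_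
    have := hd b (by simp)
    simp only [List.length_cons]; ring_nf; omega

@[simp] theorem val_filterL (f : β → Prog α Bool) (l : List β) :
    (filterL f l).val mem = l.filter fun b => (f b).val mem := by
  induction l with
  | nil => simp [filterL]
  | cons b l ih => cases h : (f b).val mem <;> simp [filterL, ih, h]

theorem within_filterL {f : β → Prog α Bool} {l : List β} {c : ℕ}
    (hf : ∀ b ∈ l, (f b).Within mem c) : (filterL f l).Within mem ((c + 1) * l.length + 1) := by
  induction l with
  | nil => exact trivial
  | cons b l ih =>
    have h : (filterL f (b :: l)).Within mem (c + ((c + 1) * l.length + 1 + 0) + 1) :=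
      ((hf b (by simp)).bind ((ih fun b hb => hf b (by simp [hb])).bind
        (Prog.Within.ite (fun _ => within_pure _ _) fun _ => within_pure _ _))).tick
    refine h.mono ?_
    simp only [List.length_cons]; ring_nf; omega

@[simp] theorem val_firstL (f : β → Prog α (Option γ)) (l : List β) :
    (firstL f l).val mem = l.findSome? fun b => (f b).val mem := by
  induction l with
  | nil => simp [firstL]
  | cons b l ih => cases h : (f b).val mem <;> simp [firstL, ih, h]

theorem within_firstL {f : β → Prog α (Option γ)} {l : List β} {c : ℕ}
    (hf : ∀ b ∈ l, (f b).Within mem c) : (firstL f l).Within mem ((c + 1) * l.length + 1) := by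
  induction l with
  | nil => exact trivial
  | cons b l ih =>
    have ih := ih fun b hb => hf b (by simp [hb])
    have h : (firstL f (b :: l)).Within mem (c + ((c + 1) * l.length + 1) + 1) := by
      refine ((hf b (by simp)).bind ?_).tick
      split
      · exact within_pure _ _
      · exact ih
    refine h.mono ?_
    simp only [List.length_cons]; ring_nf; omega

@[simp] theorem val_foldL (f : γ → β → Prog α γ) (c : γ) (l : List β) :
    (foldL f c l).val mem = l.foldl (fun c b => (f c b).val mem) c := by
  induction l generalizing c with
  | nil => simp [foldL]
  | cons b l ih => simp [foldL, ih]

/-- The cost of one round depends on the accumulator, so an invariant `I` has to travel along with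
it. -/
theorem within_foldL {f : γ → β → Prog α γ} {l : List β} {d : ℕ} (I : γ → Prop)
    (hf : ∀ c, I c → ∀ b ∈ l, (f c b).Within mem d ∧ I ((f c b).val mem)) {c : γ} (hc : I c) :
    (foldL f c l).Within mem ((d + 1) * l.length + 1) := by
  induction l generalizing c with
  | nil => exact trivial
  | cons b l ih =>
    have h : (foldL f c (b :: l)).Within mem (d + ((d + 1) * l.length + 1) + 1) :=
      ((hf c hc b (by simp)).1.bind
        (ih (fun c hc b hb => hf c hc b (by simp [hb])) (hf c hc b (by simp)).2)).tick
    refine h.mono ?_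
    simp only [List.length_cons]; ring_nf; omega

@[simp] theorem val_revOnto (l l' : List β) :
    (revOnto l l' : Prog α _).val mem = l.reverse ++ l' := by
  induction l generalizing l' with
  | nil => simp [revOnto]
  | cons b l ih => simp [revOnto, ih]

@[simp] theorem val_rev (l : List β) : (rev l : Prog α _).val mem = l.reverse := by simp [rev]

theorem within_rev (l : List β) : (rev l : Prog α _).Within mem (l.length + 1) := by
  suffices ∀ l' : List β, (revOnto l l' : Prog α _).Within mem (l.length + 1) from this []
  induction l with
  | nil => exact fun _ => trivial
  | cons b l ih => exact fun l' => (ih (b :: l')).tick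

/-- All loops have costs of the shape `(x + 1) * y + 1`, so the two additions of one can be absorbed
here once and for all. -/
theorem loop_pow_le (hm : 2 ≤ m) {a b c x y : ℕ} (hx : x ≤ m ^ b) (hy : y ≤ m ^ a)
    (h : a + b + 2 ≤ c) : (x + 1) * y + 1 ≤ m ^ c := by
  refine pow_add_pow_le hm (a := a + b + 1) (b := 0)
    (pow_mul_pow_le hm (a := b + 1) (b := a) ?_ hy ?_) (by simp) ?_ ?_
  · exact pow_add_pow_le hm hx (one_le_pow' hm b) (by omega) (by omega)
  all_goals omega

theorem within_app_pow (hm : 2 ≤ m) {a c : ℕ} {l l' : List β} (h : l.length ≤ m ^ a)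
    (hc : a < c) : (app l l' : Prog α _).Within mem (m ^ c) :=
  (within_app l l').mono (pow_add_pow_le hm h (one_le_pow' hm a) hc hc)

theorem within_rev_pow (hm : 2 ≤ m) {a c : ℕ} {l : List β} (h : l.length ≤ m ^ a)
    (hc : a < c) : (rev l : Prog α _).Within mem (m ^ c) :=
  (within_rev l).mono (pow_add_pow_le hm h (one_le_pow' hm a) hc hc)

theorem within_mapL_pow (hm : 2 ≤ m) {a b c : ℕ} {f : β → Prog α γ} {l : List β}
    (hl : l.length ≤ m ^ a) (hf : ∀ x ∈ l, (f x).Within mem (m ^ b)) (hc : a + b + 2 ≤ c) :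
    (mapL f l).Within mem (m ^ c) :=
  (within_mapL hf).mono (loop_pow_le hm le_rfl hl hc)

theorem within_filterL_pow (hm : 2 ≤ m) {a b c : ℕ} {f : β → Prog α Bool} {l : List β}
    (hl : l.length ≤ m ^ a) (hf : ∀ x ∈ l, (f x).Within mem (m ^ b)) (hc : a + b + 2 ≤ c) :
    (filterL f l).Within mem (m ^ c) :=
  (within_filterL hf).mono (loop_pow_le hm le_rfl hl hc)

theorem within_firstL_pow (hm : 2 ≤ m) {a b c : ℕ} {f : β → Prog α (Option γ)} {l : List β}
    (hl : l.length ≤ m ^ a) (hf : ∀ x ∈ l, (f x).Within mem (m ^ b)) (hc : a + b + 2 ≤ c) :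
    (firstL f l).Within mem (m ^ c) :=
  (within_firstL hf).mono (loop_pow_le hm le_rfl hl hc)

theorem within_foldL_pow (hm : 2 ≤ m) {a b d : ℕ} {f : γ → β → Prog α γ} {l : List β}
    (I : γ → Prop) (hl : l.length ≤ m ^ a)
    (hf : ∀ c, I c → ∀ x ∈ l, (f c x).Within mem (m ^ b) ∧ I ((f c x).val mem)) {c : γ}
    (hc : I c) (hd : a + b + 2 ≤ d) : (foldL f c l).Within mem (m ^ d) :=
  (within_foldL I hf hc).mono (loop_pow_le hm le_rfl hl hd)

theorem within_bindL_pow (hm : 2 ≤ m) {a b c : ℕ} {f : β → Prog α (List γ)} {l : List β}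
    (hl : l.length ≤ m ^ a) (hf : ∀ x ∈ l, (f x).Within mem (m ^ b))
    (hd : ∀ x ∈ l, ((f x).val mem).length ≤ m ^ b) (hc : a + b + 4 ≤ c) :
    (bindL f l).Within mem (m ^ c) := by
  refine (within_bindL hf hd).mono (loop_pow_le (b := b + 2) hm ?_ hl (by omega))
  exact pow_add_pow_le hm (pow_add_pow_le (c := b + 1) hm le_rfl le_rfl (by omega) (by omega))
    (one_le_pow' hm b) (by omega) (by omega)

theorem length_flatMap_le {f : β → List γ} {l : List β} {d : ℕ} (h : ∀ b ∈ l, (f b).length ≤ d) :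
    (l.flatMap f).length ≤ l.length * d := by
  induction l with
  | nil => simp
  | cons b l ih =>
    have := h b (by simp)
    have := ih fun b hb => h b (by simp [hb])
    simp only [List.flatMap_cons, List.length_append, List.length_cons, Nat.add_mul]
    omega

theorem length_flatMap_pow (hm : 2 ≤ m) {a b c : ℕ} {f : β → List γ} {l : List β}
    (hl : l.length ≤ m ^ a) (hf : ∀ x ∈ l, (f x).length ≤ m ^ b) (hc : a + b ≤ c) :
    (l.flatMap f).length ≤ m ^ c :=
  (length_flatMap_le hf).trans (pow_mul_pow_le hm hl le_rfl hc)

end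

/-! ### Equality tests -/

/-- Equality tests that are correct and whose cost is bounded by a size of the first argument. -/
class LawfulPEq (α σ : Type) [PEq α σ] where
  size : σ → ℕ
  test_iff : ∀ (mem : Word α → Word α → Bool) (s t : σ),
    (PEq.test s t : Prog α Bool).val mem = true ↔ s = t
  within_test : ∀ (mem : Word α → Word α → Bool) (s t : σ),
    (PEq.test s t : Prog α Bool).Within mem (size s)

/-- The size of a state, as far as equality tests are concerned. -/
def psize (α : Type) {σ : Type} [PEq α σ] [LawfulPEq α σ] (s : σ) : ℕ := LawfulPEq.size α s

section

variable {α σ τ : Type} {mem : Word α → Word α → Bool}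

theorem within_peq [PEq α σ] [LawfulPEq α σ] (s t : σ) :
    (peq s t : Prog α Bool).Within mem (psize α s) := LawfulPEq.within_test mem s t

open Classical in
@[simp] theorem val_peq [PEq α σ] [LawfulPEq α σ] (s t : σ) :
    (peq s t : Prog α Bool).val mem = decide (s = t) := by
  rw [Bool.eq_iff_iff, decide_eq_true_eq]
  exact LawfulPEq.test_iff mem s t

instance [DecidableEq α] : LawfulPEq α α where
  size _ := 1
  test_iff mem s t := by simp [PEq.test]
  within_test _ _ _ := trivial

theorem val_eqL_iff [PEq α σ] [LawfulPEq α σ] (l l' : List σ) :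
    (eqL l l' : Prog α Bool).val mem = true ↔ l = l' := by
  induction l generalizing l' with
  | nil => cases l' <;> simp [eqL]
  | cons a l ih =>
    cases l' with
    | nil => simp [eqL]
    | cons b l' => by_cases h : a = b <;> simp [eqL, ih, h]

/-- The comparison stops at the first difference or at the end of the shorter list, so the first
list alone bounds the cost. Nothing need be known about the size of the second. -/
theorem within_eqL [PEq α σ] [LawfulPEq α σ] (l l' : List σ) :
    (eqL l l' : Prog α Bool).Within mem ((l.map fun s => psize α s + 1).sum + 1) := by
  induction l generalizing l' with
  | nil => cases l' <;> exact trivial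
  | cons a l ih =>
    cases l' with
    | nil => exact (within_pure _ 0).tick.mono (by omega)
    | cons b l' =>
      refine Prog.Within.mono (c := psize α a + ((l.map fun s => psize α s + 1).sum + 1) + 1)
        ((within_peq a b).bind (Prog.Within.ite (fun _ => ih l') fun _ => within_pure _ _)).tick ?_
      simp only [List.map_cons, List.sum_cons]; omega

instance [PEq α σ] [LawfulPEq α σ] : LawfulPEq α (List σ) where
  size l := (l.map fun s => psize α s + 1).sum + 1
  test_iff _ s t := val_eqL_iff s t
  within_test _ s t := within_eqL s t

instance [PEq α σ] [PEq α τ] [LawfulPEq α σ] [LawfulPEq α τ] : LawfulPEq α (σ × τ) where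
  size s := psize α s.1 + psize α s.2
  test_iff mem s t := by
    obtain ⟨a, b⟩ := s
    obtain ⟨c, d⟩ := t
    by_cases h : a = c <;> simp [PEq.test, h]
  within_test mem s t := (within_peq _ _).bind
    (Prog.Within.ite (fun _ => within_peq _ _) fun _ => within_pure _ _)

instance [PEq α σ] [PEq α τ] [LawfulPEq α σ] [LawfulPEq α τ] : LawfulPEq α (σ ⊕ τ) where
  size := Sum.elim (psize α) (psize α)
  test_iff mem s t := by cases s <;> cases t <;> simp [PEq.test]
  within_test mem s t := by
    cases s <;> cases t <;> first | exact within_peq _ _ | exact within_pure _ _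

instance [PEq α σ] [LawfulPEq α σ] : LawfulPEq α (Option σ) where
  size s := (s.map (psize α)).getD 0
  test_iff mem s t := by cases s <;> cases t <;> simp [PEq.test]
  within_test mem s t := by
    cases s <;> cases t <;> first | exact within_peq _ _ | exact within_pure _ _

theorem psize_letter [DecidableEq α] (a : α) : psize α a = 1 := rfl
theorem psize_list [PEq α σ] [LawfulPEq α σ] (l : List σ) :
    psize α l = (l.map fun s => psize α s + 1).sum + 1 := rfl
theorem psize_prod [PEq α σ] [PEq α τ] [LawfulPEq α σ] [LawfulPEq α τ] (s : σ × τ) :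
    psize α s = psize α s.1 + psize α s.2 := rfl
theorem psize_inl [PEq α σ] [PEq α τ] [LawfulPEq α σ] [LawfulPEq α τ] (s : σ) :
    psize α (Sum.inl s : σ ⊕ τ) = psize α s := rfl
theorem psize_inr [PEq α σ] [PEq α τ] [LawfulPEq α σ] [LawfulPEq α τ] (s : τ) :
    psize α (Sum.inr s : σ ⊕ τ) = psize α s := rfl
theorem psize_none [PEq α σ] [LawfulPEq α σ] : psize α (none : Option σ) = 0 := rfl
theorem psize_word [DecidableEq α] (w : Word α) : psize α w = 2 * w.length + 1 := by
  simp [psize_list, psize_letter, List.map_const', Nat.mul_comm]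

variable [PEq α σ] [LawfulPEq α σ]

open Classical in
@[simp] theorem val_memL (s : σ) (l : List σ) :
    (memL s l : Prog α Bool).val mem = decide (s ∈ l) := by
  rw [Bool.eq_iff_iff]
  simp [memL, Option.isSome_iff_exists, List.isSome_findSome?]

theorem within_memL (s : σ) (l : List σ) :
    (memL s l : Prog α Bool).Within mem ((psize α s + 1) * l.length + 1) := by
  unfold memL
  refine (within_firstL fun t _ => ?_).bind (d := 0) (within_pure _ _)
  exact (within_peq s t).bind (d := 0)
    (Prog.Within.ite (fun _ => within_pure _ _) fun _ => within_pure _ _)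

open Classical in
@[simp] theorem val_assoc {γ : Type} (s : σ) (l : List (σ × γ)) :
    (assoc s l : Prog α _).val mem = l.findSome? fun e => if s = e.1 then some e.2 else none := by
  simp [assoc]

theorem within_assoc {γ : Type} (s : σ) (l : List (σ × γ)) :
    (assoc s l : Prog α (Option γ)).Within mem ((psize α s + 1) * l.length + 1) :=
  within_firstL fun t _ => (within_peq s t.1).bind (d := 0)
    (Prog.Within.ite (fun _ => within_pure _ _) fun _ => within_pure _ _)

end

/-! ## Automata constructions -/

section

variable {α β σ τ : Type} {mem : Word α → Word α → Bool} {m : ℕ}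

/-- There is a run of the automaton from `s` to `t` on the word. -/
def FA.Reach (A : FA β σ) : σ → List β → σ → Prop
  | s, [], t => s = t
  | s, b :: w, t => ∃ q, (s, b, q) ∈ A.trans ∧ A.Reach q w t

/-- The initial state and all targets of transitions are listed as states. -/
structure FA.Closed (A : FA β σ) : Prop where
  init : A.init ∈ A.states
  target : ∀ t ∈ A.trans, t.2.2 ∈ A.states

/-- The automaton is a DFA with the transition function `δ`. -/
structure FA.IsDFA (A : FA β σ) (δ : σ → β → σ) : Prop where
  init : A.init ∈ A.states
  step : ∀ s ∈ A.states, ∀ b, δ s b ∈ A.states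
  trans : ∀ s b t, (s, b, t) ∈ A.trans ↔ s ∈ A.states ∧ t = δ s b

theorem FA.Reach.append {A : FA β σ} {s t q : σ} {w w' : List β} (h : A.Reach s w t)
    (h' : A.Reach t w' q) : A.Reach s (w ++ w') q := by
  induction w generalizing s with
  | nil => cases h; exact h'
  | cons b w ih => obtain ⟨p, hp, hr⟩ := h; exact ⟨p, hp, ih hr⟩

theorem FA.reach_append {A : FA β σ} {s q : σ} {w w' : List β} :
    A.Reach s (w ++ w') q ↔ ∃ t, A.Reach s w t ∧ A.Reach t w' q := by
  refine ⟨fun h => ?_, fun ⟨t, h, h'⟩ => h.append h'⟩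
  induction w generalizing s with
  | nil => exact ⟨s, rfl, h⟩
  | cons b w ih =>
    obtain ⟨p, hp, hr⟩ := h
    obtain ⟨t, ht, ht'⟩ := ih hr
    exact ⟨t, ⟨p, hp, ht⟩, ht'⟩

namespace FA.IsDFA

variable {A : FA β σ} {δ : σ → β → σ}

theorem closed (h : A.IsDFA δ) : A.Closed where
  init := h.init
  target := fun ⟨s, b, t⟩ ht => by
    obtain ⟨hs, rfl⟩ := (h.trans s b t).1 ht
    exact h.step s hs b

theorem foldl_mem (h : A.IsDFA δ) {s : σ} (hs : s ∈ A.states) (w : List β) :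
    w.foldl δ s ∈ A.states := by
  induction w generalizing s with
  | nil => exact hs
  | cons b w ih => exact ih (h.step s hs b)

theorem reach_iff (h : A.IsDFA δ) {s t : σ} (hs : s ∈ A.states) (w : List β) :
    A.Reach s w t ↔ w.foldl δ s = t := by
  induction w generalizing s with
  | nil => rfl
  | cons b w ih =>
    constructor
    · rintro ⟨q, hq, hr⟩
      obtain ⟨-, rfl⟩ := (h.trans s b q).1 hq
      exact (ih (h.step s hs b)).1 hr
    · intro he
      exact ⟨δ s b, (h.trans _ _ _).2 ⟨hs, rfl⟩, (ih (h.step s hs b)).2 he⟩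

end FA.IsDFA

/-! ### Runs of DFAs as programs. -/

section Runs

variable [DecidableEq α] [PEq α σ] [LawfulPEq α σ] {A : FA α σ} {δ : σ → α → σ}

-- A DFA has exactly one transition for a state and a letter: every hit of the scan is the right
-- one, and there is a hit, so the default `A.init` is never used.
open Classical in
theorem FA.IsDFA.val_step (h : A.IsDFA δ) {s : σ} (hs : s ∈ A.states) (a : α) :
    (A.step s a).val mem = δ s a := by
  simp only [FA.step, val_bind, val_firstL, val_ite, val_peq, val_pure, decide_eq_true_eq]
  have h1 : ∀ q, (A.trans.findSome? fun t =>
      if t.2.1 = a then if t.1 = s then some t.2.2 else none else none) = some q → q = δ s a := by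
    intro q hq
    obtain ⟨⟨p, b, t⟩, ht, he⟩ := List.exists_of_findSome?_eq_some hq
    dsimp only at he
    split_ifs at he with h3 h4
    subst h3 h4
    cases he
    exact ((h.trans _ _ _).1 ht).2
  have h2 : (A.trans.findSome? fun t =>
      if t.2.1 = a then if t.1 = s then some t.2.2 else none else none) ≠ none := by
    intro hn
    have := List.findSome?_eq_none_iff.1 hn (s, a, δ s a) ((h.trans _ _ _).2 ⟨hs, rfl⟩)
    simp at this
  obtain ⟨q, hq⟩ := Option.ne_none_iff_exists'.1 h2
  rw [← h1 q hq]
  exact congrArg (Option.getD · A.init) hq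

theorem FA.IsDFA.val_run (h : A.IsDFA δ) {s : σ} (hs : s ∈ A.states) (w : Word α) :
    (A.run s w).val mem = w.foldl δ s := by
  induction w generalizing s with
  | nil => simp [FA.run]
  | cons a w ih => simp [FA.run, h.val_step hs, ih (h.step s hs a)]

theorem FA.IsDFA.val_reach (h : A.IsDFA δ) (w : Word α) :
    (A.reach w).val mem = w.foldl δ A.init := h.val_run h.init w

theorem within_step (hm : 2 ≤ m) (hn : A.trans.length ≤ m)
    (hs : ∀ t ∈ A.trans, psize α t.1 ≤ m) (s : σ) (a : α) :
    (A.step s a).Within mem (m ^ 6) := by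
  unfold FA.step
  refine Prog.Within.bind_pow hm (a := 5) (b := 0) ?_ (within_pure _ _) (by omega) (by omega)
  refine within_firstL_pow hm (b := 2) (le_pow_one hn) (fun t ht => ?_) (by omega)
  refine Prog.Within.ite (fun _ => ?_) fun _ => within_pure _ _
  refine Prog.Within.bind_pow hm (a := 1) (b := 0) ((within_peq _ _).mono (le_pow_one (hs t ht)))
    ?_ (by omega) (by omega)
  exact Prog.Within.ite (fun _ => within_pure _ _) fun _ => within_pure _ _

theorem within_run (hm : 2 ≤ m) (hn : A.trans.length ≤ m)
    (hs : ∀ t ∈ A.trans, psize α t.1 ≤ m) (s : σ) {w : Word α} (hw : w.length ≤ m) :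
    (A.run s w).Within mem (m ^ 9) := by
  have key : ∀ (w : Word α) (s : σ), (A.run s w).Within mem ((m ^ 6 + 1) * w.length + 1) := by
    intro w
    induction w with
    | nil => exact fun _ => trivial
    | cons a w ih =>
      intro s
      have h : (A.run s (a :: w)).Within mem (m ^ 6 + ((m ^ 6 + 1) * w.length + 1) + 1) :=
        ((within_step hm hn hs s a).bind (ih _)).tick
      refine h.mono ?_
      simp only [List.length_cons]; ring_nf; omega
  exact (key w s).mono (loop_pow_le hm le_rfl (le_pow_one hw) (by omega))

end Runs

/-! ### Products, renaming, complements and loops -/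

section Values

theorem val_prod [DecidableEq β] (A : FA β σ) (B : FA β τ) :
    ((A.prod B : Prog α _).val mem) =
      { states := A.states.flatMap fun s => B.states.map fun t => (s, t)
        init := (A.init, B.init)
        acc := A.acc.flatMap fun s => B.acc.map fun t => (s, t)
        trans := A.trans.flatMap fun d => B.trans.flatMap fun e =>
          if d.2.1 = e.2.1 then [((d.1, e.1), d.2.1, (d.2.2, e.2.2))] else [] } := by
  simp [FA.prod]

theorem mem_prod_states [DecidableEq β] {A : FA β σ} {B : FA β τ} {s : σ × τ} :
    s ∈ ((A.prod B : Prog α _).val mem).states ↔ s.1 ∈ A.states ∧ s.2 ∈ B.states := by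
  obtain ⟨s, t⟩ := s
  simp [val_prod, List.mem_flatMap]

theorem mem_prod_acc [DecidableEq β] {A : FA β σ} {B : FA β τ} {s : σ × τ} :
    s ∈ ((A.prod B : Prog α _).val mem).acc ↔ s.1 ∈ A.acc ∧ s.2 ∈ B.acc := by
  obtain ⟨s, t⟩ := s
  simp [val_prod, List.mem_flatMap]

theorem mem_prod_trans [DecidableEq β] {A : FA β σ} {B : FA β τ} {s t : σ × τ} {b : β} :
    (s, b, t) ∈ ((A.prod B : Prog α _).val mem).trans ↔
      (s.1, b, t.1) ∈ A.trans ∧ (s.2, b, t.2) ∈ B.trans := by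
  obtain ⟨s, s'⟩ := s
  obtain ⟨t, t'⟩ := t
  simp only [val_prod, List.mem_flatMap]
  constructor
  · rintro ⟨⟨p, c, q⟩, hd, ⟨p', c', q'⟩, he, h⟩
    dsimp only at h
    split_ifs at h with hc
    · subst hc
      simp only [List.mem_singleton, Prod.mk.injEq] at h
      obtain ⟨⟨rfl, rfl⟩, rfl, rfl, rfl⟩ := h
      exact ⟨hd, he⟩
    · simp at h
  · rintro ⟨h, h'⟩
    exact ⟨_, h, _, h', by simp⟩

theorem reach_prod [DecidableEq β] {A : FA β σ} {B : FA β τ} {s t : σ × τ} {w : List β} :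
    ((A.prod B : Prog α _).val mem).Reach s w t ↔ A.Reach s.1 w t.1 ∧ B.Reach s.2 w t.2 := by
  induction w generalizing s with
  | nil => simp [FA.Reach, Prod.ext_iff]
  | cons b w ih =>
    simp only [FA.Reach, ih, mem_prod_trans]
    constructor
    · rintro ⟨q, ⟨h1, h2⟩, h3, h4⟩
      exact ⟨⟨_, h1, h3⟩, _, h2, h4⟩
    · rintro ⟨⟨p, h1, h3⟩, q, h2, h4⟩
      exact ⟨(p, q), ⟨h1, h2⟩, h3, h4⟩

theorem FA.Closed.prod [DecidableEq β] {A : FA β σ} {B : FA β τ} (hA : A.Closed)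
    (hB : B.Closed) : ((A.prod B : Prog α _).val mem).Closed where
  init := mem_prod_states.2 (by simpa [val_prod] using ⟨hA.init, hB.init⟩)
  target := fun ⟨s, b, t⟩ h => by
    obtain ⟨h1, h2⟩ := mem_prod_trans.1 h
    exact mem_prod_states.2 ⟨hA.target _ h1, hB.target _ h2⟩

theorem val_rename (f : σ → Prog α τ) (A : FA β σ) :
    (A.rename f).val mem =
      { states := A.states.map fun s => (f s).val mem
        init := (f A.init).val mem
        acc := A.acc.map fun s => (f s).val mem
        trans := A.trans.map fun d => ((f d.1).val mem, d.2.1, (f d.2.2).val mem) } := by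
  simp [FA.rename]

open Classical in
theorem val_compl [PEq α σ] [LawfulPEq α σ] (A : FA β σ) :
    (A.compl : Prog α _).val mem = { A with acc := A.states.filter fun s => s ∉ A.acc } := by
  simp [FA.compl]

/-- Every transition of `P` has up to four copies: its source may be replaced by the fresh state if
it is initial, its target if it is accepting. All later reasoning about runs in components goes
through this description. -/
theorem mem_loop_trans [PEq α σ] [LawfulPEq α σ] {P : FA α σ} {x y : Option σ} {a : α} :
    (x, a, y) ∈ (P.loop.val mem).trans ↔ ∃ p q, (p, a, q) ∈ P.trans ∧
      (x = some p ∨ x = none ∧ p = P.init) ∧ (y = some q ∨ y = none ∧ q ∈ P.acc) := by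
  simp only [FA.loop, val_bind, val_mapL, val_bindL, val_pure, val_peq, val_memL,
    List.mem_flatMap, decide_eq_true_eq, List.mem_map]
  constructor
  · rintro ⟨⟨p, b, q⟩, hd, x', hx, y', hy, he⟩
    simp only [Prod.mk.injEq] at he
    obtain ⟨rfl, rfl, rfl⟩ := he
    refine ⟨p, q, hd, ?_, ?_⟩
    · split_ifs at hx with h <;> simp at hx h <;> tauto
    · split_ifs at hy with h <;> simp at hy h <;> tauto
  · rintro ⟨p, q, h, hx, hy⟩
    refine ⟨(p, a, q), h, x, ?_, y, ?_, rfl⟩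
    · dsimp only; split_ifs with h' <;> simp at h' ⊢ <;> tauto
    · dsimp only; split_ifs with h' <;> simp at h' ⊢ <;> tauto

theorem val_loop_init [PEq α σ] (P : FA α σ) : (P.loop.val mem).init = some P.init := by
  simp [FA.loop]
theorem val_loop_acc [PEq α σ] (P : FA α σ) : (P.loop.val mem).acc = [none] := by simp [FA.loop]
theorem val_loop_states [PEq α σ] (P : FA α σ) :
    (P.loop.val mem).states = none :: P.states.map some := by simp [FA.loop]

end Values

/-! ### Sizes -/

/-- All lists of the automaton have at most `m` entries, and all states in them
have size at most `m`. -/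
structure FA.Small (α : Type) {β σ : Type} [PEq α σ] [LawfulPEq α σ] (m : ℕ) (A : FA β σ) :
    Prop where
  states : A.states.length ≤ m
  acc : A.acc.length ≤ m
  trans : A.trans.length ≤ m
  size_states : ∀ s ∈ A.states, psize α s ≤ m
  size_acc : ∀ s ∈ A.acc, psize α s ≤ m
  size_init : psize α A.init ≤ m
  size_source : ∀ t ∈ A.trans, psize α t.1 ≤ m
  size_target : ∀ t ∈ A.trans, psize α t.2.2 ≤ m

/-! ### Sizes and costs of the automata constructions. -/

section Costs

variable [PEq α σ] [LawfulPEq α σ]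

theorem FA.Small.mono {A : FA β σ} {m' : ℕ} (h : A.Small α m) (hm : m ≤ m') : A.Small α m' where
  states := h.states.trans hm
  acc := h.acc.trans hm
  trans := h.trans.trans hm
  size_states s hs := (h.size_states s hs).trans hm
  size_acc s hs := (h.size_acc s hs).trans hm
  size_init := h.size_init.trans hm
  size_source s hs := (h.size_source s hs).trans hm
  size_target s hs := (h.size_target s hs).trans hm

theorem FA.Small.fromTo {A : FA β σ} (h : A.Small α m) (hm : 1 ≤ m) {s v : σ}
    (hs : psize α s ≤ m) (hv : psize α v ≤ m) : (A.fromTo s v).Small α m where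
  states := h.states
  acc := by simpa [FA.fromTo] using hm
  trans := h.trans
  size_states := h.size_states
  size_acc t ht := by obtain rfl : t = v := by simpa [FA.fromTo] using ht
                      exact hv
  size_init := hs
  size_source := h.size_source
  size_target := h.size_target

theorem FA.Small.prod [PEq α τ] [LawfulPEq α τ] [DecidableEq β] {A : FA β σ} {B : FA β τ} (hm : 2 ≤ m)
    (hA : A.Small α m) (hB : B.Small α m) : ((A.prod B : Prog α _).val mem).Small α (m ^ 2) := by
  have hadd : ∀ x y, x ≤ m → y ≤ m → x + y ≤ m ^ 2 := fun x y hx hy =>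
    pow_add_pow_le hm (le_pow_one hx) (le_pow_one hy) (by omega) (by omega)
  refine ⟨?_, ?_, ?_, fun s hs => ?_, fun s hs => ?_, ?_, fun t ht => ?_, fun t ht => ?_⟩
  · simp only [val_prod]
    refine length_flatMap_pow hm (b := 1) (le_pow_one hA.states) (fun s _ => ?_) (by omega)
    simpa using hB.states
  · simp only [val_prod]
    refine length_flatMap_pow hm (b := 1) (le_pow_one hA.acc) (fun s _ => ?_) (by omega)
    simpa using hB.acc
  · simp only [val_prod]
    refine length_flatMap_pow hm (b := 1) (le_pow_one hA.trans) (fun s _ => ?_) (by omega)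
    refine length_flatMap_pow hm (b := 0) (le_pow_one hB.trans) (fun t _ => ?_) (by omega)
    split_ifs <;> simp
  · rw [mem_prod_states] at hs
    exact hadd _ _ (hA.size_states _ hs.1) (hB.size_states _ hs.2)
  · rw [mem_prod_acc] at hs
    exact hadd _ _ (hA.size_acc _ hs.1) (hB.size_acc _ hs.2)
  · simp only [val_prod]
    exact hadd _ _ hA.size_init hB.size_init
  · obtain ⟨s, b, t⟩ := t
    rw [mem_prod_trans] at ht
    exact hadd _ _ (hA.size_source _ ht.1) (hB.size_source _ ht.2)
  · obtain ⟨s, b, t⟩ := t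
    rw [mem_prod_trans] at ht
    exact hadd _ _ (hA.size_target _ ht.1) (hB.size_target _ ht.2)

theorem FA.Small.rename [PEq α τ] [LawfulPEq α τ] {A : FA β σ} {f : σ → Prog α τ} {m' : ℕ} (h : A.Small α m)
    (hm : m ≤ m') (hf : ∀ s, psize α s ≤ m → psize α ((f s).val mem) ≤ m') :
    ((A.rename f).val mem).Small α m' := by
  simp only [val_rename]
  refine ⟨?_, ?_, ?_, fun s hs => ?_, fun s hs => ?_, ?_, fun t ht => ?_, fun t ht => ?_⟩
  · simpa using h.states.trans hm
  · simpa using h.acc.trans hm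
  · simpa using h.trans.trans hm
  · obtain ⟨s, h', rfl⟩ := List.mem_map.1 hs
    exact hf _ (h.size_states _ h')
  · obtain ⟨s, h', rfl⟩ := List.mem_map.1 hs
    exact hf _ (h.size_acc _ h')
  · exact hf _ h.size_init
  · obtain ⟨s, h', rfl⟩ := List.mem_map.1 ht
    exact hf _ (h.size_source _ h')
  · obtain ⟨s, h', rfl⟩ := List.mem_map.1 ht
    exact hf _ (h.size_target _ h')

theorem FA.Small.compl {A : FA β σ} (h : A.Small α m) :
    ((A.compl : Prog α _).val mem).Small α m := by
  simp only [val_compl]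
  exact ⟨h.states, (List.length_filter_le _ _).trans h.states, h.trans, h.size_states,
    fun s hs => h.size_states _ (List.mem_filter.1 hs).1, h.size_init, h.size_source,
    h.size_target⟩


/-- The fresh state adds one state, and the at most four copies of each transition fit into a factor
`m ^ 2`. The fresh state costs nothing in equality tests. -/
theorem FA.Small.loop {A : FA α σ} (hm : 2 ≤ m) (h : A.Small α m) :
    (A.loop.val mem).Small α (m ^ 3) := by
  have hm' : m ≤ m ^ 3 := le_pow_self hm le_rfl (by omega)
  refine ⟨?_, ?_, ?_, fun s hs => ?_, fun s hs => ?_, ?_, ?_, ?_⟩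
  · rw [val_loop_states, List.length_cons, List.length_map]
    exact pow_add_pow_le hm (le_pow_one h.states) (one_le_pow' hm 0) (by omega) (by omega)
  · rw [val_loop_acc]; exact one_le_pow' hm _
  · simp only [FA.loop, val_bind, val_mapL, val_bindL, val_pure, val_peq, val_memL]
    refine length_flatMap_pow hm (b := 2) (le_pow_one h.trans) (fun d _ => ?_) (by omega)
    refine length_flatMap_pow hm (a := 1) (b := 1) ?_ (fun e _ => ?_) (by omega)
    · split_ifs <;> simp <;> omega
    · rw [List.length_map]; split_ifs <;> simp <;> omega
  · rw [val_loop_states] at hs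
    obtain rfl | hs := List.mem_cons.1 hs
    · simp [psize_none]
    · obtain ⟨s, h', rfl⟩ := List.mem_map.1 hs
      exact (h.size_states _ h').trans hm'
  · rw [val_loop_acc] at hs
    obtain rfl : s = none := by simpa using hs
    simp [psize_none]
  · rw [val_loop_init]; exact h.size_init.trans hm'
  · rintro ⟨x, a, y⟩ ht
    obtain ⟨p, q, h', rfl | ⟨rfl, -⟩, -⟩ := mem_loop_trans.1 ht
    · exact (h.size_source _ h').trans hm'
    · simp [psize_none]
  · rintro ⟨x, a, y⟩ ht
    obtain ⟨p, q, h', -, rfl | ⟨rfl, -⟩⟩ := mem_loop_trans.1 ht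
    · exact (h.size_target _ h').trans hm'
    · simp [psize_none]

theorem within_prod [PEq α τ] [LawfulPEq α τ] [DecidableEq β] {A : FA β σ} {B : FA β τ} (hm : 2 ≤ m)
    (hA : A.Small α m) (hB : B.Small α m) : (A.prod B : Prog α _).Within mem (m ^ 14) := by
  unfold FA.prod
  have aux : ∀ (l : List σ) (l' : List τ), l.length ≤ m → l'.length ≤ m →
      (bindL (fun s => mapL (fun t => pure (s, t)) l') l : Prog α _).Within mem (m ^ 8) := by
    intro l l' h h'
    refine within_bindL_pow hm (b := 3) (le_pow_one h) (fun s _ => ?_) (fun s _ => ?_) (by omega)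
    · exact within_mapL_pow hm (b := 0) (le_pow_one h') (fun t _ => within_pure _ _) (by omega)
    · simpa using le_pow_self hm h' (by omega)
  refine Prog.Within.bind_pow hm (aux _ _ hA.states hB.states) (b := 13) ?_ (by omega) (by omega)
  refine Prog.Within.bind_pow hm (aux _ _ hA.acc hB.acc) (b := 12) ?_ (by omega) (by omega)
  refine Prog.Within.bind_pow hm (a := 11) (b := 0) ?_ (within_pure _ _) (by omega) (by omega)
  refine within_bindL_pow hm (b := 5) (le_pow_one hA.trans) (fun d _ => ?_) (fun d _ => ?_)
    (by omega)
  · refine within_bindL_pow hm (b := 0) (le_pow_one hB.trans) (fun e _ => ?_) (fun e _ => ?_)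
      (by omega)
    · exact Prog.Within.ite (fun _ => within_pure _ _) fun _ => within_pure _ _
    · rw [val_ite]; split_ifs <;> simp
  · simp only [val_bindL, val_ite, val_pure]
    refine length_flatMap_pow hm (b := 0) (le_pow_one hB.trans) (fun t _ => ?_) (by omega)
    split_ifs <;> simp


theorem within_rename {A : FA β σ} {f : σ → Prog α τ} (hm : 2 ≤ m) (h : A.Small α m)
    (hf : ∀ s, (f s).Within mem m) : (A.rename f).Within mem (m ^ 10) := by
  have hf : ∀ s, (f s).Within mem (m ^ 1) := fun s => by simpa using hf s
  unfold FA.rename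
  refine Prog.Within.bind_pow hm (a := 4) (b := 9) ?_ ?_ (by omega) (by omega)
  · exact within_mapL_pow hm (le_pow_one h.states) (fun s _ => hf s) (by omega)
  refine Prog.Within.bind_pow hm (hf _) (b := 8) ?_ (by omega) (by omega)
  refine Prog.Within.bind_pow hm (a := 4) (b := 7) ?_ ?_ (by omega) (by omega)
  · exact within_mapL_pow hm (le_pow_one h.acc) (fun s _ => hf s) (by omega)
  refine Prog.Within.bind_pow hm (a := 6) (b := 0) ?_ (within_pure _ _) (by omega) (by omega)
  refine within_mapL_pow hm (b := 3) (le_pow_one h.trans) (fun d _ => ?_) (by omega)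
  refine Prog.Within.bind_pow hm (hf _) (b := 2) ?_ (by omega) (by omega)
  exact Prog.Within.bind_pow hm (hf _) (b := 0) (within_pure _ _) (by omega) (by omega)

theorem within_memL_pow {s : σ} {l : List σ} (hm : 2 ≤ m) (hs : psize α s ≤ m)
    (hl : l.length ≤ m) : (memL s l : Prog α Bool).Within mem (m ^ 4) :=
  (within_memL s l).mono (loop_pow_le hm (le_pow_one hs) (le_pow_one hl) (by omega))

theorem within_assoc_pow {γ : Type} {s : σ} {l : List (σ × γ)} (hm : 2 ≤ m)
    (hs : psize α s ≤ m) (hl : l.length ≤ m) :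
    (assoc s l : Prog α (Option γ)).Within mem (m ^ 4) :=
  (within_assoc s l).mono (loop_pow_le hm (le_pow_one hs) (le_pow_one hl) (by omega))

theorem within_compl {A : FA β σ} (hm : 2 ≤ m) (h : A.Small α m) :
    (A.compl : Prog α _).Within mem (m ^ 9) := by
  unfold FA.compl
  refine Prog.Within.bind_pow hm (a := 8) (b := 0) ?_ (within_pure _ _) (by omega) (by omega)
  refine within_filterL_pow hm (b := 5) (le_pow_one h.states) (fun s hs => ?_) (by omega)
  exact Prog.Within.bind_pow hm (within_memL_pow hm (h.size_states s hs) h.acc) (b := 0)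
    (within_pure _ _) (by omega) (by omega)

theorem within_loop {A : FA α σ} (hm : 2 ≤ m) (h : A.Small α m) :
    A.loop.Within mem (m ^ 19) := by
  unfold FA.loop
  refine Prog.Within.bind_pow hm (a := 3) (b := 18) ?_ ?_ (by omega) (by omega)
  · exact within_mapL_pow hm (b := 0) (le_pow_one h.states) (fun s _ => within_pure _ _) (by omega)
  refine Prog.Within.bind_pow hm (a := 17) (b := 0) ?_ (within_pure _ _) (by omega) (by omega)
  have two : ∀ (c : Prop) [Decidable c] (x y z : Option σ),
      (if c then [x, y] else [z]).length ≤ m ^ 1 := by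
    intro c _ x y z; split_ifs <;> simp <;> omega
  refine within_bindL_pow hm (b := 12) (le_pow_one h.trans) (fun d hd => ?_) (fun d hd => ?_)
    (by omega)
  · refine Prog.Within.bind_pow hm (a := 1) (b := 10)
      ((within_peq _ _).mono (le_pow_one (h.size_source d hd))) ?_ (by omega) (by omega)
    refine Prog.Within.bind_pow hm (a := 4) (b := 9)
      (within_memL_pow hm (h.size_target d hd) h.acc) ?_ (by omega) (by omega)
    refine within_bindL_pow hm (a := 1) (b := 4) (two _ _ _ _) (fun p _ => ?_) (fun p _ => ?_)
      (by omega)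
    · exact within_mapL_pow hm (b := 0) (two _ _ _ _) (fun q _ => within_pure _ _) (by omega)
    · simp only [val_mapL, List.length_map]
      exact le_pow_of_le hm (two _ _ _ _) (by omega)
  · simp only [val_bind, val_bindL, val_mapL]
    refine length_flatMap_pow hm (two _ _ _ _) (fun p _ => ?_) (show 1 + 1 ≤ 12 by omega)
    simpa only [List.length_map] using two _ _ _ _

end Costs

end

/-! ## Searching an automaton for an accepting run -/

section

variable {α β σ γ : Type} {mem : Word α → Word α → Bool} {m : ℕ}

open Classical in
/-- The value stored under a key in an association list. -/
noncomputable def lookup (s : σ) (l : List (σ × γ)) : Option γ :=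
  l.findSome? fun e => if s = e.1 then some e.2 else none

theorem val_assoc_eq_lookup [PEq α σ] [LawfulPEq α σ] (s : σ) (l : List (σ × γ)) :
    (assoc s l : Prog α _).val mem = lookup s l := val_assoc s l

theorem lookup_eq_none {s : σ} {l : List (σ × γ)} : lookup s l = none ↔ s ∉ l.map Prod.fst := by
  simp only [lookup, List.findSome?_eq_none_iff, List.mem_map, not_exists, not_and]
  constructor
  · rintro h ⟨a, b⟩ hm rfl
    simpa using h _ hm
  · intro h x hx
    exact if_neg fun e => h x hx e.symm

theorem mem_of_lookup {s : σ} {c : γ} {l : List (σ × γ)} (h : lookup s l = some c) :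
    (s, c) ∈ l := by
  obtain ⟨⟨a, b⟩, hm, he⟩ := List.exists_of_findSome?_eq_some h
  dsimp only at he
  split_ifs at he with hs
  subst hs
  cases he
  exact hm

theorem lookup_of_mem {s : σ} {c : γ} {l : List (σ × γ)} (hl : (l.map Prod.fst).Nodup)
    (h : (s, c) ∈ l) : lookup s l = some c := by
  have hne : lookup s l ≠ none := fun hn =>
    lookup_eq_none.1 hn (List.mem_map.2 ⟨_, h, rfl⟩)
  obtain ⟨d, hd⟩ := Option.ne_none_iff_exists'.1 hne
  rw [hd, (List.inj_on_of_nodup_map hl (mem_of_lookup hd) h rfl : (s, d) = (s, c)) |>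
    Prod.mk.inj |>.2]

/-- A run given by its letters and target states. -/
def FA.Path (A : FA β σ) : σ → List (β × σ) → σ → Prop
  | s, [], t => s = t
  | s, d :: l, t => (s, d.1, d.2) ∈ A.trans ∧ A.Path d.2 l t

theorem FA.Path.concat {A : FA β σ} {s t q : σ} {b : β} {l : List (β × σ)} (h : A.Path s l t)
    (ht : (t, b, q) ∈ A.trans) : A.Path s (l ++ [(b, q)]) q := by
  induction l generalizing s with
  | nil => cases h; exact ⟨ht, rfl⟩
  | cons d l ih => exact ⟨h.1, ih h.2⟩

theorem FA.Path.reach {A : FA β σ} {s t : σ} {l : List (β × σ)} (h : A.Path s l t) :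
    A.Reach s (l.map Prod.fst) t := by
  induction l generalizing s with
  | nil => exact h
  | cons d l ih => exact ⟨d.2, h.1, ih h.2⟩

/-- One relaxation step of the search: extending a path by a transition that leads to a
state without a path. -/
noncomputable def relax (vis : List (σ × List (β × σ))) (d : σ × β × σ) :
    List (σ × List (β × σ)) :=
  match lookup d.1 vis with
  | none => vis
  | some path =>
    match lookup d.2.2 vis with
    | some _ => vis
    | none => (d.2.2, (d.2.1, d.2.2) :: path) :: vis

/-- The states visited by the search after some rounds, with their paths. -/
noncomputable def FA.visited (A : FA β σ) (n : ℕ) : List (σ × List (β × σ)) :=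
  (fun vis => A.trans.foldl relax vis)^[n] [(A.init, [])]

theorem foldl_const {δ : Type} (f : γ → γ) (l : List δ) (c : γ) :
    l.foldl (fun c _ => f c) c = f^[l.length] c := by
  induction l generalizing c with
  | nil => rfl
  | cons b l ih => simp [ih]

/-- The program for one relaxation step. -/
def relaxProg [PEq α σ] (vis : List (σ × List (β × σ))) (d : σ × β × σ) :
    Prog α (List (σ × List (β × σ))) := do
  match ← assoc d.1 vis with
  | none => pure vis
  | some path =>
    match ← assoc d.2.2 vis with
    | some _ => pure vis
    | none => pure ((d.2.2, (d.2.1, d.2.2) :: path) :: vis)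

@[simp] theorem val_relaxProg [PEq α σ] [LawfulPEq α σ] (vis : List (σ × List (β × σ)))
    (d : σ × β × σ) : (relaxProg vis d : Prog α _).val mem = relax vis d := by
  simp only [relaxProg, val_bind, val_assoc_eq_lookup, relax]
  cases lookup d.1 vis with
  | none => rfl
  | some p =>
    simp only [val_bind, val_assoc_eq_lookup]
    cases lookup d.2.2 vis <;> rfl

theorem search_def [PEq α σ] (A : FA β σ) : (A.search : Prog α _) = (do
    let vis ← foldL (fun vis _ => foldL relaxProg vis A.trans) [(A.init, [])] A.states
    match ← firstL (fun s => assoc s vis) A.acc with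
    | none => pure none
    | some path => do
        let r ← rev path
        pure (some r)) := rfl

/-- The outer loop ignores the state it visits; the list of states serves only as a counter. -/
theorem val_search_visited [PEq α σ] [LawfulPEq α σ] (A : FA β σ) :
    (foldL (fun vis (_ : σ) => foldL relaxProg vis A.trans) [(A.init, [])] A.states :
      Prog α _).val mem = A.visited A.states.length := by
  simp only [val_foldL, val_relaxProg]
  exact foldl_const (fun vis => A.trans.foldl relax vis) A.states _

theorem val_search [PEq α σ] [LawfulPEq α σ] (A : FA β σ) :
    (A.search : Prog α _).val mem =
      (A.acc.findSome? fun s => lookup s (A.visited A.states.length)).map List.reverse := by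
  rw [search_def, val_bind, val_search_visited]
  simp only [val_bind, val_firstL, val_assoc_eq_lookup]
  cases A.acc.findSome? fun s => lookup s (A.visited A.states.length) <;> simp

/-- The invariant of the search. -/
structure FA.SearchInv (A : FA β σ) (vis : List (σ × List (β × σ))) : Prop where
  path : ∀ e ∈ vis, A.Path A.init e.2.reverse e.1
  nodup : (vis.map Prod.fst).Nodup
  init : A.init ∈ vis.map Prod.fst
  length : ∀ e ∈ vis, e.2.length < vis.length
  states : A.Closed → ∀ e ∈ vis, e.1 ∈ A.states

/-- An idle step is informative: it certifies that the transition does not lead out of the set of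
visited states. -/
theorem relax_eq_or {vis : List (σ × List (β × σ))} {d : σ × β × σ} :
    (relax vis d = vis ∧ (d.1 ∈ vis.map Prod.fst → d.2.2 ∈ vis.map Prod.fst)) ∨
    (∃ path, (d.1, path) ∈ vis ∧ d.2.2 ∉ vis.map Prod.fst ∧
      relax vis d = (d.2.2, (d.2.1, d.2.2) :: path) :: vis) := by
  unfold relax
  cases h : lookup d.1 vis with
  | none => exact .inl ⟨rfl, fun h' => absurd h' (lookup_eq_none.1 h)⟩
  | some path =>
    cases h' : lookup d.2.2 vis with
    | none => exact .inr ⟨path, mem_of_lookup h, lookup_eq_none.1 h', rfl⟩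
    | some p => exact .inl ⟨rfl, fun _ => List.mem_map.2 ⟨_, mem_of_lookup h', rfl⟩⟩

/-- A new path is one step longer than an old one, but the list also gets one entry longer. This
keeps all paths shorter than the list and later bounds their length by the number of states. -/
theorem FA.SearchInv.relax {A : FA β σ} {vis : List (σ × List (β × σ))} {d : σ × β × σ}
    (h : A.SearchInv vis) (hd : d ∈ A.trans) : A.SearchInv (relax vis d) := by
  obtain ⟨he, -⟩ | ⟨path, hp, hn, he⟩ := relax_eq_or (vis := vis) (d := d)
  · rwa [he]
  · rw [he]
    constructor
    · intro e hm
      obtain rfl | hm := List.mem_cons.1 hm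
      · simpa using (h.path _ hp).concat hd
      · exact h.path e hm
    · simpa using ⟨by simpa using hn, h.nodup⟩
    · exact List.mem_cons_of_mem _ h.init
    · intro e hm
      obtain rfl | hm := List.mem_cons.1 hm
      · simpa using h.length _ hp
      · exact (h.length e hm).trans (by simp)
    · intro hc e hm
      obtain rfl | hm := List.mem_cons.1 hm
      · exact hc.target d hd
      · exact h.states hc e hm

theorem FA.SearchInv.foldl {A : FA β σ} {vis : List (σ × List (β × σ))} {l : List (σ × β × σ)}
    (h : A.SearchInv vis) (hl : ∀ d ∈ l, d ∈ A.trans) :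
    A.SearchInv (l.foldl BuchiLearning.relax vis) := by
  induction l generalizing vis with
  | nil => exact h
  | cons d l ih => exact ih (h.relax (hl d (by simp))) fun d hd => hl d (by simp [hd])

theorem FA.SearchInv.singleton (A : FA β σ) : A.SearchInv [(A.init, [])] where
  path e he := by obtain rfl : e = _ := by simpa using he
                  rfl
  nodup := by simp
  init := by simp
  length e he := by obtain rfl : e = _ := by simpa using he
                    simp
  states hc e he := by obtain rfl : e = _ := by simpa using he
                       exact hc.init

theorem FA.searchInv_visited (A : FA β σ) (n : ℕ) : A.SearchInv (A.visited n) := by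
  induction n with
  | zero => exact FA.SearchInv.singleton A
  | succ n ih =>
    rw [FA.visited, Function.iterate_succ_apply']
    exact ih.foldl fun _ h => h

/-- The keys are pairwise distinct, and in a closed automaton they are all listed as states. -/
theorem FA.SearchInv.length_le {A : FA β σ} {vis : List (σ × List (β × σ))}
    (h : A.SearchInv vis) (hc : A.Closed) : vis.length ≤ A.states.length := by
  have := (List.subperm_of_subset h.nodup (l₂ := A.states) fun s hs => by
    obtain ⟨e, he, rfl⟩ := List.mem_map.1 hs
    exact h.states hc e he).length_le
  simpa using this

/-- A pass over all transitions either discovers a state or changes nothing at any of its steps; in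
the latter case the visited states are closed under these transitions. -/
theorem foldl_relax_length (l : List (σ × β × σ)) (vis : List (σ × List (β × σ))) :
    vis.length < (l.foldl relax vis).length ∨ (l.foldl relax vis = vis ∧
      ∀ d ∈ l, d.1 ∈ vis.map Prod.fst → d.2.2 ∈ vis.map Prod.fst) := by
  induction l generalizing vis with
  | nil => exact .inr ⟨rfl, by simp⟩
  | cons d l ih =>
    rw [List.foldl_cons]
    obtain ⟨he, hd⟩ | ⟨path, hp, hn, he⟩ := relax_eq_or (vis := vis) (d := d)
    · rw [he]
      refine (ih vis).imp_right fun h => ⟨h.1, ?_⟩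
      simpa using ⟨by simpa using hd, by simpa using h.2⟩
    · left
      obtain h | h := ih (relax vis d)
      · refine lt_trans ?_ h
        rw [he]; simp
      · rw [h.1, he]; simp

/-- As long as the visited set is not closed, each pass adds at least one state, so the number of
passes is a lower bound for the number of visited states. -/
theorem FA.visited_length (A : FA β σ) (n : ℕ) : n < (A.visited n).length ∨
    ∀ d ∈ A.trans, d.1 ∈ (A.visited n).map Prod.fst → d.2.2 ∈ (A.visited n).map Prod.fst := by
  induction n with
  | zero => left; simp [FA.visited]
  | succ n ih =>
    have hs : A.visited (n + 1) = A.trans.foldl BuchiLearning.relax (A.visited n) := by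
      rw [FA.visited, Function.iterate_succ_apply']; rfl
    obtain h | ⟨h, h'⟩ := foldl_relax_length A.trans (A.visited n)
    · rw [← hs] at h
      obtain ih | ih := ih
      · left; omega
      · obtain h2 | ⟨h2, -⟩ := foldl_relax_length A.trans (A.visited n)
        -- The set was already closed before this pass, so every relaxation is idle and the pass
        -- cannot have enlarged it.
        · exfalso
          have fix : ∀ l : List (σ × β × σ), (∀ d ∈ l, d ∈ A.trans) →
              l.foldl BuchiLearning.relax (A.visited n) = A.visited n := by
            intro l hl
            induction l with
            | nil => rfl
            | cons d l ihl =>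
              rw [List.foldl_cons]
              obtain ⟨he, -⟩ | ⟨path, hp, hn, he⟩ := relax_eq_or (vis := A.visited n) (d := d)
              · rw [he]; exact ihl fun d hd => hl d (by simp [hd])
              · exact absurd (ih d (hl d (by simp)) (List.mem_map.2 ⟨_, hp, rfl⟩)) hn
          rw [fix A.trans fun _ h => h] at h2
          exact lt_irrefl _ h2
        · rw [hs, h2] at h; exact absurd h (lt_irrefl _)
    · rw [hs, h]; exact .inr h'

theorem search_eq_some [PEq α σ] [LawfulPEq α σ] {A : FA β σ} {path : List (β × σ)}
    (h : (A.search : Prog α _).val mem = some path) :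
    ∃ q ∈ A.acc, A.Reach A.init (path.map Prod.fst) q := by
  rw [val_search] at h
  obtain ⟨p, hp, rfl⟩ := Option.map_eq_some_iff.1 h
  obtain ⟨s, hs, he⟩ := List.exists_of_findSome?_eq_some hp
  exact ⟨s, hs, ((A.searchInv_visited _).path _ (mem_of_lookup he)).reach⟩

/-- Short witnesses matter beyond the search itself: they bound the decompositions found and hence
the experiments stored by the learner. -/
theorem search_length_le [PEq α σ] [LawfulPEq α σ] {A : FA β σ} {path : List (β × σ)}
    (hc : A.Closed) (h : (A.search : Prog α _).val mem = some path) :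
    path.length ≤ A.states.length := by
  rw [val_search] at h
  obtain ⟨p, hp, rfl⟩ := Option.map_eq_some_iff.1 h
  obtain ⟨s, hs, he⟩ := List.exists_of_findSome?_eq_some hp
  have h1 := (A.searchInv_visited A.states.length).length _ (mem_of_lookup he)
  have h2 := (A.searchInv_visited A.states.length).length_le hc
  simp only [List.length_reverse]
  dsimp only at h1
  omega

/-- With as many passes as states, strict growth in every pass would give more visited states than
there are. So the visited set is closed and contains everything reachable. -/
theorem search_eq_none [PEq α σ] [LawfulPEq α σ] {A : FA β σ} (hc : A.Closed)
    (h : (A.search : Prog α _).val mem = none) {w : List β} {q : σ} (hq : q ∈ A.acc) :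
    ¬ A.Reach A.init w q := by
  rw [val_search, Option.map_eq_none_iff, List.findSome?_eq_none_iff] at h
  have hcl : ∀ d ∈ A.trans, d.1 ∈ (A.visited A.states.length).map Prod.fst →
      d.2.2 ∈ (A.visited A.states.length).map Prod.fst := by
    refine (A.visited_length A.states.length).resolve_left fun hlt => ?_
    have := (A.searchInv_visited A.states.length).length_le hc
    omega
  have key : ∀ (w : List β) (s : σ), s ∈ (A.visited A.states.length).map Prod.fst →
      A.Reach s w q → q ∈ (A.visited A.states.length).map Prod.fst := by
    intro w
    induction w with
    | nil => rintro s hs rfl; exact hs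
    | cons b w ih =>
      rintro s hs ⟨p, hp, hr⟩
      exact ih p (hcl _ hp hs) hr
  intro hr
  exact lookup_eq_none.1 (h q hq) (key w _ (A.searchInv_visited _).init hr)

theorem within_search [PEq α σ] [LawfulPEq α σ] {A : FA β σ} (hm : 2 ≤ m) (hc : A.Closed)
    (h : A.Small α m) : (A.search : Prog α _).Within mem (m ^ 14) := by
  -- The invariant keeps the association list no longer than the list of states, so each lookup is
  -- cheap.
  have h1 : ∀ (vis : List (σ × List (β × σ))), A.SearchInv vis → ∀ d ∈ A.trans,
      (relaxProg vis d : Prog α _).Within mem (m ^ 6) ∧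
      A.SearchInv ((relaxProg vis d : Prog α _).val mem) := by
    intro vis hv d hd
    have hl := (hv.length_le hc).trans h.states
    refine ⟨?_, by simpa using hv.relax hd⟩
    refine Prog.Within.bind_pow hm (within_assoc_pow hm (h.size_source d hd) hl) (b := 5) ?_
      (by omega) (by omega)
    split
    · exact within_pure _ _
    · refine Prog.Within.bind_pow hm (within_assoc_pow hm (h.size_target d hd) hl) (b := 0) ?_
        (by omega) (by omega)
      split <;> exact within_pure _ _
  rw [search_def]
  refine Prog.Within.bind_pow hm (a := 12) (b := 13) ?_ ?_ (by omega) (by omega)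
  · refine within_foldL_pow hm (b := 9) A.SearchInv (le_pow_one h.states) (fun vis hv _ _ => ?_)
      (FA.SearchInv.singleton A) (by omega)
    refine ⟨within_foldL_pow hm A.SearchInv (le_pow_one h.trans) h1 hv (by omega), ?_⟩
    simp only [val_foldL, val_relaxProg]
    exact hv.foldl fun _ h => h
  · rw [val_search_visited]
    have hv := A.searchInv_visited A.states.length
    have hl := (hv.length_le hc).trans h.states
    refine Prog.Within.bind_pow hm (a := 7) (b := 2) ?_ ?_ (by omega) (by omega)
    · exact within_firstL_pow hm (b := 4) (le_pow_one h.acc)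
        (fun s hs => within_assoc_pow hm (h.size_acc s hs) hl) (by omega)
    · simp only [val_firstL, val_assoc_eq_lookup]
      cases he : A.acc.findSome? fun s => lookup s (A.visited A.states.length) with
      | none => exact within_pure _ _
      | some path =>
        obtain ⟨s, hs, he⟩ := List.exists_of_findSome?_eq_some he
        have h1 := hv.length _ (mem_of_lookup he)
        refine (within_rev path).bind (d := 0) ?_ |>.mono ?_
        · exact within_pure _ _
        · exact (Nat.succ_le_of_lt h1).trans (hl.trans (le_pow_self hm le_rfl (by omega)))

end

/-! ## Ultimately periodic words -/

section

variable {α : Type}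

/-- The power `y^i`. -/
def wpow (y : Word α) (i : ℕ) : Word α := (List.replicate i y).flatten

@[simp] theorem wpow_zero (y : Word α) : wpow y 0 = [] := rfl
theorem wpow_succ (y : Word α) (i : ℕ) : wpow y (i + 1) = y ++ wpow y i := by
  simp [wpow, List.replicate_succ]
@[simp] theorem wpow_one (y : Word α) : wpow y 1 = y := by simp [wpow_succ]
theorem wpow_add (y : Word α) (i j : ℕ) : wpow y (i + j) = wpow y i ++ wpow y j := by
  rw [wpow, List.replicate_add, List.flatten_append]; rfl
theorem wpow_succ' (y : Word α) (i : ℕ) : wpow y (i + 1) = wpow y i ++ y := by simp [wpow_add]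
theorem wpow_mul (y : Word α) (i j : ℕ) : wpow y (i * j) = wpow (wpow y i) j := by
  induction j with
  | zero => rfl
  | succ j ih => rw [Nat.mul_succ, wpow_add, ih, wpow_succ']
@[simp] theorem length_wpow (y : Word α) (i : ℕ) : (wpow y i).length = i * y.length := by
  simp [wpow]
theorem wpow_ne_nil {y : Word α} (hy : y ≠ []) {i : ℕ} (hi : 0 < i) : wpow y i ≠ [] := by
  obtain ⟨i, rfl⟩ : ∃ j, i = j + 1 := ⟨i - 1, by omega⟩
  simp [wpow_succ, hy]
theorem wpow_reverse (y : Word α) (i : ℕ) : (wpow y i).reverse = wpow y.reverse i := by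
  induction i with
  | zero => rfl
  | succ i ih => rw [wpow_succ, List.reverse_append, ih, ← wpow_succ']
theorem wpow_rotate (y₁ y₂ : Word α) (i : ℕ) :
    wpow (y₁ ++ y₂) i ++ y₁ = y₁ ++ wpow (y₂ ++ y₁) i := by
  induction i with
  | zero => simp
  | succ i ih => rw [wpow_succ, wpow_succ, List.append_assoc, ih]; simp

theorem cycle_unfold {v : Word α} (h : v ≠ []) :
    v ++ₛ Stream'.cycle v h = Stream'.cycle v h := (Stream'.cycle_eq v h).symm

theorem get_append_stream (l : Word α) (s : Stream' α) (i : ℕ) :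
    (l ++ₛ s).get i = if h : i < l.length then l[i] else s.get (i - l.length) := by
  split_ifs with h
  · exact Stream'.get_append_left i l s h
  · rw [← Stream'.get_append_right (i - l.length) l s]
    congr 1; omega

/-- In a fixed point of prepending `v`, each position is a letter of `v` or a copy of the position
`v.length` earlier. The identities for powers and rotations of periods are reduced to this
uniqueness. -/
theorem eq_cycle_of_append {v : Word α} (h : v ≠ []) {s : Stream' α} (hs : v ++ₛ s = s) :
    s = Stream'.cycle v h := by
  have hl : 0 < v.length := List.length_pos_of_ne_nil h
  ext i
  induction i using Nat.strong_induction_on with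
  | _ i ih =>
    rw [← hs, ← cycle_unfold h, get_append_stream, get_append_stream]
    split_ifs with hi
    · rfl
    · exact ih _ (by omega)

theorem wpow_append_cycle {y : Word α} (h : y ≠ []) (i : ℕ) :
    wpow y i ++ₛ Stream'.cycle y h = Stream'.cycle y h := by
  induction i with
  | zero => rfl
  | succ i ih => rw [wpow_succ, Stream'.append_append_stream, ih, cycle_unfold]

theorem cycle_wpow {y : Word α} (h : y ≠ []) {i : ℕ} (h' : wpow y i ≠ []) :
    Stream'.cycle (wpow y i) h' = Stream'.cycle y h :=
  (eq_cycle_of_append h' (wpow_append_cycle h i)).symm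

theorem append_cycle_rotate {y₁ y₂ : Word α} (h : y₁ ++ y₂ ≠ []) (h' : y₂ ++ y₁ ≠ []) :
    y₁ ++ₛ Stream'.cycle (y₂ ++ y₁) h' = Stream'.cycle (y₁ ++ y₂) h := by
  apply eq_cycle_of_append
  rw [Stream'.append_append_stream, ← Stream'.append_append_stream y₂, cycle_unfold]

/-- Pairs of this form are all that the search for decompositions ever looks at, so membership can
be transported between them and `(x, y)`. -/
theorem lasso_wpow {x y : Word α} (h : y ≠ []) (i : ℕ) {j : ℕ} (h' : wpow y j ≠ []) :
    (x ++ wpow y i) ++ₛ Stream'.cycle (wpow y j) h' = x ++ₛ Stream'.cycle y h := by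
  rw [cycle_wpow h, Stream'.append_append_stream, wpow_append_cycle]

theorem eq_of_append_stream_eq {l l' : Word α} {s s' : Stream' α} (h : l ++ₛ s = l' ++ₛ s')
    (hl : l.length = l'.length) : l = l' ∧ s = s' := by
  constructor
  · refine List.ext_getElem hl fun i h1 h2 => ?_
    have := congrArg (fun s => Stream'.get s i) h
    simpa [get_append_stream, h1, h2] using this
  · ext i
    have := congrArg (fun s => Stream'.get s (l.length + i)) h
    simp only [get_append_stream, hl] at this
    simpa using this

theorem take_succ_get (w : Stream' α) (n : ℕ) : w.take (n + 1) = w.take n ++ [w.get n] :=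
  Stream'.take_succ' n

theorem foldl_take_succ {σ : Type} (f : σ → α → σ) (s : σ) (w : Stream' α) (n : ℕ) :
    (w.take (n + 1)).foldl f s = f ((w.take n).foldl f s) (w.get n) := by
  rw [take_succ_get, List.foldl_append]; rfl

theorem get_cycle {z : Word α} (hz : z ≠ []) (n : ℕ) :
    (Stream'.cycle z hz).get n = z[n % z.length]'(Nat.mod_lt _ (List.length_pos_of_ne_nil hz)) := by
  have hl := List.length_pos_of_ne_nil hz
  induction n using Nat.strong_induction_on with
  | _ n ih =>
    rw [← cycle_unfold hz, get_append_stream]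
    split_ifs with h
    · simp [Nat.mod_eq_of_lt h]
    · rw [ih _ (by omega)]
      congr 1
      exact (Nat.mod_eq_sub_mod (by omega)).symm

theorem foldl_list_take_succ {σ : Type} (f : σ → α → σ) (s : σ) {z : Word α} {n : ℕ}
    (hn : n < z.length) : (z.take (n + 1)).foldl f s = f ((z.take n).foldl f s) z[n] := by
  rw [List.take_succ_eq_append_getElem hn, List.foldl_append]; rfl

/-- Pigeonhole: an orbit inside a finite list is eventually periodic. It is used for states of the
leading automaton and of a progress automaton. -/
theorem exists_iterate_add {σ : Type} {S : List σ} {g : σ → σ} {s : σ} (hg : ∀ n, g^[n] s ∈ S) :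
    ∃ a c, 0 < c ∧ g^[a + c] s = g^[a] s := by
  obtain ⟨a, -, b, -, hne, he⟩ := Set.infinite_univ.exists_ne_map_eq_of_mapsTo
    (f := fun n => g^[n] s) (t := {s | s ∈ S}) (fun n _ => hg n) S.finite_toSet
  obtain hlt | hlt := lt_or_gt_of_ne hne
  · exact ⟨a, b - a, by omega, by rw [Nat.add_sub_cancel' hlt.le]; exact he.symm⟩
  · exact ⟨b, a - b, by omega, by rw [Nat.add_sub_cancel' hlt.le]; exact he⟩

theorem foldl_wpow {σ : Type} (f : σ → α → σ) (s : σ) (y : Word α) (n : ℕ) :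
    (wpow y n).foldl f s = (fun s => y.foldl f s)^[n] s := by
  induction n generalizing s with
  | zero => rfl
  | succ n ih => rw [wpow_succ, List.foldl_append, ih, Function.iterate_succ_apply]

end

/-! ### The shortest forms -/

section

variable {α : Type} {mem : Word α → Word α → Bool} {m : ℕ}

theorem mem_prefixes {p w q : Word α} :
    q ∈ (prefixes p w).val mem ↔ ∃ w₁ w₂, w₁ ≠ [] ∧ w = w₁ ++ w₂ ∧ q = p ++ w₁ := by
  induction w generalizing p with
  | nil => simp [prefixes]
  | cons a w ih =>
    simp only [prefixes, val_tick, val_bind, val_app, val_pure, List.mem_cons, ih]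
    constructor
    · rintro (rfl | ⟨w₁, w₂, h, rfl, rfl⟩)
      · exact ⟨[a], w, by simp⟩
      · exact ⟨a :: w₁, w₂, by simp⟩
    · rintro ⟨w₁, w₂, h, he, rfl⟩
      obtain _ | ⟨b, w₁⟩ := w₁
      · exact absurd rfl h
      · obtain ⟨rfl, rfl⟩ : a = b ∧ w = w₁ ++ w₂ := by simpa using he
        obtain _ | ⟨b, w₁⟩ := w₁
        · exact .inl rfl
        · exact .inr ⟨b :: w₁, w₂, by simp⟩

theorem length_prefixes (p w : Word α) : ((prefixes p w).val mem).length = w.length := by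
  induction w generalizing p with
  | nil => simp [prefixes]
  | cons a w ih => simp [prefixes, ih]

theorem length_le_of_eq_wpow {v y : Word α} (hv : v ≠ []) {i : ℕ} (h : v = wpow y i) :
    y.length ≤ v.length := by
  obtain _ | i := i
  · exact absurd h hv
  · rw [h, wpow_succ]; simp

theorem within_prefixes (p w : Word α) :
    (prefixes p w).Within mem ((p.length + w.length + 2) * (w.length + 1)) := by
  induction w generalizing p with
  | nil => exact (within_pure (mem := mem) [] (p.length + 1)).tick.mono (by simp)
  | cons a w ih =>
    have h : (prefixes p (a :: w)).Within mem (p.length + 1 +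
        (((p ++ [a]).length + w.length + 2) * (w.length + 1) + 0) + 1) := by
      refine ((within_app p [a]).bind (Prog.Within.bind ?_ ?_)).tick
      · simpa using ih (p ++ [a])
      · exact within_pure _ _
    refine h.mono ?_
    simp only [List.length_append, List.length_cons, List.length_nil]; ring_nf; omega

variable [DecidableEq α]

theorem val_dropPrefix {p w w' : Word α} :
    (dropPrefix p w).val mem = some w' ↔ w = p ++ w' := by
  induction p generalizing w with
  | nil => simp [dropPrefix]
  | cons a p ih =>
    cases w with
    | nil => simp [dropPrefix]
    | cons b w =>
      by_cases h : a = b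
      · simp [dropPrefix, h, ih]
      · simp [dropPrefix, h, Ne.symm h]

/-- It is enough that some power has been removed. That as much as possible is removed, and likewise
that the period found is the smallest one, is never needed for correctness. -/
theorem val_dropPrefixes (p n w : Word α) :
    ∃ i, w = wpow p i ++ (dropPrefixes p n w).val mem := by
  induction n generalizing w with
  | nil => exact ⟨0, by simp [dropPrefixes]⟩
  | cons a n ih =>
    simp only [dropPrefixes, val_tick, val_bind]
    cases h : (dropPrefix p w).val mem with
    | none => exact ⟨0, by simp⟩
    | some w' =>
      rw [val_dropPrefix] at h
      obtain ⟨i, hi⟩ := ih w'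
      exact ⟨i + 1, by rw [wpow_succ, List.append_assoc, ← hi, h]⟩

theorem val_dropSuffixes (y u : Word α) :
    ∃ i, u = (dropSuffixes y u).val mem ++ wpow y i := by
  simp only [dropSuffixes, val_bind, val_rev]
  obtain ⟨i, hi⟩ := val_dropPrefixes (mem := mem) y.reverse u.reverse u.reverse
  refine ⟨i, ?_⟩
  have := congrArg List.reverse hi
  rwa [List.reverse_append, wpow_reverse, List.reverse_reverse, List.reverse_reverse] at this

theorem val_smallestPeriod {v : Word α} (hv : v ≠ []) :
    (smallestPeriod v).val mem ≠ [] ∧ ∃ i, v = wpow ((smallestPeriod v).val mem) i := by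
  simp only [smallestPeriod, val_bind, val_firstL, val_pure]
  cases h : ((prefixes [] v).val mem).findSome? fun y => Prog.val mem
      (match (dropPrefixes y v v).val mem with
      | [] => pure (some y)
      | _ :: _ => pure none) with
  -- The default value is `v` itself, its own first power, so no argument is needed that the scan
  -- succeeds.
  | none => exact ⟨hv, 1, by simp⟩
  | some y =>
    obtain ⟨z, hz, he⟩ := List.exists_of_findSome?_eq_some h
    obtain ⟨w₁, w₂, h1, -, hw⟩ := mem_prefixes.1 hz
    rw [List.nil_append] at hw
    subst hw
    cases h2 : (dropPrefixes z v v).val mem with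
    | nil =>
      rw [h2] at he
      obtain rfl : z = y := by simpa using he
      obtain ⟨i, hi⟩ := val_dropPrefixes (mem := mem) z v v
      exact ⟨h1, i, by simpa [h2] using hi⟩
    | cons b l => rw [h2] at he; simp at he

/-- Moving a letter from the period to the stem uses x(ay)^ω = xa(ya)^ω, and removing copies of the
new period from the stem does not change the ω-word. Each rotation lengthens the stem by at most one
letter. -/
theorem rotations_sound {n x y : Word α} {c : Word α × Word α}
    (h : c ∈ (rotations n x y).val mem) (hy : y ≠ []) :
    ∃ hc : c.2 ≠ [], c.1 ++ₛ Stream'.cycle c.2 hc = x ++ₛ Stream'.cycle y hy ∧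
      c.2.length = y.length ∧ c.1.length ≤ x.length + n.length := by
  induction n generalizing x y with
  | nil => simp [rotations] at h
  | cons b n ih =>
    cases y with
    | nil => simp [rotations] at h
    | cons a y =>
      simp only [rotations, val_tick, val_bind, val_app, val_pure, List.mem_cons] at h
      obtain rfl | h := h
      · exact ⟨hy, rfl, rfl, by simp⟩
      · obtain ⟨i, hi⟩ := val_dropSuffixes (mem := mem) (y ++ [a]) (x ++ [a])
        obtain ⟨hc, h1, h2, h3⟩ := ih h (by simp)
        refine ⟨hc, ?_, by simpa using h2, ?_⟩
        · rw [h1, ← wpow_append_cycle _ i, ← Stream'.append_append_stream, ← hi,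
            Stream'.append_append_stream, append_cycle_rotate (y₁ := [a]) (by simp)]
          rfl
        · have := congrArg List.length hi
          simp only [List.length_append, List.length_cons, List.length_nil] at this ⊢
          omega

/-- Each letter of `y₁` is moved by one rotation. The copies of the period removed from the stems on
the way are collected in the exponent `i`. -/
theorem rotations_complete {n x y₁ y₂ : Word α} (hn : y₁.length < n.length) (hy : y₂ ≠ []) :
    ∃ x' i, (x', y₂ ++ y₁) ∈ (rotations n x (y₁ ++ y₂)).val mem ∧
      x ++ y₁ = x' ++ wpow (y₂ ++ y₁) i := by
  induction n generalizing x y₁ y₂ with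
  | nil => simp at hn
  | cons b n ih =>
    cases y₁ with
    | nil =>
      obtain _ | ⟨a, y⟩ := y₂
      · exact absurd rfl hy
      · exact ⟨x, 0, by simp [rotations], by simp⟩
    | cons a y₁ =>
      obtain ⟨s, hs⟩ := val_dropSuffixes (mem := mem) (y₁ ++ (y₂ ++ [a])) (x ++ [a])
      obtain ⟨x', i, h1, h2⟩ := ih
        (x := (dropSuffixes (y₁ ++ (y₂ ++ [a])) (x ++ [a])).val mem) (y₁ := y₁) (y₂ := y₂ ++ [a])
        (by simpa using hn) (by simp)
      refine ⟨x', i + s, ?_, ?_⟩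
      · simp only [rotations, List.cons_append, val_tick, val_bind, val_app, val_pure,
          List.mem_cons]
        right
        simpa using h1
      · have e : x ++ a :: y₁ = (x ++ [a]) ++ y₁ := by simp
        rw [e, hs, List.append_assoc, wpow_rotate, ← List.append_assoc, h2,
          wpow_add]
        simp

theorem length_rotations (n x y : Word α) :
    ((rotations n x y).val mem).length ≤ n.length := by
  induction n generalizing x y with
  | nil => simp [rotations]
  | cons b n ih => cases y <;> simp [rotations, ih]

theorem shortestForms_sound {u v : Word α} (hv : v ≠ []) {c : Word α × Word α}
    (h : c ∈ (shortestForms u v).val mem) :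
    ∃ hc : c.2 ≠ [], c.1 ++ₛ Stream'.cycle c.2 hc = u ++ₛ Stream'.cycle v hv ∧
      c.1.length + c.2.length ≤ 2 * (u.length + v.length) := by
  simp only [shortestForms, val_bind] at h
  obtain ⟨hy, i, hi⟩ := val_smallestPeriod (mem := mem) hv
  obtain ⟨j, hj⟩ := val_dropSuffixes (mem := mem) ((smallestPeriod v).val mem) u
  obtain ⟨hc, h1, h2, h3⟩ := rotations_sound h hy
  refine ⟨hc, ?_, ?_⟩
  · rw [h1]
    generalize (smallestPeriod v).val mem = y at *
    generalize (dropSuffixes y u).val mem = x at *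
    subst hi hj
    exact (lasso_wpow hy _ _).symm
  · have := length_le_of_eq_wpow hv hi
    have := congrArg List.length hj
    rw [List.length_append] at this
    omega

/-- A run of the Büchi automaton may cut the period at any place, so every rotation of the period
must occur among the forms, with a stem that differs from the actual one only by a power of the
rotated period. -/
theorem shortestForms_complete {u v : Word α} (hv : v ≠ []) :
    ∃ (x y : Word α) (hy : y ≠ []), u ++ₛ Stream'.cycle v hv = x ++ₛ Stream'.cycle y hy ∧
      ∀ y₁ y₂, y = y₁ ++ y₂ → y₂ ≠ [] → ∃ x' i, (x', y₂ ++ y₁) ∈ (shortestForms u v).val mem ∧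
        x ++ y₁ = x' ++ wpow (y₂ ++ y₁) i := by
  obtain ⟨hy, i, hi⟩ := val_smallestPeriod (mem := mem) hv
  obtain ⟨j, hj⟩ := val_dropSuffixes (mem := mem) ((smallestPeriod v).val mem) u
  refine ⟨(dropSuffixes ((smallestPeriod v).val mem) u).val mem, (smallestPeriod v).val mem, hy,
    ?_, fun y₁ y₂ he hy₂ => ?_⟩
  · generalize (smallestPeriod v).val mem = y at *
    generalize (dropSuffixes y u).val mem = x at *
    subst hi hj
    exact lasso_wpow hy _ _
  · simp only [shortestForms, val_bind]
    generalize (smallestPeriod v).val mem = y at *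
    subst he
    refine rotations_complete ?_ hy₂
    have := List.length_pos_of_ne_nil hy₂
    simp only [List.length_append]
    omega

theorem length_shortestForms {u v : Word α} (hv : v ≠ []) :
    ((shortestForms u v).val mem).length ≤ v.length := by
  obtain ⟨hy, i, hi⟩ := val_smallestPeriod (mem := mem) hv
  simp only [shortestForms, val_bind]
  exact (length_rotations _ _ _).trans (length_le_of_eq_wpow hv hi)

theorem within_dropPrefix (p w : Word α) : (dropPrefix p w).Within mem (p.length + 1) := by
  induction p generalizing w with
  | nil => cases w <;> exact trivial
  | cons a p ih =>
    cases w with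
    | nil => exact (within_pure (mem := mem) none _).tick
    | cons b w =>
      exact (Prog.Within.ite (fun _ => ih w) fun _ => within_pure _ _).tick

theorem within_dropPrefixes (p n w : Word α) :
    (dropPrefixes p n w).Within mem ((p.length + 2) * n.length + 1) := by
  induction n generalizing w with
  | nil => exact trivial
  | cons a n ih =>
    have h : (dropPrefixes p (a :: n) w).Within mem
        (p.length + 1 + ((p.length + 2) * n.length + 1) + 1) := by
      refine ((within_dropPrefix p w).bind ?_).tick
      split
      · exact within_pure _ _
      · exact ih _
    refine h.mono ?_
    simp only [List.length_cons]; ring_nf; omega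

theorem within_dropSuffixes (hm : 2 ≤ m) {y u : Word α} (hy : y.length ≤ m) (hu : u.length ≤ m) :
    (dropSuffixes y u).Within mem (m ^ 8) := by
  unfold dropSuffixes
  refine Prog.Within.bind_pow hm (within_rev_pow hm (le_pow_one hy) (c := 2) (by omega)) (b := 7)
    ?_ (by omega) (by omega)
  refine Prog.Within.bind_pow hm (within_rev_pow hm (le_pow_one hu) (c := 2) (by omega)) (b := 6)
    ?_ (by omega) (by omega)
  refine Prog.Within.bind_pow hm (a := 5) (b := 2) ?_ ?_ (by omega) (by omega)
  · refine (within_dropPrefixes _ _ _).mono ?_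
    simp only [val_rev, List.length_reverse]
    refine loop_pow_le hm (x := y.length + 1) (b := 2) ?_ (le_pow_one hu) (by omega)
    exact pow_add_pow_le hm (le_pow_one hy) (one_le_pow' hm 0) (by omega) (by omega)
  · obtain ⟨i, hi⟩ := val_dropPrefixes (mem := mem) ((rev y).val mem) ((rev u).val mem)
      ((rev u).val mem)
    refine within_rev_pow hm (a := 1) (le_pow_one (le_trans ?_ hu)) (by omega)
    have := congrArg List.length hi
    rw [List.length_append, val_rev, val_rev, List.length_reverse] at this
    rw [val_rev, val_rev]
    omega

theorem within_smallestPeriod (hm : 2 ≤ m) {v : Word α} (hv : v.length ≤ m) :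
    (smallestPeriod v).Within mem (m ^ 10) := by
  have hm2 : m + 2 ≤ m ^ 2 := by nlinarith
  unfold smallestPeriod
  refine Prog.Within.bind_pow hm (a := 5) (b := 9) ?_ ?_ (by omega) (by omega)
  · refine (within_prefixes _ _).mono ?_
    refine pow_mul_pow_le hm (a := 2) (b := 2) ?_ ?_ (by omega)
    · simp only [List.length_nil]; omega
    · omega
  refine Prog.Within.bind_pow hm (a := 8) (b := 0) ?_ (within_pure _ _) (by omega) (by omega)
  refine within_firstL_pow hm (a := 1) (b := 5) ?_ (fun y hy => ?_) (by omega)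
  · rw [length_prefixes]; exact le_pow_one hv
  · obtain ⟨w₁, w₂, h1, rfl, rfl⟩ := mem_prefixes.1 hy
    refine Prog.Within.bind_pow hm (a := 4) (b := 0) ?_ ?_ (by omega) (by omega)
    · refine (within_dropPrefixes _ _ _).mono ?_
      refine pow_add_pow_le hm (a := 3) (b := 0) ?_ (by simp) (by omega) (by omega)
      refine pow_mul_pow_le hm (a := 2) (b := 1) ?_ (le_pow_one hv) (by omega)
      simp only [List.length_append] at hv ⊢
      omega
    · split <;> exact within_pure _ _

theorem within_rotations (hm : 2 ≤ m) {n x y : Word α} (h : x.length + n.length ≤ m)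
    (hy : y.length ≤ m) : (rotations n x y).Within mem (m ^ 18) := by
  suffices h' : (rotations n x y).Within mem ((m ^ 14 + 1) * n.length + 1) from
    h'.mono (loop_pow_le hm (a := 1) le_rfl (le_pow_one (by omega)) (by omega))
  induction n generalizing x y with
  | nil => exact trivial
  | cons b n ih =>
    cases y with
    | nil => exact (within_pure (mem := mem) [] _).tick
    | cons a y =>
      simp only [List.length_cons] at h hy
      obtain ⟨i, hi⟩ := val_dropSuffixes (mem := mem) (y ++ [a]) (x ++ [a])
      have hl := congrArg List.length hi
      simp only [List.length_append, List.length_cons, List.length_nil] at hl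
      have h1 : (rotations (b :: n) x (a :: y)).Within mem
          (x.length + 1 + (y.length + 1 + (m ^ 8 + ((m ^ 14 + 1) * n.length + 1 + 0))) + 1) := by
        refine ((within_app x [a]).bind ((within_app y [a]).bind ?_)).tick
        rw [val_app, val_app]
        refine Prog.Within.bind (within_dropSuffixes hm (by simpa using hy) (by simp; omega)) ?_
        refine Prog.Within.bind (ih (by omega) (by simpa using hy)) ?_
        exact within_pure _ _
      refine h1.mono ?_
      have : x.length + 1 + (y.length + 1) + m ^ 8 ≤ m ^ 14 := by
        refine pow_add_pow_le hm (a := 9) (b := 8) ?_ le_rfl (by omega) (by omega)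
        refine pow_add_pow_le hm (a := 1) (b := 1) ?_ ?_ (by omega) (by omega) <;>
          exact le_pow_one (by omega)
      simp only [List.length_cons]; ring_nf at this ⊢; omega

theorem within_shortestForms (hm : 2 ≤ m) {u v : Word α} (hv : v ≠ [])
    (h : u.length + v.length ≤ m) : (shortestForms u v).Within mem (m ^ 20) := by
  obtain ⟨hy, i, hi⟩ := val_smallestPeriod (mem := mem) hv
  have hl := length_le_of_eq_wpow hv hi
  obtain ⟨j, hj⟩ := val_dropSuffixes (mem := mem) ((smallestPeriod v).val mem) u
  have hl' := congrArg List.length hj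
  rw [List.length_append] at hl'
  unfold shortestForms
  refine Prog.Within.bind_pow hm (within_smallestPeriod hm (by omega)) (b := 19) ?_
    (by omega) (by omega)
  refine Prog.Within.bind_pow hm (within_dropSuffixes hm (by omega) (by omega)) (b := 18) ?_
    (by omega) (by omega)
  exact within_rotations hm (by omega) (by omega)

end

/-! ## The automata for decompositions -/

section

variable {α σ τ : Type} {mem : Word α → Word α → Bool} {m : ℕ}

/-- The word `u$v`. -/
def dollarWord (u v : Word α) : List (Option α) := u.map some ++ none :: v.map some

theorem length_dollarWord (u v : Word α) :
    (dollarWord u v).length = u.length + v.length + 1 := by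
  simp [dollarWord]; omega

theorem dollarWord_inj {u v u' v' : Word α} (h : dollarWord u v = dollarWord u' v') :
    u = u' ∧ v = v' := by
  induction u generalizing u' with
  | nil =>
    cases u' with
    | nil =>
      refine ⟨rfl, ?_⟩
      simpa [dollarWord, (Option.some_injective α).list_map.eq_iff] using h
    | cons a u' => simp [dollarWord] at h
  | cons a u ih =>
    cases u' with
    | nil => simp [dollarWord] at h
    | cons b u' =>
      obtain ⟨rfl, h'⟩ : a = b ∧ dollarWord u v = dollarWord u' v' := by
        simpa [dollarWord] using h
      obtain ⟨rfl, rfl⟩ := ih h'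
      exact ⟨rfl, rfl⟩

theorem val_letters (v : Word α) : (letters (v.map some)).val mem = v := by
  induction v with
  | nil => simp [letters]
  | cons a v ih => simp [letters, ih]

theorem val_splitDollar (u v : Word α) : (splitDollar (dollarWord u v)).val mem = (u, v) := by
  induction u with
  | nil => simp [splitDollar, dollarWord, val_letters]
  | cons a u ih =>
    rw [dollarWord] at ih
    simp [splitDollar, dollarWord, ih]

theorem within_letters (w : List (Option α)) : (letters w).Within mem (w.length + 1) := by
  induction w with
  | nil => exact trivial
  | cons a w ih =>
    cases a with
    | none => exact ih.tick
    | some a =>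
      change (Prog.tick (letters w >>= fun r => pure (a :: r))).Within mem _
      refine Prog.Within.tick (Prog.Within.bind (d := 0) ih ?_)
      exact within_pure _ _

theorem within_splitDollar (w : List (Option α)) :
    (splitDollar w).Within mem (w.length + 1) := by
  induction w with
  | nil => exact trivial
  | cons a w ih =>
    cases a with
    | none =>
      change (Prog.tick (letters w >>= fun v => pure ([], v))).Within mem _
      refine Prog.Within.tick (Prog.Within.bind (d := 0) (within_letters w) ?_)
      exact within_pure _ _
    | some a =>
      change (Prog.tick (splitDollar w >>= fun r => pure (a :: r.1, r.2))).Within mem _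
      refine Prog.Within.tick (Prog.Within.bind (d := 0) ih ?_)
      exact within_pure _ _

theorem reach_of_trans_eq {β : Type} {A B : FA β σ} (h : A.trans = B.trans) {s t : σ}
    {w : List β} : A.Reach s w t ↔ B.Reach s w t := by
  induction w generalizing s with
  | nil => rfl
  | cons b w ih => simp only [FA.Reach, h, ih]

theorem reach_fromTo {β : Type} {A : FA β σ} {p v s t : σ} {w : List β} :
    (A.fromTo p v).Reach s w t ↔ A.Reach s w t :=
  reach_of_trans_eq (A := A.fromTo p v) (B := A) rfl

/-! ### Chains and lassos -/

theorem mem_chain {p t w q r : Word α} {a : α} :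
    (q, a, r) ∈ (chain p t w).val mem ↔ ∃ w₁ w₂, w = w₁ ++ a :: w₂ ∧ q = p ++ w₁ ∧
      ((w₂ = [] ∧ r = t) ∨ (w₂ ≠ [] ∧ r = p ++ w₁ ++ [a])) := by
  induction w generalizing p with
  | nil => simp [chain]
  | cons b w ih =>
    cases w with
    | nil =>
      simp only [chain, val_tick, val_pure, List.mem_singleton, Prod.mk.injEq]
      constructor
      · rintro ⟨rfl, rfl, rfl⟩
        exact ⟨[], [], by simp⟩
      · rintro ⟨w₁, w₂, h, rfl, hr⟩
        obtain _ | ⟨c, w₁⟩ := w₁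
        · obtain ⟨rfl, rfl⟩ : b = a ∧ w₂ = [] := by simpa [eq_comm] using h
          simpa using hr
        · simp at h
    | cons c w =>
      simp only [chain, val_tick, val_bind, val_app, val_pure, List.mem_cons, Prod.mk.injEq, ih]
      constructor
      · rintro (⟨rfl, rfl, rfl⟩ | ⟨w₁, w₂, h, rfl, hr⟩)
        · exact ⟨[], c :: w, by simp⟩
        · exact ⟨b :: w₁, w₂, by simp [h], by simp, by simpa using hr⟩
      · rintro ⟨w₁, w₂, h, rfl, hr⟩
        obtain _ | ⟨d, w₁⟩ := w₁
        · obtain ⟨rfl, rfl⟩ : b = a ∧ c :: w = w₂ := by simpa using h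
          left; simpa using hr
        · obtain ⟨rfl, h'⟩ : b = d ∧ c :: w = w₁ ++ a :: w₂ := by simpa using h
          right
          exact ⟨w₁, w₂, h', by simp, by simpa using hr⟩

/-- When the chain starts at the empty word and ends at `w`, its special last target is again just
the prefix read, so the two cases of `mem_chain` merge. -/
theorem mem_chain_self {w q r : Word α} {a : α} :
    (q, a, r) ∈ (chain [] w w).val mem ↔ r = q ++ [a] ∧ ∃ w₂, w = q ++ a :: w₂ := by
  rw [mem_chain]
  constructor
  · rintro ⟨w₁, w₂, h, rfl, (⟨rfl, rfl⟩ | ⟨-, rfl⟩)⟩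
    · exact ⟨by simpa using h, [], by simpa using h⟩
    · exact ⟨by simp, w₂, by simpa using h⟩
  · rintro ⟨rfl, w₂, h⟩
    refine ⟨q, w₂, h, by simp, ?_⟩
    by_cases hw : w₂ = []
    · subst hw; exact .inl ⟨rfl, h.symm⟩
    · exact .inr ⟨hw, by simp⟩

theorem length_chain (p t w : Word α) : ((chain p t w).val mem).length = w.length := by
  induction w generalizing p with
  | nil => simp [chain]
  | cons b w ih => cases w with
    | nil => simp [chain]
    | cons c w => simp [chain, ih]

theorem reach_chain {A : FA (Option α) σ} {f : Word α → σ} {p t w : Word α}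
    (h : ∀ d ∈ (chain p t w).val mem, (f d.1, some d.2.1, f d.2.2) ∈ A.trans) (hw : w ≠ []) :
    A.Reach (f p) (w.map some) (f t) := by
  induction w generalizing p with
  | nil => exact absurd rfl hw
  | cons b w ih =>
    cases w with
    | nil => exact ⟨f t, h (p, b, t) (by simp [chain]), rfl⟩
    | cons c w =>
      refine ⟨f (p ++ [b]), h (p, b, p ++ [b]) (by simp [chain]), ih (fun d hd => h d ?_) (by simp)⟩
      simp only [chain, val_tick, val_bind, val_app, val_pure]
      exact List.mem_cons_of_mem _ hd

theorem within_chain (p t w : Word α) :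
    (chain p t w).Within mem ((p.length + w.length + 2) * (w.length + 1)) := by
  induction w generalizing p with
  | nil => exact (within_pure (mem := mem) [] (p.length + 1)).tick.mono (by simp)
  | cons b w ih =>
    cases w with
    | nil =>
      exact (within_pure (mem := mem) [(p, b, t)] (p.length + 1)).tick.mono (by simp; ring_nf; omega)
    | cons c w =>
      have h : (chain p t (b :: c :: w)).Within mem (p.length + 1 +
          (((p ++ [b]).length + (c :: w).length + 2) * ((c :: w).length + 1) + 0) + 1) := by
        refine ((within_app p [b]).bind (Prog.Within.bind ?_ ?_)).tick
        · simpa using ih (p ++ [b])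
        · exact within_pure _ _
      refine h.mono ?_
      simp only [List.length_append, List.length_cons, List.length_nil]; ring_nf; omega

variable {x y : Word α}

/-- The transition that closes the second cycle of the automaton for `x y^* $ y^+`. -/
def lassoBack (y : Word α) : List (Word α × α × Word α) :=
  match y with
  | [] => []
  | a :: _ => [(y, a, [a])]

theorem mem_lassoBack {d : Word α × α × Word α} :
    d ∈ lassoBack y ↔ ∃ a z, y = a :: z ∧ d = (y, a, [a]) := by
  cases y <;> simp [lassoBack]

theorem length_lassoBack : (lassoBack y).length ≤ 1 := by cases y <;> simp [lassoBack]

theorem val_lasso_trans : ((lassoFA x y).val mem).trans =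
    (((chain [] x x).val mem ++ (chain x x y).val mem).map fun d =>
      (Sum.inl d.1, some d.2.1, Sum.inl d.2.2)) ++ (Sum.inl x, none, Sum.inr []) ::
    (((chain [] y y).val mem).map fun d => (Sum.inr d.1, some d.2.1, Sum.inr d.2.2)) ++
    (lassoBack y).map fun d => (Sum.inr d.1, some d.2.1, Sum.inr d.2.2) := by
  cases y <;> simp [lassoFA, lassoBack]

theorem mem_lasso_trans {s t : Word α ⊕ Word α} {b : Option α} :
    (s, b, t) ∈ ((lassoFA x y).val mem).trans ↔
      (∃ d, (d ∈ (chain [] x x).val mem ∨ d ∈ (chain x x y).val mem) ∧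
        s = Sum.inl d.1 ∧ b = some d.2.1 ∧ t = Sum.inl d.2.2) ∨
      (s = Sum.inl x ∧ b = none ∧ t = Sum.inr []) ∨
      (∃ d ∈ (chain [] y y).val mem, s = Sum.inr d.1 ∧ b = some d.2.1 ∧ t = Sum.inr d.2.2) ∨
      ∃ a z, y = a :: z ∧ s = Sum.inr y ∧ b = some a ∧ t = Sum.inr [a] := by
  simp only [val_lasso_trans, List.mem_append, List.mem_cons, List.mem_map, mem_lassoBack]
  constructor
  · rintro ((⟨d, hd, he⟩ | he | ⟨d, hd, he⟩) | ⟨_, ⟨a, z, hy, rfl⟩, he⟩)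
    · simp only [Prod.mk.injEq] at he
      exact .inl ⟨d, hd, he.1.symm, he.2.1.symm, he.2.2.symm⟩
    · simp only [Prod.mk.injEq] at he
      exact .inr (.inl he)
    · simp only [Prod.mk.injEq] at he
      exact .inr (.inr (.inl ⟨d, hd, he.1.symm, he.2.1.symm, he.2.2.symm⟩))
    · simp only [Prod.mk.injEq] at he
      exact .inr (.inr (.inr ⟨a, z, hy, he.1.symm, he.2.1.symm, he.2.2.symm⟩))
  · rintro (⟨d, hd, rfl, rfl, rfl⟩ | ⟨rfl, rfl, rfl⟩ | ⟨d, hd, rfl, rfl, rfl⟩ |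
      ⟨a, z, hy, rfl, rfl, rfl⟩)
    · exact .inl (.inl ⟨d, hd, rfl⟩)
    · exact .inl (.inr (.inl rfl))
    · exact .inl (.inr (.inr ⟨d, hd, rfl⟩))
    · exact .inr ⟨_, ⟨a, z, hy, rfl⟩, rfl⟩

theorem val_lasso_init : ((lassoFA x y).val mem).init = Sum.inl [] := by simp [lassoFA]
theorem val_lasso_acc : ((lassoFA x y).val mem).acc = [Sum.inr y] := by simp [lassoFA]

theorem mem_lasso_states {s : Word α ⊕ Word α} : s ∈ ((lassoFA x y).val mem).states ↔
    (∃ d, (d ∈ (chain [] x x).val mem ∨ d ∈ (chain x x y).val mem) ∧ s = Sum.inl d.1) ∨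
      ∃ q, (q = [] ∨ q ∈ (prefixes [] y).val mem) ∧ s = Sum.inr q := by
  simp only [lassoFA, val_bind, val_app, val_mapL, val_pure, List.mem_append, List.mem_cons,
    List.mem_map, eq_comm (b := s)]

/-- What a state of the automaton for `x y^* $ y^+` says about the word read. -/
def LassoInv (x y : Word α) : Word α ⊕ Word α → List (Option α) → Prop
  | .inl s, w => ((∃ r, r ≠ [] ∧ x = s ++ r) ∧ w = s.map some) ∨
      ∃ i y₁ y₂, y₂ ≠ [] ∧ y = y₁ ++ y₂ ∧ s = x ++ y₁ ∧ w = (x ++ wpow y i ++ y₁).map some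
  | .inr s, w => ∃ i j y₂, y = s ++ y₂ ∧ w = dollarWord (x ++ wpow y i) (wpow y j ++ s)

/-- Before `$`, a state that is a proper prefix of the stem determines the word read; from the end
of the stem on, the word is determined up to the number of completed cycles. The conditions `r ≠ []`
and `y₂ ≠ []` mean that completing the stem or a cycle is recorded as the beginning of the next
cycle. -/
theorem LassoInv.step (hy : y ≠ []) {s t : Word α ⊕ Word α} {b : Option α}
    {w : List (Option α)} (h : LassoInv x y s w)
    (ht : (s, b, t) ∈ ((lassoFA x y).val mem).trans) : LassoInv x y t (w ++ [b]) := by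
  obtain ⟨⟨q, a, r⟩, hd | hd, rfl, rfl, rfl⟩ | ⟨rfl, rfl, rfl⟩ | ⟨⟨q, a, r⟩, hd, rfl, rfl, rfl⟩ |
    ⟨a, z, rfl, rfl, rfl, rfl⟩ := mem_lasso_trans.1 ht
  · obtain ⟨rfl, w₂, rfl⟩ := mem_chain_self.1 hd
    obtain ⟨-, rfl⟩ | ⟨i, y₁, y₂, -, -, hs, -⟩ := h
    · by_cases hw : w₂ = []
      · subst hw
        exact .inr ⟨0, [], y, hy, rfl, by simp, by simp⟩
      · exact .inl ⟨⟨w₂, hw, by simp⟩, by simp⟩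
    · have := congrArg List.length hs
      simp at this
  · obtain ⟨w₁, w₂, rfl, rfl, hr⟩ := mem_chain.1 hd
    obtain ⟨⟨r', hr', hx⟩, -⟩ | ⟨i, y₁, y₂, hy₂, he, hs, rfl⟩ := h
    · have h1 := congrArg List.length hx
      have h2 := List.length_pos_of_ne_nil hr'
      simp only [List.length_append] at h1
      omega
    · obtain rfl : w₁ = y₁ := List.append_cancel_left hs
      obtain rfl : a :: w₂ = y₂ := List.append_cancel_left he
      right
      obtain ⟨rfl, rfl⟩ | ⟨hw, rfl⟩ := hr
      · exact ⟨i + 1, [], w₁ ++ [a], by simp, rfl, by simp, by simp [wpow_succ']⟩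
      · exact ⟨i, w₁ ++ [a], w₂, hw, by simp, by simp, by simp⟩
  · obtain ⟨⟨r', hr', hx⟩, -⟩ | ⟨i, y₁, y₂, hy₂, he, hs, rfl⟩ := h
    · exact absurd (by simpa using hx) hr'
    · obtain rfl : y₁ = [] := by simpa using hs
      exact ⟨i, 0, y, rfl, by simp [dollarWord]⟩
  · obtain ⟨rfl, w₂, hw⟩ := mem_chain_self.1 hd
    obtain ⟨i, j, y₂, -, rfl⟩ := h
    exact ⟨i, j, w₂, by simpa using hw, by simp [dollarWord]⟩
  · obtain ⟨i, j, y₂, -, rfl⟩ := h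
    exact ⟨i, j + 1, z, rfl, by simp [dollarWord, wpow_succ']⟩

theorem reach_lasso_sound (hy : y ≠ []) {w : List (Option α)}
    (h : ((lassoFA x y).val mem).Reach (Sum.inl []) w (Sum.inr y)) :
    ∃ i j, 0 < j ∧ w = dollarWord (x ++ wpow y i) (wpow y j) := by
  have key : ∀ (w : List (Option α)) (s : Word α ⊕ Word α) (w₀ : List (Option α)),
      LassoInv x y s w₀ → ((lassoFA x y).val mem).Reach s w (Sum.inr y) →
      LassoInv x y (Sum.inr y) (w₀ ++ w) := by
    intro w
    induction w with
    | nil => rintro s w₀ h rfl; simpa using h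
    | cons b w ih =>
      rintro s w₀ h ⟨q, hq, hr⟩
      simpa using ih q (w₀ ++ [b]) (h.step hy hq) hr
  have h0 : LassoInv x y (Sum.inl []) [] := by
    by_cases hx : x = []
    · exact .inr ⟨0, [], y, hy, rfl, by simp [hx], by simp [hx]⟩
    · exact .inl ⟨⟨x, hx, rfl⟩, rfl⟩
  obtain ⟨i, j, -, -, he⟩ := key w _ [] h0 h
  -- In the accepting state the invariant shows `y` once more after its `j`-th power, so the
  -- exponent after `$` is positive.
  exact ⟨i, j + 1, by omega, by rw [wpow_succ']; simpa using he⟩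

theorem reach_lasso_complete (hy : y ≠ []) (i : ℕ) {j : ℕ} (hj : 0 < j) :
    ((lassoFA x y).val mem).Reach (Sum.inl []) (dollarWord (x ++ wpow y i) (wpow y j))
      (Sum.inr y) := by
  set A := (lassoFA x y).val mem with hA
  have h1 : A.Reach (Sum.inl []) (x.map some) (Sum.inl x) := by
    by_cases hx : x = []
    · subst hx; rfl
    · refine reach_chain (mem := mem) (f := Sum.inl) (fun d hd => ?_) hx
      exact mem_lasso_trans.2 (.inl ⟨d, .inl hd, rfl, rfl, rfl⟩)
  have h2 : ∀ i, A.Reach (Sum.inl x) ((wpow y i).map some) (Sum.inl x) := by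
    intro i
    induction i with
    | zero => rfl
    | succ i ih =>
      rw [wpow_succ, List.map_append]
      refine FA.Reach.append (reach_chain (mem := mem) (f := Sum.inl) (fun d hd => ?_) hy) ih
      exact mem_lasso_trans.2 (.inl ⟨d, .inr hd, rfl, rfl, rfl⟩)
  have hafter : ∀ d ∈ (chain [] y y).val mem, (Sum.inr d.1, some d.2.1, Sum.inr d.2.2) ∈ A.trans :=
    fun d hd => mem_lasso_trans.2 (.inr (.inr (.inl ⟨d, hd, rfl, rfl, rfl⟩)))
  have h3 : A.Reach (Sum.inr []) (y.map some) (Sum.inr y) :=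
    reach_chain (mem := mem) (f := Sum.inr) hafter hy
  have h4 : A.Reach (Sum.inr y) (y.map some) (Sum.inr y) := by
    obtain _ | ⟨a, z⟩ := y
    · exact absurd rfl hy
    · refine ⟨Sum.inr [a], mem_lasso_trans.2 (.inr (.inr (.inr ⟨a, z, rfl, rfl, rfl, rfl⟩))), ?_⟩
      -- For a period of one letter the closing transition already ends in the accepting state;
      -- otherwise the rest of the period follows the chain.
      cases z with
      | nil => rfl
      | cons b z =>
        refine reach_chain (mem := mem) (f := Sum.inr) (fun d hd => hafter d ?_) (by simp)
        simp only [chain, val_tick, val_bind, val_app, val_pure, List.nil_append]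
        exact List.mem_cons_of_mem _ hd
  have h5 : ∀ j, A.Reach (Sum.inr y) ((wpow y j).map some) (Sum.inr y) := by
    intro j
    induction j with
    | zero => rfl
    | succ j ih => rw [wpow_succ, List.map_append]; exact h4.append ih
  obtain ⟨j, rfl⟩ : ∃ k, j = k + 1 := ⟨j - 1, by omega⟩
  rw [dollarWord, List.map_append]
  refine (h1.append (h2 i)).append ⟨Sum.inr [], ?_, ?_⟩
  · exact mem_lasso_trans.2 (.inr (.inl ⟨rfl, rfl, rfl⟩))
  · rw [wpow_succ, List.map_append]; exact h3.append (h5 j)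

/-- The states before `$` are listed only as sources of transitions, so each target has to be
exhibited as a source. For the end of the stem this is the first transition of the cycle, which
exists because `y ≠ []`. -/
theorem closed_lasso (hy : y ≠ []) : ((lassoFA x y).val mem).Closed := by
  have hx : (Sum.inl x : Word α ⊕ Word α) ∈ ((lassoFA x y).val mem).states := by
    obtain ⟨a, z, rfl⟩ := List.exists_cons_of_ne_nil hy
    refine mem_lasso_states.2 (.inl ⟨(x, a, if z = [] then x else x ++ [a]), .inr ?_, rfl⟩)
    exact mem_chain.2 ⟨[], z, rfl, by simp, by by_cases hz : z = [] <;> simp [hz]⟩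
  have hstem : ∀ q r, x = q ++ r → (Sum.inl q : Word α ⊕ Word α) ∈
      ((lassoFA x y).val mem).states := by
    intro q r he
    obtain _ | ⟨a, r⟩ := r
    · rw [List.append_nil] at he; rwa [← he]
    · exact mem_lasso_states.2 (.inl ⟨(q, a, q ++ [a]), .inl (mem_chain_self.2 ⟨rfl, r, he⟩), rfl⟩)
  have hafter : ∀ q r, y = q ++ r → (Sum.inr q : Word α ⊕ Word α) ∈
      ((lassoFA x y).val mem).states := by
    intro q r he
    refine mem_lasso_states.2 (.inr ⟨q, ?_, rfl⟩)
    by_cases hq : q = []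
    · exact .inl hq
    · exact .inr (mem_prefixes.2 ⟨q, r, hq, he, rfl⟩)
  constructor
  · rw [val_lasso_init]; exact hstem [] x rfl
  · rintro ⟨s, b, t⟩ h
    obtain ⟨⟨q, a, r⟩, hd | hd, rfl, rfl, rfl⟩ | ⟨rfl, rfl, rfl⟩ |
      ⟨⟨q, a, r⟩, hd, rfl, rfl, rfl⟩ | ⟨a, z, rfl, rfl, rfl, rfl⟩ := mem_lasso_trans.1 h
    · obtain ⟨rfl, w₂, hw⟩ := mem_chain_self.1 hd
      exact hstem _ w₂ (by simpa using hw)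
    · obtain ⟨w₁, w₂, he, rfl, (⟨rfl, rfl⟩ | ⟨hw, rfl⟩)⟩ := mem_chain.1 hd
      · exact hx
      · obtain ⟨b, w₂, rfl⟩ := List.exists_cons_of_ne_nil hw
        refine mem_lasso_states.2 (.inl ⟨(x ++ w₁ ++ [a], b,
          if w₂ = [] then x else x ++ (w₁ ++ [a]) ++ [b]), .inr ?_, rfl⟩)
        exact mem_chain.2 ⟨w₁ ++ [a], w₂, by simpa using he, by simp,
          by by_cases hz : w₂ = [] <;> simp [hz]⟩
    · exact hafter [] y rfl
    · obtain ⟨rfl, w₂, hw⟩ := mem_chain_self.1 hd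
      exact hafter _ w₂ (by simpa using hw)
    · exact hafter [a] z rfl

theorem within_lasso (hm : 2 ≤ m) (h : x.length + y.length ≤ m) :
    (lassoFA x y).Within mem (m ^ 20) := by
  have hm2 : m + 2 ≤ m ^ 2 := by nlinarith
  have hsq : ∀ a b : ℕ, a ≤ m → b ≤ m → (a + 2) * (b + 1) ≤ m ^ 4 := fun a b ha hb =>
    pow_mul_pow_le hm (a := 2) (b := 2) (by omega) (by omega) (by omega)
  have hb : ((chain [] x x).val mem ++ (chain x x y).val mem).length ≤ m ^ 2 := by
    rw [List.length_append, length_chain, length_chain]; omega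
  unfold lassoFA
  refine Prog.Within.bind_pow hm (a := 4) (b := 19) ((within_chain _ _ _).mono
    (hsq _ _ (by simp; omega) (by omega))) ?_ (by omega) (by omega)
  refine Prog.Within.bind_pow hm (a := 4) (b := 18) ((within_chain _ _ _).mono
    (hsq _ _ (by omega) (by omega))) ?_ (by omega) (by omega)
  refine Prog.Within.bind_pow hm (a := 3) (b := 17) (within_app_pow hm (a := 2) ?_ (by omega)) ?_
    (by omega) (by omega)
  · rw [length_chain]; omega
  refine Prog.Within.bind_pow hm (a := 4) (b := 16) ((within_chain _ _ _).mono
    (hsq _ _ (by simp; omega) (by omega))) ?_ (by omega) (by omega)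
  refine Prog.Within.bind_pow hm (a := 4) (b := 15) ((within_prefixes _ _).mono
    (hsq _ _ (by simp; omega) (by omega))) ?_ (by omega) (by omega)
  rw [val_app]
  refine Prog.Within.bind_pow hm (a := 4) (b := 14) (within_mapL_pow hm hb
    (b := 0) (fun _ _ => within_pure _ _) (by omega)) ?_ (by omega) (by omega)
  refine Prog.Within.bind_pow hm (a := 4) (b := 13) (within_mapL_pow hm (a := 2) ?_
    (b := 0) (fun _ _ => within_pure _ _) (by omega)) ?_ (by omega) (by omega)
  · rw [List.length_cons, length_prefixes]; omega
  refine Prog.Within.bind_pow hm (a := 3) (b := 12) (within_app_pow hm (a := 2) ?_ (by omega)) ?_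
    (by omega) (by omega)
  · rw [val_mapL, List.length_map]; exact hb
  refine Prog.Within.bind_pow hm (a := 4) (b := 11) (within_mapL_pow hm hb
    (b := 0) (fun _ _ => within_pure _ _) (by omega)) ?_ (by omega) (by omega)
  refine Prog.Within.bind_pow hm (a := 4) (b := 10) (within_mapL_pow hm (a := 2) ?_
    (b := 0) (fun _ _ => within_pure _ _) (by omega)) ?_ (by omega) (by omega)
  · rw [length_chain]; omega
  refine Prog.Within.bind_pow hm (a := 4) (b := 9) (within_mapL_pow hm (a := 2)
    (by cases y <;> simp <;> omega) (b := 0) (fun _ _ => within_pure _ _) (by omega)) ?_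
    (by omega) (by omega)
  refine Prog.Within.bind_pow hm (a := 3) (b := 8) (within_app_pow hm (a := 2) ?_ (by omega)) ?_
    (by omega) (by omega)
  · rw [val_mapL, List.length_map, length_chain]; omega
  refine Prog.Within.bind_pow hm (a := 3) (b := 0) (within_app_pow hm (a := 2) ?_ (by omega)) ?_
    (by omega) (by omega)
  · rw [val_mapL, List.length_map]; exact hb
  · exact within_pure _ _

end

section

variable {α : Type} [DecidableEq α] {mem : Word α → Word α → Bool} {m : ℕ} {x y : Word α}

theorem small_lasso (hm : 2 ≤ m) (hy : y ≠ []) (h : x.length + y.length ≤ m) :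
    ((lassoFA x y).val mem).Small α (m ^ 4) := by
  have hy0 := List.length_pos_of_ne_nil hy
  have h16 : 2 * m + 2 ≤ m ^ 4 := by
    refine pow_add_pow_le hm (a := 2) (b := 1) ?_ (by simpa using hm) (by omega) (by omega)
    nlinarith
  have hlen : ∀ (d : Word α × α × Word α), (d ∈ (chain [] x x).val mem ∨
      d ∈ (chain x x y).val mem) → d.1.length ≤ m ∧ d.2.2.length ≤ m := by
    rintro ⟨q, a, r⟩ (hd | hd)
    · obtain ⟨rfl, w₂, rfl⟩ := mem_chain_self.1 hd
      simp at *; omega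
    · obtain ⟨w₁, w₂, rfl, rfl, (⟨rfl, rfl⟩ | ⟨hw, rfl⟩)⟩ := mem_chain.1 hd <;> simp at * <;> omega
  have hafter : ∀ (d : Word α × α × Word α), d ∈ (chain [] y y).val mem →
      d.1.length ≤ m ∧ d.2.2.length ≤ m := by
    rintro ⟨q, a, r⟩ hd
    obtain ⟨rfl, w₂, rfl⟩ := mem_chain_self.1 hd
    simp at *; omega
  have hback := length_lassoBack (y := y)
  refine ⟨?_, ?_, ?_, fun s hs => ?_, fun s hs => ?_, ?_, ?_, ?_⟩
  · simp only [lassoFA, val_bind, val_app, val_mapL, val_pure, List.length_append, List.length_map,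
      List.length_cons, length_chain, length_prefixes]
    omega
  · rw [val_lasso_acc]; exact one_le_pow' hm _
  · simp only [val_lasso_trans, List.length_append, List.length_map, List.length_cons,
      length_chain]
    omega
  · obtain ⟨d, hd, rfl⟩ | ⟨q, hq, rfl⟩ := mem_lasso_states.1 hs
    · rw [psize_inl, psize_word]
      have := (hlen d hd).1
      omega
    · rw [psize_inr, psize_word]
      obtain rfl | hq := hq
      · simp; omega
      · obtain ⟨w₁, w₂, -, rfl, rfl⟩ := mem_prefixes.1 hq
        simp at *; omega
  · rw [val_lasso_acc] at hs
    obtain rfl : s = Sum.inr y := by simpa using hs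
    rw [psize_inr, psize_word]; omega
  · rw [val_lasso_init, psize_inl, psize_word]; simp; omega
  all_goals
    rintro ⟨s, b, t⟩ ht
    obtain ⟨d, hd, rfl, rfl, rfl⟩ | ⟨rfl, rfl, rfl⟩ | ⟨d, hd, rfl, rfl, rfl⟩ |
      ⟨a, z, rfl, rfl, rfl, rfl⟩ := mem_lasso_trans.1 ht
    · have := hlen d hd
      simp only [psize_inl, psize_word]; omega
    · simp only [psize_inl, psize_inr, psize_word, List.length_nil]; omega
    · have := hafter d hd
      simp only [psize_inr, psize_word]; omega
    · simp only [psize_inr, psize_word, List.length_cons, List.length_nil] at *; omega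

end

/-! ## Searching for decompositions -/

section

variable {α : Type} {mem : Word α → Word α → Bool} {m : ℕ}

/-! ### An automaton that reads u in M, the letter $, and v in a part belonging to the state
reached. -/

section Dollar

variable {σ : Type} {M : FA α (Word α)} {parts : List (Word α × FA α σ)}

theorem mem_dollar_trans {s t : Word α ⊕ (Word α × σ)} {b : Option α} :
    (s, b, t) ∈ ((dollarFA M parts).val mem).trans ↔
      (∃ p a q, (p, a, q) ∈ M.trans ∧ s = Sum.inl p ∧ b = some a ∧ t = Sum.inl q) ∨
      (∃ c ∈ parts, s = Sum.inl c.1 ∧ b = none ∧ t = Sum.inr (c.1, c.2.init)) ∨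
      ∃ c ∈ parts, ∃ p a q, (p, a, q) ∈ c.2.trans ∧ s = Sum.inr (c.1, p) ∧ b = some a ∧
        t = Sum.inr (c.1, q) := by
  simp [dollarFA, eq_comm (b := s), eq_comm (b := b), eq_comm (b := t)]

theorem val_dollar_init : ((dollarFA M parts).val mem).init = Sum.inl M.init := by
  simp [dollarFA]

theorem mem_dollar_acc {s : Word α ⊕ (Word α × σ)} :
    s ∈ ((dollarFA M parts).val mem).acc ↔
      ∃ c ∈ parts, ∃ f ∈ c.2.acc, s = Sum.inr (c.1, f) := by
  simp [dollarFA, eq_comm (b := s)]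

theorem mem_dollar_states {s : Word α ⊕ (Word α × σ)} :
    s ∈ ((dollarFA M parts).val mem).states ↔
      (∃ p ∈ M.states, s = Sum.inl p) ∨ ∃ c ∈ parts, ∃ p ∈ c.2.states, s = Sum.inr (c.1, p) := by
  simp [dollarFA, eq_comm (b := s)]

theorem closed_dollar (hM : M.Closed) (hp : ∀ c ∈ parts, c.2.Closed) :
    ((dollarFA M parts).val mem).Closed where
  init := mem_dollar_states.2 (.inl ⟨_, hM.init, val_dollar_init⟩)
  target := fun ⟨s, b, t⟩ h => by
    obtain ⟨p, a, q, ht, -, -, rfl⟩ | ⟨c, hc, -, -, rfl⟩ | ⟨c, hc, p, a, q, ht, -, -, rfl⟩ :=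
      mem_dollar_trans.1 h
    · exact mem_dollar_states.2 (.inl ⟨q, hM.target (p, a, q) ht, rfl⟩)
    · exact mem_dollar_states.2 (.inr ⟨c, hc, _, (hp c hc).init, rfl⟩)
    · exact mem_dollar_states.2 (.inr ⟨c, hc, _, (hp c hc).target (p, a, q) ht, rfl⟩)

/-- After `$` every state carries the key of its part, and by `hu` a key determines its part. So the
run is a run of `N` and can read no second `$`. -/
theorem reach_dollar_inr {u : Word α} {N : FA α σ} (hN : (u, N) ∈ parts)
    (hu : ∀ c ∈ parts, c.1 = u → c = (u, N)) {s : σ} {w : List (Option α)}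
    {t : Word α ⊕ (Word α × σ)} :
    ((dollarFA M parts).val mem).Reach (Sum.inr (u, s)) w t ↔
      ∃ (v : Word α) (f : σ), w = v.map some ∧ t = Sum.inr (u, f) ∧ N.Reach s v f := by
  induction w generalizing s with
  | nil =>
    constructor
    · rintro rfl
      exact ⟨[], s, rfl, rfl, rfl⟩
    · rintro ⟨v, f, hv, rfl, hr⟩
      obtain rfl : v = [] := by simpa using hv.symm
      cases hr
      rfl
  | cons b w ih =>
    constructor
    · rintro ⟨q, hq, hr⟩
      obtain ⟨p, a, q, h, h', -⟩ | ⟨c, hc, h', -⟩ | ⟨c, hc, p, a, q, h, h', rfl, rfl⟩ :=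
        mem_dollar_trans.1 hq
      · cases h'
      · cases h'
      · obtain ⟨h1, rfl⟩ : u = c.1 ∧ s = p := by simpa using h'
        have := hu c hc h1.symm
        subst this
        obtain ⟨v, f, rfl, rfl, hr'⟩ := ih.1 hr
        exact ⟨a :: v, f, rfl, rfl, q, h, hr'⟩
    · rintro ⟨v, f, hv, rfl, hr⟩
      cases v with
      | nil => simp at hv
      | cons a v =>
        obtain ⟨rfl, rfl⟩ : b = some a ∧ w = v.map some := by simpa using hv
        obtain ⟨q, hq, hr⟩ := hr
        exact ⟨Sum.inr (u, q), mem_dollar_trans.2 (.inr (.inr ⟨_, hN, s, a, q, hq, rfl, rfl, rfl⟩)),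
          ih.2 ⟨v, f, rfl, rfl, hr⟩⟩

theorem reach_dollar {u : Word α} {N : FA α σ} (hN : (u, N) ∈ parts)
    (hu : ∀ c ∈ parts, c.1 = u → c = (u, N)) {s : Word α} {w : List (Option α)} {f : σ} :
    ((dollarFA M parts).val mem).Reach (Sum.inl s) w (Sum.inr (u, f)) ↔
      ∃ u' v', w = dollarWord u' v' ∧ M.Reach s u' u ∧ N.Reach N.init v' f := by
  induction w generalizing s with
  | nil =>
    constructor
    · intro h; cases h
    · rintro ⟨u', v', h, -⟩
      have := congrArg List.length h
      simp [length_dollarWord] at this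
  | cons b w ih =>
    constructor
    · rintro ⟨q, hq, hr⟩
      obtain ⟨p, a, q, h, h', rfl, rfl⟩ | ⟨c, hc, h', rfl, rfl⟩ |
        ⟨c, hc, p, a, q, h, h', rfl, rfl⟩ := mem_dollar_trans.1 hq
      · obtain rfl : s = p := by simpa using h'
        obtain ⟨u', v', rfl, h1, h2⟩ := ih.1 hr
        exact ⟨a :: u', v', rfl, ⟨q, h, h1⟩, h2⟩
      · obtain rfl : s = c.1 := by simpa using h'
        have hcu : c.1 = u := by
          -- The key attached to a state after `$` never changes, so the part entered is the one in
          -- which the run ends.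
          have key : ∀ (w : List (Option α)) (t : Word α ⊕ (Word α × σ)) (v : Word α) (e : σ),
              ((dollarFA M parts).val mem).Reach (Sum.inr (v, e)) w t → ∃ e', t = Sum.inr (v, e') := by
            intro w
            induction w with
            | nil => rintro t v e rfl; exact ⟨e, rfl⟩
            | cons b w ih =>
              rintro t v e ⟨q, hq, hr⟩
              obtain ⟨p, a, q, h, h', -⟩ | ⟨c, hc, h', -⟩ | ⟨c, hc, p, a, q, h, h', rfl, rfl⟩ :=
                mem_dollar_trans.1 hq
              · cases h'
              · cases h'
              · obtain ⟨rfl, -⟩ : v = c.1 ∧ e = p := by simpa using h'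
                exact ih t _ q hr
          obtain ⟨e', he'⟩ := key _ _ _ _ hr
          simpa using (Prod.mk.inj (Sum.inr.inj he')).1.symm
        have := hu c hc hcu
        subst this
        obtain ⟨v, f', rfl, hf, hr⟩ := (reach_dollar_inr hN hu).1 hr
        obtain rfl : f = f' := by simpa using hf
        exact ⟨[], v, rfl, rfl, hr⟩
      · cases h'
    · rintro ⟨u', v', he, h1, h2⟩
      cases u' with
      | nil =>
        obtain rfl : s = u := h1
        obtain ⟨rfl, rfl⟩ : b = none ∧ w = v'.map some := by simpa [dollarWord] using he
        exact ⟨_, mem_dollar_trans.2 (.inr (.inl ⟨_, hN, rfl, rfl, rfl⟩)),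
          (reach_dollar_inr hN hu).2 ⟨v', f, rfl, rfl, h2⟩⟩
      | cons a u' =>
        obtain ⟨rfl, rfl⟩ : b = some a ∧ w = dollarWord u' v' := by simpa [dollarWord] using he
        obtain ⟨q, hq, hr⟩ := h1
        exact ⟨Sum.inl q, mem_dollar_trans.2 (.inl ⟨s, a, q, hq, rfl, rfl, rfl⟩),
          ih.2 ⟨u', v', rfl, hr, h2⟩⟩

theorem small_dollar [DecidableEq α] [PEq α σ] [LawfulPEq α σ] (hm : 2 ≤ m) (hM : M.Small α m)
    (hl : parts.length ≤ m) (hp : ∀ c ∈ parts, c.2.Small α m ∧ psize α c.1 ≤ m) :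
    ((dollarFA M parts).val mem).Small α (m ^ 5) := by
  have hm5 : m ≤ m ^ 5 := le_pow_self hm le_rfl (by omega)
  have hadd : ∀ x y, x ≤ m → y ≤ m → x + y ≤ m ^ 5 := fun x y hx hy =>
    pow_add_pow_le hm (le_pow_one hx) (le_pow_one hy) (by omega) (by omega)
  refine ⟨?_, ?_, ?_, fun s hs => ?_, fun s hs => ?_, ?_, ?_, ?_⟩
  · simp only [dollarFA, val_bind, val_mapL, val_pure, val_bindL, val_app, List.length_append,
      List.length_map]
    refine pow_add_pow_le hm (a := 1) (b := 2) (le_pow_one hM.states) ?_ (by omega) (by omega)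
    refine length_flatMap_pow hm (le_pow_one hl) (b := 1) (fun c hc => ?_) (by omega)
    simpa using (hp c hc).1.states
  · simp only [dollarFA, val_bind, val_mapL, val_pure, val_bindL]
    refine length_flatMap_pow hm (le_pow_one hl) (b := 1) (fun c hc => ?_) (by omega)
    simpa using (hp c hc).1.acc
  · simp only [dollarFA, val_bind, val_mapL, val_pure, val_bindL, val_app, List.length_append,
      List.length_map]
    refine pow_add_pow_le hm (a := 1) (b := 3) (le_pow_one hM.trans) ?_ (by omega) (by omega)
    refine pow_add_pow_le hm (a := 1) (b := 2) (le_pow_one hl) ?_ (by omega) (by omega)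
    refine length_flatMap_pow hm (le_pow_one hl) (b := 1) (fun c hc => ?_) (by omega)
    simpa using (hp c hc).1.trans
  · obtain ⟨p, h, rfl⟩ | ⟨c, hc, p, h, rfl⟩ := mem_dollar_states.1 hs
    · exact (hM.size_states _ h).trans hm5
    · exact hadd _ _ (hp c hc).2 ((hp c hc).1.size_states _ h)
  · obtain ⟨c, hc, p, h, rfl⟩ := mem_dollar_acc.1 hs
    exact hadd _ _ (hp c hc).2 ((hp c hc).1.size_acc _ h)
  · rw [val_dollar_init]; exact hM.size_init.trans hm5
  · rintro ⟨s, b, t⟩ h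
    obtain ⟨p, a, q, ht, rfl, -⟩ | ⟨c, hc, rfl, -⟩ | ⟨c, hc, p, a, q, ht, rfl, -⟩ :=
      mem_dollar_trans.1 h
    · exact (hM.size_source (p, a, q) ht).trans hm5
    · exact (hp c hc).2.trans hm5
    · exact hadd _ _ (hp c hc).2 ((hp c hc).1.size_source (p, a, q) ht)
  · rintro ⟨s, b, t⟩ h
    obtain ⟨p, a, q, ht, -, -, rfl⟩ | ⟨c, hc, -, -, rfl⟩ | ⟨c, hc, p, a, q, ht, -, -, rfl⟩ :=
      mem_dollar_trans.1 h
    · exact (hM.size_target (p, a, q) ht).trans hm5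
    · exact hadd _ _ (hp c hc).2 (hp c hc).1.size_init
    · exact hadd _ _ (hp c hc).2 ((hp c hc).1.size_target (p, a, q) ht)

theorem within_dollar [DecidableEq α] [PEq α σ] [LawfulPEq α σ] (hm : 2 ≤ m) (hM : M.Small α m)
    (hl : parts.length ≤ m) (hp : ∀ c ∈ parts, c.2.Small α m ∧ psize α c.1 ≤ m) :
    (dollarFA M parts).Within mem (m ^ 18) := by
  have aux : ∀ {β γ : Type} (l : List β) (f : β → γ), l.length ≤ m →
      (mapL (fun b => pure (f b)) l : Prog α _).Within mem (m ^ 3) := fun l f h =>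
    within_mapL_pow hm (b := 0) (le_pow_one h) (fun _ _ => within_pure _ _) (by omega)
  unfold dollarFA
  refine Prog.Within.bind_pow hm (aux _ _ hM.states) (b := 17) ?_ (by omega) (by omega)
  refine Prog.Within.bind_pow hm (a := 8) (b := 16) ?_ ?_ (by omega) (by omega)
  · refine within_bindL_pow hm (b := 3) (le_pow_one hl) (fun c hc => aux _ _ (hp c hc).1.states)
      (fun c hc => ?_) (by omega)
    simpa using le_pow_self hm (hp c hc).1.states (by omega)
  refine Prog.Within.bind_pow hm (within_app_pow hm (a := 1) (c := 2) ?_ (by omega)) (b := 15) ?_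
    (by omega) (by omega)
  · simpa using hM.states
  refine Prog.Within.bind_pow hm (a := 8) (b := 14) ?_ ?_ (by omega) (by omega)
  · refine within_bindL_pow hm (b := 3) (le_pow_one hl) (fun c hc => aux _ _ (hp c hc).1.acc)
      (fun c hc => ?_) (by omega)
    simpa using le_pow_self hm (hp c hc).1.acc (by omega)
  refine Prog.Within.bind_pow hm (aux _ _ hM.trans) (b := 13) ?_ (by omega) (by omega)
  refine Prog.Within.bind_pow hm (aux _ _ hl) (b := 12) ?_ (by omega) (by omega)
  refine Prog.Within.bind_pow hm (a := 8) (b := 11) ?_ ?_ (by omega) (by omega)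
  · refine within_bindL_pow hm (b := 3) (le_pow_one hl) (fun c hc => aux _ _ (hp c hc).1.trans)
      (fun c hc => ?_) (by omega)
    simpa using le_pow_self hm (hp c hc).1.trans (by omega)
  refine Prog.Within.bind_pow hm (within_app_pow hm (a := 1) (c := 2) ?_ (by omega)) (b := 10) ?_
    (by omega) (by omega)
  · simpa using hl
  refine Prog.Within.bind_pow hm (within_app_pow hm (a := 1) (c := 2) ?_ (by omega)) (b := 0) ?_
    (by omega) (by omega)
  · simpa using hM.trans
  · exact within_pure _ _

end Dollar

/-! ### Families of DFAs -/

/-- The family consists of DFAs with transition functions `δ` and `δ' u`; there is one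
progress automaton for every state of the leading automaton. -/
structure FDFA.IsFamily (F : FDFA α) (δ : Word α → α → Word α)
    (δ' : Word α → Word α → α → Word α) : Prop where
  lead : F.lead.IsDFA δ
  lead_init : F.lead.init = []
  progress : ∀ e ∈ F.progress, e.2.IsDFA (δ' e.1)
  progress_init : ∀ e ∈ F.progress, e.2.init = []
  acc : ∀ e ∈ F.progress, ∀ v ∈ e.2.acc, v ∈ e.2.states
  nodup : (F.progress.map Prod.fst).Nodup
  mem_keys : ∀ u, u ∈ F.progress.map Prod.fst ↔ u ∈ F.lead.states

/-- All parts of the family have size at most `m`. -/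
structure FDFA.Small [DecidableEq α] (m : ℕ) (F : FDFA α) : Prop where
  lead : F.lead.Small α m
  length : F.progress.length ≤ m
  progress : ∀ e ∈ F.progress, e.2.Small α m
  key : ∀ e ∈ F.progress, psize α e.1 ≤ m

variable {F : FDFA α} {δ : Word α → α → Word α}
  {δ' : Word α → Word α → α → Word α}

theorem FDFA.IsFamily.eq_of_key (h : F.IsFamily δ δ') {e e' : Word α × FA α (Word α)}
    (he : e ∈ F.progress) (he' : e' ∈ F.progress) (hk : e.1 = e'.1) : e = e' :=
  List.inj_on_of_nodup_map h.nodup he he' hk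

theorem FDFA.IsFamily.exists_progress (h : F.IsFamily δ δ') {u : Word α}
    (hu : u ∈ F.lead.states) : ∃ A, (u, A) ∈ F.progress := by
  obtain ⟨⟨u, A⟩, he, rfl⟩ := List.mem_map.1 ((h.mem_keys u).2 hu)
  exact ⟨A, he⟩

variable [DecidableEq α]

/-- The part of the automaton for decompositions that belongs to an entry of the family. -/
def decompPart (mem : Word α → Word α → Bool) (accepted : Bool) (F : FDFA α)
    (e : Word α × FA α (Word α)) : FA α (Word α × Word α) :=
  ((F.lead.fromTo e.1 e.1).prod (if accepted then e.2 else (e.2.compl : Prog α _).val mem) :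
    Prog α _).val mem

theorem val_decompFA (b : Bool) : (decompFA b F).val mem =
    (dollarFA F.lead (F.progress.map fun e => (e.1, decompPart mem b F e))).val mem := by
  cases b <;> simp [decompFA, decompPart]

theorem mem_decompPart_acc {b : Bool} {e : Word α × FA α (Word α)}
    {f : Word α × Word α} :
    f ∈ (decompPart mem b F e).acc ↔ f.1 = e.1 ∧
      if b then f.2 ∈ e.2.acc else f.2 ∈ e.2.states ∧ f.2 ∉ e.2.acc := by
  cases b <;> simp [decompPart, mem_prod_acc, FA.fromTo, val_compl]

theorem reach_decompPart {b : Bool} {e : Word α × FA α (Word α)} {v : Word α}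
    {f : Word α × Word α} :
    (decompPart mem b F e).Reach (decompPart mem b F e).init v f ↔
      F.lead.Reach e.1 v f.1 ∧ e.2.Reach e.2.init v f.2 := by
  cases b
  · rw [decompPart, reach_prod, reach_fromTo, val_prod]
    simp only [Bool.false_eq_true, if_false, val_compl]
    refine and_congr_right fun _ => ?_
    apply reach_of_trans_eq
    rfl
  · rw [decompPart, reach_prod, reach_fromTo, val_prod]
    rfl

/-- The automaton for decompositions recognizes the words `u$v` such that `v` leads back to the
state of `u` and is accepted, or rejected, by its progress automaton. -/
theorem reach_decompFA (h : F.IsFamily δ δ') {b : Bool} {w : List (Option α)} :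
    (∃ q ∈ ((decompFA b F).val mem).acc, ((decompFA b F).val mem).Reach
      ((decompFA b F).val mem).init w q) ↔
    ∃ u v A, w = dollarWord u v ∧ v.foldl δ (u.foldl δ []) = u.foldl δ [] ∧
      (u.foldl δ [], A) ∈ F.progress ∧
      (v.foldl (δ' (u.foldl δ [])) [] ∈ A.acc ↔ b = true) := by
  rw [val_decompFA, val_dollar_init, h.lead_init]
  have huniq : ∀ e ∈ F.progress, ∀ c ∈ F.progress.map fun e => (e.1, decompPart mem b F e),
      c.1 = e.1 → c = (e.1, decompPart mem b F e) := by
    intro e he c hc hce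
    obtain ⟨e', he', rfl⟩ := List.mem_map.1 hc
    rw [h.eq_of_key he' he hce]
  have hnil : [] ∈ F.lead.states := h.lead_init ▸ h.lead.init
  constructor
  · rintro ⟨q, hq, hr⟩
    obtain ⟨c, hc, ⟨f₁, f₂⟩, hf, rfl⟩ := mem_dollar_acc.1 hq
    obtain ⟨e, he, rfl⟩ := List.mem_map.1 hc
    obtain ⟨u, v, rfl, h1, h2⟩ := (reach_dollar hc (huniq e he)).1 hr
    obtain ⟨h3, h4⟩ := reach_decompPart.1 h2
    obtain ⟨h5, h6⟩ := mem_decompPart_acc.1 hf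
    dsimp only at h1 h3 h4 h5 h6
    rw [h.lead.reach_iff hnil] at h1
    have hes : e.1 ∈ F.lead.states := (h.mem_keys _).1 (List.mem_map_of_mem he)
    rw [h.lead.reach_iff hes] at h3
    rw [(h.progress e he).reach_iff (h.progress e he).init, h.progress_init e he] at h4
    refine ⟨u, v, e.2, rfl, ?_, ?_, ?_⟩
    · rw [h1, h3, h5]
    · rw [h1]; exact he
    · rw [h1, h4]
      cases b
      · simp only [Bool.false_eq_true, if_false] at h6
        simpa using h6.2
      · simpa using h6
  · rintro ⟨u, v, A, rfl, h1, h2, h3⟩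
    refine ⟨Sum.inr (u.foldl δ [], (u.foldl δ [], v.foldl (δ' (u.foldl δ [])) [])), ?_, ?_⟩
    · refine mem_dollar_acc.2 ⟨_, List.mem_map.2 ⟨_, h2, rfl⟩, _,
        mem_decompPart_acc.2 ⟨rfl, ?_⟩, rfl⟩
      cases b
      · simp only [Bool.false_eq_true, if_false, iff_false] at h3 ⊢
        exact ⟨(h.progress _ h2).foldl_mem (h.progress_init _ h2 ▸ (h.progress _ h2).init) v, h3⟩
      · simpa using h3
    · refine (reach_dollar (List.mem_map.2 ⟨_, h2, rfl⟩) (huniq _ h2)).2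
        ⟨u, v, rfl, (h.lead.reach_iff hnil u).2 rfl, reach_decompPart.2 ⟨?_, ?_⟩⟩
      · exact (h.lead.reach_iff (h.lead.foldl_mem hnil u) v).2 h1
      · rw [(h.progress _ h2).reach_iff (h.progress _ h2).init, h.progress_init _ h2]

theorem closed_compl {A : FA α (Word α)} (h : A.Closed) :
    ((A.compl : Prog α _).val mem).Closed := by
  rw [val_compl]; exact ⟨h.init, h.target⟩

theorem closed_decompFA (h : F.IsFamily δ δ') {b : Bool} : ((decompFA b F).val mem).Closed := by
  rw [val_decompFA]
  refine closed_dollar h.lead.closed fun c hc => ?_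
  obtain ⟨e, he, rfl⟩ := List.mem_map.1 hc
  have hes : e.1 ∈ F.lead.states := (h.mem_keys _).1 (List.mem_map_of_mem he)
  refine FA.Closed.prod ⟨hes, h.lead.closed.target⟩ ?_
  cases b
  · exact closed_compl (h.progress e he).closed
  · exact (h.progress e he).closed

theorem small_decompPart (hm : 2 ≤ m) (h : F.Small m) {b : Bool}
    {e : Word α × FA α (Word α)} (he : e ∈ F.progress) :
    (decompPart mem b F e).Small α (m ^ 2) := by
  refine FA.Small.prod hm (h.lead.fromTo (by omega) (h.key e he) (h.key e he)) ?_
  cases b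
  · exact (h.progress e he).compl
  · exact h.progress e he

theorem small_decompFA (hm : 2 ≤ m) (h : F.Small m) {b : Bool} :
    ((decompFA b F).val mem).Small α (m ^ 10) := by
  have hm2 : m ≤ m ^ 2 := le_pow_self hm le_rfl (by omega)
  rw [val_decompFA, show m ^ 10 = (m ^ 2) ^ 5 by ring]
  refine small_dollar (hm.trans hm2) (h.lead.mono hm2) ?_ fun c hc => ?_
  · simpa using h.length.trans hm2
  · obtain ⟨e, he, rfl⟩ := List.mem_map.1 hc
    exact ⟨small_decompPart hm h he, (h.key e he).trans hm2⟩

theorem within_decompFA (hm : 2 ≤ m) (h : F.Small m) {b : Bool} :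
    (decompFA b F).Within mem (m ^ 40) := by
  have hm2 : m ≤ m ^ 2 := le_pow_self hm le_rfl (by omega)
  have h1 : (decompFA b F) = (do
      let parts ← mapL (fun e => do
        let A ← if b then pure e.2 else e.2.compl
        let N ← (F.lead.fromTo e.1 e.1).prod A
        pure (e.1, N)) F.progress
      dollarFA F.lead parts) := rfl
  rw [h1]
  refine Prog.Within.bind_pow hm (a := 20) (b := 36) ?_ ?_ (by omega) (by omega)
  · refine within_mapL_pow hm (le_pow_one h.length) (b := 17) (fun e he => ?_) (by omega)
    have h2 : (F.lead.fromTo e.1 e.1).Small α m :=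
      h.lead.fromTo (by omega) (h.key e he) (h.key e he)
    have h3 : ∀ A : FA α (Word α), A.Small α m → (do
        let N ← (F.lead.fromTo e.1 e.1).prod A
        pure (e.1, N) : Prog α _).Within mem (m ^ 15) := fun A hA =>
      Prog.Within.bind_pow hm (a := 14) (b := 0) (within_prod hm h2 hA) (within_pure _ _)
        (by omega) (by omega)
    refine Prog.Within.ite (fun _ => ?_) fun _ => ?_
    · exact Prog.Within.bind_pow hm (a := 0) (b := 15) (within_pure _ _)
        (h3 _ (h.progress e he)) (by omega) (by omega)
    · exact Prog.Within.bind_pow hm (a := 9) (b := 15) (within_compl hm (h.progress e he))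
        (h3 _ (h.progress e he).compl) (by omega) (by omega)
  · have hv : Prog.val mem (mapL (fun e => do
        let A ← if b then pure e.2 else e.2.compl
        let N ← (F.lead.fromTo e.1 e.1).prod A
        pure (e.1, N)) F.progress) = F.progress.map fun e => (e.1, decompPart mem b F e) := by
      cases b <;> simp [decompPart]
    rw [hv]
    refine (within_dollar (m := m ^ 2) (hm.trans hm2) (h.lead.mono hm2) ?_ fun c hc => ?_).pow_pow
      hm (by omega)
    · simpa using h.length.trans hm2
    · obtain ⟨e, he, rfl⟩ := List.mem_map.1 hc
      exact ⟨small_decompPart hm h he, (h.key e he).trans hm2⟩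

/-! ### Decompositions of ultimately periodic words -/

/-- An accepting run of the product is at the same time a run of the automaton for x y^* $ y^+,
which forces the shape of the word, and a run of `D`. -/
theorem val_findDecomp_some {σ : Type} [PEq α σ] [LawfulPEq α σ] {D : FA (Option α) σ}
    {u v : Word α} {r : Word α × Word α} (h : (findDecomp D u v).val mem = some r) (hv : v ≠ []) :
    ∃ x y i j, (x, y) ∈ (shortestForms u v).val mem ∧ 0 < j ∧ r = (x ++ wpow y i, wpow y j) ∧
      ∃ q ∈ D.acc, D.Reach D.init (dollarWord r.1 r.2) q := by
  simp only [findDecomp, val_bind, val_firstL] at h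
  obtain ⟨⟨x, y⟩, hc, he⟩ := List.exists_of_findSome?_eq_some h
  obtain ⟨hy, -⟩ := shortestForms_sound hv hc
  cases hs : (FA.search ((((lassoFA x y).val mem).prod D : Prog α _).val mem) : Prog α _).val mem with
  | none => dsimp only at he; rw [hs] at he; simp at he
  | some path =>
    dsimp only at he
    rw [hs] at he
    simp only [val_bind, val_mapL, val_pure] at he
    obtain ⟨⟨q, q'⟩, hq, hr⟩ := search_eq_some hs
    rw [mem_prod_acc, val_lasso_acc] at hq
    obtain ⟨hq, hq'⟩ := hq
    obtain rfl : q = Sum.inr y := by simpa using hq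
    rw [reach_prod, val_prod] at hr
    dsimp only at hr
    rw [val_lasso_init] at hr
    obtain ⟨i, j, hj, hw⟩ := reach_lasso_sound hy hr.1
    rw [hw, val_splitDollar] at he
    cases he
    exact ⟨x, y, i, j, hc, hj, rfl, q', hq', hw ▸ hr.2⟩

/-- A word accepted by both factors would be accepted by the product for this form, and the
emptiness test of that product is complete. -/
theorem val_findDecomp_none {σ : Type} [PEq α σ] [LawfulPEq α σ] {D : FA (Option α) σ}
    {u v : Word α} (h : (findDecomp D u v).val mem = none) (hv : v ≠ []) (hD : D.Closed)
    {x y : Word α} (hxy : (x, y) ∈ (shortestForms u v).val mem) (i : ℕ) {j : ℕ} (hj : 0 < j)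
    {q : σ} (hq : q ∈ D.acc) :
    ¬ D.Reach D.init (dollarWord (x ++ wpow y i) (wpow y j)) q := by
  intro hr
  simp only [findDecomp, val_bind, val_firstL] at h
  obtain ⟨hy, -⟩ := shortestForms_sound hv hxy
  have he := List.findSome?_eq_none_iff.1 h _ hxy
  cases hs : (FA.search ((((lassoFA x y).val mem).prod D : Prog α _).val mem) : Prog α _).val mem with
  | some path => dsimp only at he; rw [hs] at he; simp at he
  | none =>
    refine search_eq_none ((closed_lasso hy).prod hD) hs (q := (Sum.inr y, q))
      (w := dollarWord (x ++ wpow y i) (wpow y j)) ?_ ?_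
    · exact mem_prod_acc.2 ⟨by simp [val_lasso_acc], hq⟩
    · rw [reach_prod, val_prod]
      refine ⟨?_, hr⟩
      dsimp only
      rw [val_lasso_init]
      exact reach_lasso_complete hy i hj

/-- The stem and the period of a form have total length at most twice that of `u` and `v`, hence at
most `m ^ 2`, and the lasso automaton is bounded by the fourth power of this. -/
theorem small_lasso_form (hm : 2 ≤ m) {u v : Word α} (hv : v ≠ []) (huv : u.length + v.length ≤ m)
    {c : Word α × Word α} (hc : c ∈ (shortestForms u v).val mem) :
    ((lassoFA c.1 c.2).val mem).Small α (m ^ 10) := by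
  obtain ⟨hy, -, hl⟩ := shortestForms_sound hv hc
  have hm2 : 2 * (u.length + v.length) ≤ m ^ 2 := by nlinarith
  have := small_lasso (mem := mem) (hm.trans (le_pow_self hm le_rfl (show 1 ≤ 2 by omega))) hy
    (hl.trans hm2)
  exact this.mono (by rw [← pow_mul]; exact Nat.pow_le_pow_right (by omega) (by omega))

/-- The accepting run found has at most as many steps as the product has states, and both factors
have at most `m ^ 10` states. -/
theorem length_findDecomp {σ : Type} [PEq α σ] [LawfulPEq α σ] {D : FA (Option α) σ} (hm : 2 ≤ m)
    (hD : D.Closed) (hs : D.Small α (m ^ 10)) {u v : Word α} (hv : v ≠ [])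
    (huv : u.length + v.length ≤ m) {r : Word α × Word α}
    (h : (findDecomp D u v).val mem = some r) : r.1.length + r.2.length ≤ m ^ 20 := by
  simp only [findDecomp, val_bind, val_firstL] at h
  obtain ⟨⟨x, y⟩, hc, he⟩ := List.exists_of_findSome?_eq_some h
  obtain ⟨hy, -⟩ := shortestForms_sound hv hc
  have hsm := (small_lasso_form hm hv huv hc).prod (mem := mem)
    (hm.trans (le_pow_self hm le_rfl (show 1 ≤ 10 by norm_num))) hs
  cases hs : (FA.search ((((lassoFA x y).val mem).prod D : Prog α _).val mem) : Prog α _).val mem with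
  | none => dsimp only at he; rw [hs] at he; simp at he
  | some path =>
    dsimp only at he
    rw [hs] at he
    simp only [val_bind, val_mapL, val_pure] at he
    obtain ⟨⟨q, q'⟩, hq, hr⟩ := search_eq_some hs
    rw [mem_prod_acc, val_lasso_acc] at hq
    obtain ⟨hq, hq'⟩ := hq
    obtain rfl : q = Sum.inr y := by simpa using hq
    rw [reach_prod, val_prod] at hr
    dsimp only at hr
    rw [val_lasso_init] at hr
    obtain ⟨i, j, hj, hw⟩ := reach_lasso_sound hy hr.1
    have h1 := (search_length_le ((closed_lasso hy).prod hD) hs).trans hsm.states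
    have h2 := congrArg List.length hw
    rw [length_dollarWord, List.length_map] at h2
    rw [hw, val_splitDollar] at he
    cases he
    rw [← pow_mul, show 10 * 2 = 20 from rfl] at h1
    dsimp only at *
    omega

theorem within_findDecomp {σ : Type} [PEq α σ] [LawfulPEq α σ] {D : FA (Option α) σ} (hm : 2 ≤ m)
    (hD : D.Closed) (hs : D.Small α (m ^ 10)) {u v : Word α} (hv : v ≠ [])
    (huv : u.length + v.length ≤ m) : (findDecomp D u v).Within mem (m ^ 300) := by
  have hm10 : 2 ≤ m ^ 10 := hm.trans (le_pow_self hm le_rfl (by omega))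
  unfold findDecomp
  refine Prog.Within.bind_pow hm (within_shortestForms hm hv huv) (b := 299) ?_
    (by omega) (by omega)
  refine within_firstL_pow hm (a := 1) (b := 290) (le_pow_one ?_) (fun c hc => ?_) (by omega)
  · exact (length_shortestForms hv).trans (by omega)
  obtain ⟨hy, -, hl⟩ := shortestForms_sound hv hc
  have hsl := small_lasso_form hm hv huv hc
  have hsm := hsl.prod (mem := mem) hm10 hs
  rw [← pow_mul] at hsm
  have hm20 : 2 ≤ m ^ 20 := hm.trans (le_pow_self hm le_rfl (by omega))
  refine Prog.Within.bind_pow hm (a := 40) (b := 289) ?_ ?_ (by omega) (by omega)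
  · have h2 : 2 * (u.length + v.length) ≤ m ^ 2 := by nlinarith
    exact (within_lasso (two_le_pow hm (c := 2) (by omega)) (hl.trans h2)).pow_pow hm (by omega)
  refine Prog.Within.bind_pow hm (a := 140) (b := 288) ?_ ?_ (by omega) (by omega)
  · exact (within_prod hm10 hsl hs).pow_pow hm (by omega)
  refine Prog.Within.bind_pow hm (a := 280) (b := 287) ?_ ?_ (by omega) (by omega)
  · exact (within_search hm20 ((closed_lasso hy).prod hD) hsm).pow_pow hm (by omega)
  split
  · exact within_pure _ _
  · rename_i path hp
    have hlen := (search_length_le ((closed_lasso hy).prod hD) hp).trans hsm.states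
    refine Prog.Within.bind_pow hm (within_mapL_pow hm (b := 0) (c := 22) hlen
      (fun _ _ => within_pure _ _) (by omega)) (b := 23) ?_ (by omega) (by omega)
    refine Prog.Within.bind_pow hm (a := 21) (b := 0) ?_ (within_pure _ _) (by omega) (by omega)
    refine (within_splitDollar _).mono (pow_add_pow_le hm (a := 20) (b := 0) ?_ (by simp)
      (by omega) (by omega))
    simpa using hlen

end

/-! ## The Büchi automaton of a family of DFAs -/

section

variable {α : Type} [DecidableEq α] {mem : Word α → Word α → Bool} {m : ℕ}

/-! ### The product automaton belonging to one pair (u, v). -/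

section Component

variable {M A : FA α (Word α)} {u v : Word α}

/-- The product automaton of the under-approximation. -/
def underPart (mem : Word α → Word α → Bool) (M A : FA α (Word α)) (u v : Word α) :
    FA α (List (Word α)) :=
  (productPart .under M A u v).val mem

theorem underPart_init : (underPart mem M A u v).init = [u, A.init, v] := by
  simp [underPart, productPart, val_rename, val_prod, FA.fromTo]

theorem mem_underPart_acc {p : List (Word α)} :
    p ∈ (underPart mem M A u v).acc ↔ p = [u, v, v] := by
  simp [underPart, productPart, val_rename, val_prod, FA.fromTo]

theorem mem_underPart_states {p : List (Word α)} : p ∈ (underPart mem M A u v).states ↔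
    ∃ s₁ ∈ M.states, ∃ s₂ ∈ A.states, ∃ s₃ ∈ A.states, p = [s₁, s₂, s₃] := by
  simp only [underPart, productPart, val_bind, val_rename, val_prod, FA.fromTo, val_pure,
    List.mem_map, List.mem_flatMap, Prod.exists, Prod.mk.injEq]
  constructor
  · rintro ⟨a, b, c, ⟨s₁, h₁, s₂, s₃, ⟨s₂', h₂, s₃', h₃, rfl, rfl⟩, rfl, rfl, rfl⟩, rfl⟩
    exact ⟨_, h₁, _, h₂, _, h₃, rfl⟩
  · rintro ⟨s₁, h₁, s₂, h₂, s₃, h₃, rfl⟩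
    exact ⟨s₁, s₂, s₃, ⟨s₁, h₁, s₂, s₃, ⟨s₂, h₂, s₃, h₃, rfl, rfl⟩, rfl, rfl, rfl⟩, rfl⟩

theorem mem_underPart_trans {p q : List (Word α)} {a : α} :
    (p, a, q) ∈ (underPart mem M A u v).trans ↔ ∃ s₁ s₂ s₃ t₁ t₂ t₃, p = [s₁, s₂, s₃] ∧
      q = [t₁, t₂, t₃] ∧ (s₁, a, t₁) ∈ M.trans ∧ (s₂, a, t₂) ∈ A.trans ∧
      (s₃, a, t₃) ∈ A.trans := by
  have h : (underPart mem M A u v).trans =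
      ((((M.fromTo u u).prod (((A.fromTo A.init v).prod (A.fromTo v v) : Prog α _).val mem) :
        Prog α _).val mem).trans.map fun d =>
          ([d.1.1, d.1.2.1, d.1.2.2], d.2.1, [d.2.2.1, d.2.2.2.1, d.2.2.2.2])) := by
    simp [underPart, productPart, val_rename]
  rw [h, List.mem_map]
  constructor
  · rintro ⟨⟨s, b, t⟩, hd, he⟩
    obtain ⟨rfl, rfl, rfl⟩ : _ = p ∧ b = a ∧ _ = q := by simpa using he
    rw [mem_prod_trans, mem_prod_trans] at hd
    exact ⟨_, _, _, _, _, _, rfl, rfl, hd.1, hd.2.1, hd.2.2⟩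
  · rintro ⟨s₁, s₂, s₃, t₁, t₂, t₃, rfl, rfl, h1, h2, h3⟩
    exact ⟨((s₁, s₂, s₃), a, (t₁, t₂, t₃)),
      mem_prod_trans.2 ⟨h1, mem_prod_trans.2 ⟨h2, h3⟩⟩, rfl⟩

end Component

variable {F : FDFA α}

theorem buildBA_init : ((buildBA .under F).val mem).init = Sum.inl F.lead.init := by
  simp [buildBA, val_rename]

theorem mem_buildBA_acc {s : BName α} : s ∈ ((buildBA .under F).val mem).acc ↔
    ∃ e ∈ F.progress, ∃ v ∈ e.2.acc, s = Sum.inr ((e.1, v), none) := by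
  simp only [buildBA, val_bind, val_bindL, val_mapL, val_pure, val_app, List.flatMap_assoc,
    List.mem_flatMap, List.mem_map, val_rename, val_loop_acc]
  constructor
  · rintro ⟨e, he, c, ⟨v, hv, rfl⟩, hs⟩
    exact ⟨e, he, v, hv, by simpa using hs⟩
  · rintro ⟨e, he, v, hv, rfl⟩
    exact ⟨e, he, _, ⟨v, hv, rfl⟩, by simp⟩

theorem mem_buildBA_states {s : BName α} : s ∈ ((buildBA .under F).val mem).states ↔
    (∃ p ∈ F.lead.states, s = Sum.inl p) ∨ ∃ e ∈ F.progress, ∃ v ∈ e.2.acc, ∃ x,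
      (x = none ∨ ∃ p ∈ (underPart mem F.lead e.2 e.1 v).states, x = some p) ∧
      s = Sum.inr ((e.1, v), x) := by
  simp only [buildBA, val_bind, val_bindL, val_mapL, val_pure, val_app, List.flatMap_assoc,
    List.mem_append, List.mem_flatMap, List.mem_map, val_rename, val_loop_states]
  refine or_congr ?_ ?_
  · simp [eq_comm]
  · constructor
    · rintro ⟨e, he, c, ⟨v, hv, rfl⟩, hs⟩
      obtain ⟨x, hx, rfl⟩ := List.mem_map.1 hs
      refine ⟨e, he, v, hv, x, ?_, rfl⟩
      simpa [underPart, eq_comm] using hx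
    · rintro ⟨e, he, v, hv, x, hx, rfl⟩
      refine ⟨e, he, _, ⟨v, hv, rfl⟩, List.mem_map.2 ⟨x, ?_, rfl⟩⟩
      simpa [underPart, eq_comm] using hx

/-- The move from the leading automaton into a component already consumes the first letter of a word
of the product: it is a copy of a transition leaving the component's initial state, not an `ε`-move.
-/
theorem mem_buildBA_trans {s t : BName α} {a : α} :
    (s, a, t) ∈ ((buildBA .under F).val mem).trans ↔
      (∃ p q, (p, a, q) ∈ F.lead.trans ∧ s = Sum.inl p ∧ t = Sum.inl q) ∨
      ∃ e ∈ F.progress, ∃ v ∈ e.2.acc, ∃ x y,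
        (x, a, y) ∈ ((underPart mem F.lead e.2 e.1 v).loop.val mem).trans ∧
        t = Sum.inr ((e.1, v), y) ∧ (s = Sum.inr ((e.1, v), x) ∨
          s = Sum.inl e.1 ∧ x = some (underPart mem F.lead e.2 e.1 v).init) := by
  simp only [buildBA, val_bind, val_bindL, val_mapL, val_pure, val_app, List.flatMap_assoc,
    List.mem_append, List.mem_flatMap, List.mem_map, val_rename, val_ite, val_peq]
  refine or_congr ?_ ?_
  · constructor
    · rintro ⟨⟨p, b, q⟩, h, he⟩
      obtain ⟨rfl, rfl, rfl⟩ : _ = s ∧ b = a ∧ _ = t := by simpa using he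
      exact ⟨p, q, h, rfl, rfl⟩
    · rintro ⟨p, q, h, rfl, rfl⟩
      exact ⟨_, h, rfl⟩
  · constructor
    · rintro ⟨e, he, c, ⟨v, hv, rfl⟩, hs | ⟨d, hd, hs⟩⟩
      · obtain ⟨⟨x, b, y⟩, h, he'⟩ := List.mem_map.1 hs
        obtain ⟨rfl, rfl, rfl⟩ : _ = s ∧ b = a ∧ _ = t := by simpa using he'
        exact ⟨e, he, v, hv, x, y, h, rfl, .inl rfl⟩
      · obtain ⟨⟨x, b, y⟩, h, rfl⟩ := List.mem_map.1 hd
        simp only [val_loop_init, decide_eq_true_eq, Sum.inr.injEq, Prod.mk.injEq, true_and] at hs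
        split_ifs at hs with hx
        · obtain ⟨rfl, rfl, rfl⟩ : s = _ ∧ a = b ∧ t = _ := by simpa using hs
          exact ⟨e, he, v, hv, x, y, h, rfl, .inr ⟨rfl, hx⟩⟩
        · simp at hs
    · rintro ⟨e, he, v, hv, x, y, h, rfl, rfl | ⟨rfl, rfl⟩⟩
      · exact ⟨e, he, _, ⟨v, hv, rfl⟩, .inl (List.mem_map.2 ⟨(x, a, y), h, rfl⟩)⟩
      · refine ⟨e, he, _, ⟨v, hv, rfl⟩, .inr ⟨_, List.mem_map.2 ⟨_, h, rfl⟩, ?_⟩⟩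
        rw [val_loop_init, if_pos (by simp [underPart])]
        simp

/-! ### Accepted words have accepted decompositions -/

variable {δ : Word α → α → Word α} {δ' : Word α → Word α → α → Word α}

/-- A transition of the component of `(u, v)`: it reads a letter in all three automata. -/
theorem FDFA.IsFamily.loop_trans (h : F.IsFamily δ δ') {e : Word α × FA α (Word α)}
    (he : e ∈ F.progress) {v : Word α} {x y : Option (List (Word α))} {a : α}
    (hxy : (x, a, y) ∈ ((underPart mem F.lead e.2 e.1 v).loop.val mem).trans) :
    ∃ s₁ s₂ s₃, (x = some [s₁, s₂, s₃] ∨ x = none ∧ s₁ = e.1 ∧ s₂ = [] ∧ s₃ = v) ∧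
      (y = some [δ s₁ a, δ' e.1 s₂ a, δ' e.1 s₃ a] ∨
        y = none ∧ δ s₁ a = e.1 ∧ δ' e.1 s₂ a = v ∧ δ' e.1 s₃ a = v) := by
  obtain ⟨p, q, hpq, hx, hy⟩ := mem_loop_trans.1 hxy
  obtain ⟨s₁, s₂, s₃, t₁, t₂, t₃, rfl, rfl, h1, h2, h3⟩ := mem_underPart_trans.1 hpq
  obtain ⟨-, rfl⟩ := (h.lead.trans _ _ _).1 h1
  obtain ⟨-, rfl⟩ := ((h.progress e he).trans _ _ _).1 h2
  obtain ⟨-, rfl⟩ := ((h.progress e he).trans _ _ _).1 h3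
  refine ⟨s₁, s₂, s₃, hx.imp id fun hx => ?_, hy.imp id fun hy => ?_⟩
  · have := hx.2
    rw [underPart_init, h.progress_init e he] at this
    simpa [hx.1] using this
  · have := mem_underPart_acc.1 hy.2
    simpa [hy.1] using this

/-- The first factor of the product goes on running the leading automaton inside a component, and
the fresh state is entered only when that factor is back in `u`. So the leading state of the whole
prefix can be read off at any time. -/
theorem lead_of_run (h : F.IsFamily δ δ') {w : Stream' α} {ρ : ℕ → BName α}
    (h0 : ρ 0 = ((buildBA .under F).val mem).init)
    (ht : ∀ i, (ρ i, w.get i, ρ (i + 1)) ∈ ((buildBA .under F).val mem).trans) (n : ℕ) :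
    ρ n = Sum.inl ((w.take n).foldl δ []) ∨ ∃ u v x, ρ n = Sum.inr ((u, v), x) ∧
      (x = none → (w.take n).foldl δ [] = u) ∧
      ∀ p, x = some p → ∃ s₂ s₃, p = [(w.take n).foldl δ [], s₂, s₃] := by
  induction n with
  | zero => left; rw [h0, buildBA_init, h.lead_init]; rfl
  | succ n ih =>
    rw [foldl_take_succ]
    generalize (w.take n).foldl δ [] = c at ih
    obtain ⟨p, q, hpq, hs, ht⟩ | ⟨e, he, v, hv, x, y, hxy, ht, hs⟩ := mem_buildBA_trans.1 (ht n)
    · obtain ⟨-, rfl⟩ := (h.lead.trans _ _ _).1 hpq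
      obtain ih | ⟨u, v, x, hx, -⟩ := ih
      · obtain rfl : p = c := by rw [ih] at hs; simpa using hs.symm
        exact .inl ht
      · rw [hx] at hs; cases hs
    · obtain ⟨s₁, s₂, s₃, hx, hy⟩ := h.loop_trans he hxy
      -- The source may be a tuple inside the component, its fresh state, or the leading state from
      -- which the component is entered; in all three cases its first coordinate is the current
      -- leading state.
      obtain rfl : s₁ = c := by
        obtain hs | ⟨hs, rfl⟩ := hs
        · obtain ih | ⟨u, v', x', hx', h1, h2⟩ := ih
          · rw [ih] at hs; cases hs
          · rw [hx'] at hs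
            obtain ⟨⟨rfl, rfl⟩, rfl⟩ : (u = e.1 ∧ v' = v) ∧ x' = x := by simpa using hs
            obtain rfl | ⟨rfl, rfl, -⟩ := hx
            · obtain ⟨s₂', s₃', hp⟩ := h2 _ rfl
              simp only [List.cons.injEq] at hp
              exact hp.1
            · exact (h1 rfl).symm
        · obtain ih | ⟨u, v', x', hx', -⟩ := ih
          · rw [ih] at hs
            obtain rfl : c = e.1 := by simpa using hs
            rw [underPart_init, h.progress_init e he] at hx
            simp only [Option.some.injEq, List.cons.injEq, reduceCtorEq, false_and,
              or_false] at hx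
            exact hx.1.symm
          · rw [hx'] at hs; cases hs
      refine .inr ⟨e.1, v, y, ht, ?_, ?_⟩
      · rintro rfl
        simpa using hy.imp (fun h => h) fun h => h.2.1
      · rintro p rfl
        obtain hy | ⟨hy, -⟩ := hy
        · exact ⟨_, _, by simpa using hy⟩
        · cases hy

/-- This is why the product has two copies of the progress automaton. Until the first return to the
fresh state, the copy started in the initial state follows the whole segment. At each return the
segment has led to `v`, so from there the copy started in `v` follows it. Hence one of the two
copies always shows the state reached by the whole segment. -/
theorem progress_of_run (h : F.IsFamily δ δ') {w : Stream' α} {ρ : ℕ → BName α}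
    (ht : ∀ i, (ρ i, w.get i, ρ (i + 1)) ∈ ((buildBA .under F).val mem).trans)
    {u v : Word α} {p : ℕ} (hp : ρ p = Sum.inr ((u, v), none)) (n : ℕ) :
    ∃ x, ρ (p + n) = Sum.inr ((u, v), x) ∧
      (x = none → n = 0 ∨ (((w.drop p).take n).foldl δ u = u ∧
        ((w.drop p).take n).foldl (δ' u) [] = v)) ∧
      ∀ l, x = some l → ∃ s₂ s₃, l = [((w.drop p).take n).foldl δ u, s₂, s₃] ∧
        (s₂ = ((w.drop p).take n).foldl (δ' u) [] ∨
          s₃ = ((w.drop p).take n).foldl (δ' u) []) := by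
  induction n with
  | zero => exact ⟨none, hp, fun _ => .inl rfl, by simp⟩
  | succ n ih =>
    rw [foldl_take_succ, foldl_take_succ, Stream'.get_drop]
    have hc0 : n = 0 → ((w.drop p).take n).foldl δ u = u ∧
        ((w.drop p).take n).foldl (δ' u) [] = [] := by
      rintro rfl; exact ⟨rfl, rfl⟩
    generalize ((w.drop p).take n).foldl δ u = c at ih hc0
    generalize ((w.drop p).take n).foldl (δ' u) [] = d at ih hc0
    obtain ⟨x', hx', h1, h2⟩ := ih
    have htn := ht (p + n)
    rw [hx'] at htn
    obtain ⟨p', q, -, hs, -⟩ | ⟨e, he, v', hv, x, y, hxy, ht', hs | ⟨hs, -⟩⟩ :=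
      mem_buildBA_trans.1 htn
    · cases hs
    · obtain ⟨⟨rfl, rfl⟩, rfl⟩ : (u = e.1 ∧ v = v') ∧ x' = x := by simpa using hs
      obtain ⟨s₁, s₂, s₃, hx, hy⟩ := h.loop_trans he hxy
      -- At the fresh state the right copy is the one starting in `[]` if nothing has been read
      -- since `p`, and the one starting in `v` otherwise.
      have hsrc : s₁ = c ∧ (s₂ = d ∨ s₃ = d) := by
        obtain rfl | ⟨rfl, rfl, rfl, rfl⟩ := hx
        · obtain ⟨s₂', s₃', hp, hor⟩ := h2 _ rfl
          obtain ⟨rfl, rfl, rfl⟩ : s₁ = c ∧ s₂ = s₂' ∧ s₃ = s₃' := by simpa using hp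
          exact ⟨rfl, hor⟩
        · obtain hn | ⟨rfl, rfl⟩ := h1 rfl
          · obtain ⟨rfl, rfl⟩ := hc0 hn
            exact ⟨rfl, .inl rfl⟩
          · exact ⟨rfl, .inr rfl⟩
      obtain ⟨rfl, hd⟩ := hsrc
      refine ⟨y, ht', ?_, ?_⟩
      · rintro rfl
        obtain hy | ⟨-, h3, h4, h5⟩ := hy
        · cases hy
        · exact .inr ⟨h3, by obtain rfl | rfl := hd <;> assumption⟩
      · rintro l rfl
        obtain hy | ⟨hy, -⟩ := hy
        · exact ⟨_, _, by simpa using hy, hd.imp (fun h => by rw [h]) fun h => by rw [h]⟩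
        · cases hy
    · cases hs

/-- If `uv^ω` is accepted by the Büchi automaton of the family, some decomposition that is found
through the shortest forms is accepted by the family. -/
theorem exists_accepted_decomp (h : F.IsFamily δ δ') {u₀ v₀ : Word α} (hv₀ : v₀ ≠ [])
    (hw : u₀ ++ₛ Stream'.cycle v₀ hv₀ ∈ ((buildBA .under F).val mem).omegaLang) :
    ∃ x y i j A, (x, y) ∈ (shortestForms u₀ v₀).val mem ∧ 0 < j ∧
      (wpow y j).foldl δ ((x ++ wpow y i).foldl δ []) = (x ++ wpow y i).foldl δ [] ∧
      ((x ++ wpow y i).foldl δ [], A) ∈ F.progress ∧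
      (wpow y j).foldl (δ' ((x ++ wpow y i).foldl δ [])) [] ∈ A.acc := by
  obtain ⟨x, y, hy, he, hforms⟩ := shortestForms_complete (mem := mem) (u := u₀) hv₀
  rw [he] at hw
  set w := x ++ₛ Stream'.cycle y hy with hwdef
  obtain ⟨ρ, h0, -, ht, s, hs, hf⟩ := hw
  obtain ⟨e, hep, v, hv, rfl⟩ := mem_buildBA_acc.1 hs
  have hy0 := List.length_pos_of_ne_nil hy
  have hinf : {p | x.length ≤ p ∧ ρ p = Sum.inr ((e.1, v), none)}.Infinite := by
    refine Nat.frequently_atTop_iff_infinite.1 ?_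
    exact (hf.and_eventually (Filter.eventually_ge_atTop x.length)).mono fun p hp => ⟨hp.2, hp.1⟩
  -- Infinitely many visits to the fresh state fall into finitely many phases of the period. Two
  -- visits at the same phase enclose a whole number of periods.
  obtain ⟨p, ⟨hpx, hp⟩, q, ⟨hqx, hq⟩, hpq, hmod⟩ :
      ∃ p, (x.length ≤ p ∧ ρ p = Sum.inr ((e.1, v), none)) ∧
        ∃ q, (x.length ≤ q ∧ ρ q = Sum.inr ((e.1, v), none)) ∧ p < q ∧
          (p - x.length) % y.length = (q - x.length) % y.length := by
    obtain ⟨p, hp, q, hq, hne, hmod⟩ := hinf.exists_ne_map_eq_of_mapsTo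
      (f := fun p => (p - x.length) % y.length) (t := Set.Iio y.length)
      (fun p _ => Nat.mod_lt _ hy0) (Set.finite_Iio _)
    obtain hlt | hlt := lt_or_gt_of_ne hne
    · exact ⟨p, hp, q, hq, hlt, hmod⟩
    · exact ⟨q, hq, p, hp, hlt, hmod.symm⟩
  obtain ⟨i, r, hr, hpi⟩ : ∃ i r, r < y.length ∧ p = x.length + i * y.length + r := by
    refine ⟨(p - x.length) / y.length, (p - x.length) % y.length, Nat.mod_lt _ hy0, ?_⟩
    have := Nat.div_add_mod' (p - x.length) y.length
    omega
  obtain ⟨j, hj, hqj⟩ : ∃ j, 0 < j ∧ q = p + j * y.length := by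
    obtain ⟨j, hj⟩ : y.length ∣ (q - x.length) - (p - x.length) :=
      (Nat.modEq_iff_dvd' (by omega)).1 hmod
    refine ⟨j, Nat.pos_of_ne_zero ?_, ?_⟩
    · rintro rfl; rw [mul_zero] at hj; omega
    · rw [mul_comm] at hj; omega
  -- The period is cut at the phase of the two visits; after the first visit the word is periodic
  -- with the rotated period `y₂ ++ y₁`.
  obtain ⟨y₁, y₂, rfl, hy₁⟩ : ∃ y₁ y₂, y = y₁ ++ y₂ ∧ y₁.length = r :=
    ⟨y.take r, y.drop r, (List.take_append_drop r y).symm, by simp; omega⟩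
  have hy₂ : y₂ ≠ [] := by rintro rfl; simp at hr; omega
  have hy₂₁ : y₂ ++ y₁ ≠ [] := by simp [hy₂]
  obtain ⟨x', i', hform, hx'⟩ := hforms y₁ y₂ rfl hy₂
  have hxx : x ++ wpow (y₁ ++ y₂) i ++ y₁ = x' ++ wpow (y₂ ++ y₁) (i' + i) := by
    rw [List.append_assoc, wpow_rotate, ← List.append_assoc, hx', List.append_assoc, ← wpow_add]
  have hsplit : w.take p = x ++ wpow (y₁ ++ y₂) i ++ y₁ ∧
      w.drop p = Stream'.cycle (y₂ ++ y₁) hy₂₁ := by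
    refine eq_of_append_stream_eq ?_ ?_
    · rw [Stream'.append_take_drop, Stream'.append_append_stream, append_cycle_rotate hy hy₂₁,
        Stream'.append_append_stream, wpow_append_cycle]
    · rw [Stream'.length_take, hpi]; simp [hy₁, add_assoc]
  -- Both sides begin the same periodic word and have the same length.
  have hseg : (w.drop p).take (q - p) = wpow (y₂ ++ y₁) j := by
    refine (eq_of_append_stream_eq (s := (w.drop p).drop (q - p))
      (s' := Stream'.cycle (y₂ ++ y₁) hy₂₁) ?_ ?_).1
    · rw [Stream'.append_take_drop, wpow_append_cycle, hsplit.2]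
    · rw [Stream'.length_take, hqj]; simp [add_comm]
  have hlead : (x' ++ wpow (y₂ ++ y₁) (i' + i)).foldl δ [] = e.1 := by
    rw [← hxx, ← hsplit.1]
    obtain hl | ⟨u, v', z, hz, h1, -⟩ := lead_of_run h h0 ht p
    · rw [hp] at hl; cases hl
    · rw [hp] at hz
      obtain ⟨⟨rfl, rfl⟩, rfl⟩ : (e.1 = u ∧ v = v') ∧ none = z := by simpa using hz
      exact h1 rfl
  obtain ⟨z, hz, h1, -⟩ := progress_of_run h ht hp (q - p)
  rw [Nat.add_sub_cancel' hpq.le, hq] at hz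
  obtain rfl : none = z := by simpa using hz
  obtain ⟨h1, h2⟩ := (h1 rfl).resolve_left (by omega)
  rw [hseg] at h1 h2
  exact ⟨x', y₂ ++ y₁, i' + i, j, e.2, hform, hj, by rw [hlead, h1], by rw [hlead]; exact hep,
    by rw [hlead, h2]; exact hv⟩

/-! ### Words all of whose decompositions are accepted -/

/-- With `f` the state reached by `z`, the hypotheses put `z` itself into the language of the
product for `f`: the leading automaton loops, one copy goes from the initial state to `f`, and the
other from `f` to `f`. So a run can pass through the fresh state after every period; it is written
down explicitly. -/
theorem mem_buildBA_of_decomp (h : F.IsFamily δ δ') {u z : Word α} (hz : z ≠ [])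
    {A : FA α (Word α)} (hA : (u.foldl δ [], A) ∈ F.progress)
    (hlead : z.foldl δ (u.foldl δ []) = u.foldl δ [])
    (hacc : z.foldl (δ' (u.foldl δ [])) [] ∈ A.acc)
    (hloop : z.foldl (δ' (u.foldl δ [])) (z.foldl (δ' (u.foldl δ [])) []) =
      z.foldl (δ' (u.foldl δ [])) []) :
    u ++ₛ Stream'.cycle z hz ∈ ((buildBA .under F).val mem).omegaLang := by
  set c := u.foldl δ [] with hc
  set f := z.foldl (δ' c) [] with hf
  have hl := List.length_pos_of_ne_nil hz
  have hnil : [] ∈ F.lead.states := h.lead_init ▸ h.lead.init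
  have hcs : c ∈ F.lead.states := h.lead.foldl_mem hnil u
  have hAnil : [] ∈ A.states := h.progress_init _ hA ▸ (h.progress _ hA).init
  have hfs : f ∈ A.states := h.acc _ hA f hacc
  let P := underPart mem F.lead A c f
  let pt : ℕ → List (Word α) := fun r =>
    [(z.take r).foldl δ c, (z.take r).foldl (δ' c) [], (z.take r).foldl (δ' c) f]
  -- Phase zero is represented by the fresh state, which makes the run accepting, instead of the
  -- tuple of the initial states.
  let st : ℕ → Option (List (Word α)) := fun r => if r = 0 then none else some (pt r)
  let ρ : ℕ → BName α := fun n =>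
    if n ≤ u.length then Sum.inl ((u.take n).foldl δ [])
    else Sum.inr ((c, f), st ((n - u.length) % z.length))
  have hpt0 : pt 0 = P.init := by
    have := h.progress_init _ hA
    dsimp only at this
    simp [pt, P, underPart_init, this]
  have hptz : pt z.length ∈ P.acc := by
    rw [mem_underPart_acc]
    simp [pt, hlead, ← hf, hloop]
  have hstep : ∀ r (hr : r < z.length), (pt r, z[r], pt (r + 1)) ∈ P.trans := by
    intro r hr
    refine mem_underPart_trans.2 ⟨_, _, _, _, _, _, rfl, rfl, ?_, ?_, ?_⟩
    · exact (h.lead.trans _ _ _).2 ⟨h.lead.foldl_mem hcs _, foldl_list_take_succ _ _ hr⟩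
    · exact ((h.progress _ hA).trans _ _ _).2
        ⟨(h.progress _ hA).foldl_mem hAnil _, foldl_list_take_succ _ _ hr⟩
    · exact ((h.progress _ hA).trans _ _ _).2
        ⟨(h.progress _ hA).foldl_mem hfs _, foldl_list_take_succ _ _ hr⟩
  -- The condition on `x` covers a tuple inside the component, the fresh state standing for the
  -- initial tuple, and the initial tuple itself, which serves for the entry.
  have hloopstep : ∀ r (hr : r < z.length) x, (x = some (pt r) ∨ x = none ∧ pt r = P.init) →
      (x, z[r], st ((r + 1) % z.length)) ∈ (P.loop.val mem).trans := by
    intro r hr x hx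
    refine mem_loop_trans.2 ⟨pt r, pt (r + 1), hstep r hr, hx, ?_⟩
    by_cases hr' : r + 1 = z.length
    · right
      rw [hr']
      exact ⟨by simp [st], hptz⟩
    · left
      rw [Nat.mod_eq_of_lt (by omega)]
      simp [st]
  refine ⟨ρ, ?_, fun n => ?_, fun n => ?_, Sum.inr ((c, f), none), ?_, ?_⟩
  · simp [ρ, buildBA_init, h.lead_init]
  · by_cases hn : n ≤ u.length
    · simp only [ρ, if_pos hn]
      exact mem_buildBA_states.2 (.inl ⟨_, h.lead.foldl_mem hnil _, rfl⟩)
    · simp only [ρ, if_neg hn]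
      refine mem_buildBA_states.2 (.inr ⟨_, hA, f, hacc, _, ?_, rfl⟩)
      simp only [st]
      split_ifs
      · exact .inl rfl
      · refine .inr ⟨_, mem_underPart_states.2 ⟨_, h.lead.foldl_mem hcs _, _,
          (h.progress _ hA).foldl_mem hAnil _, _, (h.progress _ hA).foldl_mem hfs _, rfl⟩, rfl⟩
  · rw [get_append_stream]
    split_ifs with hn
    · simp only [ρ, if_pos hn.le, if_pos (Nat.succ_le_of_lt hn)]
      refine mem_buildBA_trans.2 (.inl ⟨_, _, ?_, rfl, rfl⟩)
      exact (h.lead.trans _ _ _).2 ⟨h.lead.foldl_mem hnil _, foldl_list_take_succ _ _ hn⟩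
    · rw [get_cycle hz]
      have hr := Nat.mod_lt (n - u.length) hl
      have hsucc : (n + 1 - u.length) % z.length =
          ((n - u.length) % z.length + 1) % z.length := by
        rw [Nat.mod_add_mod]; congr 1; omega
      have hρ : ρ (n + 1) = Sum.inr ((c, f), st (((n - u.length) % z.length + 1) % z.length)) := by
        simp only [ρ, if_neg (show ¬ n + 1 ≤ u.length by omega), hsucc]
      rw [hρ]
      -- At position `u.length` the run is still in the leading automaton, so the first letter of
      -- the first period is read by an entry transition; later periods start from the fresh state.
      by_cases hn' : n = u.length
      · have h0 : (n - u.length) % z.length = 0 := by simp [hn']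
        refine mem_buildBA_trans.2 (.inr ⟨_, hA, f, hacc, some P.init, _, ?_, rfl, .inr ⟨?_, rfl⟩⟩)
        · refine hloopstep _ hr _ (.inl ?_)
          rw [h0, hpt0]
        · simp [ρ, hn', ← hc]
      · refine mem_buildBA_trans.2 (.inr ⟨_, hA, f, hacc, st ((n - u.length) % z.length), _,
          hloopstep _ hr _ ?_, rfl, .inl ?_⟩)
        · by_cases h0 : (n - u.length) % z.length = 0
          · rw [h0]; exact .inr ⟨rfl, hpt0⟩
          · left; simp only [st, if_neg h0]
        · simp only [ρ, if_neg (show ¬ n ≤ u.length by omega)]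
  · exact mem_buildBA_acc.2 ⟨_, hA, f, hacc, rfl⟩
  · refine Filter.frequently_atTop.2 fun N => ⟨u.length + (N + 1) * z.length, ?_, ?_⟩
    · nlinarith
    · have h1 : ¬ u.length + (N + 1) * z.length ≤ u.length := by
        have : 0 < (N + 1) * z.length := by positivity
        omega
      simp only [ρ, if_neg h1, Nat.add_sub_cancel_left, Nat.mul_mod_left, st, if_true]

/-- If all decompositions of `xy^ω` that lead back to the same state are accepted by the family,
then `xy^ω` is accepted by its Büchi automaton. -/
theorem mem_buildBA_of_forall (h : F.IsFamily δ δ') {x y : Word α} (hy : y ≠ [])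
    (hall : ∀ i j A, 0 < j →
      (wpow y j).foldl δ ((x ++ wpow y i).foldl δ []) = (x ++ wpow y i).foldl δ [] →
      ((x ++ wpow y i).foldl δ [], A) ∈ F.progress →
      (wpow y j).foldl (δ' ((x ++ wpow y i).foldl δ [])) [] ∈ A.acc) :
    x ++ₛ Stream'.cycle y hy ∈ ((buildBA .under F).val mem).omegaLang := by
  have hnil : [] ∈ F.lead.states := h.lead_init ▸ h.lead.init
  -- The leading states after `x`, `xy`, `xyy`, … repeat eventually: from the state after `xy^i`,
  -- reading `y^d` leads back.
  obtain ⟨i, d, hd, hi⟩ := exists_iterate_add (S := F.lead.states)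
    (g := fun s => y.foldl δ s) (s := x.foldl δ []) fun n => by
      rw [← foldl_wpow, ← List.foldl_append]; exact h.lead.foldl_mem hnil _
  have hc : (x ++ wpow y i).foldl δ [] = (fun s => y.foldl δ s)^[i] (x.foldl δ []) := by
    rw [List.foldl_append, foldl_wpow]
  have hcd : (wpow y d).foldl δ ((x ++ wpow y i).foldl δ []) = (x ++ wpow y i).foldl δ [] := by
    rw [foldl_wpow, hc, ← Function.iterate_add_apply, add_comm, hi]
  have hcdm : ∀ n, (wpow y (d * n)).foldl δ ((x ++ wpow y i).foldl δ []) =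
      (x ++ wpow y i).foldl δ [] := by
    intro n
    rw [wpow_mul, foldl_wpow]
    exact Function.iterate_fixed hcd n
  obtain ⟨A, hA⟩ := h.exists_progress (h.lead.foldl_mem hnil (x ++ wpow y i))
  have hAnil : [] ∈ A.states := h.progress_init _ hA ▸ (h.progress _ hA).init
  set c := (x ++ wpow y i).foldl δ [] with hcdef
  -- The states of the progress automaton after powers of `y^d` have a preperiod `a` and a period
  -- `b`.
  obtain ⟨a, b, hb, hab⟩ := exists_iterate_add (S := A.states)
    (g := fun s => (wpow y d).foldl (δ' c) s) (s := []) fun n => by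
      rw [← foldl_wpow]; exact (h.progress _ hA).foldl_mem hAnil _
  have hper : ∀ n t, a ≤ t → (fun s => (wpow y d).foldl (δ' c) s)^[t + b * n] [] =
      (fun s => (wpow y d).foldl (δ' c) s)^[t] [] := by
    intro n
    induction n with
    | zero => intro t _; rfl
    | succ n ih =>
      intro t ht
      have h1 := ih (t + b) (by omega)
      rw [show t + b * (n + 1) = t + b + b * n by ring, h1]
      obtain ⟨t, rfl⟩ := Nat.exists_eq_add_of_le' ht
      rw [add_assoc, Function.iterate_add_apply, hab, ← Function.iterate_add_apply]
  -- `b * (a + 1)` is a multiple of the period that is not below the preperiod. Iterating that often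
  -- leads to a state that is left unchanged by iterating as often again, which is the idempotence
  -- needed.
  have hm : a ≤ b * (a + 1) := by nlinarith
  have hpos : 0 < d * (b * (a + 1)) := by positivity
  have hz := wpow_ne_nil hy hpos
  rw [← lasso_wpow hy i hz]
  have hfold : ∀ s, (wpow y (d * (b * (a + 1)))).foldl (δ' c) s =
      (fun s => (wpow y d).foldl (δ' c) s)^[b * (a + 1)] s := by
    intro s; rw [wpow_mul, foldl_wpow]
  refine mem_buildBA_of_decomp h hz hA (hcdm _) (hall i _ A hpos (hcdm _) hA) ?_
  rw [← hcdef, hfold, hfold, ← Function.iterate_add_apply]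
  exact hper (a + 1) (b * (a + 1)) hm

end

/-! ## The canonical congruences of an ω-regular language have finite index -/

section

variable {α σ : Type}

/-- There is an accepting run on the ω-word that starts in `q`. -/
def FA.AcceptsFrom (A : FA α σ) (q : σ) (w : Stream' α) : Prop :=
  ∃ ρ : ℕ → σ, ρ 0 = q ∧ (∀ i, (ρ i, w.get i, ρ (i + 1)) ∈ A.trans) ∧
    ∃ᶠ i in Filter.atTop, ρ i ∈ A.acc

/-- There is a run on the word that visits an accepting state after its first letter. -/
def FA.ReachAcc (A : FA α σ) : σ → Word α → σ → Prop
  | _, [], _ => False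
  | s, a :: w, t => ∃ q, (s, a, q) ∈ A.trans ∧ ((q ∈ A.acc ∧ A.Reach q w t) ∨ A.ReachAcc q w t)

open Classical in
/-- The automaton without the transitions whose ends are not listed as states. -/
noncomputable def FA.trim (A : FA α σ) : FA α σ :=
  { A with trans := A.trans.filter fun d => d.1 ∈ A.states ∧ d.2.2 ∈ A.states }

/-- If each of the finitely many entries occurred only finitely often, the list as a whole would be
avoided from some point on. -/
theorem frequently_mem_list {ρ : ℕ → σ} {l : List σ} :
    (∃ᶠ i in Filter.atTop, ρ i ∈ l) ↔ ∃ q ∈ l, ∃ᶠ i in Filter.atTop, ρ i = q := by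
  constructor
  · intro h
    by_contra hne
    push Not at hne
    have := (Filter.eventually_all_finite l.finite_toSet (p := fun q i => ρ i ≠ q)
      (l := Filter.atTop)).2 fun q hq => by simpa using hne q hq
    exact h (this.mono fun i hi hm => hi _ hm rfl)
  · rintro ⟨q, hq, h⟩
    exact h.mono fun i hi => hi ▸ hq

/-- The condition that all states of a run are listed is moved into the transitions. What remains is
local, so runs can be cut and glued. -/
theorem mem_omegaLang_iff {A : FA α σ} {w : Stream' α} :
    w ∈ A.omegaLang ↔ A.trim.AcceptsFrom A.init w := by
  simp only [FA.omegaLang, Set.mem_ofPred_eq, FA.AcceptsFrom, frequently_mem_list, FA.trim,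
    List.mem_filter, decide_eq_true_eq]
  constructor
  · rintro ⟨ρ, h0, hs, ht, hf⟩
    exact ⟨ρ, h0, fun i => ⟨ht i, hs i, hs (i + 1)⟩, hf⟩
  · rintro ⟨ρ, h0, ht, hf⟩
    exact ⟨ρ, h0, fun i => (ht i).2.1, fun i => (ht i).1, hf⟩

variable {A : FA α σ}

theorem frequently_succ {p : ℕ → Prop} :
    (∃ᶠ i in Filter.atTop, p (i + 1)) ↔ ∃ᶠ i in Filter.atTop, p i := by
  rw [← Filter.frequently_map (m := (· + 1)) (P := p), Filter.map_add_atTop_eq_nat]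

theorem acceptsFrom_cons {q : σ} {a : α} {w : Stream' α} :
    A.AcceptsFrom q (Stream'.cons a w) ↔ ∃ p, (q, a, p) ∈ A.trans ∧ A.AcceptsFrom p w := by
  constructor
  · rintro ⟨ρ, rfl, ht, hf⟩
    exact ⟨ρ 1, ht 0, fun i => ρ (i + 1), rfl, fun i => ht (i + 1), frequently_succ.2 hf⟩
  · rintro ⟨p, hp, ρ, rfl, ht, hf⟩
    refine ⟨fun i => Nat.casesOn i q ρ, rfl, fun i => ?_, frequently_succ.1 hf⟩
    cases i with
    | zero => exact hp
    | succ i => exact ht i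

theorem acceptsFrom_append {q : σ} {x : Word α} {w : Stream' α} :
    A.AcceptsFrom q (x ++ₛ w) ↔ ∃ p, A.Reach q x p ∧ A.AcceptsFrom p w := by
  induction x generalizing q with
  | nil => exact ⟨fun h => ⟨q, rfl, h⟩, fun ⟨p, hp, h⟩ => by cases hp; exact h⟩
  | cons a x ih =>
    rw [Stream'.cons_append_stream, acceptsFrom_cons]
    constructor
    · rintro ⟨p, hp, h⟩
      obtain ⟨r, hr, h⟩ := ih.1 h
      exact ⟨r, ⟨p, hp, hr⟩, h⟩
    · rintro ⟨r, ⟨p, hp, hr⟩, h⟩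
      exact ⟨p, hp, ih.2 ⟨r, hr, h⟩⟩

theorem FA.ReachAcc.reach {s t : σ} {w : Word α} (h : A.ReachAcc s w t) : A.Reach s w t := by
  induction w generalizing s with
  | nil => exact h.elim
  | cons a w ih =>
    obtain ⟨q, hq, ⟨-, h⟩ | h⟩ := h
    · exact ⟨q, hq, h⟩
    · exact ⟨q, hq, ih h⟩

/-- The target of each letter counts but the state at the start does not, so every accepting visit
belongs to exactly one of the two factors. -/
theorem reachAcc_append {s t : σ} {w w' : Word α} : A.ReachAcc s (w ++ w') t ↔
    ∃ q, (A.ReachAcc s w q ∧ A.Reach q w' t) ∨ (A.Reach s w q ∧ A.ReachAcc q w' t) := by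
  induction w generalizing s with
  | nil => simp [FA.ReachAcc, FA.Reach]
  | cons a w ih =>
    simp only [List.cons_append, FA.ReachAcc, FA.Reach, ih, FA.reach_append]
    constructor
    · rintro ⟨q, hq, ⟨ha, r, h1, h2⟩ | ⟨r, ⟨h1, h2⟩ | ⟨h1, h2⟩⟩⟩
      · exact ⟨r, .inl ⟨⟨q, hq, .inl ⟨ha, h1⟩⟩, h2⟩⟩
      · exact ⟨r, .inl ⟨⟨q, hq, .inr h1⟩, h2⟩⟩
      · exact ⟨r, .inr ⟨⟨q, hq, h1⟩, h2⟩⟩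
    · rintro ⟨r, ⟨⟨q, hq, ⟨ha, h1⟩ | h1⟩, h2⟩ | ⟨⟨q, hq, h1⟩, h2⟩⟩
      · exact ⟨q, hq, .inl ⟨ha, r, h1, h2⟩⟩
      · exact ⟨q, hq, .inr ⟨r, .inl ⟨h1, h2⟩⟩⟩
      · exact ⟨q, hq, .inr ⟨r, .inr ⟨h1, h2⟩⟩⟩

theorem reach_iff_exists_run {s t : σ} {w : Word α} : A.Reach s w t ↔
    ∃ g : ℕ → σ, g 0 = s ∧ g w.length = t ∧ ∀ i (h : i < w.length), (g i, w[i], g (i + 1)) ∈ A.trans := by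
  induction w generalizing s with
  | nil => exact ⟨fun h => ⟨fun _ => s, rfl, h, by simp⟩, fun ⟨g, h0, h1, _⟩ => h0.symm.trans h1⟩
  | cons a w ih =>
    constructor
    · rintro ⟨q, hq, h⟩
      obtain ⟨g, rfl, h1, h2⟩ := ih.1 h
      refine ⟨fun i => Nat.casesOn i s g, rfl, h1, fun i hi => ?_⟩
      cases i with
      | zero => exact hq
      | succ i => exact h2 i (by simpa using hi)
    · rintro ⟨g, rfl, h1, h2⟩
      exact ⟨g 1, h2 0 (by simp), ih.2 ⟨fun i => g (i + 1), rfl, h1, fun i hi =>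
        h2 (i + 1) (by simpa using hi)⟩⟩

theorem reachAcc_iff_exists_run {s t : σ} {w : Word α} : A.ReachAcc s w t ↔
    ∃ g : ℕ → σ, g 0 = s ∧ g w.length = t ∧
      (∀ i (h : i < w.length), (g i, w[i], g (i + 1)) ∈ A.trans) ∧
      ∃ i < w.length, g (i + 1) ∈ A.acc := by
  induction w generalizing s with
  | nil => simp [FA.ReachAcc]
  | cons a w ih =>
    constructor
    · rintro ⟨q, hq, ⟨ha, h⟩ | h⟩
      · obtain ⟨g, rfl, h1, h2⟩ := reach_iff_exists_run.1 h
        refine ⟨fun i => Nat.casesOn i s g, rfl, h1, fun i hi => ?_, 0, by simp, ha⟩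
        cases i with
        | zero => exact hq
        | succ i => exact h2 i (by simpa using hi)
      · obtain ⟨g, rfl, h1, h2, j, hj, hja⟩ := ih.1 h
        refine ⟨fun i => Nat.casesOn i s g, rfl, h1, fun i hi => ?_, j + 1, by simpa using hj, hja⟩
        cases i with
        | zero => exact hq
        | succ i => exact h2 i (by simpa using hi)
    · rintro ⟨g, rfl, h1, h2, j, hj, hja⟩
      refine ⟨g 1, h2 0 (by simp), ?_⟩
      cases j with
      | zero =>
        exact .inl ⟨hja, reach_iff_exists_run.2 ⟨fun i => g (i + 1), rfl, h1, fun i hi =>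
          h2 (i + 1) (by simpa using hi)⟩⟩
      | succ j =>
        exact .inr (ih.2 ⟨fun i => g (i + 1), rfl, h1, fun i hi =>
          h2 (i + 1) (by simpa using hi), j, by simpa using hj, hja⟩)

/-- Acceptance of a periodic word in terms of the states at the ends of the periods. -/
theorem acceptsFrom_cycle {q : σ} {z : Word α} (hz : z ≠ []) :
    A.AcceptsFrom q (Stream'.cycle z hz) ↔ ∃ s : ℕ → σ, s 0 = q ∧
      (∀ i, A.Reach (s i) z (s (i + 1))) ∧
      ∃ᶠ i in Filter.atTop, A.ReachAcc (s i) z (s (i + 1)) := by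
  have hl := List.length_pos_of_ne_nil hz
  constructor
  · rintro ⟨ρ, rfl, ht, hf⟩
    have hstep : ∀ k i (hi : i < z.length),
        (ρ (k * z.length + i), z[i], ρ (k * z.length + (i + 1))) ∈ A.trans := by
      intro k i hi
      have := ht (k * z.length + i)
      rw [get_cycle hz] at this
      have hm : (k * z.length + i) % z.length = i := by
        rw [Nat.add_comm, Nat.add_mul_mod_self_right, Nat.mod_eq_of_lt hi]
      simp only [hm] at this
      exact this
    have hend : ∀ k, ρ (k * z.length + z.length) = ρ ((k + 1) * z.length) := by
      intro k; rw [Nat.succ_mul]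
    refine ⟨fun i => ρ (i * z.length), by simp, fun k => ?_, ?_⟩
    · exact reach_iff_exists_run.2 ⟨fun i => ρ (k * z.length + i), rfl, hend k, hstep k⟩
    · refine Filter.frequently_atTop.2 fun N => ?_
      -- The state at position `n ≥ 1` is the target of the letter at position `n - 1` and therefore
      -- counts for the period with number `(n - 1) / z.length`.
      obtain ⟨n, hn, hacc⟩ := Filter.frequently_atTop.1 hf (N * z.length + 1)
      refine ⟨(n - 1) / z.length, (Nat.le_div_iff_mul_le hl).2 (by omega), ?_⟩
      refine reachAcc_iff_exists_run.2 ⟨fun i => ρ ((n - 1) / z.length * z.length + i), rfl,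
        hend _, hstep _, (n - 1) % z.length, Nat.mod_lt _ hl, ?_⟩
      have := Nat.div_add_mod' (n - 1) z.length
      change ρ ((n - 1) / z.length * z.length + ((n - 1) % z.length + 1)) ∈ A.acc
      rwa [← add_assoc, this, Nat.sub_add_cancel (by omega)]
  · rintro ⟨s, rfl, hr, hf⟩
    -- For each period a run between the prescribed end states is chosen, one with an accepting
    -- visit whenever there is any.
    have hg : ∀ i, ∃ g : ℕ → σ, g 0 = s i ∧ g z.length = s (i + 1) ∧
        (∀ j (h : j < z.length), (g j, z[j], g (j + 1)) ∈ A.trans) ∧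
        (A.ReachAcc (s i) z (s (i + 1)) → ∃ j < z.length, g (j + 1) ∈ A.acc) := by
      intro i
      by_cases h : A.ReachAcc (s i) z (s (i + 1))
      · obtain ⟨g, h1, h2, h3, h4⟩ := reachAcc_iff_exists_run.1 h
        exact ⟨g, h1, h2, h3, fun _ => h4⟩
      · obtain ⟨g, h1, h2, h3⟩ := reach_iff_exists_run.1 (hr i)
        exact ⟨g, h1, h2, h3, fun h' => absurd h' h⟩
    choose g h1 h2 h3 h4 using hg
    -- The case `j = z.length` says that the end of one chosen run is the beginning of the next, so
    -- the glued run is well defined at the seams.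
    have hρ : ∀ i j, j ≤ z.length →
        g ((i * z.length + j) / z.length) ((i * z.length + j) % z.length) = g i j := by
      intro i j hj
      obtain hj | rfl := lt_or_eq_of_le hj
      · rw [Nat.add_comm, Nat.add_mul_mod_self_right, Nat.mod_eq_of_lt hj,
          Nat.add_mul_div_right _ _ hl, Nat.div_eq_of_lt hj, Nat.zero_add]
      · rw [← Nat.succ_mul, Nat.mul_div_cancel _ hl, Nat.mul_mod_left, h1, h2]
    refine ⟨fun n => g (n / z.length) (n % z.length), by simp [h1], fun n => ?_, ?_⟩
    · have hlt := Nat.mod_lt n hl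
      have hn := Nat.div_add_mod' n z.length
      have hs : g ((n + 1) / z.length) ((n + 1) % z.length) =
          g (n / z.length) (n % z.length + 1) := by
        rw [← hρ (n / z.length) (n % z.length + 1) hlt, ← add_assoc, hn]
      change (g (n / z.length) (n % z.length), _, g ((n + 1) / z.length) ((n + 1) % z.length)) ∈ _
      rw [hs, get_cycle hz]
      exact h3 _ _ hlt
    · refine Filter.frequently_atTop.2 fun N => ?_
      obtain ⟨i, hi, ha⟩ := Filter.frequently_atTop.1 hf N
      obtain ⟨j, hj, hja⟩ := h4 i ha
      refine ⟨i * z.length + (j + 1), ?_, ?_⟩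
      · nlinarith
      · change g ((i * z.length + (j + 1)) / z.length) ((i * z.length + (j + 1)) % z.length) ∈ A.acc
        rwa [hρ i (j + 1) hj]

/-- The initial state and the targets of transitions. -/
def FA.targets (A : FA α σ) : Set σ := {q | q = A.init ∨ ∃ d ∈ A.trans, d.2.2 = q}

theorem FA.targets_finite (A : FA α σ) : Finite A.targets := by
  have : A.targets = {q | q ∈ A.init :: A.trans.map fun d => d.2.2} := by
    ext q; simp [FA.targets]
  rw [this]
  exact List.finite_toSet _

theorem FA.Reach.mem_targets {s t : σ} {w : Word α} (h : A.Reach s w t) (hs : s ∈ A.targets) :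
    t ∈ A.targets := by
  induction w generalizing s with
  | nil => cases h; exact hs
  | cons a w ih =>
    obtain ⟨q, hq, h⟩ := h
    exact ih h (.inr ⟨_, hq, rfl⟩)

/-- A profile that determines the class is injective on representatives of the classes. -/
theorem index_le_of_profile {β γ : Type} [Finite γ] (r : Setoid β) (f : β → γ)
    (h : ∀ x y, f x = f y → r.r x y) :
    Finite (Quotient r) ∧ Nat.card (Quotient r) ≤ Nat.card γ := by
  have hinj : Function.Injective fun q : Quotient r => f q.out := by
    intro p q hpq
    rw [← p.out_eq, ← q.out_eq]
    exact Quotient.sound (h _ _ hpq)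
  exact ⟨Finite.of_injective _ hinj, Nat.card_le_card_of_injective _ hinj⟩

variable {L : Set (Stream' α)}

/-- The continuation sees only the set of states reachable on the prefix, and there are finitely
many such sets. -/
theorem finite_leadCongr (hL : IsOmegaRegular L) : Finite (Quotient (leadCongr L)) := by
  obtain ⟨σ, A, rfl⟩ := hL
  have := A.trim.targets_finite
  refine (index_le_of_profile (leadCongr A.omegaLang)
    (fun x => {q : A.trim.targets | A.trim.Reach A.init x q}) fun x y h w => ?_).1
  have key : ∀ x y : Word α, {q : A.trim.targets | A.trim.Reach A.init x q} =
      {q : A.trim.targets | A.trim.Reach A.init y q} →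
      x ++ₛ w ∈ A.omegaLang → y ++ₛ w ∈ A.omegaLang := by
    intro x y h
    rw [mem_omegaLang_iff, mem_omegaLang_iff, acceptsFrom_append, acceptsFrom_append]
    rintro ⟨p, hp, hacc⟩
    have hpt := hp.mem_targets (.inl rfl)
    exact ⟨p, (Set.ext_iff.1 h ⟨p, hpt⟩).1 hp, hacc⟩
  exact ⟨key x y h, key y x h.symm⟩

/-- The profile of `x` consists of the pairs of states that it connects and of those that it
connects through an accepting state; replacing `x` by a word of the same profile in every period
preserves acceptance. The component `x = []` is needed because an empty period never counts as a
member. The profiles do not mention `u`, so the bound is uniform; without it the supremum in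
`progressIndex` would be meaningless. -/
theorem finite_periodicCongr (hL : IsOmegaRegular L) : ∃ k, ∀ u,
    Finite (Quotient (periodicCongr L u)) ∧ Nat.card (Quotient (periodicCongr L u)) ≤ k := by
  obtain ⟨σ, A, rfl⟩ := hL
  have := A.trim.targets_finite
  let V := A.trim.targets
  let f : Word α → Prop × Set (V × V) × Set (V × V) := fun x =>
    (x = [], {p | A.trim.Reach p.1 x p.2}, {p | A.trim.ReachAcc p.1 x p.2})
  refine ⟨Nat.card (Prop × Set (V × V) × Set (V × V)), fun u =>
    index_le_of_profile (periodicCongr A.omegaLang u) f fun x y h v => ?_⟩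
  have key : ∀ x y : Word α, f x = f y → UPMem A.omegaLang u (x ++ v) →
      UPMem A.omegaLang u (y ++ v) := by
    rintro x y h ⟨hne, hmem⟩
    obtain ⟨h0, h1, h2⟩ : (x = []) = (y = []) ∧ _ = _ ∧ _ = _ := by simpa only [f, Prod.mk.injEq] using h
    have hne' : y ++ v ≠ [] := by
      intro he
      obtain ⟨hy, rfl⟩ := List.append_eq_nil_iff.1 he
      rw [← h0] at hy
      exact hne (by simp [hy])
    refine ⟨hne', ?_⟩
    rw [mem_omegaLang_iff, acceptsFrom_append] at hmem ⊢
    obtain ⟨q, hq, hacc⟩ := hmem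
    refine ⟨q, hq, ?_⟩
    rw [acceptsFrom_cycle] at hacc ⊢
    obtain ⟨s, rfl, hr, hf⟩ := hacc
    have hs : ∀ i, s i ∈ A.trim.targets := by
      intro i
      induction i with
      | zero => exact hq.mem_targets (.inl rfl)
      | succ i ih => exact (hr i).mem_targets ih
    have hR : ∀ p ∈ V, ∀ q, A.trim.Reach p x q → A.trim.Reach p y q := fun p hp q h =>
      (Set.ext_iff.1 h1 (⟨p, hp⟩, ⟨q, h.mem_targets hp⟩)).1 h
    have hRA : ∀ p ∈ V, ∀ q, A.trim.ReachAcc p x q → A.trim.ReachAcc p y q := fun p hp q h =>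
      (Set.ext_iff.1 h2 (⟨p, hp⟩, ⟨q, h.reach.mem_targets hp⟩)).1 h
    refine ⟨s, rfl, fun i => ?_, hf.mono fun i hi => ?_⟩
    · obtain ⟨t, h3, h4⟩ := FA.reach_append.1 (hr i)
      exact (hR _ (hs i) _ h3).append h4
    · obtain ⟨t, ⟨h3, h4⟩ | ⟨h3, h4⟩⟩ := reachAcc_append.1 hi
      · exact reachAcc_append.2 ⟨t, .inl ⟨hRA _ (hs i) _ h3, h4⟩⟩
      · exact reachAcc_append.2 ⟨t, .inr ⟨hR _ (hs i) _ h3, h4⟩⟩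
  exact ⟨key x y h, key y x h.symm⟩

theorem length_le_card_quotient {β : Type} (r : Setoid β) [Finite (Quotient r)] {l : List β}
    (hl : l.Nodup) (h : ∀ s ∈ l, ∀ t ∈ l, r.r s t → s = t) : l.length ≤ Nat.card (Quotient r) := by
  have hn : (l.map (Quotient.mk r)).Nodup :=
    List.Nodup.map_on (fun s hs t ht he => h s hs t ht (Quotient.exact he)) hl
  have := Fintype.ofFinite (Quotient r)
  rw [Nat.card_eq_fintype_card, ← List.length_map (f := Quotient.mk r)]
  exact hn.length_le_card

theorem card_periodic_le (hL : IsOmegaRegular L) (u : Word α) :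
    Nat.card (Quotient (periodicCongr L u)) ≤ progressIndex L := by
  obtain ⟨k, hk⟩ := finite_periodicCongr hL
  exact le_ciSup (f := fun u => Nat.card (Quotient (periodicCongr L u)))
    ⟨k, by rintro _ ⟨u, rfl⟩; exact (hk u).2⟩ u

theorem length_le_leadIndex (hL : IsOmegaRegular L) {l : List (Word α)} (hl : l.Nodup)
    (h : ∀ s ∈ l, ∀ t ∈ l, (leadCongr L).r s t → s = t) : l.length ≤ leadIndex L := by
  have := finite_leadCongr hL
  exact length_le_card_quotient _ hl h

/-- Words that are told apart by a function with at most `n` values on a list together with the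
periodic congruence. -/
theorem length_le_mul_progressIndex (hL : IsOmegaRegular L) (u : Word α) {β : Type} {l : List (Word α)}
    (hl : l.Nodup) (f : Word α → β) {k : List β} (hf : ∀ s ∈ l, f s ∈ k)
    (h : ∀ s ∈ l, ∀ t ∈ l, f s = f t → (periodicCongr L u).r s t → s = t) :
    l.length ≤ k.length * progressIndex L := by
  classical
  obtain ⟨b, hb⟩ := finite_periodicCongr hL
  have := (hb u).1
  have := Fintype.ofFinite (Quotient (periodicCongr L u))
  let g : Word α → β × Quotient (periodicCongr L u) := fun s => (f s, Quotient.mk _ s)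
  have hn : (l.map g).Nodup := List.Nodup.map_on (fun s hs t ht he =>
    h s hs t ht (Prod.mk.inj he).1 (Quotient.exact (Prod.mk.inj he).2)) hl
  have hsub : (l.map g).toFinset ⊆ k.toFinset ×ˢ Finset.univ := by
    intro p hp
    obtain ⟨s, hs, rfl⟩ := List.mem_map.1 (List.mem_toFinset.1 hp)
    simpa using hf s hs
  have := Finset.card_le_card hsub
  rw [List.toFinset_card_of_nodup hn, List.length_map, Finset.card_product, Finset.card_univ,
    ← Nat.card_eq_fintype_card] at this
  exact this.trans (Nat.mul_le_mul (List.toFinset_card_le _) (card_periodic_le hL u))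

end

/-! ## The cost of the Büchi automaton of a family of DFAs -/

section

variable {α : Type} [DecidableEq α] {mem : Word α → Word α → Bool} {m : ℕ}

theorem small_underPart (hm : 2 ≤ m) {M A : FA α (Word α)} {u v : Word α} (hM : M.Small α m)
    (hA : A.Small α m) (hu : psize α u ≤ m) (hv : psize α v ≤ m) :
    (underPart mem M A u v).Small α (m ^ 6) := by
  have hm2 : m ≤ m ^ 2 := le_pow_self hm le_rfl (by omega)
  have hN := (hA.fromTo (by omega) hA.size_init hv).prod (mem := mem) hm
    (hA.fromTo (by omega) hv hv)
  have hP := ((hM.fromTo (by omega) hu hu).mono hm2).prod (mem := mem) (hm.trans hm2) hN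
  rw [← pow_mul] at hP
  have := hP.rename (mem := mem) (f := fun s : Word α × Word α × Word α =>
    (pure [s.1, s.2.1, s.2.2] : Prog α _)) (m' := m ^ 6)
    (Nat.pow_le_pow_right (by omega) (by omega)) fun s hs => ?_
  · simpa only [underPart, productPart, val_bind] using this
  · rw [psize_prod, psize_prod] at hs
    have h4 : 4 ≤ m ^ 2 := by nlinarith
    have : psize α s.1 + (psize α s.2.1 + psize α s.2.2) + 4 ≤ m ^ 6 :=
      pow_add_pow_le hm hs h4 (by omega) (by omega)
    simp only [val_pure, psize_list, List.map_cons, List.map_nil, List.sum_cons, List.sum_nil]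
    simp only [psize_list] at this
    omega

theorem within_underPart (hm : 2 ≤ m) {M A : FA α (Word α)} {u v : Word α} (hM : M.Small α m)
    (hA : A.Small α m) (hu : psize α u ≤ m) (hv : psize α v ≤ m) :
    (productPart .under M A u v).Within mem (m ^ 50) := by
  have hm2 : m ≤ m ^ 2 := le_pow_self hm le_rfl (by omega)
  have hN := (hA.fromTo (by omega) hA.size_init hv).prod (mem := mem) hm
    (hA.fromTo (by omega) hv hv)
  have hM' := (hM.fromTo (by omega) hu hu).mono hm2
  have hP := hM'.prod (mem := mem) (hm.trans hm2) hN
  rw [← pow_mul] at hP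
  unfold productPart
  refine Prog.Within.bind_pow hm (a := 14) (b := 49) ?_ ?_ (by omega) (by omega)
  · exact within_prod hm (hA.fromTo (by omega) hA.size_init hv) (hA.fromTo (by omega) hv hv)
  refine Prog.Within.bind_pow hm (a := 28) (b := 40) ?_ ?_ (by omega) (by omega)
  · exact (within_prod (hm.trans hm2) hM' hN).pow_pow hm (by omega)
  · exact (within_rename (two_le_pow hm (by omega)) hP fun _ => within_pure _ _).pow_pow hm
      (by omega)

/-- The component of the Büchi automaton for the pair `(u, v)`. -/
def baPart (mem : Word α → Word α → Bool) (M A : FA α (Word α)) (u v : Word α) : BA α :=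
  (((underPart mem M A u v).loop.val mem).rename fun s =>
    (pure (Sum.inr ((u, v), s)) : Prog α (BName α))).val mem

theorem small_baPart (hm : 2 ≤ m) {M A : FA α (Word α)} {u v : Word α} (hM : M.Small α m)
    (hA : A.Small α m) (hu : psize α u ≤ m) (hv : psize α v ≤ m) :
    (baPart mem M A u v).Small α (m ^ 20) := by
  have h := (small_underPart (mem := mem) hm hM hA hu hv).loop (mem := mem)
    (two_le_pow hm (by omega))
  rw [← pow_mul] at h
  refine h.rename (Nat.pow_le_pow_right (by omega) (by omega)) fun s hs => ?_
  rw [val_pure, psize_inr, psize_prod, psize_prod]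
  exact pow_add_pow_le hm (a := 2) (pow_add_pow_le hm (le_pow_one hu) (le_pow_one hv)
    (by omega) (by omega)) hs (by omega) (by omega)

theorem within_buildBA (hm : 2 ≤ m) {F : FDFA α} (h : F.Small m) :
    (buildBA .under F).Within mem (m ^ 250) := by
  unfold buildBA
  have hpart : ∀ e ∈ F.progress, ∀ v ∈ e.2.acc, (do
      let P ← productPart .under F.lead e.2 e.1 v
      let C ← P.loop
      let C' ← C.rename fun s => pure (Sum.inr ((e.1, v), s))
      pure (e.1, C') : Prog α (Word α × BA α)).Within mem (m ^ 190) := by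
    intro e he v hv
    have hv := (h.progress e he).size_acc v hv
    have hP := small_underPart (mem := mem) hm h.lead (h.progress e he) (h.key e he) hv
    have hL := hP.loop (mem := mem) (two_le_pow hm (by omega))
    rw [← pow_mul] at hL
    refine Prog.Within.bind_pow hm (within_underPart hm h.lead (h.progress e he) (h.key e he) hv)
      (b := 189) ?_ (by omega) (by omega)
    refine Prog.Within.bind_pow hm (a := 114) (b := 188) ?_ ?_ (by omega) (by omega)
    · exact (within_loop (two_le_pow hm (by omega)) hP).pow_pow hm (by omega)
    refine Prog.Within.bind_pow hm (a := 180) (b := 0) ?_ (within_pure _ _) (by omega) (by omega)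
    exact (within_rename (two_le_pow hm (by omega)) hL fun _ => within_pure _ _).pow_pow hm
      (by omega)
  refine Prog.Within.bind_pow hm (a := 200) (b := 249) ?_ ?_ (by omega) (by omega)
  · refine within_bindL_pow hm (b := 193) (le_pow_one h.length) (fun e he => ?_) (fun e he => ?_)
      (by omega)
    · exact within_mapL_pow hm (le_pow_one (h.progress e he).acc) (hpart e he) (by omega)
    · simpa using le_pow_self hm (h.progress e he).acc (by omega)
  set parts := (bindL (fun e : Word α × FA α (Word α) => mapL (fun v => do
      let P ← productPart .under F.lead e.2 e.1 v
      let C ← P.loop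
      let C' ← C.rename fun s => pure (Sum.inr ((e.1, v), s))
      pure (e.1, C')) e.2.acc) F.progress : Prog α (List (Word α × BA α))).val mem with hparts
  have hpe : parts = F.progress.flatMap fun e => e.2.acc.map fun v =>
      (e.1, baPart mem F.lead e.2 e.1 v) := by
    rw [hparts]; simp [baPart, underPart]
  have hlen : parts.length ≤ m ^ 2 := by
    rw [hpe]
    refine length_flatMap_pow hm (le_pow_one h.length) (fun e he => ?_) (show 1 + 1 ≤ 2 by omega)
    simpa using (h.progress e he).acc
  have hsm : ∀ c ∈ parts, c.2.Small α (m ^ 20) := by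
    intro c hc
    rw [hpe] at hc
    obtain ⟨e, he, hc⟩ := List.mem_flatMap.1 hc
    obtain ⟨v, hv, rfl⟩ := List.mem_map.1 hc
    exact small_baPart hm h.lead (h.progress e he) (h.key e he) ((h.progress e he).size_acc v hv)
  clear_value parts
  refine Prog.Within.bind_pow hm (a := 10) (b := 248) ?_ ?_ (by omega) (by omega)
  · exact within_rename hm h.lead fun _ => within_pure _ _
  refine Prog.Within.bind_pow hm (a := 30) (b := 247) ?_ ?_ (by omega) (by omega)
  · exact within_bindL_pow hm (b := 20) hlen (fun _ _ => within_pure _ _)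
      (fun c hc => (hsm c hc).states) (by omega)
  refine Prog.Within.bind_pow hm (a := 2) (b := 246) ?_ ?_ (by omega) (by omega)
  · refine within_app_pow hm (a := 1) ?_ (by omega)
    simpa [val_rename] using h.lead.states
  refine Prog.Within.bind_pow hm (a := 30) (b := 245) ?_ ?_ (by omega) (by omega)
  · exact within_bindL_pow hm (b := 20) hlen (fun _ _ => within_pure _ _)
      (fun c hc => (hsm c hc).acc) (by omega)
  refine Prog.Within.bind_pow hm (a := 70) (b := 5) ?_ ?_ (by omega) (by omega)
  · have hentry : ∀ c ∈ parts, ((bindL (fun d => do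
        if ← peq d.1 c.2.init then pure [(Sum.inl c.1, d.2.1, d.2.2)] else pure []) c.2.trans :
          Prog α (List (BName α × α × BName α))).val mem).length ≤ m ^ 20 := by
      intro c hc
      simp only [val_bindL, val_bind, val_ite, val_pure]
      refine length_flatMap_pow hm (b := 0) (hsm c hc).trans (fun d _ => ?_) (by omega)
      split_ifs <;> simp
    refine within_bindL_pow hm (b := 62) hlen (fun c hc => ?_) (fun c hc => ?_) (by omega)
    · refine Prog.Within.bind_pow hm (a := 50) (b := 21) ?_ ?_ (by omega) (by omega)
      · refine within_bindL_pow hm (b := 21) (hsm c hc).trans (fun d hd => ?_) (fun d hd => ?_)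
          (by omega)
        · exact Prog.Within.bind_pow hm (a := 20) (b := 0) ((within_peq _ _).mono
            ((hsm c hc).size_source d hd))
            (Prog.Within.ite (fun _ => within_pure _ _) fun _ => within_pure _ _)
            (by omega) (by omega)
        · rw [val_bind, val_ite]
          split_ifs <;> simp [one_le_pow' hm]
      · exact within_app_pow hm (hsm c hc).trans (by omega)
    · rw [val_bind, val_app, List.length_append]
      exact pow_add_pow_le hm (hsm c hc).trans (hentry c hc) (by omega) (by omega)
  refine Prog.Within.bind_pow hm (a := 2) (b := 0) ?_ (within_pure _ _) (by omega) (by omega)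
  refine within_app_pow hm (a := 1) ?_ (by omega)
  simpa [val_rename] using h.lead.trans

end

/-! ## Classification trees and observation tables -/

section

variable {α E : Type} [DecidableEq α] {mem : Word α → Word α → Bool} {m : ℕ}
  {te : Word α → E → Prog α (Label α)}

/-- The size of a label, as far as equality tests are concerned. -/
def Label.size : Label α → ℕ
  | .truth _ => 0
  | .mark q _ => psize α q

open Classical in
@[simp] theorem val_eqLabel (c d : Label α) : (eqLabel c d).val mem = decide (c = d) := by
  cases c <;> cases d <;> simp [eqLabel]
  · rename_i b c; cases b <;> cases c <;> rfl
  · rename_i q k q' k'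
    by_cases h : q = q' <;> cases k <;> cases k' <;> simp [h]

theorem within_eqLabel (c d : Label α) : (eqLabel c d).Within mem c.size := by
  cases c <;> cases d
  · exact within_pure _ _
  · exact within_pure _ _
  · exact within_pure _ _
  · rename_i q k q' k'
    refine (within_peq q q').bind (d := 0) (Prog.Within.ite (fun _ => ?_) fun _ => within_pure _ _)
    cases k <;> cases k' <;> exact within_pure _ _

open Classical in
@[simp] theorem val_eqRow (c d : List (Label α)) : (eqRow c d).val mem = decide (c = d) := by
  rw [Bool.eq_iff_iff, decide_eq_true_eq]
  induction c generalizing d with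
  | nil => cases d <;> simp [eqRow]
  | cons a l ih =>
    cases d with
    | nil => simp [eqRow]
    | cons b d => by_cases h : a = b <;> simp [eqRow, ih, h]

theorem within_eqRow {c d : List (Label α)} {k : ℕ} (h : ∀ a ∈ c, a.size ≤ k) :
    (eqRow c d).Within mem ((k + 1) * c.length + 1) := by
  induction c generalizing d with
  | nil => cases d <;> exact trivial
  | cons a l ih =>
    cases d with
    | nil => exact (within_pure _ 0).tick.mono (by omega)
    | cons b d =>
      have : (eqRow (a :: l) (b :: d)).Within mem (k + ((k + 1) * l.length + 1) + 1) :=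
        (((within_eqLabel a b).mono (h a (by simp))).bind (Prog.Within.ite
          (fun _ => ih fun c hc => h c (by simp [hc])) fun _ => within_pure _ _)).tick
      refine this.mono ?_
      simp only [List.length_cons]; ring_nf; omega

namespace CTree

/-- The states at the terminal nodes, from left to right. -/
def leafList : CTree α E → List (Word α)
  | .absent => []
  | .leaf s => [s]
  | .branch _ _ t r => t.leafList ++ r.leafList

/-- The experiments of the tree. -/
def exps : CTree α E → List E
  | .absent => []
  | .leaf _ => []
  | .branch e _ t r => e :: (t.exps ++ r.exps)

/-- The number of constructors. -/
def size : CTree α E → ℕ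
  | .absent => 1
  | .leaf _ => 1
  | .branch _ _ t r => t.size + r.size + 1

/-- Edges lead to subtrees that are there. -/
def Proper : CTree α E → Prop
  | .absent => True
  | .leaf _ => True
  | .branch _ _ t r => t ≠ .absent ∧ t.Proper ∧ r.Proper

@[simp] theorem val_leaves (t : CTree α E) : t.leaves.val mem = t.leafList := by
  induction t <;> simp_all [leaves, leafList]

theorem length_leafList_le (t : CTree α E) : t.leafList.length ≤ t.size := by
  induction t <;> simp_all [leafList, size]
  omega

open Classical in
theorem val_sift_branch (x : Word α) (e : E) (d : Label α) (t r : CTree α E) :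
    ((branch e d t r).sift te x).val mem =
      if (te x e).val mem = d then (t.sift te x).val mem else (r.sift te x).val mem := by
  simp [sift]

theorem mem_of_sift {x q : Word α} {t : CTree α E} (h : (t.sift te x).val mem = some q) :
    q ∈ t.leafList := by
  induction t with
  | absent => simp [sift] at h
  | leaf s => simp [sift] at h; simp [leafList, h]
  | branch e d t r iht ihr =>
    rw [val_sift_branch] at h
    rw [leafList, List.mem_append]
    split_ifs at h
    · exact .inl (iht h)
    · exact .inr (ihr h)

theorem sift_congr {x y : Word α} (h : ∀ e, (te x e).val mem = (te y e).val mem)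
    (t : CTree α E) : (t.sift te x).val mem = (t.sift te y).val mem := by
  induction t with
  | absent => simp [sift]
  | leaf s => simp [sift]
  | branch e d t r iht ihr => rw [val_sift_branch, val_sift_branch, h, iht, ihr]

/-- In a proper tree a walk fails only at the end of a chain of siblings, and exactly there the new
branch is attached. Words that already reach a leaf never get there, so their class does not change.
An `absent` of size 1 becomes a branch of size 3. -/
theorem graft_spec {x : Word α} {t : CTree α E} (ht : t.Proper) (hne : t ≠ .absent)
    (hx : (t.sift te x).val mem = none) :
    ((t.graft te x).val mem).Proper ∧ (t.graft te x).val mem ≠ .absent ∧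
    ((t.graft te x).val mem).size = t.size + 2 ∧
    ((t.graft te x).val mem).leafList.Perm (x :: t.leafList) ∧
    (∀ e ∈ ((t.graft te x).val mem).exps, e ∈ t.exps) ∧
    (((t.graft te x).val mem).sift te x).val mem = some x ∧
    ∀ y q, (t.sift te y).val mem = some q →
      (((t.graft te x).val mem).sift te y).val mem = some q := by
  classical
  induction t with
  | absent => exact absurd rfl hne
  | leaf s => simp [sift] at hx
  | branch e d t r iht ihr =>
    obtain ⟨h1, h2, h3⟩ := ht
    rw [val_sift_branch] at hx
    by_cases hd : (te x e).val mem = d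
    · rw [if_pos hd] at hx
      obtain ⟨i1, i2, i3, i4, i5, i6, i7⟩ := iht h2 h1 hx
      have hg : ((branch e d t r).graft te x).val mem =
          branch e d ((t.graft te x).val mem) r := by simp [graft, hd]
      rw [hg]
      refine ⟨⟨i2, i1, h3⟩, by simp, by simp only [size]; omega, ?_, ?_, ?_, ?_⟩
      · simp only [leafList]; exact i4.append_right _
      · intro e'
        simp only [exps, List.mem_cons, List.mem_append]
        rintro (h | h | h)
        · exact .inl h
        · exact .inr (.inl (i5 _ h))
        · exact .inr (.inr h)
      · rw [val_sift_branch, if_pos hd, i6]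
      · intro y q
        rw [val_sift_branch, val_sift_branch]
        split_ifs
        · exact i7 y q
        · exact id
    · rw [if_neg hd] at hx
      by_cases hr : r = .absent
      · subst hr
        have hg : ((branch e d t absent).graft te x).val mem =
            branch e d t (branch e ((te x e).val mem) (leaf x) absent) := by simp [graft, hd]
        rw [hg]
        refine ⟨⟨h1, h2, by simp, trivial, trivial⟩, by simp, by simp only [size],
          ?_, ?_, ?_, ?_⟩
        · simp only [leafList, List.append_nil]
          exact List.perm_append_singleton _ _
        · intro e'
          simp only [exps, List.mem_cons, List.mem_append]
          tauto
        · rw [val_sift_branch, if_neg hd, val_sift_branch, if_pos rfl]; simp [sift]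
        · intro y q
          rw [val_sift_branch, val_sift_branch]
          split_ifs
          · exact id
          · simp [sift]
      · obtain ⟨i1, i2, i3, i4, i5, i6, i7⟩ := ihr h3 hr hx
        have hg : ((branch e d t r).graft te x).val mem =
            branch e d t ((r.graft te x).val mem) := by
          cases r with
          | absent => exact absurd rfl hr
          | leaf s => simp [graft, hd]
          | branch e' d' t' r' => rw [graft]; simp [hd]
        rw [hg]
        refine ⟨⟨h1, h2, i1⟩, by simp, by simp only [size]; omega, ?_, ?_, ?_, ?_⟩
        · simp only [leafList]
          exact (i4.append_left _).trans List.perm_middle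
        · intro e'
          simp only [exps, List.mem_cons, List.mem_append]
          rintro (h | h | h)
          · exact .inl h
          · exact .inr (.inl h)
          · exact .inr (.inr (i5 _ h))
        · rw [val_sift_branch, if_neg hd, i6]
        · intro y q
          rw [val_sift_branch, val_sift_branch]
          split_ifs
          · exact id
          · exact i7 y q

-- The multiplicity of `q` among the leaves makes the induction over both subtrees work; in the
-- application the leaves are distinct and it is 1. A split leaf of size 1 becomes a tree of size 5.
-- The last clause says that only words assigned to `q` are affected, and that `e` decides about
-- them.
open Classical in
theorem split_spec (q x : Word α) (e : E) (dq dx : Label α) (t : CTree α E) :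
    (t.Proper → ((t.split q x e dq dx).val mem).Proper) ∧
    (t ≠ .absent → (t.split q x e dq dx).val mem ≠ .absent) ∧
    ((t.split q x e dq dx).val mem).size = t.size + 4 * t.leafList.count q ∧
    ((t.split q x e dq dx).val mem).leafList.Perm
      (List.replicate (t.leafList.count q) x ++ t.leafList) ∧
    (∀ e' ∈ ((t.split q x e dq dx).val mem).exps, e' = e ∨ e' ∈ t.exps) ∧
    ∀ y, (((t.split q x e dq dx).val mem).sift te y).val mem =
      if (t.sift te y).val mem = some q then
        if (te y e).val mem = dq then some q else if (te y e).val mem = dx then some x else none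
      else (t.sift te y).val mem := by
  induction t with
  | absent => simp [split, Proper, size, leafList, exps, sift]
  | leaf s =>
    by_cases h : s = q
    · subst h
      simp [split, Proper, size, leafList, exps, sift, List.Perm.swap]
    · simp [split, h, Proper, size, leafList, exps, sift]
  | branch e' d t r iht ihr =>
    obtain ⟨i1, i2, i3, i4, i5, i6⟩ := iht
    obtain ⟨j1, j2, j3, j4, j5, j6⟩ := ihr
    have hg : ((branch e' d t r).split q x e dq dx).val mem =
        branch e' d ((t.split q x e dq dx).val mem) ((r.split q x e dq dx).val mem) := by
      simp [split]
    rw [hg]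
    refine ⟨fun ⟨h1, h2, h3⟩ => ⟨i2 h1, i1 h2, j1 h3⟩, by simp, ?_, ?_, ?_, fun y => ?_⟩
    · simp only [size, leafList, List.count_append]; omega
    · simp only [leafList, List.count_append, List.replicate_add]
      refine (i4.append j4).trans ?_
      simp only [List.append_assoc]
      refine List.Perm.append_left _ ?_
      rw [← List.append_assoc, ← List.append_assoc]
      exact List.perm_append_comm.append_right _
    · intro e₁
      simp only [exps, List.mem_cons, List.mem_append]
      rintro (h | h | h)
      · exact .inr (.inl h)
      · exact (i5 _ h).imp_right fun h => .inr (.inl h)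
      · exact (j5 _ h).imp_right fun h => .inr (.inr h)
    · rw [val_sift_branch, val_sift_branch, i6, j6]
      by_cases hd : (te y e').val mem = d
      · simp only [if_pos hd]
      · simp only [if_neg hd]

/-! ### Costs -/

theorem within_leaves {k : ℕ} {t : CTree α E} (h : t.size ≤ k) :
    t.leaves.Within mem ((k + 2) * t.size) := by
  induction t with
  | absent => exact (within_pure _ 0).tick.mono (by simp [size])
  | leaf s => exact (within_pure _ 0).tick.mono (by simp [size])
  | branch e d t r iht ihr =>
    simp only [size] at h
    have h1 := t.length_leafList_le
    have : (branch e d t r).leaves.Within mem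
        ((k + 2) * t.size + ((k + 2) * r.size + (t.leafList.length + 1)) + 1) := by
      refine ((iht (by omega)).bind ((ihr (by omega)).bind ?_)).tick
      rw [val_leaves]
      exact within_app _ _
    refine this.mono ?_
    simp only [size]; ring_nf; omega

theorem within_sift {x : Word α} {k : ℕ} {t : CTree α E}
    (h : ∀ e ∈ t.exps, (te x e).Within mem k ∧ ((te x e).val mem).size ≤ k) :
    (t.sift te x).Within mem ((2 * k + 1) * t.size) := by
  induction t with
  | absent => exact (within_pure _ 0).tick.mono (by simp [size])
  | leaf s => exact (within_pure _ 0).tick.mono (by simp [size])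
  | branch e d t r iht ihr =>
    simp only [exps, List.mem_cons, List.mem_append] at h
    have he := h e (.inl rfl)
    have : ((branch e d t r).sift te x).Within mem
        (k + (k + ((2 * k + 1) * t.size + (2 * k + 1) * r.size)) + 1) :=
      (he.1.bind (((within_eqLabel _ _).mono he.2).bind (Prog.Within.ite
        (fun _ => (iht fun e' h' => h e' (.inr (.inl h'))).mono (by omega))
        fun _ => (ihr fun e' h' => h e' (.inr (.inr h'))).mono (by omega)))).tick
    refine this.mono ?_
    simp only [size]; ring_nf; omega

theorem within_graft {x : Word α} {k : ℕ} {t : CTree α E}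
    (h : ∀ e ∈ t.exps, (te x e).Within mem k ∧ ((te x e).val mem).size ≤ k) :
    (t.graft te x).Within mem ((2 * k + 1) * t.size) := by
  induction t with
  | absent => exact (within_pure _ 0).tick.mono (by simp [size])
  | leaf s => exact (within_pure _ 0).tick.mono (by simp [size])
  | branch e d t r iht ihr =>
    simp only [exps, List.mem_cons, List.mem_append] at h
    have he := h e (.inl rfl)
    have hr := ihr fun e' h' => h e' (.inr (.inr h'))
    have ht := iht fun e' h' => h e' (.inr (.inl h'))
    have : ((branch e d t r).graft te x).Within mem
        (k + (k + ((2 * k + 1) * t.size + (2 * k + 1) * r.size)) + 1) := by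
      rw [graft]
      refine (he.1.bind (((within_eqLabel _ _).mono he.2).bind (Prog.Within.ite
        (fun _ => ?_) fun _ => ?_))).tick
      · refine ht.bind ?_
        exact within_pure _ _
      · split
        · exact within_pure _ _
        · refine (hr.bind (d := 0) ?_).mono (Nat.le_add_left _ _)
          exact within_pure _ _
    refine this.mono ?_
    simp only [size]; ring_nf; omega

theorem within_split (q x : Word α) (e : E) (dq dx : Label α) {k : ℕ} {t : CTree α E}
    (h : ∀ s ∈ t.leafList, psize α s ≤ k) :
    (t.split q x e dq dx).Within mem ((k + 1) * t.size) := by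
  induction t with
  | absent => exact (within_pure _ 0).tick.mono (by simp [size])
  | leaf s =>
    have hb : ((peq s q : Prog α Bool) >>= fun b => if b = true then
        pure (.branch e dq (.leaf q) (.branch e dx (.leaf x) .absent))
        else pure (.leaf s) : Prog α (CTree α E)).Within mem (k + 0) :=
      ((within_peq s q).mono (h s (by simp [leafList]))).bind
        (Prog.Within.ite (fun _ => within_pure _ _) fun _ => within_pure _ _)
    exact hb.tick.mono (by simp [size])
  | branch e' d t r iht ihr =>
    simp only [leafList, List.mem_append] at h
    have : ((branch e' d t r).split q x e dq dx).Within mem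
        ((k + 1) * t.size + ((k + 1) * r.size + 0) + 1) := by
      refine ((iht fun s hs => h s (.inl hs)).bind ((ihr fun s hs => h s (.inr hs)).bind ?_)).tick
      exact within_pure _ _
    refine this.mono ?_
    simp only [size]; ring_nf; omega

end CTree

end

/-! ## DFA learners -/

section

variable {α E : Type} [DecidableEq α] {mem : Word α → Word α → Bool} {m : ℕ}
  {te : Word α → E → Prog α (Label α)}

namespace Classifier

/-- The states distinguished so far. -/
def stateList : Classifier α E → List (Word α)
  | .tree t => t.leafList
  | .table _ rows => rows.map Prod.fst

/-- The experiments used so far. -/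
def exps : Classifier α E → List E
  | .tree t => t.exps
  | .table columns _ => columns

/-- Trees have no superfluous nodes; tables are filled in with the values of the experiments and
have no more columns than rows. -/
def Shape (mem : Word α → Word α → Bool) (te : Word α → E → Prog α (Label α)) :
    Classifier α E → Prop
  | .tree t => t.Proper ∧ t ≠ .absent ∧ t.size ≤ 4 * t.leafList.length
  | .table columns rows => (∀ r ∈ rows, r.2 = columns.map fun e => (te r.1 e).val mem) ∧
      columns.length ≤ rows.length

/-- The invariant of DFA learners, for experiments of length at most `ℓ`. -/
structure Good (mem : Word α → Word α → Bool) (te : Word α → E → Prog α (Label α))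
    (len : E → ℕ) (ℓ : ℕ) (C : Classifier α E) : Prop where
  shape : C.Shape mem te
  nodup : C.stateList.Nodup
  nil_mem : [] ∈ C.stateList
  prefix_closed : ∀ s ∈ C.stateList, s = [] ∨ ∃ p ∈ C.stateList, ∃ a, s = p ++ [a]
  length_lt : ∀ s ∈ C.stateList, s.length < C.stateList.length
  len_le : ∀ e ∈ C.exps, len e ≤ ℓ
  classify_self : ∀ s ∈ C.stateList, (C.classify te s).val mem = some s

@[simp] theorem val_states (C : Classifier α E) : C.states.val mem = C.stateList := by
  cases C <;> simp [states, stateList]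

open Classical in
theorem val_classify_table (x : Word α) (columns : List E)
    (rows : List (Word α × List (Label α))) :
    ((table columns rows).classify te x).val mem = rows.findSome? fun r =>
      if columns.map (fun e => (te x e).val mem) = r.2 then some r.1 else none := by
  simp [classify, rowOf]

theorem mem_of_classify {C : Classifier α E} {x q : Word α}
    (h : (C.classify te x).val mem = some q) : q ∈ C.stateList := by
  classical
  cases C with
  | tree t => exact CTree.mem_of_sift h
  | table columns rows =>
    rw [val_classify_table] at h
    obtain ⟨r, hr, he⟩ := List.exists_of_findSome?_eq_some h
    split_ifs at he
    cases he
    exact List.mem_map_of_mem hr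

theorem classify_congr {x y : Word α} (h : ∀ e, (te x e).val mem = (te y e).val mem)
    (C : Classifier α E) : (C.classify te x).val mem = (C.classify te y).val mem := by
  classical
  cases C with
  | tree t => exact CTree.sift_congr h t
  | table columns rows => simp only [val_classify_table, h]

variable {len : E → ℕ} {ℓ : ℕ} {C : Classifier α E}

theorem Good.mono (h : C.Good mem te len ℓ) {ℓ' : ℕ} (hℓ : ℓ ≤ ℓ') : C.Good mem te len ℓ' :=
  { h with len_le := fun e he => (h.len_le e he).trans hℓ }

/-- A tree or table sees a word only through experiments, and every state is assigned to itself.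
Read contrapositively, distinct states differ in some experiment, which is the source of all bounds
on numbers of states. -/
theorem Good.eq_of_forall (h : C.Good mem te len ℓ) {s t : Word α} (hs : s ∈ C.stateList)
    (ht : t ∈ C.stateList) (he : ∀ e, (te s e).val mem = (te t e).val mem) : s = t := by
  have := classify_congr he C
  rw [h.classify_self s hs, h.classify_self t ht] at this
  exact Option.some.inj this

theorem good_initial (S : Storage) :
    (initial S : Classifier α E).Good mem te len ℓ := by
  classical
  cases S
  · constructor <;> simp [initial, Shape, stateList, CTree.leafList, CTree.Proper, CTree.size,
      exps, CTree.exps, classify, CTree.sift]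
  · constructor <;> simp [initial, Shape, stateList, exps, val_classify_table]

@[simp] theorem stateList_initial (S : Storage) :
    (initial S : Classifier α E).stateList = [[]] := by
  cases S <;> simp [initial, stateList, CTree.leafList]

/-- In a table, words are told apart by their rows. -/
theorem Good.classify_table {columns : List E} {rows : List (Word α × List (Label α))}
    (h : (table columns rows).Good mem te len ℓ) {x q : Word α} :
    ((table columns rows).classify te x).val mem = some q ↔ q ∈ rows.map Prod.fst ∧
      ∀ e ∈ columns, (te x e).val mem = (te q e).val mem := by
  classical
  have key : ∀ x q, ((table columns rows).classify te x).val mem = some q →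
      q ∈ rows.map Prod.fst ∧ ∀ e ∈ columns, (te x e).val mem = (te q e).val mem := by
    intro x q h'
    rw [val_classify_table] at h'
    obtain ⟨r, hr, he⟩ := List.exists_of_findSome?_eq_some h'
    split_ifs at he with hc
    cases he
    rw [h.shape.1 r hr] at hc
    exact ⟨List.mem_map_of_mem hr, List.map_inj_left.1 hc⟩
  refine ⟨key x q, fun ⟨hq, he⟩ => ?_⟩
  have := h.classify_self q hq
  rw [val_classify_table] at this ⊢
  rw [← this]
  congr 1
  funext r
  rw [List.map_congr_left he]

/-- The invariant is kept when a state is added that extends a state by a letter. -/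
theorem Good.of_perm (h : C.Good mem te len ℓ) {C' : Classifier α E} {p : Word α} {a : α}
    (hp : p ∈ C.stateList) (hx : p ++ [a] ∉ C.stateList) (shape : C'.Shape mem te)
    (hperm : C'.stateList.Perm ((p ++ [a]) :: C.stateList))
    (len_le : ∀ e ∈ C'.exps, len e ≤ ℓ)
    (hself : (C'.classify te (p ++ [a])).val mem = some (p ++ [a]))
    (hold : ∀ s ∈ C.stateList, (C'.classify te s).val mem = some s) : C'.Good mem te len ℓ where
  shape := shape
  nodup := hperm.nodup_iff.2 (List.nodup_cons.2 ⟨hx, h.nodup⟩)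
  nil_mem := hperm.mem_iff.2 (List.mem_cons_of_mem _ h.nil_mem)
  prefix_closed s hs := by
    obtain rfl | hs := List.mem_cons.1 (hperm.mem_iff.1 hs)
    · exact .inr ⟨p, hperm.mem_iff.2 (List.mem_cons_of_mem _ hp), a, rfl⟩
    · exact (h.prefix_closed s hs).imp_right fun ⟨p, hp, a, he⟩ =>
        ⟨p, hperm.mem_iff.2 (List.mem_cons_of_mem _ hp), a, he⟩
  length_lt s hs := by
    rw [hperm.length_eq, List.length_cons]
    obtain rfl | hs := List.mem_cons.1 (hperm.mem_iff.1 hs)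
    -- The new state is one letter longer than `p`, and there is one state more.
    · simpa using h.length_lt p hp
    · exact (h.length_lt s hs).trans (Nat.lt_succ_self _)
  len_le := len_le
  classify_self s hs := by
    obtain rfl | hs := List.mem_cons.1 (hperm.mem_iff.1 hs)
    · exact hself
    · exact hold s hs

/-- A word without a class shares its leaf or row with no state, so adding it leaves the old states
assigned to themselves. In a tree the size grows by 2, within the 4 allowed per leaf. -/
theorem Good.extend (h : C.Good mem te len ℓ) {p : Word α} {a : α} (hp : p ∈ C.stateList)
    (hx : (C.classify te (p ++ [a])).val mem = none) :
    ((C.extend te (p ++ [a])).val mem).Good mem te len ℓ ∧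
      ((C.extend te (p ++ [a])).val mem).stateList.Perm ((p ++ [a]) :: C.stateList) := by
  classical
  have hmem : p ++ [a] ∉ C.stateList := fun hm => by
    rw [h.classify_self _ hm] at hx; cases hx
  cases C with
  | tree t =>
    obtain ⟨h1, h2, h3⟩ := h.shape
    obtain ⟨i1, i2, i3, i4, i5, i6, i7⟩ := CTree.graft_spec h1 h2 hx
    have hv : ((tree t).extend te (p ++ [a])).val mem = tree ((t.graft te (p ++ [a])).val mem) := by
      simp [Classifier.extend]
    rw [hv]
    refine ⟨h.of_perm hp hmem ⟨i1, i2, ?_⟩ i4 (fun e he => h.len_le e (i5 e he)) i6 fun s hs =>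
      i7 s s (h.classify_self s hs), i4⟩
    rw [i3, i4.length_eq, List.length_cons]; omega
  | table columns rows =>
    have hv : ((table columns rows).extend te (p ++ [a])).val mem =
        table columns (rows ++ [(p ++ [a], columns.map fun e => (te (p ++ [a]) e).val mem)]) := by
      simp [Classifier.extend, rowOf]
    have hperm : (table columns (rows ++ [(p ++ [a], columns.map fun e =>
        (te (p ++ [a]) e).val mem)])).stateList.Perm
          ((p ++ [a]) :: (table columns rows).stateList) := by
      simp only [stateList, List.map_append, List.map_cons, List.map_nil]
      exact List.perm_append_singleton _ _
    rw [hv]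
    refine ⟨h.of_perm hp hmem ⟨?_, ?_⟩ hperm h.len_le ?_ fun s hs => ?_, hperm⟩
    · intro r hr
      rw [List.mem_append, List.mem_singleton] at hr
      obtain hr | rfl := hr
      · exact h.shape.1 r hr
      · rfl
    · have := h.shape.2
      rw [List.length_append]; omega
    · rw [val_classify_table] at hx ⊢
      rw [List.findSome?_append, hx]
      simp
    · have := h.classify_self s hs
      rw [val_classify_table] at this ⊢
      rw [List.findSome?_append, this]
      rfl

/-- The word `p ++ [a]` is assigned to `q` although `e` tells them apart. In a tree the leaf of `q`
is split by `e`, which affects no other state. In a table the column `e` makes the row of the new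
state different from that of `q`, and the old columns already distinguish it from all other rows. -/
theorem Good.refineBy (h : C.Good mem te len ℓ) {p q : Word α} {a : α} {e : E}
    (hp : p ∈ C.stateList) (hx : (C.classify te (p ++ [a])).val mem = some q)
    (he : (te q e).val mem ≠ (te (p ++ [a]) e).val mem) (hlen : len e ≤ ℓ) :
    ((C.refineBy te q (p ++ [a]) e ((te q e).val mem) ((te (p ++ [a]) e).val mem)).val mem).Good
        mem te len ℓ ∧
      ((C.refineBy te q (p ++ [a]) e ((te q e).val mem)
        ((te (p ++ [a]) e).val mem)).val mem).stateList.Perm ((p ++ [a]) :: C.stateList) := by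
  classical
  have hq := mem_of_classify hx
  have hmem : p ++ [a] ∉ C.stateList := fun hm => by
    rw [h.classify_self _ hm] at hx; cases hx; exact he rfl
  have hne : ∀ s ∈ C.stateList, s ≠ p ++ [a] := fun s hs h' => hmem (h' ▸ hs)
  cases C with
  | tree t =>
    obtain ⟨h1, h2, h3⟩ := h.shape
    obtain ⟨i1, i2, i3, i4, i5, i6⟩ := CTree.split_spec (te := te) (mem := mem) q (p ++ [a]) e
      ((te q e).val mem) ((te (p ++ [a]) e).val mem) t
    have hc : t.leafList.count q = 1 := List.count_eq_one_of_mem h.nodup hq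
    rw [hc] at i3 i4
    have hv : ((tree t).refineBy te q (p ++ [a]) e ((te q e).val mem)
        ((te (p ++ [a]) e).val mem)).val mem = tree ((t.split q (p ++ [a]) e ((te q e).val mem)
          ((te (p ++ [a]) e).val mem)).val mem) := by
      simp [Classifier.refineBy]
    rw [hv]
    have hx' : (t.sift te (p ++ [a])).val mem = some q := hx
    refine ⟨h.of_perm hp hmem ⟨i1 h1, i2 h2, ?_⟩ i4 (fun e' he' => ?_) ?_ fun s hs => ?_, i4⟩
    · rw [i3, i4.length_eq]; simp only [List.replicate_one, List.length_append,
        List.length_singleton]; omega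
    · obtain rfl | he' := i5 e' he'
      · exact hlen
      · exact h.len_le e' he'
    · refine (i6 _).trans ?_
      rw [if_pos hx', if_neg he.symm, if_pos rfl]
    · refine (i6 _).trans ?_
      have hs' : (t.sift te s).val mem = some s := h.classify_self s hs
      rw [hs']
      -- The state `q` passes through the new node and takes the edge labeled with its own value;
      -- other states do not meet the new node.
      by_cases hsq : s = q
      · subst hsq; simp
      · rw [if_neg (by simpa using hsq)]
  | table columns rows =>
    have hv : ((table columns rows).refineBy te q (p ++ [a]) e ((te q e).val mem)
        ((te (p ++ [a]) e).val mem)).val mem = table (columns ++ [e])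
          (rows.map (fun r => (r.1, r.2 ++ [(te r.1 e).val mem])) ++
            [(p ++ [a], (columns ++ [e]).map fun e => (te (p ++ [a]) e).val mem)]) := by
      simp [Classifier.refineBy, rowOf]
    rw [hv]
    set C' := table (columns ++ [e])
          (rows.map (fun r => (r.1, r.2 ++ [(te r.1 e).val mem])) ++
            [(p ++ [a], (columns ++ [e]).map fun e => (te (p ++ [a]) e).val mem)]) with hC'
    have hperm : C'.stateList.Perm ((p ++ [a]) :: (table columns rows).stateList) := by
      simp only [hC', stateList, List.map_append, List.map_cons, List.map_nil, List.map_map]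
      exact List.perm_append_singleton _ _
    have hshape : C'.Shape mem te := by
      refine ⟨fun r hr => ?_, ?_⟩
      · rw [List.mem_append, List.mem_singleton, List.mem_map] at hr
        obtain ⟨r, hr, rfl⟩ | rfl := hr
        · simp [h.shape.1 r hr]
        · rfl
      · have := h.shape.2
        simp only [List.length_append, List.length_map, List.length_singleton]; omega
    have hinj : ∀ s ∈ C'.stateList, ∀ t ∈ C'.stateList,
        (∀ e' ∈ columns ++ [e], (te s e').val mem = (te t e').val mem) → s = t := by
      have hold : ∀ s ∈ (table columns rows).stateList, ∀ t ∈ (table columns rows).stateList,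
          (∀ e' ∈ columns, (te s e').val mem = (te t e').val mem) → s = t := by
        intro s hs t ht hst
        have := h.classify_table.2 ⟨ht, hst⟩
        rw [h.classify_self s hs] at this
        exact Option.some.inj this
      -- A state that agrees with the new word in the old columns must be `q`, and `q` disagrees
      -- with it in the column `e`.
      have hnew : ∀ s ∈ (table columns rows).stateList,
          ¬ ∀ e' ∈ columns ++ [e], (te s e').val mem = (te (p ++ [a]) e').val mem := by
        intro s hs hst
        have h1 := (h.classify_table.1 hx).2
        obtain rfl := hold s hs q hq fun e' he' => (hst e' (by simp [he'])).trans (h1 e' he')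
        exact he (hst e (by simp))
      intro s hs t ht hst
      obtain rfl | hs := List.mem_cons.1 (hperm.mem_iff.1 hs)
      · obtain rfl | ht := List.mem_cons.1 (hperm.mem_iff.1 ht)
        · rfl
        · exact absurd (fun e' he' => (hst e' he').symm) (hnew t ht)
      · obtain rfl | ht := List.mem_cons.1 (hperm.mem_iff.1 ht)
        · exact absurd hst (hnew s hs)
        · exact hold s hs t ht fun e' he' => hst e' (by simp [he'])
    have hself : ∀ s ∈ C'.stateList, (C'.classify te s).val mem = some s := by
      intro s hs
      obtain ⟨⟨s, c⟩, hr, rfl⟩ := List.mem_map.1 hs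
      have hrow := hshape.1 _ hr
      dsimp only at hrow hs ⊢
      subst hrow
      have hn : (C'.classify te s).val mem ≠ none := by
        rw [hC', val_classify_table]
        intro hn
        have := List.findSome?_eq_none_iff.1 hn _ hr
        simp at this
      obtain ⟨t, ht⟩ := Option.ne_none_iff_exists'.1 hn
      rw [ht]
      have hts := mem_of_classify ht
      rw [hC', val_classify_table] at ht
      obtain ⟨r, hr', he'⟩ := List.exists_of_findSome?_eq_some ht
      split_ifs at he' with hc
      cases he'
      rw [hshape.1 r hr'] at hc
      exact congrArg some (hinj r.1 hts s hs fun e' h' => (List.map_inj_left.1 hc e' h').symm)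
    refine ⟨h.of_perm hp hmem hshape hperm (fun e' he' => ?_)
      (hself _ (hperm.mem_iff.2 List.mem_cons_self))
      fun s hs => hself s (hperm.mem_iff.2 (List.mem_cons_of_mem _ hs)), hperm⟩
    rw [hC', exps, List.mem_append, List.mem_singleton] at he'
    obtain he' | rfl := he'
    · exact h.len_le e' he'
    · exact hlen

/-! ### The DFA of a learner -/

/-- The transition function of the DFA of a learner. -/
def next (mem : Word α → Word α → Bool) (te : Word α → E → Prog α (Label α))
    (C : Classifier α E) (s : Word α) (a : α) : Word α :=
  ((C.classify te (s ++ [a])).val mem).getD []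

theorem val_toDFA_inl {sig : List α} {x : Word α} (h : (C.toDFA sig te).val mem = Sum.inl x) :
    ∃ p ∈ C.stateList, ∃ a, x = p ++ [a] ∧ (C.classify te x).val mem = none := by
  simp only [toDFA, val_bind, val_states, val_bindL, val_mapL, val_app, val_pure, val_firstL] at h
  split at h
  · rename_i y hy
    obtain ⟨d, hd, he⟩ := List.exists_of_findSome?_eq_some hy
    obtain ⟨p, hp, hd⟩ := List.mem_flatMap.1 hd
    obtain ⟨a, ha, rfl⟩ := List.mem_map.1 hd
    cases h
    dsimp only at he
    split_ifs at he with hn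
    cases he
    exact ⟨p, hp, a, rfl, by simpa using hn⟩
  · simp at h

/-- If no target is missing, the default value in `getD` is never used. The last clause keeps this
information, which makes the automaton a DFA and lets refinement know the class of `s ++ [a]`. -/
theorem val_toDFA_inr {sig : List α} (hsig : ∀ a, a ∈ sig) {A : FA α (Word α)}
    (h : (C.toDFA sig te).val mem = Sum.inr A) :
    A.states = C.stateList ∧ A.init = [] ∧ A.acc = [] ∧
    A.trans.length ≤ C.stateList.length * sig.length ∧
    (∀ s a t, (s, a, t) ∈ A.trans ↔ s ∈ C.stateList ∧ t = C.next mem te s a) ∧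
    ∀ s ∈ C.stateList, ∀ a, (C.classify te (s ++ [a])).val mem = some (C.next mem te s a) := by
  simp only [toDFA, val_bind, val_states, val_bindL, val_mapL, val_app, val_pure, val_firstL] at h
  split at h
  · cases h
  · rename_i hn
    rw [List.findSome?_eq_none_iff] at hn
    simp only [val_bind, val_mapL, val_pure] at h
    cases h
    refine ⟨rfl, rfl, rfl, ?_, fun s a t => ?_, fun s hs a => ?_⟩
    · rw [List.length_map]
      exact length_flatMap_le fun s _ => by simp
    · simp only [List.mem_map, List.mem_flatMap, next]
      constructor
      · rintro ⟨d, ⟨p, hp, b, hb, rfl⟩, he⟩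
        obtain ⟨rfl, rfl, rfl⟩ : p = s ∧ b = a ∧ _ = t := by simpa using he
        exact ⟨hp, rfl⟩
      · rintro ⟨hs, rfl⟩
        exact ⟨_, ⟨s, hs, a, hsig a, rfl⟩, rfl⟩
    · have := hn _ (List.mem_flatMap.2 ⟨s, hs, List.mem_map.2 ⟨a, hsig a, rfl⟩⟩)
      dsimp only at this
      split_ifs at this with h'
      rw [next]
      cases hc : (C.classify te (s ++ [a])).val mem with
      | none => simp [hc] at h'
      | some q => rfl

theorem Good.isDFA (h : C.Good mem te len ℓ) {sig : List α} (hsig : ∀ a, a ∈ sig)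
    {A : FA α (Word α)} (hA : (C.toDFA sig te).val mem = Sum.inr A) :
    A.IsDFA (C.next mem te) := by
  obtain ⟨h1, h2, -, -, h5, h6⟩ := val_toDFA_inr hsig hA
  refine ⟨?_, fun s hs a => ?_, fun s a t => ?_⟩
  · rw [h1, h2]; exact h.nil_mem
  · rw [h1] at hs ⊢
    exact mem_of_classify (h6 s hs a)
  · rw [h1]; exact h5 s a t

/-- Every state is reached by itself. -/
theorem Good.foldl_self (h : C.Good mem te len ℓ) {s : Word α} (hs : s ∈ C.stateList) :
    s.foldl (C.next mem te) [] = s := by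
  induction hn : s.length using Nat.strong_induction_on generalizing s with
  | _ n ih =>
    obtain rfl | ⟨p, hp, a, rfl⟩ := h.prefix_closed s hs
    · rfl
    · rw [List.foldl_append, ih p.length (by simp [← hn]) hp rfl]
      simp [next, h.classify_self _ hs]

/-- States are shorter than their number, by prefix-closedness, so their sizes stay below `2 * m`;
there is one transition for each state and letter. -/
theorem Good.small (h : C.Good mem te len ℓ) {sig : List α} (hsig : ∀ a, a ∈ sig)
    {A : FA α (Word α)} (hA : (C.toDFA sig te).val mem = Sum.inr A) (hm : 2 ≤ m)
    (hC : C.stateList.length ≤ m) (hs : sig.length ≤ m) : A.Small α (m ^ 3) := by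
  obtain ⟨h1, h2, h3, h4, h5, h6⟩ := val_toDFA_inr hsig hA
  have hps : ∀ s ∈ C.stateList, psize α s ≤ m ^ 3 := by
    intro s hs
    have := h.length_lt s hs
    rw [psize_word]
    have : 2 * m ≤ m ^ 3 := pow_mul_pow_le hm (a := 1) (b := 1) (le_pow_one hm) (le_pow_one le_rfl) (by omega)
    omega
  have hl : C.stateList.length ≤ m ^ 3 := le_pow_self hm hC (by omega)
  refine ⟨by rwa [h1], by simp [h3], ?_, by rwa [h1], by simp [h3], ?_, ?_, ?_⟩
  · exact h4.trans (pow_mul_pow_le hm (le_pow_one hC) (le_pow_one hs) (by omega))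
  · rw [h2]; exact hps _ h.nil_mem
  · rintro ⟨s, a, t⟩ ht
    exact hps _ ((h5 s a t).1 ht).1
  · rintro ⟨s, a, t⟩ ht
    obtain ⟨hs, rfl⟩ := (h5 s a t).1 ht
    exact hps _ (mem_of_classify (h6 s hs a))

end Classifier

end

/-! ## The cost of DFA learners -/

section

variable {α E : Type} [DecidableEq α] {mem : Word α → Word α → Bool} {m : ℕ}
  {te : Word α → E → Prog α (Label α)} {len : E → ℕ}

/-- The values of the experiment function on words and experiments of length at most `m` are small
and can be computed fast. -/
def TEWithin (mem : Word α → Word α → Bool) (te : Word α → E → Prog α (Label α)) (len : E → ℕ)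
    (m : ℕ) : Prop :=
  ∀ x e, x.length ≤ m → len e ≤ m → (te x e).Within mem (m ^ 35) ∧ ((te x e).val mem).size ≤ m

theorem within_rowOf (hm : 2 ≤ m) (hte : TEWithin mem te len m) {x : Word α} (hx : x.length ≤ m)
    {es : List E} (hl : es.length ≤ m ^ 2) (he : ∀ e ∈ es, len e ≤ m) :
    (rowOf te x es).Within mem (m ^ 39) :=
  within_mapL_pow hm hl (fun e h => (hte x e hx (he e h)).1) (by omega)

namespace Classifier

theorem Shape.length_columns {columns : List E} {rows : List (Word α × List (Label α))}
    (h : (table columns rows).Shape mem te) (hC : rows.length ≤ m) : columns.length ≤ m :=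
  h.2.trans hC

theorem Shape.size_tree {t : CTree α E} (h : (tree t).Shape mem te) (hm : 2 ≤ m)
    (hC : t.leafList.length ≤ m) : t.size ≤ m ^ 3 :=
  h.2.2.trans (pow_mul_pow_le hm (a := 2) (b := 1) (by nlinarith) (le_pow_one hC) (by omega))

variable {C : Classifier α E}

theorem within_states (hm : 2 ≤ m) (h : C.Shape mem te) (hC : C.stateList.length ≤ m) :
    C.states.Within mem (m ^ 8) := by
  cases C with
  | tree t =>
    have := h.size_tree hm hC
    refine (CTree.within_leaves this).mono (pow_mul_pow_le hm (a := 4) ?_ this (by omega))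
    exact pow_add_pow_le hm le_rfl (two_le_pow hm (c := 1) (by omega)) (by omega) (by omega)
  | table columns rows =>
    have hC : rows.length ≤ m := by simpa [stateList] using hC
    exact within_mapL_pow hm (b := 0) (le_pow_one hC) (fun _ _ => within_pure _ _) (by omega)

theorem within_tree {t : CTree α E} (hm : 2 ≤ m) (ht : t.size ≤ m ^ 3) :
    (2 * m ^ 35 + 1) * t.size ≤ m ^ 41 := by
  refine pow_mul_pow_le hm (a := 38) (b := 3) ?_ ht (by omega)
  refine pow_add_pow_le hm (a := 36) (b := 0) ?_ (by simp) (by omega) (by omega)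
  exact pow_mul_pow_le hm (a := 1) (b := 35) (by simpa using hm) le_rfl (by omega)

theorem within_classify (hm : 2 ≤ m) (hte : TEWithin mem te len m) (h : C.Shape mem te)
    (hC : C.stateList.length ≤ m) (hlen : ∀ e ∈ C.exps, len e ≤ m) {x : Word α}
    (hx : x.length ≤ m) : (C.classify te x).Within mem (m ^ 41) := by
  cases C with
  | tree t =>
    refine (CTree.within_sift (k := m ^ 35) fun e he => ?_).mono
      (within_tree hm (h.size_tree hm hC))
    have := hte x e hx (hlen e he)
    exact ⟨this.1, this.2.trans (le_pow_self hm le_rfl (by omega))⟩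
  | table columns rows =>
    have hC : rows.length ≤ m := by simpa [stateList] using hC
    have hcol := h.length_columns hC
    refine Prog.Within.bind_pow hm (within_rowOf hm hte hx (le_pow_self hm hcol (by omega)) hlen)
      (b := 10) ?_ (by omega) (by omega)
    refine within_firstL_pow hm (b := 6) (le_pow_one hC) (fun r _ => ?_) (by omega)
    refine Prog.Within.bind_pow hm (a := 5) (b := 0) ?_
      (Prog.Within.ite (fun _ => within_pure _ _) fun _ => within_pure _ _) (by omega) (by omega)
    refine (within_eqRow (k := m) fun a ha => ?_).mono
      (loop_pow_le hm (le_pow_one le_rfl) (a := 1) ?_ (by omega))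
    · simp only [rowOf, val_mapL, List.mem_map] at ha
      obtain ⟨e, he, rfl⟩ := ha
      exact (hte x e hx (hlen e he)).2
    · simpa [rowOf] using hcol

theorem within_extend (hm : 2 ≤ m) (hte : TEWithin mem te len m) (h : C.Shape mem te)
    (hC : C.stateList.length ≤ m) (hlen : ∀ e ∈ C.exps, len e ≤ m) {x : Word α}
    (hx : x.length ≤ m) : (C.extend te x).Within mem (m ^ 42) := by
  cases C with
  | tree t =>
    refine Prog.Within.bind_pow hm (a := 41) (b := 0) ?_ (within_pure _ _) (by omega) (by omega)
    refine (CTree.within_graft (k := m ^ 35) fun e he => ?_).mono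
      (within_tree hm (h.size_tree hm hC))
    have := hte x e hx (hlen e he)
    exact ⟨this.1, this.2.trans (le_pow_self hm le_rfl (by omega))⟩
  | table columns rows =>
    have hC : rows.length ≤ m := by simpa [stateList] using hC
    have hcol := h.length_columns hC
    refine Prog.Within.bind_pow hm (within_rowOf hm hte hx (le_pow_self hm hcol (by omega)) hlen)
      (b := 3) ?_ (by omega) (by omega)
    exact Prog.Within.bind_pow hm (within_app_pow hm (a := 1) (le_pow_one hC) (c := 2) (by omega))
      (b := 0) (within_pure _ _) (by omega) (by omega)

theorem within_refineBy (hm : 2 ≤ m) (hte : TEWithin mem te len m) (h : C.Shape mem te)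
    (hC : C.stateList.length ≤ m) (hlen : ∀ e ∈ C.exps, len e ≤ m)
    (hs : ∀ s ∈ C.stateList, s.length ≤ m) {x : Word α} (hx : x.length ≤ m) (q : Word α) {e : E}
    (he : len e ≤ m) (dq dx : Label α) : (C.refineBy te q x e dq dx).Within mem (m ^ 43) := by
  cases C with
  | tree t =>
    refine Prog.Within.bind_pow hm (a := 7) (b := 0) ?_ (within_pure _ _) (by omega) (by omega)
    refine (CTree.within_split (k := m ^ 3) _ _ _ _ _ fun s h' => ?_).mono
      (pow_mul_pow_le hm (a := 4) ?_ (h.size_tree hm hC) (by omega))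
    · rw [psize_word]
      refine pow_add_pow_le hm (a := 2) (b := 0) ?_ (by simp) (by omega) (by omega)
      exact pow_mul_pow_le hm (le_pow_one hm) (le_pow_one (hs s h')) (by omega)
    · exact pow_add_pow_le hm le_rfl (one_le_pow' hm 0) (by omega) (by omega)
  | table columns rows =>
    have hC : rows.length ≤ m := by simpa [stateList] using hC
    have hcol := h.length_columns hC
    have happ : ∀ e', (app columns [e'] : Prog α _).Within mem (m ^ 2) := fun e' =>
      within_app_pow hm (le_pow_one hcol) (by omega)
    refine Prog.Within.bind_pow hm (happ e) (b := 42) ?_ (by omega) (by omega)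
    refine Prog.Within.bind_pow hm (a := 40) (b := 41) ?_ ?_ (by omega) (by omega)
    · refine within_mapL_pow hm (b := 37) (le_pow_one hC) (fun r hr => ?_) (by omega)
      have hr1 : r.1.length ≤ m := hs _ (List.mem_map_of_mem hr)
      refine Prog.Within.bind_pow hm (hte r.1 e hr1 he).1 (b := 36) ?_ (by omega) (by omega)
      refine Prog.Within.bind_pow hm (a := 2) (b := 0) ?_ (within_pure _ _) (by omega) (by omega)
      refine within_app_pow hm (a := 1) ?_ (by omega)
      rw [h.1 r hr]
      simpa using hcol
    · refine Prog.Within.bind_pow hm (a := 39) (b := 4) ?_ ?_ (by omega) (by omega)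
      · rw [val_app]
        refine within_rowOf hm hte hx ?_ fun e' h' => ?_
        · rw [List.length_append]
          exact pow_add_pow_le hm (le_pow_one hcol) (one_le_pow' hm 0) (by omega) (by omega)
        · obtain h' | h' := List.mem_append.1 h'
          · exact hlen e' h'
          · obtain rfl := List.mem_singleton.1 h'
            exact he
      · refine Prog.Within.bind_pow hm (a := 2) (b := 0) ?_ (within_pure _ _) (by omega) (by omega)
        refine within_app_pow hm (a := 1) ?_ (by omega)
        simpa using hC

theorem within_toDFA (hm : 2 ≤ m) (hte : TEWithin mem te len m) (h : C.Shape mem te)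
    (hC : C.stateList.length ≤ m) (hlen : ∀ e ∈ C.exps, len e ≤ m)
    (hs : ∀ s ∈ C.stateList, s.length < m) {sig : List α} (hsig : sig.length ≤ m) :
    (C.toDFA sig te).Within mem (m ^ 55) := by
  unfold toDFA
  refine Prog.Within.bind_pow hm (within_states hm h hC) (b := 54) ?_ (by omega) (by omega)
  rw [val_states]
  refine Prog.Within.bind_pow hm (a := 52) (b := 10) ?_ ?_ (by omega) (by omega)
  · refine within_bindL_pow hm (b := 47) (le_pow_one hC) (fun s h' => ?_) (fun s h' => ?_)
      (by omega)
    · refine within_mapL_pow hm (b := 43) (le_pow_one hsig) (fun a _ => ?_) (by omega)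
      refine Prog.Within.bind_pow hm (a := 2) (b := 42)
        (within_app_pow hm (le_pow_one (hs s h').le) (by omega)) ?_ (by omega) (by omega)
      refine Prog.Within.bind_pow hm (a := 41) (b := 0) ?_ (within_pure _ _) (by omega) (by omega)
      refine within_classify hm hte h hC hlen ?_
      simpa using hs s h'
    · simpa using le_pow_self hm hsig (by omega)
  · have hlen : ∀ l : List (Word α × α × Word α × Option (Word α)), l = ((bindL (fun s => mapL
        (fun a => do
          let x ← app s [a]
          let r ← C.classify te x
          pure (s, a, x, r)) sig) C.stateList).val mem) → l.length ≤ m ^ 2 := by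
      rintro l rfl
      rw [val_bindL]
      exact length_flatMap_pow hm (b := 1) (le_pow_one hC) (fun s _ => by simpa using hsig)
        (by omega)
    have hl := hlen _ rfl
    refine Prog.Within.bind_pow hm (a := 4) (b := 9) ?_ ?_ (by omega) (by omega)
    · exact within_firstL_pow hm (b := 0) hl (fun _ _ => within_pure _ _) (by omega)
    · split
      · exact within_pure _ _
      · exact Prog.Within.bind_pow hm (within_mapL_pow hm (b := 0) (c := 4) hl
          (fun _ _ => within_pure _ _) (by omega)) (b := 0) (within_pure _ _) (by omega) (by omega)

end Classifier

/-! ## Experiment functions -/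

@[simp] theorem val_leadTE (x : Word α) (e : Word α × Word α) :
    (leadTE x e).val mem = .truth (mem (x ++ e.1) e.2) := by
  simp [leadTE]

/-- The length of an experiment of the leading automaton. -/
def leadLen (e : Word α × Word α) : ℕ := e.1.length + e.2.length

theorem within_leadTE (hm : 2 ≤ m) : TEWithin mem (leadTE : Word α → _ → Prog α (Label α)) leadLen m := by
  intro x e hx he
  refine ⟨?_, by simp [Label.size]⟩
  refine Prog.Within.bind_pow hm (within_app_pow hm (le_pow_one hx) (c := 2) (by omega)) (b := 1) ?_
    (by omega) (by omega)
  exact Prog.Within.bind_pow hm (within_askMem_pow hm _ _ 0) (b := 0) (within_pure _ _)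
    (by omega) (by omega)

variable {K : Kind} {M : FA α (Word α)} {δ : Word α → α → Word α}

theorem within_progressTE (hm : 2 ≤ m) {u : Word α} (hu : u.length ≤ m) (hM : M.IsDFA δ)
    (hs : M.Small α m) : TEWithin mem (progressTE K M u) List.length m := by
  intro x e hx he
  have hm3 : 2 ≤ m ^ 3 := two_le_pow hm (by omega)
  have hmm : m ≤ m ^ 3 := le_pow_self hm le_rfl (by omega)
  have hreach : ∀ w : Word α, w.length ≤ m ^ 3 → (M.reach w).Within mem (m ^ 27) := fun w hw =>
    (within_run hm3 (hs.trans.trans hmm) (fun t ht => (hs.size_source t ht).trans hmm) _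
      hw).pow_pow hm (by omega)
  have hl : (x ++ e).length ≤ m ^ 2 := by
    rw [List.length_append]
    exact pow_add_pow_le hm (le_pow_one hx) (le_pow_one he) (by omega) (by omega)
  -- A label contains at most one word, in the syntactic case, and that word is a state of the
  -- leading automaton.
  have hmem : ∀ w : Word α, psize α ((M.reach w).val mem) ≤ m := fun w => by
    rw [hM.val_reach]
    exact hs.size_states _ (hM.foldl_mem hM.init w)
  have happ : ∀ w : Word α, (app u w : Prog α _).Within mem (m ^ 2) := fun w =>
    within_app_pow hm (le_pow_one hu) (by omega)
  have hul : ∀ w : Word α, w.length ≤ m ^ 2 → (u ++ w).length ≤ m ^ 3 := fun w hw => by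
    rw [List.length_append]
    exact pow_add_pow_le hm (le_pow_one hu) hw (by omega) (by omega)
  constructor
  · unfold progressTE
    refine Prog.Within.bind_pow hm (within_app_pow hm (le_pow_one hx) (c := 2) (by omega)) (b := 34)
      ?_ (by omega) (by omega)
    rw [val_app]
    cases K with
    | periodic =>
      exact Prog.Within.bind_pow hm (within_askMem_pow hm _ _ 0) (b := 0) (within_pure _ _)
        (by omega) (by omega)
    | recurrent =>
      refine (Prog.Within.bind_pow hm (happ _) (b := 28) (c := 34) ?_ (by omega) (by omega))
      rw [val_app]
      refine Prog.Within.bind_pow hm (hreach _ (hul _ hl)) (b := 4) ?_ (by omega) (by omega)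
      refine Prog.Within.bind_pow hm ((within_peq _ _).mono (le_pow_one (hmem _))) (b := 3) ?_
        (by omega) (by omega)
      refine Prog.Within.ite (fun _ => ?_) fun _ => within_pure _ _
      exact Prog.Within.bind_pow hm (within_askMem_pow hm _ _ 0) (b := 0) (within_pure _ _)
        (by omega) (by omega)
    | syntactic =>
      have hux : (u ++ x).length ≤ m ^ 3 := hul x (le_pow_self hm hx (by omega))
      refine Prog.Within.bind_pow hm (happ x) (b := 33) ?_ (by omega) (by omega)
      rw [val_app]
      refine Prog.Within.bind_pow hm (hreach _ hux) (b := 32) ?_ (by omega) (by omega)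
      refine Prog.Within.bind_pow hm (happ _) (b := 31) ?_ (by omega) (by omega)
      rw [val_app]
      refine Prog.Within.bind_pow hm (hreach _ (hul _ hl)) (b := 30) ?_ (by omega) (by omega)
      refine Prog.Within.bind_pow hm ((within_peq _ _).mono (le_pow_one (hmem _))) (b := 3) ?_
        (by omega) (by omega)
      refine Prog.Within.ite (fun _ => ?_) fun _ => within_pure _ _
      refine Prog.Within.bind_pow hm (within_askMem_pow hm _ _ 0) (b := 0) ?_
        (by omega) (by omega)
      exact Prog.Within.ite (fun _ => within_pure _ _) fun _ => within_pure _ _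
  · cases K with
    | periodic => simp [progressTE, Label.size]
    | recurrent =>
      simp only [progressTE, val_bind, val_ite]
      split_ifs <;> simp [Label.size]
    | syntactic =>
      simp only [progressTE, val_bind, val_ite, val_pure]
      split_ifs <;> exact hmem _

end

/-! ## Refinement -/

section

variable {α E : Type} [DecidableEq α] {mem : Word α → Word α → Bool} {m : ℕ}
  {te : Word α → E → Prog α (Label α)} {len : E → ℕ}

/-- What an entry for a progress automaton says about membership. -/
def Label.verdict : Label α → Option Bool
  | .truth b => some b
  | .mark _ .A => some true
  | .mark _ .B => some false
  | .mark _ .C => none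

/-- What a progress automaton of `u` has to say about a word. -/
def verdict (mem : Word α → Word α → Bool) (K : Kind) (δ : Word α → α → Word α) (u x : Word α) :
    Option Bool :=
  match K with
  | .periodic => some (mem u x)
  | .recurrent => some (decide ((u ++ x).foldl δ [] = u) && mem u x)
  | .syntactic => if (u ++ x).foldl δ [] = u then some (mem u x) else none

variable {K : Kind} {M : FA α (Word α)} {δ : Word α → α → Word α} {u : Word α}

/-- Whatever the kind, the entry for `x` and `e` determines what has to be said about the word `x ++
e`, regardless of how it is split. This lets one telescoping argument serve all three kinds. -/
theorem verdict_progressTE (hM : M.IsDFA δ) (h0 : M.init = []) (x e : Word α) :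
    ((progressTE K M u x e).val mem).verdict = verdict mem K δ u (x ++ e) := by
  cases K with
  | periodic => simp [progressTE, verdict, Label.verdict]
  | recurrent =>
    simp only [progressTE, verdict, val_bind, val_app, hM.val_reach, h0, val_ite, val_peq,
      decide_eq_true_eq, val_askMem, val_pure]
    split_ifs with h <;> simp_all [Label.verdict]
  | syntactic =>
    simp only [progressTE, verdict, val_bind, val_app, hM.val_reach, h0, val_ite, val_peq,
      decide_eq_true_eq, val_askMem, val_pure]
    split_ifs <;> simp_all [Label.verdict]

/-- Acceptance compares the states reached by `u ++ v` and by `u`; as `u` is a state that reaches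
itself, this is the test occurring in the verdict. -/
theorem isAccepting_iff (hM : M.IsDFA δ) (h0 : M.init = []) (hu : u.foldl δ [] = u)
    (v : Word α) : (isAccepting K M u v).val mem = true ↔ verdict mem K δ u v = some true := by
  cases K <;> simp only [isAccepting, verdict, val_bind, val_app, hM.val_reach, h0, val_ite,
    val_peq, decide_eq_true_eq, val_askMem, val_pure, hu] <;>
  by_cases h : (u ++ v).foldl δ [] = u <;> simp [h]

theorem within_isAccepting (hm : 2 ≤ m) (hM : M.IsDFA δ) (hs : M.Small α m) {v : Word α}
    (hu : u.length ≤ m) (hv : v.length ≤ m) : (isAccepting K M u v).Within mem (m ^ 30) := by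
  have hm2 : 2 ≤ m ^ 2 := two_le_pow hm (by omega)
  have hmm : m ≤ m ^ 2 := le_pow_self hm le_rfl (by omega)
  have hreach : ∀ w : Word α, w.length ≤ m ^ 2 → (M.reach w).Within mem (m ^ 18) := fun w hw =>
    (within_run hm2 (hs.trans.trans hmm) (fun t ht => (hs.size_source t ht).trans hmm) _
      hw).pow_pow hm (by omega)
  have hl : (u ++ v).length ≤ m ^ 2 := by
    rw [List.length_append]
    exact pow_add_pow_le hm (le_pow_one hu) (le_pow_one hv) (by omega) (by omega)
  have key : (do
      let uv ← app u v
      let p ← M.reach uv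
      let q ← M.reach u
      if ← peq p q then askMem u v else pure false : Prog α Bool).Within mem (m ^ 30) := by
    refine Prog.Within.bind_pow hm (within_app_pow hm (le_pow_one hu) (c := 2) (by omega)) (b := 29)
      ?_ (by omega) (by omega)
    rw [val_app]
    refine Prog.Within.bind_pow hm (hreach _ hl) (b := 28) ?_ (by omega) (by omega)
    refine Prog.Within.bind_pow hm (hreach _ (hu.trans hmm)) (b := 27) ?_ (by omega) (by omega)
    refine Prog.Within.bind_pow hm (a := 1) (b := 0) ((within_peq _ _).mono (le_pow_one ?_))
      (Prog.Within.ite (fun _ => within_askMem_pow hm _ _ _) fun _ => within_pure _ _)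
      (by omega) (by omega)
    rw [hM.val_reach]
    exact hs.size_states _ (hM.foldl_mem hM.init _)
  cases K with
  | periodic => exact within_askMem_pow hm _ _ _
  | recurrent => exact key
  | syntactic => exact key

/-! ### The first position of a run where an experiment tells the state from the word. -/

section Breakpoint

variable {ex : Word α → E} {A : FA α (Word α)}

open Classical in
theorem val_breakpoint_cons (hA : A.IsDFA δ) {p : Word α} (hp : p ∈ A.states) (a : α)
    (w : Word α) : (breakpoint te ex A p (a :: w)).val mem =
      if (te (δ p a) (ex w)).val mem = (te (p ++ [a]) (ex w)).val mem then
        (breakpoint te ex A (δ p a) w).val mem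
      else some (δ p a, p ++ [a], ex w, (te (δ p a) (ex w)).val mem,
        (te (p ++ [a]) (ex w)).val mem) := by
  simp [breakpoint, hA.val_step hp]

theorem val_breakpoint_some (hA : A.IsDFA δ) {p w q x : Word α} (hp : p ∈ A.states) {e : E}
    {dq dx : Label α} (h : (breakpoint te ex A p w).val mem = some (q, x, e, dq, dx)) :
    ∃ s ∈ A.states, ∃ a w', w'.length ≤ w.length ∧ q = δ s a ∧ x = s ++ [a] ∧ e = ex w' ∧
      dq = (te q e).val mem ∧ dx = (te x e).val mem ∧ dq ≠ dx := by
  classical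
  induction w generalizing p with
  | nil => simp [breakpoint] at h
  | cons a w ih =>
    rw [val_breakpoint_cons hA hp] at h
    split_ifs at h with heq
    · obtain ⟨s, hs, b, w', hl, h'⟩ := ih (hA.step p hp a) h
      exact ⟨s, hs, b, w', hl.trans (Nat.le_succ _), h'⟩
    · simp only [Option.some.injEq, Prod.mk.injEq] at h
      obtain ⟨rfl, rfl, rfl, rfl, rfl⟩ := h
      exact ⟨p, hp, a, w, Nat.le_succ _, rfl, rfl, rfl, rfl, rfl, heq⟩

/-- A telescoping argument: in each step `p ++ [a]` is replaced by its class in front of the same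
rest `w`, and equal experiments force equal values of `G`. So the absence of a breakpoint transports
`G` from the whole word to the state in which the run ends. -/
theorem val_breakpoint_none (hA : A.IsDFA δ) {β : Type} (G : Word α → β)
    (hG : ∀ x y w, (te x (ex w)).val mem = (te y (ex w)).val mem → G (x ++ w) = G (y ++ w))
    {p w : Word α} (hp : p ∈ A.states) (h : (breakpoint te ex A p w).val mem = none) :
    G (p ++ w) = G (w.foldl δ p) := by
  classical
  induction w generalizing p with
  | nil => simp
  | cons a w ih =>
    rw [val_breakpoint_cons hA hp] at h
    split_ifs at h with heq
    rw [List.foldl_cons, ← ih (hA.step p hp a) h, hG _ _ _ heq]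
    simp

theorem within_breakpoint (hm : 2 ≤ m) (hte : TEWithin mem te len m) (hA : A.IsDFA δ)
    (hs : A.Small α (m ^ 3)) (hlt : ∀ s ∈ A.states, s.length < m) {p w : Word α}
    (hp : p ∈ A.states) (hw : w.length ≤ m)
    (hex : ∀ w' : Word α, w'.length ≤ w.length → len (ex w') ≤ m) :
    (breakpoint te ex A p w).Within mem (m ^ 50) := by
  suffices (breakpoint te ex A p w).Within mem ((m ^ 40 + 1) * w.length + 1) from
    this.mono (loop_pow_le hm le_rfl (le_pow_one hw) (by omega))
  clear hw
  induction w generalizing p with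
  | nil => exact (within_pure _ 0).tick.mono (by simp)
  | cons a w ih =>
    have hq := hA.step p hp a
    have hpa : (p ++ [a]).length ≤ m := by simpa using hlt p hp
    have hew : len (ex w) ≤ m := hex w (by simp)
    have ih := ih hq fun w' h' => hex w' (by simp; omega)
    have : (breakpoint te ex A p (a :: w)).Within mem (m ^ 18 + (m ^ 2 + (m ^ 35 + (m ^ 35 +
        (m + ((m ^ 40 + 1) * w.length + 1))))) + 1) := by
      refine Prog.Within.tick (Prog.Within.bind ?_ ?_)
      · exact (within_step (two_le_pow hm (by omega)) hs.trans hs.size_source p a).pow_pow hm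
          (by omega)
      rw [hA.val_step hp]
      refine Prog.Within.bind (within_app_pow hm (le_pow_one (hlt p hp).le) (by omega)) ?_
      rw [val_app]
      refine Prog.Within.bind (hte _ _ (hlt _ hq).le hew).1 ?_
      refine Prog.Within.bind (hte _ _ hpa hew).1 ?_
      refine Prog.Within.bind ((within_eqLabel _ _).mono (hte _ _ (hlt _ hq).le hew).2) ?_
      exact Prog.Within.ite (fun _ => ih) fun _ => within_pure _ _
    refine this.mono ?_
    have h1 : m ^ 18 + m ^ 2 ≤ m ^ 19 := pow_add_pow_le hm le_rfl le_rfl (by omega) (by omega)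
    have h2 : m ^ 35 + m ^ 35 ≤ m ^ 36 := pow_add_pow_le hm le_rfl le_rfl (by omega) (by omega)
    have h3 : m ^ 36 + m ≤ m ^ 37 :=
      pow_add_pow_le hm le_rfl (le_pow_one le_rfl) (by omega) (by omega)
    have h4 : m ^ 19 + m ^ 37 ≤ m ^ 38 := pow_add_pow_le hm le_rfl le_rfl (by omega) (by omega)
    have h5 : m ^ 38 + 1 ≤ m ^ 39 := pow_add_pow_le hm le_rfl (one_le_pow' hm 0) (by omega) (by omega)
    have h6 : m ^ 39 ≤ m ^ 40 := le_pow_of_le hm le_rfl (by omega)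
    rw [List.length_cons, Nat.mul_succ]
    omega

end Breakpoint

/-! ### The number of states -/

section Bounds

variable {L : Set (Stream' α)} {ℓ : ℕ}

open Classical in
/-- The answers to membership queries. -/
noncomputable def upMem (L : Set (Stream' α)) (u v : Word α) : Bool := decide (UPMem L u v)

/-- An experiment tests one particular continuation, so congruent words agree in all experiments,
and distinct states lie in distinct classes. -/
theorem length_le_leadIndex_of_good (hL : IsOmegaRegular L) {C : Classifier α (Word α × Word α)}
    (h : C.Good (upMem L) leadTE leadLen ℓ) : C.stateList.length ≤ leadIndex L := by
  refine length_le_leadIndex hL h.nodup fun s hs t ht hst => h.eq_of_forall hs ht fun e => ?_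
  rw [val_leadTE, val_leadTE]
  simp only [upMem, Label.truth.injEq]
  refine decide_eq_decide.2 (exists_congr fun hv => ?_)
  rw [Stream'.append_append_stream, Stream'.append_append_stream]
  exact hst _

/-- For every kind, the entries for `s` are determined by the leading state of `u ++ s` and the
periodic class of `s`: the former decides whether a continuation returns to `u`, the latter the
membership queries. -/
theorem length_le_progressIndex_of_good (hL : IsOmegaRegular L) {C : Classifier α (Word α)}
    (h : C.Good (upMem L) (progressTE K M u) List.length ℓ)
    (hM : M.IsDFA δ) (h0 : M.init = []) : C.stateList.length ≤ M.states.length * progressIndex L := by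
  refine length_le_mul_progressIndex hL u h.nodup (fun s => (u ++ s).foldl δ [])
    (fun s _ => h0 ▸ hM.foldl_mem hM.init _) fun s hs t ht hf hst => h.eq_of_forall hs ht fun e => ?_
  have hmem : upMem L u (s ++ e) = upMem L u (t ++ e) := by
    simpa only [upMem, decide_eq_decide] using hst e
  have hfe : (u ++ (s ++ e)).foldl δ [] = (u ++ (t ++ e)).foldl δ [] := by
    rw [← List.append_assoc, ← List.append_assoc, List.foldl_append, List.foldl_append (l' := e)]
    exact congrArg (fun q => e.foldl δ q) hf
  have hv : ∀ x, (progressTE .syntactic M u x e).val (upMem L) = .mark ((u ++ x).foldl δ [])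
      (if (u ++ (x ++ e)).foldl δ [] = u then if upMem L u (x ++ e) then .A else .B else .C) := by
    intro x
    simp only [progressTE, val_bind, val_app, hM.val_reach, h0, val_ite, val_peq,
      decide_eq_true_eq, val_askMem, val_pure]
    split_ifs <;> simp_all
  cases K with
  | syntactic => simp only [hv, hmem, hfe, hf]
  | periodic => simp only [progressTE, val_bind, val_app, val_askMem, val_pure, hmem]
  | recurrent =>
    simp only [progressTE, val_bind, val_app, hM.val_reach, h0, val_ite, val_peq, val_askMem,
      val_pure, hmem, hfe]

/-- Periodic experiments do not look at the leading automaton, so here nothing is required of `M`.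
-/
theorem length_le_progressIndex_periodic (hL : IsOmegaRegular L) {C : Classifier α (Word α)}
    (h : C.Good (upMem L) (progressTE .periodic M u) List.length ℓ) :
    C.stateList.length ≤ progressIndex L := by
  have := length_le_mul_progressIndex hL u h.nodup (fun _ => ()) (k := [()]) (by simp)
    fun s hs t ht _ hst => h.eq_of_forall hs ht fun e => ?_
  · simpa using this
  have hmem : upMem L u (s ++ e) = upMem L u (t ++ e) := by
    simpa only [upMem, decide_eq_decide] using hst e
  simp [progressTE, hmem]

end Bounds

end

/-! ## The data of the learner -/

section

variable {α : Type} [DecidableEq α] {mem : Word α → Word α → Bool} {m : ℕ} {sig : List α}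
  {S : Storage} {K : Kind} {ℓ : ℕ} {D : Learner α}

namespace Learner

/-- The invariant of the algorithm, for experiments of length at most `ℓ`. The learners of progress
automata depend on the leading automaton, unless the periodic FDFA is learned. -/
structure Inv (mem : Word α → Word α → Bool) (sig : List α) (K : Kind) (ℓ : ℕ) (D : Learner α) :
    Prop where
  lead : D.lead.Good mem leadTE leadLen ℓ
  nodup : (D.progress.map Prod.fst).Nodup
  mem_keys : ∀ u, u ∈ D.progress.map Prod.fst ↔ u ∈ D.lead.stateList
  progress : ∀ M, (K = .periodic ∨ (D.lead.toDFA sig leadTE).val mem = Sum.inr M) →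
    ∀ c ∈ D.progress, c.2.Good mem (progressTE K M c.1) List.length ℓ

theorem Inv.mono (h : D.Inv mem sig K ℓ) {ℓ' : ℕ} (hℓ : ℓ ≤ ℓ') : D.Inv mem sig K ℓ' where
  lead := h.lead.mono hℓ
  nodup := h.nodup
  mem_keys := h.mem_keys
  progress M hM c hc := (h.progress M hM c hc).mono hℓ

theorem inv_initial (S : Storage) : (initial S : Learner α).Inv mem sig K ℓ where
  lead := Classifier.good_initial S
  nodup := by simp [initial]
  mem_keys u := by simp [initial]
  progress M _ c hc := by
    obtain rfl : c = ([], Classifier.initial S) := by simpa [initial] using hc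
    exact Classifier.good_initial S

theorem val_newLead_lead (lead : Classifier α (Word α × Word α)) (x : Word α) :
    ((D.newLead S K lead x).val mem).lead = lead := by
  cases K <;> simp [newLead]

/-- Periodic experiments do not depend on the leading automaton, so the old learners stay good. In
the other cases all learners are fresh, and a fresh learner is good for any leading automaton that
may come. -/
theorem Inv.newLead (h : D.Inv mem sig K ℓ) {lead : Classifier α (Word α × Word α)} {x : Word α}
    (hl : lead.Good mem leadTE leadLen ℓ) (hp : lead.stateList.Perm (x :: D.lead.stateList)) :
    ((D.newLead S K lead x).val mem).Inv mem sig K ℓ := by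
  have hx : x ∉ D.lead.stateList := (List.nodup_cons.1 (hp.nodup_iff.1 hl.nodup)).1
  have key : ∀ D' : Learner α, D' = { lead := lead
                                      progress := lead.stateList.map fun s =>
                                        (s, Classifier.initial S) } →
      D'.Inv mem sig K ℓ := by
    rintro _ rfl
    refine ⟨hl, ?_, fun u => ?_, fun M _ c hc => ?_⟩
    · simpa [Function.comp_def] using hl.nodup
    · simp
    · obtain ⟨s, hs, rfl⟩ := List.mem_map.1 hc
      exact Classifier.good_initial S
  cases K with
  | periodic =>
    have hv : (D.newLead S .periodic lead x).val mem =
        { lead := lead, progress := D.progress ++ [(x, Classifier.initial S)] } := by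
      simp [Learner.newLead]
    rw [hv]
    refine ⟨hl, ?_, fun u => ?_, fun M _ c hc => ?_⟩
    · rw [List.map_append]
      refine (List.perm_append_singleton _ _).nodup_iff.2 (List.nodup_cons.2 ⟨?_, h.nodup⟩)
      rwa [h.mem_keys]
    · rw [hp.mem_iff, List.map_append, List.mem_append, h.mem_keys]
      simp [or_comm]
    · obtain hc | hc := List.mem_append.1 hc
      · exact h.progress M (.inl rfl) c hc
      · obtain rfl := List.mem_singleton.1 hc
        exact Classifier.good_initial S
  | syntactic => exact key _ (by simp [Learner.newLead])
  | recurrent => exact key _ (by simp [Learner.newLead])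

/-- The data after the learner of the progress automaton of `u` has been changed to `C`. -/
def update (D : Learner α) (u : Word α) (C : Classifier α (Word α)) : Learner α :=
  { lead := D.lead, progress := D.progress.map fun c => if c.1 = u then (c.1, C) else c }

theorem map_fst_update (u : Word α) (C : Classifier α (Word α)) :
    (D.update u C).progress.map Prod.fst = D.progress.map Prod.fst := by
  simp only [update, List.map_map]
  refine List.map_congr_left fun c _ => ?_
  simp only [Function.comp]
  split_ifs <;> rfl

theorem Inv.update (h : D.Inv mem sig K ℓ) {u : Word α} {C : Classifier α (Word α)}
    (hC : ∀ M, (K = .periodic ∨ (D.lead.toDFA sig leadTE).val mem = Sum.inr M) →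
      C.Good mem (progressTE K M u) List.length ℓ) : (D.update u C).Inv mem sig K ℓ where
  lead := h.lead
  nodup := by rw [map_fst_update]; exact h.nodup
  mem_keys v := by rw [map_fst_update]; exact h.mem_keys v
  progress M hM c hc := by
    obtain ⟨d, hd, rfl⟩ := List.mem_map.1 hc
    split_ifs with hu
    · rw [hu]; exact hC M hM
    · exact h.progress M hM d hd

/-- The total number of states of the progress automata. -/
def total (D : Learner α) : ℕ := (D.progress.map fun c => c.2.stateList.length).sum

theorem sum_update {u : Word α} {C C' : Classifier α (Word α)} (f : Classifier α (Word α) → ℕ)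
    {l : List (Word α × Classifier α (Word α))} (hl : (l.map Prod.fst).Nodup) (hu : (u, C) ∈ l)
    (hC : f C' = f C + 1) :
    ((l.map fun c => if c.1 = u then (c.1, C') else c).map fun c => f c.2).sum =
      (l.map fun c => f c.2).sum + 1 := by
  induction l with
  | nil => simp at hu
  | cons c l ih =>
    rw [List.map_cons, List.nodup_cons] at hl
    simp only [List.map_cons, List.sum_cons]
    obtain rfl | hu := List.mem_cons.1 hu
    · have hid : (l.map fun c => if c.1 = u then (c.1, C') else c) = l := by
        refine (List.map_congr_left fun c hc => ?_).trans l.map_id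
        rw [if_neg]
        · rfl
        · rintro rfl
          have := List.mem_map_of_mem (f := Prod.fst) hc
          exact hl.1 this
      rw [hid]
      simp only [if_true, hC]
      omega
    · have hne : c.1 ≠ u := fun h => hl.1 (h ▸ List.mem_map_of_mem hu)
      rw [if_neg hne, ih hl.2 hu, add_assoc]

theorem Inv.total_update (h : D.Inv mem sig K ℓ) {u : Word α} {C C' : Classifier α (Word α)}
    (hu : (u, C) ∈ D.progress) (hC : C'.stateList.length = C.stateList.length + 1) :
    (D.update u C').total = D.total + 1 :=
  sum_update (fun C => C.stateList.length) h.nodup hu hC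

/-- How many states can still be added, if the leading automaton has at most `n` states and
the progress automata have at most `N` states. -/
def potential (n N : ℕ) (D : Learner α) : ℕ :=
  (n - D.lead.stateList.length) * (n * N + 1) + (n * N - D.total)

theorem Inv.length_progress (h : D.Inv mem sig K ℓ) :
    D.progress.length = D.lead.stateList.length := by
  rw [← List.length_map (f := Prod.fst)]
  exact ((List.perm_ext_iff_of_nodup h.nodup h.lead.nodup).2 h.mem_keys).length_eq

/-- Learning the progress automata anew may raise the second summand, but never above `n * N`, and
the first summand drops by `n * N + 1`. -/
theorem potential_newLead {n N : ℕ} {D' : Learner α}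
    (hl : D'.lead.stateList.length = D.lead.stateList.length + 1)
    (hn : D'.lead.stateList.length ≤ n) : D'.potential n N < D.potential n N := by
  unfold potential
  obtain ⟨k, hk⟩ : ∃ k, n - D.lead.stateList.length = k + 1 := ⟨n - D.lead.stateList.length - 1, by omega⟩
  rw [hk, show n - D'.lead.stateList.length = k by omega, Nat.succ_mul]
  omega

/-- There are at most `n` progress automata with at most `N` states each, so the new total is still
at most `n * N`, and the truncated subtraction really decreases. -/
theorem Inv.potential_update {n N : ℕ} (h : D.Inv mem sig K ℓ) {u : Word α}
    {C C' : Classifier α (Word α)} (hu : (u, C) ∈ D.progress)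
    (hC : C'.stateList.length = C.stateList.length + 1) (hn : D.lead.stateList.length ≤ n)
    (hN : ∀ c ∈ (D.update u C').progress, c.2.stateList.length ≤ N) :
    (D.update u C').potential n N < D.potential n N := by
  have h1 := h.total_update hu hC
  have h2 : (D.update u C').total ≤ n * N := by
    refine (List.sum_le_card_nsmul _ N ?_).trans ?_
    · intro x hx
      obtain ⟨c, hc, rfl⟩ := List.mem_map.1 hx
      exact hN c hc
    · rw [List.length_map, smul_eq_mul]
      refine Nat.mul_le_mul_right _ ?_
      rw [Learner.update, List.length_map, h.length_progress]
      exact hn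
  unfold potential
  have : (D.update u C').lead = D.lead := rfl
  rw [this]
  omega

/-! ### Bounds -/

section Bounds

variable {L : Set (Stream' α)}

theorem Inv.length_lead (hL : IsOmegaRegular L) (h : D.Inv (upMem L) sig K ℓ) :
    D.lead.stateList.length ≤ leadIndex L := length_le_leadIndex_of_good hL h.lead

theorem Inv.length_of_mem (hL : IsOmegaRegular L) (h : D.Inv (upMem L) sig K ℓ)
    (hsig : ∀ a, a ∈ sig) {M : FA α (Word α)}
    (hM : K = .periodic ∨ (D.lead.toDFA sig leadTE).val (upMem L) = Sum.inr M)
    {c : Word α × Classifier α (Word α)} (hc : c ∈ D.progress) :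
    c.2.stateList.length ≤ leadIndex L * progressIndex L := by
  have hg := h.progress M hM c hc
  have hn := h.length_lead hL
  -- There is at least one leading state, so the better bound of the periodic case may be weakened
  -- to the common one.
  have hpos : 0 < D.lead.stateList.length := List.length_pos_of_mem h.lead.nil_mem
  obtain rfl | hM := hM
  · refine (length_le_progressIndex_periodic hL hg).trans (Nat.le_mul_of_pos_left _ (by omega))
  · obtain ⟨h1, h2, -⟩ := Classifier.val_toDFA_inr hsig hM
    refine (length_le_progressIndex_of_good hL hg (h.lead.isDFA hsig hM) h2).trans ?_
    rw [h1]
    exact Nat.mul_le_mul_right _ hn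

end Bounds

/-! ### The FDFA -/

/-- The progress automaton of the FDFA. -/
def progressDFA (mem : Word α → Word α → Bool) (sig : List α) (K : Kind) (M : FA α (Word α))
    (c : Word α × Classifier α (Word α)) : FA α (Word α) :=
  match (c.2.toDFA sig (progressTE K M c.1)).val mem with
  | .inl _ => { states := [], init := [], acc := [], trans := [] }
  | .inr A => { A with acc := A.states.filter fun v => (isAccepting K M c.1 v).val mem }

/-- The FDFA constructed from the data of the learner. -/
def fdfa (mem : Word α → Word α → Bool) (sig : List α) (K : Kind) (M : FA α (Word α))
    (D : Learner α) : FDFA α :=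
  { lead := M, progress := D.progress.map fun c => (c.1, progressDFA mem sig K M c) }

/-- The transition functions of the progress automata. -/
noncomputable def progressNext (mem : Word α → Word α → Bool) (K : Kind) (M : FA α (Word α))
    (D : Learner α) (u : Word α) : Word α → α → Word α :=
  match lookup u D.progress with
  | none => fun _ _ => []
  | some C => C.next mem (progressTE K M u)

theorem Inv.progressNext_eq (h : D.Inv mem sig K ℓ) {M : FA α (Word α)}
    {c : Word α × Classifier α (Word α)} (hc : c ∈ D.progress) :
    D.progressNext mem K M c.1 = c.2.next mem (progressTE K M c.1) := by
  rw [progressNext, lookup_of_mem h.nodup hc]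

variable {M : FA α (Word α)}

theorem progressDFA_of_eq {c : Word α × Classifier α (Word α)} {A : FA α (Word α)}
    (hA : (c.2.toDFA sig (progressTE K M c.1)).val mem = Sum.inr A) :
    progressDFA mem sig K M c =
      { A with acc := A.states.filter fun v => (isAccepting K M c.1 v).val mem } := by
  rw [progressDFA, hA]

theorem Inv.isFamily (h : D.Inv mem sig K ℓ) (hsig : ∀ a, a ∈ sig)
    (hM : (D.lead.toDFA sig leadTE).val mem = Sum.inr M)
    (hall : ∀ c ∈ D.progress, ∃ A, (c.2.toDFA sig (progressTE K M c.1)).val mem = Sum.inr A) :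
    (D.fdfa mem sig K M).IsFamily (D.lead.next mem leadTE) (D.progressNext mem K M) where
  lead := h.lead.isDFA hsig hM
  lead_init := (Classifier.val_toDFA_inr hsig hM).2.1
  progress e he := by
    obtain ⟨c, hc, rfl⟩ := List.mem_map.1 he
    obtain ⟨A, hA⟩ := hall c hc
    have := (h.progress M (.inr hM) c hc).isDFA hsig hA
    rw [progressDFA_of_eq hA, h.progressNext_eq hc]
    exact ⟨this.init, this.step, this.trans⟩
  progress_init e he := by
    obtain ⟨c, hc, rfl⟩ := List.mem_map.1 he
    obtain ⟨A, hA⟩ := hall c hc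
    rw [progressDFA_of_eq hA]
    exact (Classifier.val_toDFA_inr hsig hA).2.1
  acc e he v hv := by
    obtain ⟨c, hc, rfl⟩ := List.mem_map.1 he
    obtain ⟨A, hA⟩ := hall c hc
    rw [progressDFA_of_eq hA] at hv ⊢
    exact (List.mem_filter.1 hv).1
  nodup := by simpa [fdfa, Function.comp_def] using h.nodup
  mem_keys u := by
    have : (D.fdfa mem sig K M).progress.map Prod.fst = D.progress.map Prod.fst := by
      simp [fdfa, Function.comp_def]
    rw [this, h.mem_keys, fdfa, (Classifier.val_toDFA_inr hsig hM).1]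

theorem Inv.small_fdfa (h : D.Inv mem sig K ℓ) (hsig : ∀ a, a ∈ sig) (hm : 2 ≤ m)
    (hM : (D.lead.toDFA sig leadTE).val mem = Sum.inr M)
    (hall : ∀ c ∈ D.progress, ∃ A, (c.2.toDFA sig (progressTE K M c.1)).val mem = Sum.inr A)
    (hs : sig.length ≤ m) (hl : D.lead.stateList.length ≤ m)
    (hp : ∀ c ∈ D.progress, c.2.stateList.length ≤ m) :
    (D.fdfa mem sig K M).Small (m ^ 3) where
  lead := h.lead.small hsig hM hm hl hs
  length := by
    rw [fdfa, List.length_map, h.length_progress]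
    exact le_pow_self hm hl (by omega)
  progress e he := by
    obtain ⟨c, hc, rfl⟩ := List.mem_map.1 he
    obtain ⟨A, hA⟩ := hall c hc
    have := (h.progress M (.inr hM) c hc).small hsig hA hm (hp c hc) hs
    rw [progressDFA_of_eq hA]
    exact ⟨this.states, (List.length_filter_le _ _).trans this.states, this.trans,
      this.size_states, fun s hs => this.size_states s (List.mem_filter.1 hs).1,
      this.size_init, this.size_source, this.size_target⟩
  key e he := by
    obtain ⟨c, hc, rfl⟩ := List.mem_map.1 he
    have hk := (h.mem_keys c.1).1 (List.mem_map_of_mem hc)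
    rw [← (Classifier.val_toDFA_inr hsig hM).1] at hk
    exact (h.lead.small hsig hM hm hl hs).size_states _ hk

end Learner

end

/-! ## Counterexample analysis -/

section

variable {α : Type} [DecidableEq α] {mem : Word α → Word α → Bool} {m : ℕ}

theorem upMem_eq_of_lasso {L : Set (Stream' α)} {x y u v : Word α} (hy : y ≠ []) (hv : v ≠ [])
    (h : x ++ₛ Stream'.cycle y hy = u ++ₛ Stream'.cycle v hv) : upMem L x y = upMem L u v := by
  refine decide_eq_decide.2 ⟨fun ⟨_, hm⟩ => ⟨hv, h ▸ hm⟩, fun ⟨_, hm⟩ => ⟨hy, h ▸ hm⟩⟩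

theorem upMem_iff {L : Set (Stream' α)} {u v : Word α} (hv : v ≠ []) :
    upMem L u v = true ↔ u ++ₛ Stream'.cycle v hv ∈ L := by
  simp only [upMem, decide_eq_true_eq]
  exact ⟨fun ⟨_, h⟩ => h, fun h => ⟨hv, h⟩⟩

variable {F : FDFA α} {δ : Word α → α → Word α} {δ' : Word α → Word α → α → Word α}
  {L : Set (Stream' α)} {u v : Word α}

/-- With the under-approximation method, every counterexample for the Büchi automaton yields one
for the FDFA. -/
theorem analyze_under (h : F.IsFamily δ δ') (hm : 2 ≤ m) (hs : F.Small m) (hv : v ≠ [])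
    (huv : u.length + v.length ≤ m)
    (hce : ¬ (u ++ₛ Stream'.cycle v hv ∈ L ↔
      u ++ₛ Stream'.cycle v hv ∈ ((buildBA .under F).val (upMem L)).omegaLang)) :
    ∃ x y A, (analyze .under F u v).val (upMem L) = some (x, y) ∧
      x.length + y.length ≤ m ^ 20 ∧ y.foldl δ (x.foldl δ []) = x.foldl δ [] ∧
      (x.foldl δ [], A) ∈ F.progress ∧
      (y.foldl (δ' (x.foldl δ [])) [] ∈ A.acc ↔ upMem L x y = false) := by
  -- The flag `b` selects accepted or rejected decompositions and is opposite to the membership of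
  -- the counterexample. So any pair found is one on which the family contradicts `L`.
  have hfind : ∀ b : Bool, upMem L u v = !b → ∀ r,
      (findDecomp ((decompFA b F).val (upMem L)) u v).val (upMem L) = some r →
      ∃ x y A, some r = some (x, y) ∧
        x.length + y.length ≤ m ^ 20 ∧ y.foldl δ (x.foldl δ []) = x.foldl δ [] ∧
        (x.foldl δ [], A) ∈ F.progress ∧
        (y.foldl (δ' (x.foldl δ [])) [] ∈ A.acc ↔ upMem L x y = false) := by
    rintro b hb ⟨x, y⟩ hr
    have hlen := length_findDecomp hm (closed_decompFA h) (small_decompFA hm hs) hv huv hr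
    obtain ⟨x₀, y₀, i, j, hxy, hj, he, hq⟩ := val_findDecomp_some hr hv
    obtain ⟨rfl, rfl⟩ := Prod.mk.inj he
    obtain ⟨hy₀, hlasso, -⟩ := shortestForms_sound hv hxy
    obtain ⟨x', y', A, hw, h1, h2, h3⟩ := (reach_decompFA h).1 hq
    obtain ⟨rfl, rfl⟩ := dollarWord_inj hw
    refine ⟨_, _, A, rfl, hlen, h1, h2, h3.trans ?_⟩
    rw [upMem_eq_of_lasso (wpow_ne_nil hy₀ hj) hv
      ((lasso_wpow hy₀ i (wpow_ne_nil hy₀ hj)).trans hlasso), hb]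
    cases b <;> simp
  -- A failed search excludes all decompositions of the given kind that are made of powers of a
  -- shortest form.
  have hnone : ∀ {b : Bool} {x y : Word α} {i j : ℕ},
      (findDecomp ((decompFA b F).val (upMem L)) u v).val (upMem L) = none →
      (x, y) ∈ (shortestForms u v).val (upMem L) → 0 < j →
      ∀ A, (wpow y j).foldl δ ((x ++ wpow y i).foldl δ []) = (x ++ wpow y i).foldl δ [] →
      ((x ++ wpow y i).foldl δ [], A) ∈ F.progress →
      ¬ ((wpow y j).foldl (δ' ((x ++ wpow y i).foldl δ [])) [] ∈ A.acc ↔ b = true) := by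
    intro b x y i j hn hxy hj A h1 h2 h3
    obtain ⟨q, hq, hr⟩ := (reach_decompFA h (mem := upMem L)).2 ⟨_, _, A, rfl, h1, h2, h3⟩
    exact val_findDecomp_none hn hv (closed_decompFA h) hxy i hj hq hr
  cases hmem : upMem L u v with
  | true =>
    have hval : (analyze .under F u v).val (upMem L) =
        (findDecomp ((decompFA false F).val (upMem L)) u v).val (upMem L) := by
      simp [analyze, hmem]
    cases hf : (findDecomp ((decompFA false F).val (upMem L)) u v).val (upMem L) with
    | some r =>
      rw [hval, hf]
      exact hfind false hmem r hf
    | none =>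
      -- If no decomposition of a word of `L` is rejected, then all decompositions along one
      -- shortest form that loop in the leading automaton are accepted. So the Büchi automaton
      -- accepts the word, which then is no counterexample.
      refine absurd ⟨fun _ => ?_, fun _ => (upMem_iff hv).1 hmem⟩ hce
      obtain ⟨x, y, hy, -⟩ := shortestForms_complete (mem := upMem L) (u := u) hv
      obtain ⟨x, y, hxy⟩ : ∃ x y, (x, y) ∈ (shortestForms u v).val (upMem L) := by
        obtain ⟨x, y, hy, -, hforms⟩ := shortestForms_complete (mem := upMem L) (u := u) hv
        obtain ⟨x', i, hx', -⟩ := hforms [] y rfl hy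
        exact ⟨_, _, hx'⟩
      obtain ⟨hy, hlasso, -⟩ := shortestForms_sound hv hxy
      rw [← hlasso]
      refine mem_buildBA_of_forall h hy fun i j A hj h1 h2 => ?_
      by_contra hacc
      exact hnone hf hxy hj A h1 h2 (by simpa using hacc)
  | false =>
    have hval : (analyze .under F u v).val (upMem L) =
        (findDecomp ((decompFA true F).val (upMem L)) u v).val (upMem L) := by
      simp only [analyze, val_bind, val_askMem, hmem,
        Bool.false_eq_true, if_false]
      split
      · rename_i hr; rw [hr]; rfl
      · rename_i hr; rw [hr]; rfl
    cases hf : (findDecomp ((decompFA true F).val (upMem L)) u v).val (upMem L) with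
    | some r =>
      rw [hval, hf]
      exact hfind true hmem r hf
    | none =>
      have hnot : u ++ₛ Stream'.cycle v hv ∉ L := fun hL => by
        rw [(upMem_iff hv).2 hL] at hmem; cases hmem
      have hin : u ++ₛ Stream'.cycle v hv ∈ ((buildBA .under F).val (upMem L)).omegaLang := by
        by_contra hni
        exact hce ⟨fun h => absurd h hnot, fun h => absurd h hni⟩
      -- The word is accepted by the Büchi automaton, so an accepted decomposition exists among
      -- those that have been searched.
      obtain ⟨x, y, i, j, A, hxy, hj, h1, h2, h3⟩ := exists_accepted_decomp h hv hin
      exact (hnone hf hxy hj A h1 h2 (by simpa using h3)).elim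

theorem within_analyze (h : F.IsFamily δ δ') (hm : 2 ≤ m) (hs : F.Small m) (hv : v ≠ [])
    (huv : u.length + v.length ≤ m) : (analyze .under F u v).Within mem (m ^ 310) := by
  have hfind : ∀ b : Bool, (findDecomp ((decompFA b F).val mem) u v).Within mem (m ^ 300) :=
    fun b => within_findDecomp hm (closed_decompFA h) (small_decompFA hm hs) hv huv
  unfold analyze
  refine Prog.Within.bind_pow hm (within_askMem_pow hm _ _ 0) (b := 309) ?_ (by omega) (by omega)
  refine Prog.Within.ite (fun _ => ?_) fun _ => ?_
  · exact Prog.Within.bind_pow hm (within_decompFA hm hs) (hfind false) (by omega) (by omega)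
  · refine Prog.Within.bind_pow hm (within_decompFA hm hs) (b := 308) ?_ (by omega) (by omega)
    refine Prog.Within.bind_pow hm (hfind true) (b := 0) ?_ (by omega) (by omega)
    split <;> exact within_pure _ _

end

/-! ## Refinement of the learner -/

section

variable {α : Type} [DecidableEq α] {mem : Word α → Word α → Bool} {m : ℕ} {sig : List α}
  {S : Storage} {K : Kind} {ℓ : ℕ} {D : Learner α} {M : FA α (Word α)}

namespace Learner

/-- A state has been added to the leading automaton, or to one of the progress automata while the
leading automaton remains the same. -/
def Step (D D' : Learner α) : Prop :=
  D'.lead.stateList.length = D.lead.stateList.length + 1 ∨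
  ∃ u C C', (u, C) ∈ D.progress ∧ D' = D.update u C' ∧
    C'.stateList.length = C.stateList.length + 1

theorem within_newLead (hm : 2 ≤ m) {lead : Classifier α (Word α × Word α)} {x : Word α}
    (hl : lead.Shape mem leadTE) (hn : lead.stateList.length ≤ m) (hp : D.progress.length ≤ m) :
    (D.newLead S K lead x).Within mem (m ^ 10) := by
  have key : (do
      let states ← lead.states
      let progress ← mapL (fun s => pure (s, Classifier.initial S)) states
      pure { lead := lead, progress := progress } : Prog α (Learner α)).Within mem (m ^ 10) := by
    refine Prog.Within.bind_pow hm (Classifier.within_states hm hl hn) (b := 9) ?_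
      (by omega) (by omega)
    refine Prog.Within.bind_pow hm (a := 3) (b := 0) ?_ (within_pure _ _) (by omega) (by omega)
    rw [Classifier.val_states]
    exact within_mapL_pow hm (b := 0) (le_pow_one hn) (fun _ _ => within_pure _ _) (by omega)
  cases K with
  | periodic =>
    exact Prog.Within.bind_pow hm (within_app_pow hm (le_pow_one hp) (c := 2) (by omega)) (b := 0)
      (within_pure _ _) (by omega) (by omega)
  | syntactic => exact key
  | recurrent => exact key

theorem map_update (h : (D.progress.map Prod.fst).Nodup) {u : Word α} {C : Classifier α (Word α)}
    (hu : (u, C) ∈ D.progress) (f : Classifier α (Word α) → Classifier α (Word α)) :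
    D.progress.map (fun c => if c.1 = u then (c.1, f c.2) else c) = (D.update u (f C)).progress := by
  refine List.map_congr_left fun c hc => ?_
  split_ifs with hcu
  · rw [List.inj_on_of_nodup_map h hc hu hcu]
  · rfl

/-- Sizes of the data of the learner. -/
structure Bounded (mem : Word α → Word α → Bool) (sig : List α) (ℓ m : ℕ) (D : Learner α) :
    Prop where
  two_le : 2 ≤ m
  sig : sig.length ≤ m
  len : ℓ ≤ m
  lead : ∀ C : Classifier α (Word α × Word α), C.Good mem leadTE leadLen ℓ →
    C.stateList.length ≤ m

theorem Inv.length_key_lt (h : D.Inv mem sig K ℓ) (hb : D.Bounded mem sig ℓ m)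
    {c : Word α × Classifier α (Word α)} (hc : c ∈ D.progress) : c.1.length < m :=
  (h.lead.length_lt _ ((h.mem_keys _).1 (List.mem_map_of_mem hc))).trans_le (hb.lead _ h.lead)

theorem Inv.psize_key_le (h : D.Inv mem sig K ℓ) (hb : D.Bounded mem sig ℓ m)
    {c : Word α × Classifier α (Word α)} (hc : c ∈ D.progress) : psize α c.1 ≤ m ^ 2 := by
  have h1 := h.length_key_lt hb hc
  have h2 := hb.two_le
  rw [psize_word]
  nlinarith

end Learner

open Learner

/-- By `hacc`, the progress automaton of the state of `x` is wrong about `y` relative to `x`. Either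
the word `x` and its state disagree about `y^ω`, which is an error of the leading automaton, or the
error persists when `x` is replaced by its state and belongs to the progress automaton. In both
cases the absence of a breakpoint would mean that there is no error. -/
theorem refine_spec (h : D.Inv mem sig K ℓ) (hsig : ∀ a, a ∈ sig)
    (hM : (D.lead.toDFA sig leadTE).val mem = Sum.inr M)
    (hall : ∀ c ∈ D.progress, ∃ A, (c.2.toDFA sig (progressTE K M c.1)).val mem = Sum.inr A)
    (hb : D.Bounded mem sig ℓ m) (hF : (D.fdfa mem sig K M).Small m)
    (hp : ∀ c ∈ D.progress, c.2.stateList.length ≤ m) {x y : Word α} {A : FA α (Word α)}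
    (hxy : x.length + y.length ≤ ℓ)
    (hloop : y.foldl (D.lead.next mem leadTE) (x.foldl (D.lead.next mem leadTE) []) =
      x.foldl (D.lead.next mem leadTE) [])
    (hA : (x.foldl (D.lead.next mem leadTE) [], A) ∈ (D.fdfa mem sig K M).progress)
    (hacc : y.foldl (D.progressNext mem K M (x.foldl (D.lead.next mem leadTE) [])) [] ∈ A.acc ↔
      mem x y = false) :
    ∃ D', (refine S K D (D.fdfa mem sig K M) x y).val mem = some D' ∧ D'.Inv mem sig K ℓ ∧
      D.Step D' ∧ (refine S K D (D.fdfa mem sig K M) x y).Within mem (m ^ 60) := by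
  have hm := hb.two_le
  have hfam := h.isFamily hsig hM hall
  obtain ⟨hM1, hM2, -, -, -, hM6⟩ := Classifier.val_toDFA_inr hsig hM
  set δ := D.lead.next mem leadTE with hδ
  have hMdfa : M.IsDFA δ := h.lead.isDFA hsig hM
  have hMs : M.Small α m := hF.lead
  have hlen : D.lead.stateList.length ≤ m := hb.lead _ h.lead
  have hmm : m ≤ m ^ 3 := le_pow_self hm le_rfl (by omega)
  have hx : x.length ≤ m := by have := hb.len; omega
  have hy : y.length ≤ m := by have := hb.len; omega
  have hlead : (D.fdfa mem sig K M).lead = M := rfl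
  have hreach : (M.reach x).val mem = x.foldl δ [] := by rw [hMdfa.val_reach, hM2]
  have hwreach : (M.reach x).Within mem (m ^ 9) :=
    within_run hm hMs.trans hMs.size_source _ hx
  have hlt : ∀ s ∈ M.states, s.length < m := fun s hs =>
    (h.lead.length_lt s (hM1 ▸ hs)).trans_le hlen
  have hnil : [] ∈ M.states := hM2 ▸ hMdfa.init
  set q₀ := x.foldl δ [] with hq₀
  have hq₀M : q₀ ∈ M.states := hMdfa.foldl_mem hnil x
  by_cases hmem : mem x y = mem q₀ y
  · obtain ⟨c, hc, he⟩ := List.mem_map.1 hA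
    obtain ⟨u, C⟩ := c
    obtain ⟨rfl, rfl⟩ := Prod.mk.inj he
    obtain ⟨B, hB⟩ := hall _ hc
    have hgood : C.Good mem (progressTE K M q₀) List.length ℓ := h.progress M (.inr hM) _ hc
    have hBdfa := hgood.isDFA hsig hB
    obtain ⟨hB1, hB2, -, -, -, hB6⟩ := Classifier.val_toDFA_inr hsig hB
    have hAdfa := hfam.progress _ hA
    have hAs : (progressDFA mem sig K M (q₀, C)).Small α m := hF.progress _ hA
    rw [h.progressNext_eq hc] at hacc
    have hAB := progressDFA_of_eq (mem := mem) hB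
    have hAinit : (progressDFA mem sig K M (q₀, C)).init = [] := by rw [hAB]; exact hB2
    have hAst : (progressDFA mem sig K M (q₀, C)).states = C.stateList := by rw [hAB]; exact hB1
    have hAdfa : (progressDFA mem sig K M (q₀, C)).IsDFA (C.next mem (progressTE K M q₀)) := by
      have := hfam.progress _ hA
      rwa [h.progressNext_eq hc] at this
    have hu : q₀.foldl δ [] = q₀ := h.lead.foldl_self (hM1 ▸ hq₀M)
    have hlookup : lookup q₀ (D.fdfa mem sig K M).progress =
        some (progressDFA mem sig K M (q₀, C)) := lookup_of_mem hfam.nodup hA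
    have hte : TEWithin mem (progressTE K M q₀) List.length m :=
      within_progressTE hm (hlt _ hq₀M).le hMdfa hMs
    have hltA : ∀ s ∈ (progressDFA mem sig K M (q₀, C)).states, s.length < m := fun s hs => by
      rw [hAst] at hs
      exact (hgood.length_lt s hs).trans_le (hp _ hc)
    have hwbp := within_breakpoint (ex := fun w => w) hm hte hAdfa (hAs.mono hmm) hltA hAdfa.init hy
      fun w' hw' => hw'.trans hy
    cases hbp : (breakpoint (progressTE K M q₀) (fun w => w) (progressDFA mem sig K M (q₀, C))
        (progressDFA mem sig K M (q₀, C)).init y).val mem with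
    -- Without a breakpoint `y` and the state it reaches have the same verdict. As `y` loops, its
    -- verdict is the answer for `q₀` and `y`, so the progress automaton would be right.
    | none =>
      have hG := val_breakpoint_none hAdfa (verdict mem K δ q₀) (fun x y w hxy => by
        rw [← verdict_progressTE hMdfa hM2, ← verdict_progressTE hMdfa hM2, hxy])
        hAdfa.init hbp
      rw [hAinit, List.nil_append] at hG
      have hv : verdict mem K δ q₀ y = some (mem q₀ y) := by
        have : (q₀ ++ y).foldl δ [] = q₀ := by rw [List.foldl_append, hu, hloop]
        cases K <;> simp only [verdict, this, decide_true, Bool.true_and, if_true]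
      have hst : y.foldl (C.next mem (progressTE K M q₀)) [] ∈ B.states :=
        hBdfa.foldl_mem (hB2 ▸ hBdfa.init) y
      rw [hAB, List.mem_filter, isAccepting_iff hMdfa hM2 hu, ← hG, hv, hmem] at hacc
      cases hmu : mem q₀ y <;> simp [hmu, hst] at hacc
    | some r =>
      obtain ⟨q, z, e, dq, dz⟩ := r
      -- The experiment is a suffix of `y`, so it respects the length bound of the invariant.
      obtain ⟨s, hs, a, w', hw', rfl, rfl, rfl, rfl, rfl, hne⟩ := val_breakpoint_some hAdfa hAdfa.init hbp
      rw [hAst] at hs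
      obtain ⟨hgood', hperm⟩ := hgood.refineBy hs (hB6 s hs a) hne (hw'.trans (by omega))
      set q := C.next mem (progressTE K M q₀) s a
      set C' := ((C.refineBy (progressTE K M q₀) q (s ++ [a]) e ((progressTE K M q₀ q e).val mem)
        ((progressTE K M q₀ (s ++ [a]) e).val mem)).val mem)
      have hlow : e.length ≤ m := hw'.trans hy
      refine ⟨D.update q₀ C', ?_, h.update fun M' hM' => ?_, .inr ⟨q₀, C, C', hc, rfl, ?_⟩, ?_⟩
      · simp only [refine, val_bind, hlead, hreach, val_askMem, hmem, val_assoc_eq_lookup, hlookup,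
          bne_self_eq_false, Bool.false_eq_true, if_false, hbp, val_mapL, val_ite, val_peq,
          decide_eq_true_eq, val_pure]
        refine congrArg some ?_
        exact congrArg (fun p => ({ lead := D.lead, progress := p } : Learner α))
          (map_update h.nodup hc fun C => ((C.refineBy (progressTE K M q₀) q (s ++ [a]) e
            ((progressTE K M q₀ q e).val mem)
            ((progressTE K M q₀ (s ++ [a]) e).val mem)).val mem))
      · obtain rfl | hM' := hM'
        · exact hgood'
        · obtain rfl := Sum.inr.inj (hM.symm.trans hM')
          exact hgood'
      · rw [hperm.length_eq, List.length_cons]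
      · unfold refine
        refine Prog.Within.bind_pow hm hwreach (b := 59) ?_ (by omega) (by omega)
        refine Prog.Within.bind_pow hm (within_askMem_pow hm _ _ 0) (b := 58) ?_ (by omega) (by omega)
        refine Prog.Within.bind_pow hm (within_askMem_pow hm _ _ 0) (b := 57) ?_ (by omega) (by omega)
        rw [hlead, hreach, val_askMem, val_askMem, hmem, bne_self_eq_false]
        refine Prog.Within.ite (fun h => by simp at h) fun _ => ?_
        refine Prog.Within.bind_pow hm (within_assoc_pow hm (hF.key _ hA) hF.length) (b := 56) ?_
          (by omega) (by omega)
        rw [val_assoc_eq_lookup, hlookup]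
        refine Prog.Within.bind_pow hm hwbp (b := 55) ?_ (by omega) (by omega)
        rw [hbp]
        refine Prog.Within.bind_pow hm (a := 50) (b := 0) ?_ (within_pure _ _) (by omega) (by omega)
        refine within_mapL_pow hm (b := 46) (a := 1) ?_ (fun c hc' => ?_) (by omega)
        · rw [h.length_progress]; exact le_pow_one hlen
        refine Prog.Within.bind_pow hm ((within_peq _ _).mono (h.psize_key_le hb hc')) (b := 45) ?_
          (by omega) (by omega)
        refine Prog.Within.ite (fun hcu => ?_) fun _ => within_pure _ _
        have hcu : c.1 = q₀ := by simpa using hcu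
        obtain rfl := List.inj_on_of_nodup_map h.nodup hc' hc hcu
        refine Prog.Within.bind_pow hm (a := 43) (b := 0) ?_ (within_pure _ _) (by omega) (by omega)
        refine Classifier.within_refineBy hm hte hgood.shape (hp _ hc)
          (fun e he => (hgood.len_le e he).trans hb.len) (fun s hs => ?_) ?_ _ hlow _ _
        · exact (hltA s (hAst ▸ hs)).le
        · simpa using hltA s (hAst ▸ hs)
  · have hwbp := within_breakpoint (mem := mem) (ex := fun w => (w, y)) hm (within_leadTE hm) hMdfa
      (hMs.mono hmm) hlt hMdfa.init hx fun w' hw' => by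
        have := hb.len
        simp only [leadLen]; omega
    cases hbp : (breakpoint leadTE (fun w => (w, y)) M M.init x).val mem with
    -- Without a breakpoint `x` and the state it reaches would agree about `y`.
    | none =>
      have hG := val_breakpoint_none hMdfa (fun z => mem z y) (fun x y w hxy => by
        simpa using hxy) hMdfa.init hbp
      rw [hM2] at hG
      exact absurd hG hmem
    | some r =>
      obtain ⟨q, z, e, dq, dz⟩ := r
      obtain ⟨s, hs, a, w', hw', rfl, rfl, rfl, rfl, rfl, hne⟩ := val_breakpoint_some hMdfa hMdfa.init hbp
      rw [hM1] at hs
      have hlw : leadLen (w', y) ≤ ℓ := by simp only [leadLen]; omega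
      obtain ⟨hgood', hperm⟩ := h.lead.refineBy hs (hM6 s hs a) hne hlw
      set lead := (D.lead.refineBy leadTE (δ s a) (s ++ [a]) (w', y)
        ((leadTE (δ s a) (w', y)).val mem) ((leadTE (s ++ [a]) (w', y)).val mem)).val mem
      have hsl : (s ++ [a]).length ≤ m := by simpa using hlt s (hM1 ▸ hs)
      refine ⟨(D.newLead S K lead (s ++ [a])).val mem, ?_, h.newLead hgood' hperm, .inl ?_, ?_⟩
      · have hbne : (mem x y != mem q₀ y) = true := by simpa using hmem
        simp only [refine, val_bind, hlead, hreach, val_askMem, hbne, if_true, hbp, val_pure]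
        rfl
      · rw [val_newLead_lead, hperm.length_eq, List.length_cons]
      · unfold refine
        refine Prog.Within.bind_pow hm hwreach (b := 59) ?_ (by omega) (by omega)
        refine Prog.Within.bind_pow hm (within_askMem_pow hm _ _ 0) (b := 58) ?_ (by omega) (by omega)
        refine Prog.Within.bind_pow hm (within_askMem_pow hm _ _ 0) (b := 57) ?_ (by omega) (by omega)
        rw [hlead, hreach, val_askMem, val_askMem]
        refine Prog.Within.ite (fun _ => ?_) fun h => absurd (by simpa using h) hmem
        refine Prog.Within.bind_pow hm hwbp (b := 55) ?_ (by omega) (by omega)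
        rw [hbp]
        refine Prog.Within.bind_pow hm (a := 43) (b := 54) ?_ ?_ (by omega) (by omega)
        · exact Classifier.within_refineBy hm (within_leadTE hm) h.lead.shape hlen
            (fun e he => (h.lead.len_le e he).trans hb.len)
            (fun s hs => (hlt s (hM1 ▸ hs)).le) hsl _ (hlw.trans hb.len) _ _
        -- The bound `hb.lead` holds for every good learner of the leading automaton, hence also for
        -- the refined one.
        · refine Prog.Within.bind_pow hm (within_newLead hm hgood'.shape (hb.lead _ hgood') ?_)
            (b := 0) (within_pure _ _) (by omega) (by omega)
          rw [h.length_progress]; exact hlen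

end

/-! ## The rounds of the algorithm -/

section

variable {α β γ : Type} {mem : Word α → Word α → Bool} {m : ℕ}

/-- Within `c` steps and without equivalence queries, `p` comes to the point where it continues
like `q`. -/
def Prog.LeadsTo (mem : Word α → Word α → Bool) (c : ℕ) (p q : Prog α β) : Prop :=
  ∀ equiv h, ∃ t h', p.eval mem equiv h = ((q.eval mem equiv h').1,
    t + (q.eval mem equiv h').2.1, (q.eval mem equiv h').2.2) ∧ t ≤ c ∧ longestCE h' = longestCE h

theorem leadsTo_refl (c : ℕ) (p : Prog α β) : p.LeadsTo mem c p :=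
  fun _ h => ⟨0, h, by simp, Nat.zero_le _, rfl⟩

theorem Prog.LeadsTo.bind_pow (hm : 2 ≤ m) {p : Prog α β} {f : β → Prog α γ} {q : Prog α γ}
    {a b c : ℕ} (h : p.Within mem (m ^ a)) (h' : (f (p.val mem)).LeadsTo mem (m ^ b) q)
    (ha : a < c) (hb : b < c) : (p >>= f).LeadsTo mem (m ^ c) q := by
  intro equiv g
  obtain ⟨t, g', he, ht, hl⟩ := h.eval equiv g
  obtain ⟨t', g'', he', ht', hl'⟩ := h' equiv g'
  refine ⟨t + t', g'', ?_, (Nat.add_le_add ht ht').trans (pow_add_pow_le hm le_rfl le_rfl ha hb),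
    hl'.trans hl⟩
  rw [Prog.eval_bind, he, he', Nat.add_assoc]

theorem Prog.LeadsTo.tick_pow (hm : 2 ≤ m) {p q : Prog α β} {a c : ℕ}
    (h : p.LeadsTo mem (m ^ a) q) (ha : a < c) : (Prog.tick p).LeadsTo mem (m ^ c) q := by
  intro equiv g
  obtain ⟨t, g', he, ht, hl⟩ := h equiv g
  refine ⟨t + 1, g', ?_, (Nat.add_le_add ht le_rfl).trans
    (pow_add_pow_le hm le_rfl (one_le_pow' hm a) ha ha), hl⟩
  rw [Prog.eval, he]
  simp only [Nat.add_right_comm]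

end

section

variable {α : Type} [DecidableEq α] {sig : List α} {S : Storage} {K : Kind} {D : Learner α}
  {L : Set (Stream' α)} {mem : Word α → Word α → Bool}

/-- What the algorithm does with the answer to an equivalence query. -/
def afterEqu (S : Storage) (K : Kind) (D : Learner α) (F : FDFA α) (B : BA α) :
    Option (Word α × Word α) → Prog α (Learner α ⊕ Outcome α)
  | none => pure (.inr (.returned B))
  | some (u, v) => do
    match ← analyze .under F u v with
    | none => pure (.inr .error)
    | some (u', v') =>
      match ← refine S K D F u' v' with
      | none => pure (.inr .error)
      | some D' => pure (.inl D')

/-- The scale on which sizes and costs are measured when the longest counterexample so far has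
length `ℓ`. -/
@[irreducible] noncomputable def scale (L : Set (Stream' α)) (sig : List α) (ℓ : ℕ) : ℕ :=
  leadIndex L + progressIndex L + sig.length + ℓ + 2

theorem two_le_scale (L : Set (Stream' α)) (sig : List α) (ℓ : ℕ) : 2 ≤ scale L sig ℓ := by
  unfold scale; omega

theorem scale_mono (L : Set (Stream' α)) (sig : List α) {ℓ ℓ' : ℕ} (h : ℓ ≤ ℓ') :
    scale L sig ℓ ≤ scale L sig ℓ' := by
  unfold scale; omega

namespace Learner

/-- The exponent comes from the length of experiments. The family is small on the level `scale ^ 6`,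
and the decompositions found for it have length at most the 20th power of that. -/
theorem Inv.bounded (hL : IsOmegaRegular L) (ℓ : ℕ) :
    D.Bounded (upMem L) sig (scale L sig ℓ ^ 120) (scale L sig ℓ ^ 120) where
  two_le := two_le_pow (two_le_scale L sig ℓ) (by omega)
  sig := le_pow_self (two_le_scale L sig ℓ) (by unfold scale; omega) (by omega)
  len := le_rfl
  lead C hC := (length_le_leadIndex_of_good hL hC).trans
    (le_pow_self (two_le_scale L sig ℓ) (by unfold scale; omega) (by omega))

variable {ℓ ℓ' : ℕ}

theorem Inv.length_lead_scale (hL : IsOmegaRegular L) (h : D.Inv (upMem L) sig K ℓ') :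
    D.lead.stateList.length ≤ scale L sig ℓ :=
  (h.length_lead hL).trans (by unfold scale; omega)

theorem Inv.length_progress_scale (hL : IsOmegaRegular L) (h : D.Inv (upMem L) sig K ℓ')
    (hsig : ∀ a, a ∈ sig) {M : FA α (Word α)}
    (hM : (D.lead.toDFA sig leadTE).val (upMem L) = Sum.inr M)
    {c : Word α × Classifier α (Word α)} (hc : c ∈ D.progress) :
    c.2.stateList.length ≤ scale L sig ℓ ^ 2 :=
  (h.length_of_mem hL hsig (.inr hM) hc).trans (pow_mul_pow_le (two_le_scale L sig ℓ)
    (a := 1) (b := 1) (le_pow_one (by unfold scale; omega)) (le_pow_one (by unfold scale; omega))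
    (by omega))

theorem Step.potential_lt (hL : IsOmegaRegular L) (h : D.Inv (upMem L) sig K ℓ)
    (hsig : ∀ a, a ∈ sig) {M : FA α (Word α)}
    (hM : (D.lead.toDFA sig leadTE).val (upMem L) = Sum.inr M) {D' : Learner α}
    (h' : D'.Inv (upMem L) sig K ℓ') (hs : D.Step D') :
    D'.potential (leadIndex L) (leadIndex L * progressIndex L) <
      D.potential (leadIndex L) (leadIndex L * progressIndex L) := by
  obtain hs | ⟨u, C, C', hu, rfl, hC⟩ := hs
  · exact potential_newLead hs (h'.length_lead hL)
  · exact h.potential_update hu hC (h.length_lead hL) fun c hc =>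
      h'.length_of_mem hL hsig (.inr hM) hc

theorem Inv.small_scale (hL : IsOmegaRegular L) (h : D.Inv (upMem L) sig K ℓ')
    (hsig : ∀ a, a ∈ sig) {M : FA α (Word α)}
    (hM : (D.lead.toDFA sig leadTE).val (upMem L) = Sum.inr M)
    (hall : ∀ c ∈ D.progress,
      ∃ A, (c.2.toDFA sig (progressTE K M c.1)).val (upMem L) = Sum.inr A) (ℓ : ℕ) :
    (D.fdfa (upMem L) sig K M).Small (scale L sig ℓ ^ 6) := by
  have h2 := two_le_scale L sig ℓ
  have := h.small_fdfa hsig (m := scale L sig ℓ ^ 2) (two_le_pow h2 (by omega)) hM hall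
    (le_pow_self h2 (by unfold scale; omega) (by omega))
    (le_pow_self h2 (h.length_lead_scale hL) (by omega))
    fun c hc => h.length_progress_scale hL hsig hM hc
  rwa [← pow_mul] at this

end Learner

theorem FDFA.Small.mono {m m' : ℕ} {F : FDFA α} (h : F.Small m) (hm : m ≤ m') : F.Small m' where
  lead := h.lead.mono hm
  length := h.length.trans hm
  progress e he := (h.progress e he).mono hm
  key e he := (h.key e he).trans hm

open Learner

theorem within_afterEqu {m : ℕ} (hm : 2 ≤ m) {F : FDFA α}
    {B : BA α} {u v u' v' : Word α} {D' : Learner α} {a b c : ℕ}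
    (h : (analyze .under F u v).Within mem (m ^ a))
    (ha : (analyze .under F u v).val mem = some (u', v'))
    (h' : (refine S K D F u' v').Within mem (m ^ b))
    (hr : (refine S K D F u' v').val mem = some D') (hac : a < c) (hbc : b + 1 < c) :
    (afterEqu S K D F B (some (u, v))).Within mem (m ^ c) := by
  unfold afterEqu
  refine Prog.Within.bind_pow hm h (b := b + 1) ?_ hac hbc
  rw [ha]
  refine Prog.Within.bind_pow hm h' (b := 0) ?_ (by omega) (by omega)
  rw [hr]
  exact within_pure _ _

/-- The data are refined after every counterexample. -/
theorem afterEqu_some (hL : IsOmegaRegular L) (hsig : ∀ a, a ∈ sig) {ℓ : ℕ}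
    (h : D.Inv (upMem L) sig K (scale L sig ℓ ^ 120)) {M : FA α (Word α)}
    (hM : (D.lead.toDFA sig leadTE).val (upMem L) = Sum.inr M)
    (hall : ∀ c ∈ D.progress,
      ∃ A, (c.2.toDFA sig (progressTE K M c.1)).val (upMem L) = Sum.inr A)
    {u v : Word α} (hv : v ≠ []) (huv : u.length + v.length ≤ ℓ)
    (hce : ¬ (u ++ₛ Stream'.cycle v hv ∈ L ↔ u ++ₛ Stream'.cycle v hv ∈
      ((buildBA .under (D.fdfa (upMem L) sig K M)).val (upMem L)).omegaLang)) (B : BA α) {c : ℕ} (hc : 7201 < c) :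
    ∃ D', (afterEqu S K D (D.fdfa (upMem L) sig K M) B (some (u, v))).val (upMem L) = .inl D' ∧
      D'.Inv (upMem L) sig K (scale L sig ℓ ^ 120) ∧ D.Step D' ∧
      (afterEqu S K D (D.fdfa (upMem L) sig K M) B (some (u, v))).Within (upMem L)
        (scale L sig ℓ ^ c) := by
  have h2 := two_le_scale L sig ℓ
  have hfam := h.isFamily hsig hM hall
  have hF := h.small_scale hL hsig hM hall ℓ
  have h6 : 2 ≤ scale L sig ℓ ^ 6 := two_le_pow h2 (by omega)
  have huv' : u.length + v.length ≤ scale L sig ℓ ^ 6 :=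
    le_pow_self h2 (huv.trans (by unfold scale; omega)) (by omega)
  obtain ⟨x, y, A, ha, hxy, hloop, hA, hacc⟩ := analyze_under hfam h6 hF hv huv' hce
  rw [← pow_mul] at hxy
  have hle : scale L sig ℓ ^ 6 ≤ scale L sig ℓ ^ 120 := le_pow_of_le h2 le_rfl (by omega)
  obtain ⟨D', hr, hinv, hstep, hw⟩ := refine_spec (S := S) h hsig hM hall (Inv.bounded hL ℓ)
    (hF.mono hle) (fun c hc => (h.length_progress_scale (ℓ := ℓ) hL hsig hM hc).trans
      (le_pow_of_le h2 le_rfl (by omega))) hxy hloop hA hacc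
  refine ⟨D', ?_, hinv, hstep, ?_⟩
  · simp only [afterEqu, val_bind, ha, hr, val_pure]
  · have hwa := within_analyze (mem := upMem L) hfam h6 hF hv huv'
    rw [← pow_mul] at hwa
    -- Refinement is charged with base `scale ^ 120` and exponent 60, that is, 7200 on the scale;
    -- this is where the condition on `c` comes from.
    rw [← pow_mul] at hw
    exact within_afterEqu h2 hwa ha hw hr (by omega) (by omega)

/-- The unassigned word extends a state by one letter, as `Good.extend` requires. The round ends
before any equivalence query is posed. -/
theorem round_of_lead {m : ℕ} (h : D.Inv mem sig K m) (hb : D.Bounded mem sig m m) {x : Word α}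
    (hx : (D.lead.toDFA sig leadTE).val mem = Sum.inl x) :
    ∃ D', (round sig S K .under D).val mem = .inl D' ∧ D'.Inv mem sig K m ∧
      D'.lead.stateList.length = D.lead.stateList.length + 1 ∧
      (round sig S K .under D).Within mem (m ^ 60) := by
  obtain ⟨p, hp, a, rfl, hnone⟩ := Classifier.val_toDFA_inl hx
  obtain ⟨hgood, hperm⟩ := h.lead.extend hp hnone
  have hm := hb.two_le
  have hlt : ∀ s ∈ D.lead.stateList, s.length < m := fun s hs =>
    (h.lead.length_lt s hs).trans_le (hb.lead _ h.lead)
  refine ⟨_, ?_, h.newLead (S := S) hgood hperm, ?_, ?_⟩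
  · simp only [round, val_tick, val_bind, hx, val_pure]
  · rw [val_newLead_lead, hperm.length_eq, List.length_cons]
  · unfold round
    refine Prog.Within.tick_pow hm (a := 59) ?_ (by omega)
    refine Prog.Within.bind_pow hm (Classifier.within_toDFA hm (within_leadTE hm) h.lead.shape
      (hb.lead _ h.lead) h.lead.len_le hlt hb.sig) (b := 58) ?_ (by omega) (by omega)
    rw [hx]
    refine Prog.Within.bind_pow hm (Classifier.within_extend hm (within_leadTE hm) h.lead.shape
      (hb.lead _ h.lead) h.lead.len_le (by simpa using hlt p hp)) (b := 57) ?_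
      (by omega) (by omega)
    refine Prog.Within.bind_pow hm (within_newLead hm hgood.shape (hb.lead _ hgood) ?_) (b := 0)
      (within_pure _ _) (by omega) (by omega)
    rw [h.length_progress]
    exact hb.lead _ h.lead

end

/-! ## A round after the leading automaton has been completed -/

section

variable {α : Type} [DecidableEq α] {mem : Word α → Word α → Bool} {m : ℕ} {sig : List α}
  {S : Storage} {K : Kind} {D : Learner α} {M : FA α (Word α)}

open Learner

theorem Learner.Inv.teWithin_progress (h : D.Inv mem sig K m) (hsig : ∀ a, a ∈ sig)
    (hb : D.Bounded mem sig m m) (hM : (D.lead.toDFA sig leadTE).val mem = Sum.inr M)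
    (hMs : M.Small α m) {c : Word α × Classifier α (Word α)} (hc : c ∈ D.progress) :
    TEWithin mem (progressTE K M c.1) List.length m :=
  within_progressTE hb.two_le (h.length_key_lt hb hc).le (h.lead.isDFA hsig hM) hMs

theorem Learner.Inv.within_toDFA_lead (h : D.Inv mem sig K m) (hb : D.Bounded mem sig m m) :
    (D.lead.toDFA sig leadTE).Within mem (m ^ 55) :=
  Classifier.within_toDFA hb.two_le (within_leadTE hb.two_le) h.lead.shape (hb.lead _ h.lead)
    h.lead.len_le (fun s hs => (h.lead.length_lt s hs).trans_le (hb.lead _ h.lead)) hb.sig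

theorem Learner.Inv.within_toDFA_progress (h : D.Inv mem sig K m) (hsig : ∀ a, a ∈ sig)
    (hb : D.Bounded mem sig m m) (hM : (D.lead.toDFA sig leadTE).val mem = Sum.inr M)
    (hMs : M.Small α m) (hp : ∀ c ∈ D.progress, c.2.stateList.length ≤ m) :
    (mapL (fun c : Word α × Classifier α (Word α) => do
      let A ← c.2.toDFA sig (progressTE K M c.1)
      pure (c.1, A)) D.progress).Within mem (m ^ 59) := by
  have hm := hb.two_le
  refine within_mapL_pow hm (a := 1) (b := 56) ?_ (fun c hc => ?_) (by omega)
  · rw [h.length_progress]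
    exact le_pow_one (hb.lead _ h.lead)
  · have hg := h.progress M (.inr hM) c hc
    exact Prog.Within.bind_pow hm (Classifier.within_toDFA hm
      (h.teWithin_progress hsig hb hM hMs hc) hg.shape (hp c hc) hg.len_le
      (fun s hs => (hg.length_lt s hs).trans_le (hp c hc)) hb.sig) (b := 0) (within_pure _ _)
      (by omega) (by omega)

/-- An incomplete progress automaton is extended. -/
theorem round_of_progress (h : D.Inv mem sig K m) (hsig : ∀ a, a ∈ sig)
    (hb : D.Bounded mem sig m m) (hM : (D.lead.toDFA sig leadTE).val mem = Sum.inr M)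
    (hMs : M.Small α m) (hp : ∀ c ∈ D.progress, c.2.stateList.length ≤ m)
    (hall : ¬ ∀ c ∈ D.progress, ∃ A, (c.2.toDFA sig (progressTE K M c.1)).val mem = Sum.inr A) :
    ∃ D', (round sig S K .under D).val mem = .inl D' ∧ D'.Inv mem sig K m ∧ D.Step D' ∧
      (round sig S K .under D).Within mem (m ^ 64) := by
  have hm := hb.two_le
  have hplen : D.progress.length ≤ m ^ 1 := by
    rw [h.length_progress]
    exact le_pow_one (hb.lead _ h.lead)
  set built := D.progress.map fun c =>
    (c.1, (c.2.toDFA sig (progressTE K M c.1)).val mem) with hbuilt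
  have hbv : (mapL (fun c : Word α × Classifier α (Word α) => (do
      let A ← c.2.toDFA sig (progressTE K M c.1)
      pure (c.1, A) : Prog α _)) D.progress).val mem = built := by
    simp only [val_mapL, val_bind, val_pure, hbuilt]
  set first : Word α × (Word α ⊕ FA α (Word α)) → Prog α (Option (Word α × Word α)) := fun c =>
    match c.2 with
    | .inl x => pure (some (c.1, x))
    | .inr _ => pure none with hfirst
  have hfind : ∃ r, (firstL first built).val mem = some r := by
    by_contra hno
    rw [not_exists] at hno
    have hnone := Option.eq_none_iff_forall_ne_some.2 hno
    rw [val_firstL, List.findSome?_eq_none_iff] at hnone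
    refine hall fun c hc => ?_
    have := hnone _ (List.mem_map_of_mem hc)
    cases hA : (c.2.toDFA sig (progressTE K M c.1)).val mem with
    | inl x => simp [hfirst, hA] at this
    | inr A => exact ⟨A, rfl⟩
  obtain ⟨⟨u, x⟩, hr⟩ := hfind
  obtain ⟨d, hd, he⟩ := List.exists_of_findSome?_eq_some ((val_firstL first built).symm.trans hr)
  obtain ⟨⟨u', C⟩, hc, rfl⟩ := List.mem_map.1 hd
  obtain ⟨rfl, hx⟩ : u' = u ∧ (C.toDFA sig (progressTE K M u')).val mem = Sum.inl x := by
    cases hA : (C.toDFA sig (progressTE K M u')).val mem with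
    | inl y => simpa [hfirst, hA] using he
    | inr A => simp [hfirst, hA] at he
  obtain ⟨p, hpC, a, rfl, hnone⟩ := Classifier.val_toDFA_inl hx
  have hgood : ∀ M', (K = .periodic ∨ (D.lead.toDFA sig leadTE).val mem = Sum.inr M') →
      C.Good mem (progressTE K M' u') List.length m := fun M' hM' => h.progress M' hM' _ hc
  -- In the periodic case the invariant quantifies over all leading automata, but the experiments do
  -- not depend on them; otherwise `M'` is the present one.
  have hte : ∀ M', (K = .periodic ∨ (D.lead.toDFA sig leadTE).val mem = Sum.inr M') →
      progressTE K M' u' = progressTE K M u' := by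
    rintro M' (rfl | hM')
    · rfl
    · rw [hM] at hM'
      cases hM'
      rfl
  set C' := (C.extend (progressTE K M u') (p ++ [a])).val mem with hC'
  obtain ⟨hgood', hperm⟩ := (hgood M (.inr hM)).extend hpC hnone
  refine ⟨D.update u' C', ?_, h.update fun M' hM' => ?_, .inr ⟨u', C, C', hc, rfl, ?_⟩, ?_⟩
  · unfold round
    simp only [val_tick, val_bind, hM]
    rw [hbv]
    generalize hg : Prog.val mem (firstL _ built) = r
    obtain rfl : r = some (u', p ++ [a]) := hg.symm.trans hr
    simp only [val_bind, val_mapL, val_peq, val_ite, val_pure, decide_eq_true_eq]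
    rw [map_update h.nodup hc fun C => (C.extend (progressTE K M u') (p ++ [a])).val mem]
    rfl
  · rw [hte M' hM']
    exact hgood'
  · rw [hperm.length_eq, List.length_cons]
  · unfold round
    refine Prog.Within.tick_pow hm (a := 63) ?_ (by omega)
    refine Prog.Within.bind_pow hm (h.within_toDFA_lead hb) (b := 62) ?_ (by omega) (by omega)
    rw [hM]
    refine Prog.Within.bind_pow hm (h.within_toDFA_progress hsig hb hM hMs hp) (b := 61) ?_
      (by omega) (by omega)
    rw [hbv]
    refine Prog.Within.bind_pow hm (a := 3) (b := 60) ?_ ?_ (by omega) (by omega)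
    · refine within_firstL_pow hm (a := 1) (b := 0) (by simpa [hbuilt] using hplen)
        (fun c _ => ?_) (by omega)
      rcases c with ⟨v, y | A⟩ <;> exact within_pure _ _
    · generalize hg : Prog.val mem (firstL _ built) = r
      obtain rfl : r = some (u', p ++ [a]) := hg.symm.trans hr
      dsimp only
      refine Prog.Within.bind_pow hm (a := 50) (b := 0) ?_ (within_pure _ _) (by omega) (by omega)
      refine within_mapL_pow hm (a := 1) (b := 47) hplen (fun c hc' => ?_) (by omega)
      refine Prog.Within.bind_pow hm ((within_peq c.1 u').mono (h.psize_key_le hb hc')) (b := 46)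
        ?_ (by omega) (by omega)
      rw [val_peq]
      refine Prog.Within.ite (fun hcu => ?_) fun _ => within_pure _ _
      obtain rfl : c.1 = u' := by simpa using hcu
      have hg := h.progress M (.inr hM) c hc'
      exact Prog.Within.bind_pow hm (Classifier.within_extend hm
        (h.teWithin_progress hsig hb hM hMs hc') hg.shape (hp c hc') hg.len_le
        (by simpa using ((hgood M (.inr hM)).length_lt p hpC).trans_le (hp _ hc))) (b := 0)
        (within_pure _ _) (by omega) (by omega)

/-- When all automata are complete, an equivalence query is posed. -/
theorem round_of_complete (h : D.Inv mem sig K m) (hsig : ∀ a, a ∈ sig)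
    (hb : D.Bounded mem sig m m) (hM : (D.lead.toDFA sig leadTE).val mem = Sum.inr M)
    (hF : (D.fdfa mem sig K M).Small m) (hp : ∀ c ∈ D.progress, c.2.stateList.length ≤ m)
    (hall : ∀ c ∈ D.progress, ∃ A, (c.2.toDFA sig (progressTE K M c.1)).val mem = Sum.inr A) :
    (round sig S K .under D).LeadsTo mem (m ^ 260)
      (askEqu ((buildBA .under (D.fdfa mem sig K M)).val mem) >>=
        afterEqu S K D (D.fdfa mem sig K M) ((buildBA .under (D.fdfa mem sig K M)).val mem)) := by
  have hm := hb.two_le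
  have hplen : D.progress.length ≤ m ^ 1 := by
    rw [h.length_progress]
    exact le_pow_one (hb.lead _ h.lead)
  set built := D.progress.map fun c =>
    (c.1, (c.2.toDFA sig (progressTE K M c.1)).val mem) with hbuilt
  have hbv : (mapL (fun c : Word α × Classifier α (Word α) => (do
      let A ← c.2.toDFA sig (progressTE K M c.1)
      pure (c.1, A) : Prog α _)) D.progress).val mem = built := by
    simp only [val_mapL, val_bind, val_pure, hbuilt]
  set first : Word α × (Word α ⊕ FA α (Word α)) → Prog α (Option (Word α × Word α)) := fun c =>
    match c.2 with
    | .inl x => pure (some (c.1, x))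
    | .inr _ => pure none with hfirst
  have hr : (firstL first built).val mem = none := by
    rw [val_firstL, List.findSome?_eq_none_iff]
    intro d hd
    obtain ⟨c, hc, rfl⟩ := List.mem_map.1 hd
    obtain ⟨A, hA⟩ := hall c hc
    simp [hfirst, hA]
  set fin : Word α × (Word α ⊕ FA α (Word α)) → Prog α (List (Word α × FA α (Word α))) := fun c =>
    match c.2 with
    | .inl _ => pure []
    | .inr A => do
        let acc ← filterL (isAccepting K M c.1) A.states
        pure [(c.1, { A with acc := acc })] with hfin
  have hfv : ∀ c ∈ D.progress,
      (fin (c.1, (c.2.toDFA sig (progressTE K M c.1)).val mem)).val mem =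
        [(c.1, progressDFA mem sig K M c)] := fun c hc => by
    obtain ⟨A, hA⟩ := hall c hc
    simp only [hfin, hA, val_bind, val_filterL, val_pure, progressDFA_of_eq hA]
  have hbind : (bindL fin built).val mem = (D.fdfa mem sig K M).progress := by
    rw [val_bindL, hbuilt, List.flatMap_map, List.flatMap_congr hfv, fdfa]
    exact List.flatMap_pure_eq_map _ _
  unfold round
  refine Prog.LeadsTo.tick_pow hm (a := 259) ?_ (by omega)
  refine Prog.LeadsTo.bind_pow hm (h.within_toDFA_lead hb) (b := 258) ?_ (by omega) (by omega)
  rw [hM]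
  refine Prog.LeadsTo.bind_pow hm (h.within_toDFA_progress hsig hb hM hF.lead hp) (b := 257) ?_
    (by omega) (by omega)
  rw [hbv]
  refine Prog.LeadsTo.bind_pow hm (a := 3) (b := 256) ?_ ?_ (by omega) (by omega)
  · refine within_firstL_pow hm (a := 1) (b := 0) (by simpa [hbuilt] using hplen)
      (fun c _ => ?_) (by omega)
    rcases c with ⟨v, y | A⟩ <;> exact within_pure _ _
  generalize hg : Prog.val mem (firstL _ built) = r
  obtain rfl : r = none := hg.symm.trans hr
  dsimp only
  refine Prog.LeadsTo.bind_pow hm (a := 40) (b := 255) ?_ ?_ (by omega) (by omega)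
  · refine within_bindL_pow hm (a := 1) (b := 34) (by simpa [hbuilt] using hplen)
      (fun d hd => ?_) (fun d hd => ?_) (by omega)
    · obtain ⟨c, hc, rfl⟩ := List.mem_map.1 hd
      obtain ⟨A, hA⟩ := hall c hc
      rw [hA]
      have hg := h.progress M (.inr hM) c hc
      have hst := (Classifier.val_toDFA_inr hsig hA).1
      refine Prog.Within.bind_pow hm (a := 33) (b := 0) ?_ (within_pure _ _) (by omega) (by omega)
      refine within_filterL_pow hm (a := 1) (b := 30) ?_ (fun s hs => ?_) (by omega)
      · rw [hst]
        exact le_pow_one (hp c hc)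
      · rw [hst] at hs
        exact within_isAccepting hm (h.lead.isDFA hsig hM) hF.lead (h.length_key_lt hb hc).le
          ((hg.length_lt s hs).trans_le (hp c hc)).le
    · obtain ⟨c, hc, rfl⟩ := List.mem_map.1 hd
      change ((fin _).val mem).length ≤ _
      rw [hfv c hc]
      exact one_le_pow' hm _
  generalize hg : Prog.val mem (bindL _ built) = r
  obtain rfl : r = (D.fdfa mem sig K M).progress := hg.symm.trans hbind
  refine Prog.LeadsTo.bind_pow hm (within_buildBA (F := D.fdfa mem sig K M) hm hF) (b := 254) ?_
    (by omega) (by omega)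
  convert leadsTo_refl _ _ using 3
  · rfl
  · rename_i r
    rcases r with _ | ⟨u, v⟩ <;> rfl

end

/-! ## Termination -/

section

variable {α : Type} [DecidableEq α] {sig : List α} {S : Storage} {K : Kind} {D : Learner α}
  {L : Set (Stream' α)}

open Learner

theorem le_longestCE_equ (B : BA α) (r : Option (Word α × Word α)) (h : Log α) :
    longestCE h ≤ longestCE (.equ B r :: h) := by
  rcases r with _ | ⟨u, v⟩
  · exact le_rfl
  · exact le_max_right _ _

/-- A round returns a correct automaton, or it refines the data. -/
theorem round_spec (hL : IsOmegaRegular L) (hsig : ∀ a, a ∈ sig) (τ : BATeacher L) (h : Log α)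
    (hD : D.Inv (upMem L) sig K (scale L sig (longestCE h) ^ 120)) :
    ∃ t h', longestCE h ≤ longestCE h' ∧ t ≤ scale L sig (longestCE h') ^ 32000 ∧
      ((∃ D', (round sig S K .under D).eval (upMem L) τ.answer h = (.inl D', t, h') ∧
        D'.Inv (upMem L) sig K (scale L sig (longestCE h') ^ 120) ∧
        D'.potential (leadIndex L) (leadIndex L * progressIndex L) <
          D.potential (leadIndex L) (leadIndex L * progressIndex L)) ∨
      ∃ B, (round sig S K .under D).eval (upMem L) τ.answer h = (.inr (.returned B), t, h') ∧
        B.omegaLang = L) := by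
  set ℓ := longestCE h with hℓ
  have h2 := two_le_scale L sig ℓ
  have hb := Inv.bounded (D := D) (sig := sig) hL ℓ
  set m := scale L sig ℓ ^ 120 with hm
  cases hM : (D.lead.toDFA sig leadTE).val (upMem L) with
  | inl x =>
    obtain ⟨D', hv, hinv, hlen, hw⟩ := round_of_lead (S := S) hD hb hM
    obtain ⟨t, h', he, ht, hl⟩ := hw.eval τ.answer h
    rw [hm, ← pow_mul] at ht
    refine ⟨t, h', hl.ge, hl ▸ le_pow_of_le h2 ht (by omega), .inl ⟨D', by rw [he, hv], ?_, ?_⟩⟩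
    · rw [hl]
      exact hinv
    · exact potential_newLead hlen (hinv.length_lead hL)
  | inr M =>
    have hMs : M.Small α m := (hD.lead.small hsig hM (m := scale L sig ℓ)
      h2 ((hD.length_lead_scale hL)) (by unfold scale; omega)).mono (le_pow_of_le h2 le_rfl (by omega))
    have hp : ∀ c ∈ D.progress, c.2.stateList.length ≤ m := fun c hc =>
      (hD.length_progress_scale hL hsig hM hc).trans (le_pow_of_le h2 le_rfl (by omega))
    by_cases hall : ∀ c ∈ D.progress,
        ∃ A, (c.2.toDFA sig (progressTE K M c.1)).val (upMem L) = Sum.inr A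
    · have hF := (hD.small_scale hL hsig hM hall ℓ).mono
        (le_pow_of_le h2 le_rfl (by omega : 6 ≤ 120))
      -- Up to the query the round costs at most `m ^ 260`, that is, exponent 31200 on the scale;
      -- the 32000 leaves room for the steps after the answer.
      obtain ⟨t, h', he, ht, hl⟩ := round_of_complete (S := S) hD hsig hb hM hF hp hall τ.answer h
      rw [hm, ← pow_mul] at ht
      set B := (buildBA .under (D.fdfa (upMem L) sig K M)).val (upMem L) with hB
      have hask : (askEqu B).eval (upMem L) τ.answer h' =
        (τ.answer h' B, 1, .equ B (τ.answer h' B) :: h') := rfl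
      rw [Prog.eval_bind, hask] at he
      -- The answer may contain a longer counterexample than all before and so enlarge the scale;
      -- bounds obtained earlier survive by monotonicity.
      have hle := hl.ge.trans (le_longestCE_equ B (τ.answer h' B) h')
      have ht' := ht.trans (Nat.pow_le_pow_left (scale_mono L sig hle) _)
      have h2' := two_le_scale L sig (longestCE (.equ B (τ.answer h' B) :: h'))
      cases hr : τ.answer h' B with
      | none =>
        rw [hr] at he hle ht' h2'
        refine ⟨t + 1, .equ B none :: h', hle, ?_, .inr ⟨B, he, (τ.yes_iff _ _).1 hr⟩⟩
        exact pow_add_pow_le h2' ht' (one_le_pow' h2' 0) (by omega) (by omega)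
      | some r =>
        obtain ⟨u, v⟩ := r
        obtain ⟨hv, hce⟩ := τ.counterexample _ _ _ _ hr
        rw [hr] at he hle ht' h2'
        have huv : u.length + v.length ≤ longestCE (.equ B (some (u, v)) :: h') :=
          le_max_left _ _
        -- The invariant is moved to the scale that already includes the new counterexample before
        -- the latter is analyzed.
        obtain ⟨D', hv', hinv, hstep, hw⟩ := afterEqu_some (S := S) hL hsig
          (hD.mono (Nat.pow_le_pow_left (scale_mono L sig hle) _)) hM hall hv huv hce B
          (c := 7202) (by omega)
        obtain ⟨t', h'', he', ht'', hl'⟩ := hw.eval τ.answer (.equ B (some (u, v)) :: h')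
        dsimp only at he
        rw [he', hv'] at he
        refine ⟨t + (1 + t'), h'', hl' ▸ hle, ?_, .inl ⟨D', he, ?_, Step.potential_lt hL hD hsig hM hinv hstep⟩⟩
        · rw [hl']
          exact pow_add_pow_le h2' ht' (pow_add_pow_le h2' (one_le_pow' h2' 0) ht''
            (c := 7203) (by omega) (by omega)) (by omega) (by omega)
        · rw [hl']
          exact hinv
    · obtain ⟨D', hv, hinv, hstep, hw⟩ := round_of_progress (S := S) hD hsig hb hM hMs hp hall
      obtain ⟨t, h', he, ht, hl⟩ := hw.eval τ.answer h
      rw [hm, ← pow_mul] at ht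
      refine ⟨t, h', hl.ge, hl ▸ le_pow_of_le h2 ht (by omega), .inl ⟨D', by rw [he, hv], ?_,
        Step.potential_lt hL hD hsig hM hinv hstep⟩⟩
      rw [hl]
      exact hinv

/-- The algorithm with the under-approximation method terminates. -/
theorem exists_terminates (hL : IsOmegaRegular L) (hsig : ∀ a, a ∈ sig) (τ : BATeacher L)
    (h : Log α) (hD : D.Inv (upMem L) sig K (scale L sig (longestCE h) ^ 120)) :
    ∃ B t h', Terminates (upMem L) τ.answer sig S K .under D h (.returned B) t h' ∧
      B.omegaLang = L ∧ longestCE h ≤ longestCE h' ∧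
      t ≤ (D.potential (leadIndex L) (leadIndex L * progressIndex L) + 1) *
        scale L sig (longestCE h') ^ 32000 := by
  induction hN : D.potential (leadIndex L) (leadIndex L * progressIndex L) using
    Nat.strong_induction_on generalizing D h with
  | _ N ih =>
    obtain ⟨t, h', hle, ht, ⟨D', he, hinv, hlt⟩ | ⟨B, he, hB⟩⟩ := round_spec (S := S) hL hsig τ h hD
    · obtain ⟨B, t', h'', hT, hB, hle', ht'⟩ := ih _ (hN ▸ hlt) h' hinv rfl
      refine ⟨B, t + t', h'', .next _ _ _ _ _ _ _ _ he hT, hB, hle.trans hle', ?_⟩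
      -- This round was measured with the longest counterexample so far; all rounds are compared on
      -- the final scale.
      have h1 := ht.trans (Nat.pow_le_pow_left (scale_mono L sig hle') 32000)
      generalize scale L sig (longestCE h'') ^ 32000 = c at h1 ht' ⊢
      rw [hN] at hlt
      calc t + t' ≤ (D'.potential (leadIndex L) (leadIndex L * progressIndex L) + 1) * c + c := by
            omega
        _ = (D'.potential (leadIndex L) (leadIndex L * progressIndex L) + 1 + 1) * c := by ring
        _ ≤ (N + 1) * c := Nat.mul_le_mul_right _ (by omega)
    · exact ⟨B, t, h', .finish _ _ _ _ _ he, hB, hle, ht.trans (Nat.le_mul_of_pos_left _ (by omega))⟩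

/-- Dropping the subtrahends leaves `n * (n * N + 1) + n * N`, a polynomial bound for the number of
rounds. -/
theorem potential_initial_le (S : Storage) {n N m : ℕ} (hm : 2 ≤ m) (hn : n ≤ m) (hN : N ≤ m ^ 2) :
    (Learner.initial S : Learner α).potential n N + 1 ≤ m ^ 10 := by
  have h3 : n * N ≤ m ^ 3 := pow_mul_pow_le hm (le_pow_one hn) hN (by omega)
  have h4 : n * N + 1 ≤ m ^ 4 := pow_add_pow_le hm h3 (one_le_pow' hm 0) (by omega) (by omega)
  have h5 : n * (n * N + 1) ≤ m ^ 5 := pow_mul_pow_le hm (le_pow_one hn) h4 (by omega)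
  have h6 : n * (n * N + 1) + n * N ≤ m ^ 6 := pow_add_pow_le hm h5 h3 (by omega) (by omega)
  refine (Nat.add_le_add_right (Nat.add_le_add (Nat.mul_le_mul_right _ (Nat.sub_le _ _))
    (Nat.sub_le _ _)) 1).trans ?_
  exact pow_add_pow_le hm h6 (one_le_pow' hm 0) (by omega) (by omega)

theorem exists_terminates_initial (hL : IsOmegaRegular L) (hsig : ∀ a, a ∈ sig) (τ : BATeacher L)
    (S : Storage) (K : Kind) :
    ∃ B t h, Terminates (upMem L) τ.answer sig S K .under (Learner.initial S) [] (.returned B) t h ∧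
      B.omegaLang = L ∧
      t ≤ (leadIndex L + progressIndex L + sig.length + longestCE h + 2) ^ 32010 := by
  obtain ⟨B, t, h, hT, hB, -, ht⟩ := exists_terminates (S := S) (K := K) hL hsig τ []
    (inv_initial S)
  refine ⟨B, t, h, hT, hB, ?_⟩
  have h2 := two_le_scale L sig (longestCE h)
  have hs : scale L sig (longestCE h) =
      leadIndex L + progressIndex L + sig.length + longestCE h + 2 := by unfold scale; rfl
  have hn : leadIndex L ≤ scale L sig (longestCE h) := by omega
  have hk : progressIndex L ≤ scale L sig (longestCE h) := by omega
  rw [← hs]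
  generalize scale L sig (longestCE h) = s at h2 hn hk ht ⊢
  have hN : leadIndex L * progressIndex L ≤ s ^ 2 :=
    pow_mul_pow_le h2 (le_pow_one hn) (le_pow_one hk) (by omega)
  -- At most `s ^ 10` rounds with at most `s ^ 32000` steps each.
  refine ht.trans (pow_mul_pow_le h2 (potential_initial_le S h2 hn hN)
    (le_refl (s ^ 32000)) (by omega))

end

/-! ## Returned automata are confirmed by the teacher -/

section

variable {α β γ : Type} {mem : Word α → Word α → Bool}
  {equiv : Log α → BA α → Option (Word α × Word α)}

/-- The program returns a Büchi automaton only after the answer "yes" to an equivalence query. -/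
def Prog.Confirms (mem : Word α → Word α → Bool)
    (equiv : Log α → BA α → Option (Word α × Word α)) (p : Prog α (β ⊕ Outcome α)) : Prop :=
  ∀ h B, (p.eval mem equiv h).1 = .inr (.returned B) → ∃ h', equiv h' B = none

/-- The outcome is that of the continuation, so nothing need be known about the first program. The
whole analysis of counterexamples can be skipped over in this way. -/
theorem Prog.Confirms.bind {p : Prog α γ} {f : γ → Prog α (β ⊕ Outcome α)}
    (hf : ∀ c, (f c).Confirms mem equiv) : (p >>= f).Confirms mem equiv := by
  intro h B hB
  rw [Prog.eval_bind] at hB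
  exact hf _ _ _ hB

theorem Prog.Confirms.tick {p : Prog α (β ⊕ Outcome α)} (hp : p.Confirms mem equiv) :
    (Prog.tick p).Confirms mem equiv :=
  fun h B hB => hp h B hB

theorem confirms_inl (b : β) : (pure (.inl b) : Prog α (β ⊕ Outcome α)).Confirms mem equiv :=
  fun _ _ hB => nomatch hB

theorem confirms_error : (pure (.inr .error) : Prog α (β ⊕ Outcome α)).Confirms mem equiv :=
  fun _ _ hB => nomatch hB

/-- The automaton returned in the branch `none` is the one just queried, and the log at that moment
is the witness. -/
theorem confirms_askEqu {B : BA α} {f : Option (Word α × Word α) → Prog α (β ⊕ Outcome α)}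
    (hn : f none = pure (.inr (.returned B))) (hs : ∀ r, (f (some r)).Confirms mem equiv) :
    (askEqu B >>= f).Confirms mem equiv := by
  intro h B' hB
  rw [Prog.eval_bind] at hB
  change ((f (equiv h B)).eval mem equiv (.equ B (equiv h B) :: h)).1 = _ at hB
  cases hr : equiv h B with
  | none =>
    rw [hr, hn] at hB
    cases hB
    exact ⟨h, hr⟩
  | some r =>
    rw [hr] at hB
    exact hs _ _ _ hB

/-- Apart from the branch after "yes", all branches end with new data or with an error. Neither the
invariant nor the method plays a role. -/
theorem confirms_round [DecidableEq α] (sig : List α) (S : Storage) (K : Kind) (me : Method)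
    (D : Learner α) : (round sig S K me D).Confirms mem equiv := by
  refine Prog.Confirms.tick (Prog.Confirms.bind fun r => ?_)
  cases r with
  | inl x => exact Prog.Confirms.bind fun _ => Prog.Confirms.bind fun _ => confirms_inl _
  | inr M =>
    refine Prog.Confirms.bind fun built => Prog.Confirms.bind fun r => ?_
    cases r with
    | some r => exact Prog.Confirms.bind fun _ => confirms_inl _
    | none =>
      refine Prog.Confirms.bind fun _ => Prog.Confirms.bind fun B => confirms_askEqu rfl fun r => ?_
      refine Prog.Confirms.bind fun r => ?_
      cases r with
      | none => exact confirms_error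
      | some r =>
        refine Prog.Confirms.bind fun r => ?_
        cases r with
        | none => exact confirms_error
        | some D' => exact confirms_inl _

theorem Terminates.confirmed [DecidableEq α] {sig : List α} {S : Storage} {K : Kind} {me : Method}
    {D : Learner α} {h : Log α} {o : Outcome α} {t : ℕ} {h' : Log α}
    (hT : Terminates mem equiv sig S K me D h o t h') {B : BA α} (ho : o = .returned B) :
    ∃ g, equiv g B = none := by
  induction hT with
  | finish D h o t h' hr => exact confirms_round sig S K me D h B (by rw [hr, ho])
  | next D D' h h' h'' o t t' hr ht ih => exact ih ho

end

end BuchiLearning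

/-! ### Correctness and termination. -/

theorem mainTheorem1 :
    (∃ p : MvPolynomial (Fin 4) ℕ,
      ∀ (α : Type) [Fintype α] [DecidableEq α] (L : Set (Stream' α)), IsOmegaRegular L →
        ∀ (τ : BATeacher L) (S : Storage) (K : Kind),
          ∃ (B : BA α) (t : ℕ) (h : Log α),
            LearnsWith τ S K .under (.returned B) t h ∧
            B.omegaLang = L ∧
            t ≤ MvPolynomial.eval
              ![leadIndex L, progressIndex L, Fintype.card α, longestCE h] p) ∧
    (∀ (α : Type) [Fintype α] [DecidableEq α] (L : Set (Stream' α)), IsOmegaRegular L →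
      ∀ (τ : BATeacher L) (S : Storage) (K : Kind) (B : BA α) (t : ℕ) (h : Log α),
        LearnsWith τ S K .over (.returned B) t h → B.omegaLang = L) := by
  -- The sum of the four variables plus 2 evaluates to the scale for the longest counterexample of
  -- the whole run; the exponent is that of `exists_terminates_initial`.
  refine ⟨⟨(∑ i, MvPolynomial.X i + 2) ^ 32010, fun α _ _ L hL τ S K => ?_⟩,
    fun α _ _ L _ τ S K B t h hT => ?_⟩
  · have hsig : ∀ a : α, a ∈ (Finset.univ : Finset α).toList := by simp
    obtain ⟨B, t, h, hT, hB, ht⟩ := exists_terminates_initial hL hsig τ S K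
    rw [Finset.length_toList, Finset.card_univ] at ht
    refine ⟨B, t, h, hT, hB, ht.trans_eq ?_⟩
    rw [map_pow, map_add, map_sum, map_ofNat]
    congr 1
    simp [Fin.sum_univ_four]
  -- The teacher has answered "yes" to this automaton at some moment `g`, and that answer certifies
  -- its language.
  · obtain ⟨g, hg⟩ := hT.confirmed rfl
    exact (τ.yes_iff g B).1 hg
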